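/- **Setting.** Let $\mathbb T^d=\mathbb R^d/\mathbb Z^d$, let $\rho>0$, let $r:\mathbb T^d\to\mathbb R$, $b:\mathbb T^d\to\mathbb R^d$, $\sigma:\mathbb T^d\to\mathbb R^{d\times d_W}$ be of class $C^p$ and $\varphi:\mathbb T^d\to\mathbb R^{n}$ of class $C^{p+2}$, for some integer $p\ge 2$. Put $v(x,\theta)=\theta^\top\varphi(x)$ for $\theta\in\mathbb R^n$ and $$\mathcal L f=\rho f-\mathrm{tr}\big(\tfrac{\sigma\sigma^\top}{2}D_x^2f\big)-b\cdot\nabla_xf .$$ Let $m$ be a stationary probability measure of $dX_t=b(X_t)\,dt+\sigma(X_t)\,dW_t$ on $\mathbb T^d$, that is, $-D^2\cdot(\frac{\sigma\sigma^\top}{2}m)+\mathrm{div}(bm)=0$ in the weak sense. Assume that the coordinates of $\varphi$ are linearly independent modulo $m$-null sets (equivalently, $\mathbb E_{X\sim m}[\varphi(X)\varphi(X)^\top]$ is positive definite). **Observations.** Let $\Delta t_k>0$ $(k\ge0)$ be deterministic with $\Delta t_k\to0$, and let $(X_k,X'_k,R_k)_{k\ge0}$ be mutually independent, where $X'_k-X_k$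 denotes the displacement in $\mathbb R^d$ from $X_k$ to $X'_k$ (this displacement is part of the observation). Either all of them are real-world observations: $X_k=\tilde X_0$, $X'_k=\tilde X_{\Delta t_k}$, $R_k=\frac1{\Delta t_k}\int_0^{\Delta t_k}r(\tilde X_t)\,dt$ for a (weak) solution $\tilde X$ of the SDE (depending on $k$); or all of them come from a simulator: $X'_k=X_k+\Delta t_k\,b(X_k)+\sqrt{\Delta t_k}\,\sigma(X_k)\xi_k$ and $R_k=r(X_k)$ with $\xi_k\sim\mathcal N(0,I_{d_W})$ independent of $X_k$. Assume that for every $f\in C^p(\mathbb T^d;\mathbb R)$ there is $C_f>0$ such that $|\mathbb E[f(X_k)]-\mathbb E_{X\sim m}[f(X)]|\le C_f\Delta t_k$ for all $k\ge0$. **Algorithm.** The stochastic temporal difference is $$\tilde\delta_k(\theta)=\tfrac1{\Delta t_k}\big(v(X_k,\theta)-e^{-\rho\Delta t_k}v(X'_k,\theta)-\Delta t_kR_k\big)+\tfrac1{\Delta t_k}\big(X'_k-X_k-\Delta t_k\,b(X_k)\big)\cdot\nabla_xv(X_k,\theta).$$ For a deterministic $\theta_0\in\mathbb R^n$ and a constant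 step $\alpha>0$, the stochastic residual gradient iterates are $\tilde\theta_0=\theta_0$, $\tilde\theta_{k+1}=\tilde\theta_k-\alpha\,\tilde\delta_k(\tilde\theta_k)\,\nabla_\theta\tilde\delta_k(\tilde\theta_k)$, and $\bar\theta_k=\frac1k\sum_{i=0}^{k-1}\tilde\theta_i$ for $k\ge1$. Let $\theta^*\in\mathbb R^n$ be a minimiser over $\mathbb R^n$ of $$F(\theta)=\mathbb E_{X\sim m}\big[(\mathcal Lv(X,\theta)-r(X))^2\big]+\tfrac12\,\mathbb E_{X\sim m}\big[\mathrm{tr}\big((\sigma\sigma^\top D_x^2v(X,\theta))^2\big)\big].$$ **Theorem.** In the following, $X\sim m$ is independent of $\bar\theta_k$, and the expectations are finite. 1. If $\sum_{i=0}^\infty\Delta t_i^2<\infty$, there exist $C,R>0$ such that, for all $0<\alpha<R^{-2}$ and all $k\ge1$, $$\mathbb E\big[|\mathcal Lv(X,\bar\theta_k)-\mathcal Lv(X,\theta^*)|^2\big]\le\frac{C}{\alpha k}+\frac{Cn}{k}.$$ 2. If instead $\sum_{i=0}^{k-1}\Delta t_i^2\le a\ln(1+k)$ for some $a>0$ and all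 $k\ge0$, then for every $\varepsilon>0$ there exist $C,R>0$ such that, for all $0<\alpha<R^{-2}$ and all $k\ge1$, $$\mathbb E\big[|\mathcal Lv(X,\bar\theta_k)-\mathcal Lv(X,\theta^*)|^2\big]\le\frac{C}{\alpha k}+\frac{Cn}{k^{1-\varepsilon}}.$$ -/

import Mathlib

open MeasureTheory ProbabilityTheory Filter Topology
open scoped NNReal

noncomputable section

namespace ResidualGradient

/-! ## Calculus on the torus -/

/-- The state space: the `d`-dimensional flat torus `ℝ^d / ℤ^d`. -/
abbrev Torus (d : ℕ) : Type := UnitAddTorus (Fin d)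

/-- Euclidean space `ℝ^d`. -/
abbrev Euc (d : ℕ) : Type := EuclideanSpace ℝ (Fin d)

/-- The quotient map `ℝ^d → ℝ^d / ℤ^d`. -/
def proj {d : ℕ} (y : Euc d) : Torus d := fun i => ((y i : ℝ) : UnitAddCircle)

/-- `f ∈ C^p(ℝ^d / ℤ^d; F)`: the periodic function on `ℝ^d` induced by `f` is `C^p`. -/
def TorusContDiff {d : ℕ} {F : Type*} [NormedAddCommGroup F] [NormedSpace ℝ F]
    (p : ℕ) (f : Torus d → F) : Prop :=
  ContDiff ℝ p (fun y : Euc d => f (proj y))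

/-- The Hessian matrix `(∂_i ∂_j g (y))_{i,j}` of `g : ℝ^d → ℝ`. -/
def hessian {d : ℕ} (g : Euc d → ℝ) (y : Euc d) : Matrix (Fin d) (Fin d) ℝ :=
  Matrix.of fun i j =>
    iteratedFDeriv ℝ 2 g y ![EuclideanSpace.single i (1 : ℝ), EuclideanSpace.single j (1 : ℝ)]

/-- The function `y ↦ f (x + y)` on `ℝ^d`, i.e. `f` read in the standard chart around `x`. -/
def localLift {d : ℕ} (f : Torus d → ℝ) (x : Torus d) : Euc d → ℝ := fun y => f (x + proj y)

/-- The gradient `∇_x f (x)` of a function on the torus. -/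
def torusGrad {d : ℕ} (f : Torus d → ℝ) (x : Torus d) : Euc d := gradient (localLift f x) 0

/-- The Hessian `D²_x f (x)` of a function on the torus. -/
def torusHess {d : ℕ} (f : Torus d → ℝ) (x : Torus d) : Matrix (Fin d) (Fin d) ℝ :=
  hessian (localLift f x) 0

/-! ## The continuous-time dynamics -/

/-- The data of the policy evaluation problem with dynamics `dX = b(X) dt + σ(X) dW` on the torus:
the discount rate `ρ`, the reward `r`, the drift `b` and the diffusion matrix `σ`. -/
structure Dynamics (d dW : ℕ) where
  rho : ℝ
  r : Torus d → ℝ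
  b : Torus d → Euc d
  sigma : Torus d → Matrix (Fin d) (Fin dW) ℝ

variable {d dW n : ℕ}

/-- The matrix `σ σᵀ`. -/
def Dynamics.a (D : Dynamics d dW) (x : Torus d) : Matrix (Fin d) (Fin d) ℝ :=
  D.sigma x * (D.sigma x).transpose

/-- The second-order operator `½ tr (σσᵀ(x) M) + b(x) · q` applied to a Hessian `M` and a gradient
`q`. -/
def Dynamics.symbol (D : Dynamics d dW) (x : Torus d) (M : Matrix (Fin d) (Fin d) ℝ)
    (q : Euc d) : ℝ :=
  (1 / 2) * (D.a x * M).trace + inner ℝ (D.b x) q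

/-- The operator `𝓛 f = ρ f - tr (σσᵀ/2 D²f) - b · ∇f`. -/
def Dynamics.L (D : Dynamics d dW) (f : Torus d → ℝ) (x : Torus d) : ℝ :=
  D.rho * f x - D.symbol x (torusHess f x) (torusGrad f x)

/-- `m` is a stationary measure of the dynamics: it solves the stationary Fokker-Planck equation
`- D² · (σσᵀ/2 m) + div (b m) = 0` in the weak sense. -/
def Dynamics.IsStationary (D : Dynamics d dW) (m : Measure (Torus d)) : Prop :=
  ∀ f : Torus d → ℝ, TorusContDiff 2 f →
    ∫ x, D.symbol x (torusHess f x) (torusGrad f x) ∂m = 0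

variable {Ω : Type*} [MeasurableSpace Ω]

/-- `X_t = X₀ + Y_t` (mod `ℤ^d`) is a (weak) solution of `dX = b(X) dt + σ(X) dW` on the torus,
where `Y_t ∈ ℝ^d` is the displacement between the times `0` and `t`. This is expressed by the
martingale problem of Stroock and Varadhan for the continuous process `Y`, started from `0`. -/
def Dynamics.IsSolution (D : Dynamics d dW) (P : Measure Ω) (X₀ : Ω → Torus d)
    (Y : ℝ≥0 → Ω → Euc d) : Prop :=
  (∀ ω, Continuous fun t => Y t ω) ∧ (∀ ω, Y 0 ω = 0) ∧
  ∃ 𝓕 : Filtration ℝ≥0 (inferInstance : MeasurableSpace Ω),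
    Measurable[𝓕 0] X₀ ∧ (∀ t, Measurable[𝓕 t] (Y t)) ∧
    ∀ g : Euc d → ℝ, ContDiff ℝ 2 g → HasCompactSupport g →
      Martingale
        (fun (t : ℝ≥0) (ω : Ω) => g (Y t ω) -
          ∫ s in (0 : ℝ)..(t : ℝ),
            D.symbol (X₀ ω + proj (Y s.toNNReal ω))
              (hessian g (Y s.toNNReal ω)) (gradient g (Y s.toNNReal ω)))
        𝓕 P

/-! ## Observations

An observation with time step `Δt` is given by the state `X`, the displacement `Z ∈ ℝ^d` from `X`
to the next state `X' = X + Z (mod ℤ^d)` (it is this vector that `X' - X` denotes in the stochastic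
temporal difference) and the running reward `R`. -/

/-- Real-world observation: `X`, `X' = X + Z` and `R` are the initial state, the state at time `Δt`
and the mean reward on `[0, Δt]` of a solution of the SDE. -/
def Dynamics.IsRealWorldObs (D : Dynamics d dW) (P : Measure Ω) (dt : ℝ)
    (X : Ω → Torus d) (Z : Ω → Euc d) (R : Ω → ℝ) : Prop :=
  ∃ Y : ℝ≥0 → Ω → Euc d, D.IsSolution P X Y ∧
    ∀ᵐ ω ∂P, Z ω = Y dt.toNNReal ω ∧
      R ω = (1 / dt) * ∫ t in (0 : ℝ)..dt, D.r (X ω + proj (Y t.toNNReal ω))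

/-- Observation from a simulator: one step of the Euler-Maruyama scheme, with a standard Gaussian
noise that is independent of `X`. -/
def Dynamics.IsSimulatorObs (D : Dynamics d dW) (P : Measure Ω) (dt : ℝ)
    (X : Ω → Torus d) (Z : Ω → Euc d) (R : Ω → ℝ) : Prop :=
  ∃ ξ : Ω → Euc dW, Measurable ξ ∧ P.map ξ = stdGaussian (Euc dW) ∧ IndepFun X ξ P ∧
    ∀ᵐ ω ∂P,
      Z ω = dt • D.b (X ω) +
        Real.sqrt dt • WithLp.toLp 2 ((D.sigma (X ω)).mulVec (WithLp.ofLp (ξ ω))) ∧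
      R ω = D.r (X ω)

/-! ## The algorithm -/

/-- The linear parametrisation `v(x, θ) = θᵀ φ(x)`, as a function of `x`. -/
def value (φ : Torus d → Euc n) (θ : Euc n) : Torus d → ℝ := fun x => inner ℝ θ (φ x)

/-- The stochastic temporal difference of the parameter `θ` at the observation `(Δt, x, x + z, R)`:
`Δt⁻¹ (v(x,θ) - e^{-ρΔt} v(x+z,θ) - Δt R) + Δt⁻¹ (z - Δt b(x)) · ∇_x v(x,θ)`. -/
def Dynamics.stochTD (D : Dynamics d dW) (φ : Torus d → Euc n) (dt : ℝ) (x : Torus d) (z : Euc d)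
    (R : ℝ) (θ : Euc n) : ℝ :=
  (1 / dt) * (value φ θ x - Real.exp (-D.rho * dt) * value φ θ (x + proj z) - dt * R) +
    (1 / dt) * inner ℝ (z - dt • D.b x) (torusGrad (value φ θ) x)

/-- The stochastic residual gradient iterates with constant learning step `α`:
`θ_{k+1} = θ_k - α δ_k ∇_θ δ_k`, with `δ_k` the stochastic temporal difference at `θ_k` and at the
`k`-th observation. -/
def Dynamics.iterate (D : Dynamics d dW) (φ : Torus d → Euc n) (dt : ℕ → ℝ)
    (X : ℕ → Ω → Torus d) (Z : ℕ → Ω → Euc d) (R : ℕ → Ω → ℝ) (α : ℝ) (θ₀ : Euc n) :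
    ℕ → Ω → Euc n
  | 0 => fun _ => θ₀
  | k + 1 => fun ω =>
      let θ := D.iterate φ dt X Z R α θ₀ k ω
      let δ := D.stochTD φ (dt k) (X k ω) (Z k ω) (R k ω)
      θ - α • (δ θ • gradient δ θ)

/-- The averaged iterates `θ̄_k = (1/k) ∑_{i<k} θ_i`. -/
def Dynamics.average (D : Dynamics d dW) (φ : Torus d → Euc n) (dt : ℕ → ℝ)
    (X : ℕ → Ω → Torus d) (Z : ℕ → Ω → Euc d) (R : ℕ → Ω → ℝ) (α : ℝ) (θ₀ : Euc n)
    (k : ℕ) (ω : Ω) : Euc n :=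
  (1 / (k : ℝ)) • ∑ i ∈ Finset.range k, D.iterate φ dt X Z R α θ₀ i ω

/-- The residual gradient cost
`F(θ) = E[(𝓛v(X,θ) - r(X))²] + ½ E[tr ((σσᵀ D²_x v(X,θ))²)]`, `X ∼ m`. -/
def Dynamics.cost (D : Dynamics d dW) (φ : Torus d → Euc n) (m : Measure (Torus d))
    (θ : Euc n) : ℝ :=
  ∫ x, (D.L (value φ θ) x - D.r x) ^ 2 ∂m +
    (1 / 2) * ∫ x, ((D.a x * torusHess (value φ θ) x) ^ 2).trace ∂m

/-- The bound `E[|𝓛v(X,θ̄_k) - 𝓛v(X,θ*)|²] ≤ B`, with `X ∼ m` independent of `θ̄_k`; the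
integrability is part of the claim. -/
def Dynamics.MeanSquareErrorLE (D : Dynamics d dW) (φ : Torus d → Euc n) (m : Measure (Torus d))
    (P : Measure Ω) (θbar : Ω → Euc n) (θs : Euc n) (B : ℝ) : Prop :=
  Integrable (fun q : Ω × Torus d =>
      |D.L (value φ (θbar q.1)) q.2 - D.L (value φ θs) q.2| ^ 2) (P.prod m) ∧
    ∫ q : Ω × Torus d,
      |D.L (value φ (θbar q.1)) q.2 - D.L (value φ θs) q.2| ^ 2 ∂(P.prod m) ≤ B

end ResidualGradient

end

noncomputable section

namespace ResidualGradient

set_option linter.unusedSectionVars false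

section

/-! The stochastic temporal difference is affine in the parameter: at the k-th observation it equals
⟨V_k, θ⟩ - R_k, where V_k is `tdVec`. With e_k = θ_k - θ*, the algorithm is therefore e_{k+1} = e_k
- α (⟨V_k, θ* + e_k⟩ - R_k) V_k, stochastic gradient descent for a least squares problem with
independent data. Two facts about this recursion are needed: its mean field is A e + O(Δt_k (1 +
|e|)), where A = `gramOp` is half the Hessian of F, and A is coercive.

Mean field. The gradient term in the temporal difference cancels the fluctuation z·∇f/Δt, of size
Δt^(-1/2), of the increment of a feature f, z being the displacement. A Taylor expansion of order
four (`Dynamics.hasExpansion_td`) leaves Q - z·D²f z/(2Δt), of size one, with Q = ρf - b·∇f, then a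
part of odd degree in z and size Δt^(1/2), then O(Δt). The displacement has second moments Δt σσᵀ
and Gaussian fourth moments at leading order, and its odd moments are half an order smaller than
their size suggests. Hence the second moment of the expansion is the expectation of (𝓛f)² + ½
tr((σσᵀD²f)²) at X_k, up to O(Δt) and not merely O(Δt^(1/2)): this is the quadratic part of the
integrand of F (`Dynamics.energy_self`). It is of class C^p, so X_k may be replaced by a variable of
law m at the cost of another O(Δt). The constant terms cancel by the normal equations for θ*.

For solutions of the SDE the moments are found by iterating Dynkin's formula on polynomials, each
application lowering the degree (`mean_odd_isBigO`, `mean_even_isBigO`). The reward is then a time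
average, correlated with the displacement, which calls for two-time moments
(`exists_two_time_bound`). For the simulator the moments are explicit Gaussian computations
(`euler_mon_isBigO`). Both cases end in the structure `MomentExpansion`.

Coercivity. Stationarity of m gives ρ ∫f² ≤ ∫ f 𝓛f. If ⟨Aθ, θ⟩ ≤ 0 then 𝓛v(·,θ) = 0 m-almost
everywhere, hence v(·,θ) = 0 m-almost everywhere and θ = 0. Compactness of the unit sphere
concludes.

Averaging (`StochasticApproximation.average_bound`). A Lyapunov inequality bounds E|e_k|² uniformly
in k and in small α. Summing the recursion gives A ∑ e_i = (e_0 - e_k)/α + ∑ bias_i + ∑ noise_i. The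
three terms have mean squares of order α^(-2), k ∑Δt_i² (Cauchy-Schwarz) and k (orthogonality of
martingale differences). Dividing by k² gives (αk)^(-2) + (1 + ∑Δt_i²)/k, and the uniform bound
turns (αk)^(-2) into (αk)^(-1). The sum of squares is bounded in the first case and at most of order
k^ε in the second; finally 𝓛v(x,θ) is Lipschitz in θ uniformly in x. -/

theorem integrable_fun_sub {Ω E : Type*} [MeasurableSpace Ω] [NormedAddCommGroup E] {P : Measure Ω}
    {f g : Ω → E} (hf : Integrable f P) (hg : Integrable g P) :
    Integrable (fun ω => f ω - g ω) P :=
  hf.sub hg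

/-! ## Freezing lemmas for independent random variables -/

section Freezing

variable {Ω β S : Type*} [MeasurableSpace Ω] [MeasurableSpace β] [MeasurableSpace S]
  {P : Measure Ω} [IsProbabilityMeasure P]

/-- A random variable that depends on the past only is independent of the present. -/
lemma indepFun_of_measurable_past {obs : ℕ → Ω → S} (hobs : ∀ k, Measurable (obs k))
    (hind : iIndepFun obs P) {k : ℕ} {W : Ω → β}
    (hW : Measurable[⨆ i ∈ Set.Iio k, MeasurableSpace.comap (obs i) inferInstance] W) :
    IndepFun W (obs k) P := by
  have h := indep_iSup_of_disjoint (m := fun i => MeasurableSpace.comap (obs i) inferInstance)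
    (fun i => (hobs i).comap_le) hind (S := Set.Iio k) (T := {k}) (by simp)
  rw [IndepFun_iff_Indep]
  refine indep_of_indep_of_le_left (indep_of_indep_of_le_right h ?_) ?_
  · simp
  · exact hW.comap_le

lemma past_le {obs : ℕ → Ω → S} (hobs : ∀ k, Measurable (obs k)) (k : ℕ) :
    (⨆ i ∈ Set.Iio k, MeasurableSpace.comap (obs i) inferInstance) ≤
      (inferInstance : MeasurableSpace Ω) :=
  iSup₂_le fun i _ => (hobs i).comap_le

variable {E : Type*} [NormedAddCommGroup E] [NormedSpace ℝ E]

/-- By independence the joint law is a product, so Fubini plays the role of conditioning on `U`. It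
serves to hold an iterate fixed while the next observation is averaged, without conditional
expectations. -/
lemma integral_freeze {U : Ω → β} {V : Ω → S} (hU : Measurable U) (hV : Measurable V)
    (hUV : IndepFun U V P) {F : β × S → E} (hF : StronglyMeasurable F)
    (hint : Integrable (fun ω => F (U ω, V ω)) P) :
    ∫ ω, F (U ω, V ω) ∂P = ∫ ω, ∫ ω', F (U ω, V ω') ∂P ∂P := by
  have hmap := (indepFun_iff_map_prod_eq_prod_map_map hU.aemeasurable hV.aemeasurable).1 hUV
  have := Measure.isProbabilityMeasure_map (μ := P) hU.aemeasurable
  have := Measure.isProbabilityMeasure_map (μ := P) hV.aemeasurable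
  have h1 : ∫ ω, F (U ω, V ω) ∂P = ∫ q, F q ∂(P.map fun ω => (U ω, V ω)) :=
    (integral_map (hU.prodMk hV).aemeasurable hF.aestronglyMeasurable).symm
  have h2 : Integrable F (P.map fun ω => (U ω, V ω)) :=
    (integrable_map_measure hF.aestronglyMeasurable (hU.prodMk hV).aemeasurable).2 hint
  rw [h1, hmap, integral_prod _ (hmap ▸ h2), integral_map hU.aemeasurable]
  · refine integral_congr_ae (ae_of_all _ fun ω => ?_)
    exact integral_map hV.aemeasurable
      (hF.comp_measurable measurable_prodMk_left).aestronglyMeasurable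
  · exact hF.integral_prod_right'.aestronglyMeasurable

/-- The Tonelli criterion on the product law. It carries moment bounds known at each fixed parameter
over to a random parameter independent of the observation. -/
lemma integrable_freeze {U : Ω → β} {V : Ω → S} (hU : Measurable U) (hV : Measurable V)
    (hUV : IndepFun U V P) {F : β × S → E} (hF : StronglyMeasurable F)
    (h1 : ∀ u, Integrable (fun ω => F (u, V ω)) P)
    (h2 : Integrable (fun ω => ∫ ω', ‖F (U ω, V ω')‖ ∂P) P) :
    Integrable (fun ω => F (U ω, V ω)) P := by
  have hmap := (indepFun_iff_map_prod_eq_prod_map_map hU.aemeasurable hV.aemeasurable).1 hUV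
  have := Measure.isProbabilityMeasure_map (μ := P) hU.aemeasurable
  have := Measure.isProbabilityMeasure_map (μ := P) hV.aemeasurable
  refine (integrable_map_measure hF.aestronglyMeasurable (hU.prodMk hV).aemeasurable).1 ?_
  rw [hmap, integrable_prod_iff hF.aestronglyMeasurable]
  have hFu : ∀ u, StronglyMeasurable fun s => F (u, s) :=
    fun u => hF.comp_measurable measurable_prodMk_left
  constructor
  · exact ae_of_all _ fun u =>
      (integrable_map_measure (hFu u).aestronglyMeasurable hV.aemeasurable).2 (h1 u)
  · have h3 : (fun u => ∫ s, ‖F (u, s)‖ ∂(P.map V)) = fun u => ∫ ω', ‖F (u, V ω')‖ ∂P := by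
      funext u
      exact integral_map hV.aemeasurable (hFu u).norm.aestronglyMeasurable
    have h4 : StronglyMeasurable fun u => ∫ s, ‖F (u, s)‖ ∂(P.map V) :=
      hF.norm.integral_prod_right'
    rw [integrable_map_measure h4.aestronglyMeasurable hU.aemeasurable, h3]
    exact h2

end Freezing

/-! ## Averaged stochastic approximation with a constant step -/

/-- A recursion `e_{k+1} = e_k - α Γ_k(obs_k, e_k)` driven by independent observations, whose mean
field is close to a coercive linear map `A`. -/
structure StochasticApproximation {Ω S E : Type*} [MeasurableSpace Ω] [MeasurableSpace S]
    [NormedAddCommGroup E] [InnerProductSpace ℝ E] [MeasurableSpace E]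
    (P : Measure Ω) (obs : ℕ → Ω → S) (Γ : ℕ → S → E → E) (A : E →L[ℝ] E) (τ : ℕ → ℝ)
    (M μ : ℝ) : Prop where
  measurable_obs : ∀ k, Measurable (obs k)
  indep : iIndepFun obs P
  measurable_field : ∀ k, Measurable fun q : E × S => Γ k q.2 q.1
  integrable_sq : ∀ k e, Integrable (fun ω => ‖Γ k (obs k ω) e‖ ^ 2) P
  sq_le : ∀ k e, ∫ ω, ‖Γ k (obs k ω) e‖ ^ 2 ∂P ≤ M * (1 + ‖e‖ ^ 2)
  bias_le : ∀ k e, ‖∫ ω, Γ k (obs k ω) e ∂P - A e‖ ≤ M * τ k * (1 + ‖e‖)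
  coercive : ∀ e, μ * ‖e‖ ^ 2 ≤ inner ℝ (A e) e
  M_nonneg : 0 ≤ M
  mu_pos : 0 < μ
  tau_nonneg : ∀ k, 0 ≤ τ k
  tau_tendsto : Tendsto τ atTop (𝓝 0)

namespace StochasticApproximation

variable {Ω S E : Type*} [MeasurableSpace Ω] [MeasurableSpace S]
  [NormedAddCommGroup E] [InnerProductSpace ℝ E] [CompleteSpace E] [SecondCountableTopology E]
  [MeasurableSpace E] [BorelSpace E]
  {P : Measure Ω} [IsProbabilityMeasure P] {obs : ℕ → Ω → S} {Γ : ℕ → S → E → E}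
  {A : E →L[ℝ] E} {τ : ℕ → ℝ} {M μ : ℝ}

lemma integrable_inner_of_memLp_two {f g : Ω → E} (hf : MemLp f 2 P) (hg : MemLp g 2 P) :
    Integrable (fun ω => inner ℝ (f ω) (g ω)) P := by
  refine (hf.norm.integrable_mul hg.norm).mono' (hf.1.inner hg.1) (ae_of_all _ fun ω => ?_)
  exact norm_inner_le_norm _ _

/-- The mean field `E[Γ_k(obs_k, e)]`. -/
def mean (P : Measure Ω) (obs : ℕ → Ω → S) (Γ : ℕ → S → E → E) (k : ℕ) (e : E) : E :=
  ∫ ω, Γ k (obs k ω) e ∂P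

/-- The trajectories of the recursion. -/
structure IsTrajectory (P : Measure Ω) (obs : ℕ → Ω → S) (Γ : ℕ → S → E → E) (α : ℝ) (e₀ : E)
    (e : ℕ → Ω → E) : Prop where
  zero : ∀ ω, e 0 ω = e₀
  succ : ∀ k ω, e (k + 1) ω = e k ω - α • Γ k (obs k ω) (e k ω)

variable (h : StochasticApproximation P obs Γ A τ M μ)
include h

lemma measurable_mean (k : ℕ) : Measurable (mean P obs Γ k) := by
  have h1 : StronglyMeasurable fun q : E × Ω => Γ k (obs k q.2) q.1 :=
    ((h.measurable_field k).comp (measurable_fst.prodMk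
      ((h.measurable_obs k).comp measurable_snd))).stronglyMeasurable
  exact (h1.integral_prod_right' (ν := P)).measurable

lemma norm_mean_le (k : ℕ) (e : E) :
    ‖mean P obs Γ k e‖ ≤ (‖A‖ + M * τ k) * (1 + ‖e‖) := by
  have h1 : mean P obs Γ k e = (∫ ω, Γ k (obs k ω) e ∂P - A e) + A e := by simp [mean]
  have h2 := h.bias_le k e
  have h3 := A.le_opNorm e
  have h4 := norm_nonneg A
  rw [h1]
  refine (norm_add_le _ _).trans ?_
  nlinarith

/-- The k-th iterate is built from the observations of index below `k` only. Together with
`indepFun_of_measurable_past` this makes it independent of `obs k`. -/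
lemma measurable_past {α : ℝ} {e₀ : E} {e : ℕ → Ω → E} (he : IsTrajectory P obs Γ α e₀ e)
    (k : ℕ) :
    Measurable[⨆ i ∈ Set.Iio k, MeasurableSpace.comap (obs i) inferInstance] (e k) := by
  induction k with
  | zero =>
    have : e 0 = fun _ => e₀ := funext he.zero
    rw [this]
    exact measurable_const
  | succ k ih =>
    have h0 : (⨆ i ∈ Set.Iio k, MeasurableSpace.comap (obs i) inferInstance) ≤
        (⨆ i ∈ Set.Iio (k + 1), MeasurableSpace.comap (obs i) (inferInstance : MeasurableSpace S)) :=
      biSup_mono fun i hi => Nat.lt_succ_of_lt hi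
    have h1 : Measurable[⨆ i ∈ Set.Iio (k + 1), MeasurableSpace.comap (obs i) inferInstance]
        (e k) := ih.mono h0 le_rfl
    have h2 : Measurable[⨆ i ∈ Set.Iio (k + 1), MeasurableSpace.comap (obs i) inferInstance]
        (obs k) := by
      refine (comap_measurable (obs k)).mono ?_ le_rfl
      exact le_iSup₂_of_le k (Nat.lt_succ_self k) le_rfl
    have h3 : e (k + 1) = fun ω => e k ω - α • Γ k (obs k ω) (e k ω) := funext (he.succ k)
    rw [h3]
    have h4 : Measurable[⨆ i ∈ Set.Iio (k + 1), MeasurableSpace.comap (obs i) inferInstance]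
        (fun ω => Γ k (obs k ω) (e k ω)) := (h.measurable_field k).comp (h1.prodMk h2)
    exact h1.sub (h4.const_smul α)

/-- The hypothesis `sq_le` concerns a deterministic argument; freezing integrates it against the law
of `e`. The recursion thereby stays in `L²`. -/
lemma memLp_field {k : ℕ} {e : Ω → E} (hem : Measurable e)
    (hi : IndepFun e (obs k) P) (he : MemLp e 2 P) :
    MemLp (fun ω => Γ k (obs k ω) (e ω)) 2 P ∧
      ∫ ω, ‖Γ k (obs k ω) (e ω)‖ ^ 2 ∂P ≤ M * (1 + ∫ ω, ‖e ω‖ ^ 2 ∂P) := by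
  have hm : Measurable fun ω => Γ k (obs k ω) (e ω) :=
    (h.measurable_field k).comp (hem.prodMk (h.measurable_obs k))
  have hF : StronglyMeasurable fun q : E × S => ‖Γ k q.2 q.1‖ ^ 2 :=
    ((h.measurable_field k).norm.pow_const 2).stronglyMeasurable
  have hsq : Integrable (fun ω => ‖e ω‖ ^ 2) P := (memLp_two_iff_integrable_sq_norm he.1).1 he
  have hdom : Integrable (fun ω => M * (1 + ‖e ω‖ ^ 2)) P :=
    ((integrable_const 1).add hsq).const_mul M
  have hmeas : StronglyMeasurable fun u : E => ∫ ω', ‖Γ k (obs k ω') u‖ ^ 2 ∂P := by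
    have h1 : StronglyMeasurable fun q : E × Ω => ‖Γ k (obs k q.2) q.1‖ ^ 2 :=
      (((h.measurable_field k).comp (measurable_fst.prodMk
        ((h.measurable_obs k).comp measurable_snd))).norm.pow_const 2).stronglyMeasurable
    exact h1.integral_prod_right'
  have hint2 : Integrable (fun ω => ∫ ω', ‖Γ k (obs k ω') (e ω)‖ ^ 2 ∂P) P := by
    refine hdom.mono' (hmeas.comp_measurable hem).aestronglyMeasurable (ae_of_all _ fun ω => ?_)
    rw [Real.norm_of_nonneg (integral_nonneg fun _ => by positivity)]
    exact h.sq_le k (e ω)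
  have hint : Integrable (fun ω => ‖Γ k (obs k ω) (e ω)‖ ^ 2) P :=
    integrable_freeze hem (h.measurable_obs k) hi hF (fun u => h.integrable_sq k u) (by
      simpa only [norm_pow, norm_norm] using hint2)
  refine ⟨(memLp_two_iff_integrable_sq_norm hm.aestronglyMeasurable).2 hint, ?_⟩
  rw [integral_freeze hem (h.measurable_obs k) hi hF hint]
  calc _ ≤ ∫ ω, M * (1 + ‖e ω‖ ^ 2) ∂P := integral_mono hint2 hdom fun ω => h.sq_le k (e ω)
    _ = _ := by
      rw [integral_const_mul, integral_add (integrable_const 1) hsq]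
      simp

lemma memLp_mean {k : ℕ} {e : Ω → E} (hem : Measurable e) (he : MemLp e 2 P) :
    MemLp (fun ω => mean P obs Γ k (e ω)) 2 P := by
  have h1 : MemLp (fun ω => 1 + ‖e ω‖) 2 P := (memLp_const (1 : ℝ)).add he.norm
  refine h1.of_le_mul (c := ‖A‖ + M * τ k)
    ((h.measurable_mean k).comp hem).aestronglyMeasurable (ae_of_all _ fun ω => ?_)
  rw [Real.norm_of_nonneg (by positivity : 0 ≤ 1 + ‖e ω‖)]
  exact h.norm_mean_le k (e ω)

lemma integrable_field (k : ℕ) (e : E) : Integrable (fun ω => Γ k (obs k ω) e) P := by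
  have hm : Measurable fun ω => Γ k (obs k ω) e :=
    (h.measurable_field k).comp (measurable_const.prodMk (h.measurable_obs k))
  exact ((memLp_two_iff_integrable_sq_norm hm.aestronglyMeasurable).2
    (h.integrable_sq k e)).integrable one_le_two

/-- Given the past, the field averages to its mean, so against a past weight `W` the two are
interchangeable. The weight is the iterate itself in the Lyapunov inequality, and the sum of the
earlier noises in the orthogonality argument. -/
lemma integral_inner_field {k : ℕ} {e W : Ω → E} (hem : Measurable e) (hWm : Measurable W)
    (hi : IndepFun (fun ω => (W ω, e ω)) (obs k) P) (he : MemLp e 2 P) (hW : MemLp W 2 P) :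
    ∫ ω, inner ℝ (W ω) (Γ k (obs k ω) (e ω)) ∂P =
      ∫ ω, inner ℝ (W ω) (mean P obs Γ k (e ω)) ∂P := by
  have hie : IndepFun e (obs k) P := hi.comp measurable_snd measurable_id
  have hF : StronglyMeasurable fun q : (E × E) × S => inner ℝ q.1.1 (Γ k q.2 q.1.2) := by
    refine (Measurable.inner ?_ ?_).stronglyMeasurable
    · exact measurable_fst.comp measurable_fst
    · exact (h.measurable_field k).comp ((measurable_snd.comp measurable_fst).prodMk measurable_snd)
  have hint : Integrable (fun ω => inner ℝ (W ω) (Γ k (obs k ω) (e ω))) P :=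
    integrable_inner_of_memLp_two hW (h.memLp_field hem hie he).1
  rw [integral_freeze (U := fun ω => (W ω, e ω)) (hWm.prodMk hem) (h.measurable_obs k) hi hF hint]
  refine integral_congr_ae (ae_of_all _ fun ω => ?_)
  exact integral_inner (h.integrable_field k (e ω)) (W ω)

end StochasticApproximation

end

/-! ### Lyapunov inequality and uniform mean square bound for the iterates -/

section

namespace StochasticApproximation

variable {Ω S E : Type*} [MeasurableSpace Ω] [MeasurableSpace S]
  [NormedAddCommGroup E] [InnerProductSpace ℝ E] [CompleteSpace E] [SecondCountableTopology E]
  [MeasurableSpace E] [BorelSpace E]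
  {P : Measure Ω} [IsProbabilityMeasure P] {obs : ℕ → Ω → S} {Γ : ℕ → S → E → E}
  {A : E →L[ℝ] E} {τ : ℕ → ℝ} {M μ : ℝ}
  (h : StochasticApproximation P obs Γ A τ M μ)
  {α : ℝ} {e₀ : E} {e : ℕ → Ω → E} (he : IsTrajectory P obs Γ α e₀ e)

include h he

lemma measurable_trajectory (k : ℕ) : Measurable (e k) :=
  (h.measurable_past he k).mono (past_le h.measurable_obs k) le_rfl

lemma indep_trajectory (k : ℕ) : IndepFun (e k) (obs k) P :=
  indepFun_of_measurable_past h.measurable_obs h.indep (h.measurable_past he k)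

lemma memLp_trajectory (k : ℕ) : MemLp (e k) 2 P := by
  induction k with
  | zero =>
    have : e 0 = fun _ => e₀ := funext he.zero
    rw [this]
    exact memLp_const _
  | succ k ih =>
    have h3 : e (k + 1) = fun ω => e k ω - α • Γ k (obs k ω) (e k ω) := funext (he.succ k)
    rw [h3]
    exact ih.sub ((h.memLp_field (h.measurable_trajectory he k) (h.indep_trajectory he k)
      ih).1.const_smul α)

lemma integrable_sq_trajectory (k : ℕ) : Integrable (fun ω => ‖e k ω‖ ^ 2) P :=
  (memLp_two_iff_integrable_sq_norm (h.memLp_trajectory he k).1).1 (h.memLp_trajectory he k)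

/-- Coercivity of `A` survives up to the bias. The bias grows linearly in ‖x‖, so pairing it with
`x` costs at most a multiple of ‖x‖(1 + ‖x‖) ≤ 1 + 2‖x‖². -/
lemma inner_mean_ge (k : ℕ) (x : E) :
    μ * ‖x‖ ^ 2 - M * τ k * (1 + 2 * ‖x‖ ^ 2) ≤ inner ℝ x (mean P obs Γ k x) := by
  have h1 : inner ℝ x (mean P obs Γ k x) =
      inner ℝ (A x) x + inner ℝ x (mean P obs Γ k x - A x) := by
    rw [inner_sub_right, real_inner_comm x (A x)]; ring
  have h2 := abs_le.1 (abs_real_inner_le_norm x (mean P obs Γ k x - A x))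
  have h3 := h.bias_le k x
  have h4 := h.coercive x
  have h5 : ‖x‖ * ‖mean P obs Γ k x - A x‖ ≤ ‖x‖ * (M * τ k * (1 + ‖x‖)) :=
    mul_le_mul_of_nonneg_left h3 (norm_nonneg x)
  have h6 : 0 ≤ M * τ k := mul_nonneg h.M_nonneg (h.tau_nonneg k)
  have h7 : ‖x‖ * (M * τ k * (1 + ‖x‖)) ≤ M * τ k * (1 + 2 * ‖x‖ ^ 2) := by
    have : ‖x‖ * (1 + ‖x‖) ≤ 1 + 2 * ‖x‖ ^ 2 := by nlinarith [sq_nonneg (‖x‖ - 1)]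
    calc _ = M * τ k * (‖x‖ * (1 + ‖x‖)) := by ring
      _ ≤ _ := mul_le_mul_of_nonneg_left this h6
  linarith [h2.1]

/-- The Lyapunov inequality for the mean square distance. -/
lemma lyapunov (hα : 0 ≤ α) (k : ℕ) :
    ∫ ω, ‖e (k + 1) ω‖ ^ 2 ∂P ≤ ∫ ω, ‖e k ω‖ ^ 2 ∂P
      - 2 * α * (μ * ∫ ω, ‖e k ω‖ ^ 2 ∂P - M * τ k * (1 + 2 * ∫ ω, ‖e k ω‖ ^ 2 ∂P))
      + α ^ 2 * (M * (1 + ∫ ω, ‖e k ω‖ ^ 2 ∂P)) := by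
  have hem := h.measurable_trajectory he k
  have hL := h.memLp_trajectory he k
  have hsq := h.integrable_sq_trajectory he k
  obtain ⟨hΓ, hΓle⟩ := h.memLp_field hem (h.indep_trajectory he k) hL
  have hΓsq := (memLp_two_iff_integrable_sq_norm hΓ.1).1 hΓ
  have hin := integrable_inner_of_memLp_two hL hΓ
  have hexp : ∀ ω, ‖e (k + 1) ω‖ ^ 2 = ‖e k ω‖ ^ 2
      - 2 * α * inner ℝ (e k ω) (Γ k (obs k ω) (e k ω))
      + α ^ 2 * ‖Γ k (obs k ω) (e k ω)‖ ^ 2 := by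
    intro ω
    rw [he.succ, norm_sub_sq_real, inner_smul_right, norm_smul, mul_pow, Real.norm_eq_abs, sq_abs]
    ring
  have hmean : ∫ ω, inner ℝ (e k ω) (Γ k (obs k ω) (e k ω)) ∂P =
      ∫ ω, inner ℝ (e k ω) (mean P obs Γ k (e k ω)) ∂P := by
    refine h.integral_inner_field hem hem ?_ hL hL
    exact (h.indep_trajectory he k).comp (φ := fun x => (x, x)) (by fun_prop) measurable_id
  have hge : μ * ∫ ω, ‖e k ω‖ ^ 2 ∂P - M * τ k * (1 + 2 * ∫ ω, ‖e k ω‖ ^ 2 ∂P) ≤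
      ∫ ω, inner ℝ (e k ω) (mean P obs Γ k (e k ω)) ∂P := by
    have hi1 : Integrable (fun ω => μ * ‖e k ω‖ ^ 2 - M * τ k * (1 + 2 * ‖e k ω‖ ^ 2)) P :=
      (hsq.const_mul _).sub (((integrable_const 1).fun_add (hsq.const_mul 2)).const_mul _)
    have hle := integral_mono hi1 (integrable_inner_of_memLp_two hL (h.memLp_mean hem hL))
      fun ω => h.inner_mean_ge he k (e k ω)
    refine le_trans (le_of_eq ?_) hle
    rw [integral_sub (hsq.const_mul _) (((integrable_const 1).fun_add (hsq.const_mul 2)).const_mul _),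
      integral_const_mul, integral_const_mul, integral_add (integrable_const 1) (hsq.const_mul 2),
      integral_const_mul]
    simp
  simp_rw [hexp]
  rw [integral_add (integrable_fun_sub hsq (hin.const_mul _)) (hΓsq.const_mul _),
    integral_sub hsq (hin.const_mul _), integral_const_mul, integral_const_mul, hmean]
  have h1 := mul_le_mul_of_nonneg_left hge (by positivity : 0 ≤ 2 * α)
  have h2 := mul_le_mul_of_nonneg_left hΓle (by positivity : 0 ≤ α ^ 2)
  linarith

end StochasticApproximation

namespace StochasticApproximation

variable {Ω S E : Type*} [MeasurableSpace Ω] [MeasurableSpace S]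
  [NormedAddCommGroup E] [InnerProductSpace ℝ E] [CompleteSpace E] [SecondCountableTopology E]
  [MeasurableSpace E] [BorelSpace E]
  {P : Measure Ω} [IsProbabilityMeasure P] {obs : ℕ → Ω → S} {Γ : ℕ → S → E → E}
  {A : E →L[ℝ] E} {τ : ℕ → ℝ} {M μ : ℝ}

/-- The iterates are bounded in mean square, uniformly in the step. -/
lemma exists_bound (h : StochasticApproximation P obs Γ A τ M μ) (e₀ : E) : ∃ B : ℝ, 0 ≤ B ∧ ∀ α : ℝ, 0 < α → α * (1 + 2 * M / μ + μ) < 1 →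
    ∀ e, IsTrajectory P obs Γ α e₀ e → ∀ k, ∫ ω, ‖e k ω‖ ^ 2 ∂P ≤ B := by
  obtain ⟨T, hT⟩ := h.tau_tendsto.bddAbove_range
  have hT' : ∀ k, τ k ≤ T := fun k => hT ⟨k, rfl⟩
  have hT0 : 0 ≤ T := (h.tau_nonneg 0).trans (hT' 0)
  have hM := h.M_nonneg
  have hμ := h.mu_pos
  -- From `K₀` on, the bias costs at most αμ out of the contraction 2αμ. The index `K₀` depends
  -- neither on `α` nor on the trajectory.
  obtain ⟨K₀, hK₀⟩ : ∃ K₀, ∀ k ≥ K₀, M * τ k ≤ μ / 4 := by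
    have h1 : Tendsto (fun k => M * τ k) atTop (𝓝 (M * 0)) := h.tau_tendsto.const_mul M
    rw [mul_zero] at h1
    exact eventually_atTop.1 (h1.eventually_le_const (by positivity : 0 < μ / 4))
  -- A crude factor by which `E‖e‖² + 1` can grow in one step, valid for every α ≤ 1. It is only
  -- used for the first `K₀` steps.
  set L : ℝ := 1 + 4 * M * T + M with hLdef
  have hL1 : 1 ≤ L := by
    have := mul_nonneg hM hT0
    linarith
  set c : ℝ := 2 * M * T + M with hcdef
  have hc0 : 0 ≤ c := by positivity
  -- The first entry covers the first `K₀` steps. Afterwards one step sends a mean square m to at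
  -- most (1 - αμ/2) m + αc, whose fixed point is 2c/μ; any level above it is preserved.
  refine ⟨max ((‖e₀‖ ^ 2 + 1) * L ^ K₀) (2 * c / μ), le_max_of_le_left (by positivity), ?_⟩
  intro α hα hα1 e he
  -- The smallness condition is a sum of three nonnegative terms α, 2αM/μ and αμ, each of which is
  -- thus below 1.
  have hα' : α ≤ 1 ∧ α * M ≤ μ / 2 ∧ α * μ ≤ 1 := by
    have h1 : α * (1 + 2 * M / μ + μ) = α + 2 * (α * M) / μ + α * μ := by ring
    have h2 : 0 ≤ 2 * (α * M) / μ := by positivity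
    have h3 : 0 ≤ α * μ := by positivity
    rw [h1] at hα1
    refine ⟨by linarith, ?_, by linarith⟩
    have h4 : 2 * (α * M) / μ ≤ 1 := by linarith
    rw [div_le_one hμ] at h4
    linarith
  obtain ⟨hαa, hαb, hαc⟩ := hα'
  have hnn : ∀ k, 0 ≤ ∫ ω, ‖e k ω‖ ^ 2 ∂P := fun k => integral_nonneg fun _ => by positivity
  have hzero : ∫ ω, ‖e 0 ω‖ ^ 2 ∂P = ‖e₀‖ ^ 2 := by simp [he.zero]
  have hstep : ∀ k, ∫ ω, ‖e (k + 1) ω‖ ^ 2 ∂P + 1 ≤ L * (∫ ω, ‖e k ω‖ ^ 2 ∂P + 1) := by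
    intro k
    have h1 := h.lyapunov he hα.le k
    have h2 := hnn k
    set m := ∫ ω, ‖e k ω‖ ^ 2 ∂P
    have h3 : α * (M * τ k) ≤ M * T := by
      calc α * (M * τ k) ≤ 1 * (M * T) :=
            mul_le_mul hαa (mul_le_mul_of_nonneg_left (hT' k) hM)
              (mul_nonneg hM (h.tau_nonneg k)) zero_le_one
        _ = _ := one_mul _
    have h4 : α ^ 2 * M ≤ M := by
      have : α ^ 2 ≤ 1 := pow_le_one₀ hα.le hαa
      nlinarith
    have h5 : 0 ≤ α * μ * m := by positivity
    have h6 : α * (M * τ k) * (1 + 2 * m) ≤ M * T * (1 + 2 * m) :=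
      mul_le_mul_of_nonneg_right h3 (by linarith)
    have h7 : α ^ 2 * M * (1 + m) ≤ M * (1 + m) := mul_le_mul_of_nonneg_right h4 (by linarith)
    have h8 : 0 ≤ M * T := by positivity
    simp only [hLdef]
    nlinarith
  have hfirst : ∀ k ≤ K₀, ∫ ω, ‖e k ω‖ ^ 2 ∂P ≤ (‖e₀‖ ^ 2 + 1) * L ^ K₀ := by
    intro k hk
    have h1 : ∀ j, ∫ ω, ‖e j ω‖ ^ 2 ∂P + 1 ≤ (‖e₀‖ ^ 2 + 1) * L ^ j := by
      intro j
      induction j with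
      | zero => simp [hzero]
      | succ j ih =>
        calc _ ≤ L * (∫ ω, ‖e j ω‖ ^ 2 ∂P + 1) := hstep j
          _ ≤ L * ((‖e₀‖ ^ 2 + 1) * L ^ j) := by gcongr
          _ = _ := by ring
    have h2 : (‖e₀‖ ^ 2 + 1) * L ^ k ≤ (‖e₀‖ ^ 2 + 1) * L ^ K₀ := by gcongr
    linarith [h1 k]
  intro k
  rcases le_total k K₀ with hk | hk
  · exact (hfirst k hk).trans (le_max_left _ _)
  induction k, hk using Nat.le_induction with
  | base => exact (hfirst K₀ le_rfl).trans (le_max_left _ _)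
  | succ k hk ih =>
    have h1 := h.lyapunov he hα.le k
    have h2 := hnn k
    set m := ∫ ω, ‖e k ω‖ ^ 2 ∂P
    set B := max ((‖e₀‖ ^ 2 + 1) * L ^ K₀) (2 * c / μ)
    have hB : c ≤ μ / 2 * B := by
      have : 2 * c / μ ≤ B := le_max_right _ _
      rw [div_le_iff₀ hμ] at this
      linarith
    have h3 : α * (M * τ k) * m ≤ α * (μ / 4) * m :=
      mul_le_mul_of_nonneg_right (mul_le_mul_of_nonneg_left (hK₀ k hk) hα.le) h2
    have h4 : α * (M * τ k) ≤ α * (M * T) := by gcongr; exact hT' k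
    have h5 : α * (α * M) * m ≤ α * (μ / 2) * m :=
      mul_le_mul_of_nonneg_right (mul_le_mul_of_nonneg_left hαb hα.le) h2
    have h6 : α * (α * M) ≤ α * M := by
      have : α * M ≤ 1 * M := mul_le_mul_of_nonneg_right hαa hM
      nlinarith
    have h7 : (1 - α * μ / 2) * m ≤ (1 - α * μ / 2) * B :=
      mul_le_mul_of_nonneg_left ih (by linarith)
    have h8 : α * c ≤ α * (μ / 2 * B) := mul_le_mul_of_nonneg_left hB hα.le
    have h9 : α * c = 2 * (α * (M * T)) + α * M := by rw [hcdef]; ring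
    nlinarith

end StochasticApproximation

end

/-! ### Averaging: telescoping sum, bias, and orthogonality of the noise -/

section

namespace StochasticApproximation

variable {Ω S E : Type*} [MeasurableSpace Ω] [MeasurableSpace S]
  [NormedAddCommGroup E] [InnerProductSpace ℝ E] [CompleteSpace E] [SecondCountableTopology E]
  [MeasurableSpace E] [BorelSpace E]
  {P : Measure Ω} [IsProbabilityMeasure P] {obs : ℕ → Ω → S} {Γ : ℕ → S → E → E}
  {A : E →L[ℝ] E} {τ : ℕ → ℝ} {M μ : ℝ}

/-- The martingale differences `E[Γ_k(obs_k, x)]|_{x = e_k} - Γ_k(obs_k, e_k)`. -/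
def noise (P : Measure Ω) (obs : ℕ → Ω → S) (Γ : ℕ → S → E → E) (e : ℕ → Ω → E) (k : ℕ) (ω : Ω) :
    E :=
  mean P obs Γ k (e k ω) - Γ k (obs k ω) (e k ω)

section

variable (h : StochasticApproximation P obs Γ A τ M μ)
  {α : ℝ} {e₀ : E} {e : ℕ → Ω → E} (he : IsTrajectory P obs Γ α e₀ e)

include h he

lemma measurable_past_sum_noise (k : ℕ) :
    Measurable[⨆ i ∈ Set.Iio k, MeasurableSpace.comap (obs i) inferInstance]
      (fun ω => ∑ i ∈ Finset.range k, noise P obs Γ e i ω) := by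
  refine Finset.measurable_fun_sum _ fun i hi => ?_
  have hik : i < k := Finset.mem_range.1 hi
  have h0 : (⨆ j ∈ Set.Iio i, MeasurableSpace.comap (obs j) inferInstance) ≤
      (⨆ j ∈ Set.Iio k, MeasurableSpace.comap (obs j) (inferInstance : MeasurableSpace S)) :=
    biSup_mono fun j hj => lt_trans hj hik
  have h1 := (h.measurable_past he i).mono h0 le_rfl
  have h2 : Measurable[⨆ j ∈ Set.Iio k, MeasurableSpace.comap (obs j) inferInstance]
      (obs i) := by
    refine (comap_measurable (obs i)).mono ?_ le_rfl
    exact le_iSup₂_of_le i hik le_rfl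
  have h4 : Measurable[⨆ j ∈ Set.Iio k, MeasurableSpace.comap (obs j) inferInstance]
      (fun ω => Γ i (obs i ω) (e i ω)) := (h.measurable_field i).comp (h1.prodMk h2)
  exact ((h.measurable_mean i).comp h1).sub h4

lemma memLp_noise (k : ℕ) : MemLp (noise P obs Γ e k) 2 P :=
  (h.memLp_mean (h.measurable_trajectory he k) (h.memLp_trajectory he k)).sub
    (h.memLp_field (h.measurable_trajectory he k) (h.indep_trajectory he k)
      (h.memLp_trajectory he k)).1

/-- The noise terms are martingale differences, hence orthogonal in `L²`: their variances add up and
the sum grows like `k` instead of `k ^ 2`. -/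
lemma integral_sq_sum_noise_le {c : ℝ} (hc : ∀ k, ∫ ω, ‖noise P obs Γ e k ω‖ ^ 2 ∂P ≤ c) (k : ℕ) :
    ∫ ω, ‖∑ i ∈ Finset.range k, noise P obs Γ e i ω‖ ^ 2 ∂P ≤ k * c := by
  induction k with
  | zero => simp
  | succ k ih =>
    have hem := h.measurable_trajectory he k
    have hL := h.memLp_trajectory he k
    have hSp := h.measurable_past_sum_noise he k
    have hSm := hSp.mono (past_le h.measurable_obs k) le_rfl
    have hS : MemLp (fun ω => ∑ i ∈ Finset.range k, noise P obs Γ e i ω) 2 P :=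
      memLp_finsetSum _ fun i _ => h.memLp_noise he i
    have hN := h.memLp_noise he k
    have hind : IndepFun (fun ω => (∑ i ∈ Finset.range k, noise P obs Γ e i ω, e k ω)) (obs k) P :=
      indepFun_of_measurable_past h.measurable_obs h.indep (hSp.prodMk (h.measurable_past he k))
    have horth : ∫ ω, inner ℝ (∑ i ∈ Finset.range k, noise P obs Γ e i ω) (noise P obs Γ e k ω) ∂P
        = 0 := by
      have h1 := h.integral_inner_field hem hSm hind hL hS
      have h2 := h.memLp_mean (k := k) hem hL
      have h3 := (h.memLp_field hem (h.indep_trajectory he k) hL).1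
      have h5 : ∀ ω, inner ℝ (∑ i ∈ Finset.range k, noise P obs Γ e i ω) (noise P obs Γ e k ω) =
          inner ℝ (∑ i ∈ Finset.range k, noise P obs Γ e i ω) (mean P obs Γ k (e k ω)) -
          inner ℝ (∑ i ∈ Finset.range k, noise P obs Γ e i ω) (Γ k (obs k ω) (e k ω)) :=
        fun ω => inner_sub_right _ _ _
      simp_rw [h5]
      rw [integral_sub (integrable_inner_of_memLp_two hS h2)
        (integrable_inner_of_memLp_two hS h3), h1, sub_self]
    have hSsq := (memLp_two_iff_integrable_sq_norm hS.1).1 hS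
    have hNsq := (memLp_two_iff_integrable_sq_norm hN.1).1 hN
    have hin := integrable_inner_of_memLp_two hS hN
    simp_rw [Finset.sum_range_succ, norm_add_sq_real]
    rw [integral_add (hSsq.fun_add (hin.const_mul 2)) hNsq, integral_add hSsq (hin.const_mul 2),
      integral_const_mul, horth]
    have := hc k
    push_cast
    linarith

/-- The increments of the recursion telescope, while their means are nearly linear in the iterates.
The sum of the iterates can therefore be read off the two ends of the trajectory, up to accumulated
bias and noise. -/
lemma map_sum_trajectory (hα : α ≠ 0) (k : ℕ) (ω : Ω) :
    A (∑ i ∈ Finset.range k, e i ω) = α⁻¹ • (e₀ - e k ω) +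
      ∑ i ∈ Finset.range k, (A (e i ω) - mean P obs Γ i (e i ω)) +
      ∑ i ∈ Finset.range k, noise P obs Γ e i ω := by
  have h1 : e₀ - e k ω = α • ∑ i ∈ Finset.range k, Γ i (obs i ω) (e i ω) := by
    induction k with
    | zero => simp [he.zero]
    | succ k ih =>
      rw [he.succ, Finset.sum_range_succ, smul_add, ← ih]
      abel
  rw [h1, smul_smul, inv_mul_cancel₀ hα, one_smul, map_sum, ← Finset.sum_add_distrib,
    ← Finset.sum_add_distrib]
  exact Finset.sum_congr rfl fun i _ => by rw [noise]; abel

/-- Cauchy-Schwarz separates the sizes `τ i` from the iterates. This is where the sum of the squares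
of the time steps enters; the second factor is of order `k` in mean. -/
lemma norm_sum_bias_sq_le (k : ℕ) (ω : Ω) :
    ‖∑ i ∈ Finset.range k, (A (e i ω) - mean P obs Γ i (e i ω))‖ ^ 2 ≤
      M ^ 2 * (∑ i ∈ Finset.range k, τ i ^ 2) *
        ∑ i ∈ Finset.range k, (2 + 2 * ‖e i ω‖ ^ 2) := by
  have h1 : ‖∑ i ∈ Finset.range k, (A (e i ω) - mean P obs Γ i (e i ω))‖ ≤
      M * ∑ i ∈ Finset.range k, τ i * (1 + ‖e i ω‖) := by
    rw [Finset.mul_sum]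
    refine norm_sum_le_of_le _ fun i _ => ?_
    rw [norm_sub_rev, ← mul_assoc]
    exact h.bias_le i (e i ω)
  calc _ ≤ (M * ∑ i ∈ Finset.range k, τ i * (1 + ‖e i ω‖)) ^ 2 := by gcongr
    _ = M ^ 2 * (∑ i ∈ Finset.range k, τ i * (1 + ‖e i ω‖)) ^ 2 := by ring
    _ ≤ M ^ 2 * ((∑ i ∈ Finset.range k, τ i ^ 2) *
        ∑ i ∈ Finset.range k, (1 + ‖e i ω‖) ^ 2) := by
      gcongr
      exact Finset.sum_mul_sq_le_sq_mul_sq _ _ _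
    _ ≤ M ^ 2 * ((∑ i ∈ Finset.range k, τ i ^ 2) *
        ∑ i ∈ Finset.range k, (2 + 2 * ‖e i ω‖ ^ 2)) := by
      have h0 : 0 ≤ ∑ i ∈ Finset.range k, τ i ^ 2 := Finset.sum_nonneg fun i _ => sq_nonneg _
      gcongr with i
      nlinarith [sq_nonneg (‖e i ω‖ - 1)]
    _ = _ := by ring

lemma integral_sq_noise_le {B T : ℝ} (hB : ∀ k, ∫ ω, ‖e k ω‖ ^ 2 ∂P ≤ B) (hT' : ∀ k, τ k ≤ T)
    (hT0 : 0 ≤ T) (i : ℕ) :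
    ∫ ω, ‖noise P obs Γ e i ω‖ ^ 2 ∂P ≤
      2 * (M * (1 + B)) + 2 * ((‖A‖ + M * T) ^ 2 * (2 + 2 * B)) := by
  have hM := h.M_nonneg
  obtain ⟨hΓ, hΓle⟩ := h.memLp_field (h.measurable_trajectory he i) (h.indep_trajectory he i)
    (h.memLp_trajectory he i)
  have hΓsq := (memLp_two_iff_integrable_sq_norm hΓ.1).1 hΓ
  have hN := (memLp_two_iff_integrable_sq_norm (h.memLp_noise he i).1).1 (h.memLp_noise he i)
  have hi1 : Integrable (fun ω => 2 + 2 * ‖e i ω‖ ^ 2) P :=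
    (integrable_const 2).fun_add ((h.integrable_sq_trajectory he i).const_mul 2)
  calc _ ≤ ∫ ω, (2 * ‖Γ i (obs i ω) (e i ω)‖ ^ 2 +
        2 * ((‖A‖ + M * T) ^ 2 * (2 + 2 * ‖e i ω‖ ^ 2))) ∂P := by
        refine integral_mono hN ((hΓsq.const_mul 2).add ((hi1.const_mul _).const_mul 2))
          fun ω => ?_
        have h1 : ‖noise P obs Γ e i ω‖ ≤ ‖mean P obs Γ i (e i ω)‖ +
          ‖Γ i (obs i ω) (e i ω)‖ := norm_sub_le _ _
        have h2 : ‖mean P obs Γ i (e i ω)‖ ≤ (‖A‖ + M * T) * (1 + ‖e i ω‖) := by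
          refine (h.norm_mean_le i _).trans ?_
          gcongr
          exact hT' i
        have h3 : ‖mean P obs Γ i (e i ω)‖ ^ 2 ≤
            (‖A‖ + M * T) ^ 2 * (2 + 2 * ‖e i ω‖ ^ 2) := by
          calc _ ≤ ((‖A‖ + M * T) * (1 + ‖e i ω‖)) ^ 2 := by gcongr
            _ = (‖A‖ + M * T) ^ 2 * (1 + ‖e i ω‖) ^ 2 := by ring
            _ ≤ _ := by
              gcongr
              nlinarith [sq_nonneg (‖e i ω‖ - 1)]
        have h4 : ‖noise P obs Γ e i ω‖ ^ 2 ≤ (‖mean P obs Γ i (e i ω)‖ +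
          ‖Γ i (obs i ω) (e i ω)‖) ^ 2 := by gcongr
        simp only
        nlinarith [sq_nonneg (‖mean P obs Γ i (e i ω)‖ - ‖Γ i (obs i ω) (e i ω)‖)]
    _ = 2 * ∫ ω, ‖Γ i (obs i ω) (e i ω)‖ ^ 2 ∂P +
        2 * ((‖A‖ + M * T) ^ 2 * (2 + 2 * ∫ ω, ‖e i ω‖ ^ 2 ∂P)) := by
        rw [integral_add (hΓsq.const_mul 2) ((hi1.const_mul _).const_mul 2),
          integral_const_mul, integral_const_mul, integral_const_mul,
          integral_add (integrable_const 2) ((h.integrable_sq_trajectory he i).const_mul 2), integral_const_mul]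
        simp
    _ ≤ 2 * (M * (1 + ∫ ω, ‖e i ω‖ ^ 2 ∂P)) +
        2 * ((‖A‖ + M * T) ^ 2 * (2 + 2 * ∫ ω, ‖e i ω‖ ^ 2 ∂P)) := by gcongr
    _ ≤ _ := by
        have := hB i
        gcongr

lemma norm_sum_sq_le (hα : 0 < α) (k : ℕ) (ω : Ω) :
    μ ^ 2 * ‖∑ i ∈ Finset.range k, e i ω‖ ^ 2 ≤
      3 * (α⁻¹ ^ 2 * (2 * ‖e₀‖ ^ 2 + 2 * ‖e k ω‖ ^ 2)) +
      3 * (M ^ 2 * (∑ i ∈ Finset.range k, τ i ^ 2) *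
        ∑ i ∈ Finset.range k, (2 + 2 * ‖e i ω‖ ^ 2)) +
      3 * ‖∑ i ∈ Finset.range k, noise P obs Γ e i ω‖ ^ 2 := by
  have hμ := h.mu_pos
  -- Coercivity bounds `A` from below: μ‖x‖² ≤ ⟨Ax, x⟩ ≤ ‖Ax‖‖x‖, then divide by ‖x‖.
  have hco : μ * ‖∑ i ∈ Finset.range k, e i ω‖ ≤ ‖A (∑ i ∈ Finset.range k, e i ω)‖ := by
    rcases eq_or_lt_of_le (norm_nonneg (∑ i ∈ Finset.range k, e i ω)) with h0 | h0
    · rw [← h0, mul_zero]; exact norm_nonneg _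
    · have h1 := h.coercive (∑ i ∈ Finset.range k, e i ω)
      have h2 := real_inner_le_norm (A (∑ i ∈ Finset.range k, e i ω))
        (∑ i ∈ Finset.range k, e i ω)
      refine le_of_mul_le_mul_right ?_ h0
      linarith
  have hmap := h.map_sum_trajectory he hα.ne' k ω
  have hb := h.norm_sum_bias_sq_le he k ω
  set x := ‖α⁻¹ • (e₀ - e k ω)‖
  set y := ‖∑ i ∈ Finset.range k, (A (e i ω) - mean P obs Γ i (e i ω))‖
  set z := ‖∑ i ∈ Finset.range k, noise P obs Γ e i ω‖
  have htri : ‖A (∑ i ∈ Finset.range k, e i ω)‖ ≤ x + y + z := by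
    rw [hmap]; exact norm_add₃_le
  have hx : x ^ 2 ≤ α⁻¹ ^ 2 * (2 * ‖e₀‖ ^ 2 + 2 * ‖e k ω‖ ^ 2) := by
    have h1 : x = α⁻¹ * ‖e₀ - e k ω‖ := by
      simp only [x]
      rw [norm_smul, Real.norm_of_nonneg (by positivity)]
    have h2 := norm_sub_le e₀ (e k ω)
    rw [h1, mul_pow]
    gcongr
    nlinarith [sq_nonneg (‖e₀‖ - ‖e k ω‖), norm_nonneg (e₀ - e k ω)]
  have h3 : (μ * ‖∑ i ∈ Finset.range k, e i ω‖) ^ 2 ≤ (x + y + z) ^ 2 :=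
    pow_le_pow_left₀ (by positivity) (hco.trans htri) 2
  nlinarith [sq_nonneg (x - y), sq_nonneg (y - z), sq_nonneg (x - z)]

end

/-- Mean square convergence rate of the averaged iterates. -/
theorem average_bound (h : StochasticApproximation P obs Γ A τ M μ) (e₀ : E) :
    ∃ C R₀ : ℝ, 0 < C ∧ 0 < R₀ ∧ ∀ α : ℝ, 0 < α → α < (R₀ ^ 2)⁻¹ →
      ∀ e, IsTrajectory P obs Γ α e₀ e → ∀ k : ℕ, 1 ≤ k →
        Integrable (fun ω => ‖(1 / (k : ℝ)) • ∑ i ∈ Finset.range k, e i ω‖ ^ 2) P ∧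
        ∫ ω, ‖(1 / (k : ℝ)) • ∑ i ∈ Finset.range k, e i ω‖ ^ 2 ∂P ≤
          C / (α * k) + C * (1 + ∑ i ∈ Finset.range k, τ i ^ 2) / k := by
  obtain ⟨B, hB0, hB⟩ := h.exists_bound e₀
  obtain ⟨T, hT⟩ := h.tau_tendsto.bddAbove_range
  have hT' : ∀ k, τ k ≤ T := fun k => hT ⟨k, rfl⟩
  have hT0 : 0 ≤ T := (h.tau_nonneg 0).trans (hT' 0)
  have hM := h.M_nonneg
  have hμ := h.mu_pos
  set c : ℝ := 2 * (M * (1 + B)) + 2 * ((‖A‖ + M * T) ^ 2 * (2 + 2 * B)) with hcdef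
  have hc0 : 0 ≤ c := by positivity
  set C₁ : ℝ := 3 * (2 * ‖e₀‖ ^ 2 + 2 * B) / μ ^ 2 with hC₁
  set C₂ : ℝ := 3 * (M ^ 2 * (2 + 2 * B) + c) / μ ^ 2 with hC₂
  have hC₁0 : 0 ≤ C₁ := by positivity
  have hC₂0 : 0 ≤ C₂ := by positivity
  have hq : 0 < 1 + 2 * M / μ + μ := by positivity
  -- The square root makes `α < (R₀ ^ 2)⁻¹` exactly the smallness condition of `exists_bound`.
  refine ⟨B + C₁ + C₂ + 1, √(1 + 2 * M / μ + μ), by positivity, Real.sqrt_pos.2 hq, ?_⟩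
  intro α hα hαR e he k hk
  rw [Real.sq_sqrt hq.le, lt_inv_comm₀ hα hq, lt_inv_comm₀ hq hα, ← one_div, lt_div_iff₀ hq] at hαR
  have hBk : ∀ k, ∫ ω, ‖e k ω‖ ^ 2 ∂P ≤ B := hB α hα hαR e he
  have hsq := h.integrable_sq_trajectory he
  have hkpos : (0 : ℝ) < k := by exact_mod_cast hk
  have hkne : (k : ℝ) ≠ 0 := hkpos.ne'
  have hsumL : MemLp (fun ω => ∑ i ∈ Finset.range k, e i ω) 2 P :=
    memLp_finsetSum _ fun i _ => h.memLp_trajectory he i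
  have hsumsq := (memLp_two_iff_integrable_sq_norm hsumL.1).1 hsumL
  have hnorm : ∀ ω, ‖(1 / (k : ℝ)) • ∑ i ∈ Finset.range k, e i ω‖ ^ 2 =
      (1 / (k : ℝ) ^ 2) * ‖∑ i ∈ Finset.range k, e i ω‖ ^ 2 := by
    intro ω
    rw [norm_smul, mul_pow, Real.norm_eq_abs, sq_abs]
    ring
  simp_rw [hnorm]
  refine ⟨hsumsq.const_mul _, ?_⟩
  rw [integral_const_mul]
  have htau : 0 ≤ ∑ i ∈ Finset.range k, τ i ^ 2 := Finset.sum_nonneg fun i _ => sq_nonneg _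
  -- the crude bound
  have hcrude : (1 / (k : ℝ) ^ 2) * ∫ ω, ‖∑ i ∈ Finset.range k, e i ω‖ ^ 2 ∂P ≤ B := by
    have h1 : ∀ ω, ‖∑ i ∈ Finset.range k, e i ω‖ ^ 2 ≤ k * ∑ i ∈ Finset.range k, ‖e i ω‖ ^ 2 := by
      intro ω
      calc _ ≤ (∑ i ∈ Finset.range k, ‖e i ω‖) ^ 2 := by gcongr; exact norm_sum_le _ _
        _ ≤ _ := by simpa using sq_sum_le_card_mul_sum_sq (s := Finset.range k)
                      (f := fun i => ‖e i ω‖)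
    have h2 : ∫ ω, ‖∑ i ∈ Finset.range k, e i ω‖ ^ 2 ∂P ≤ k * (k * B) := by
      calc _ ≤ ∫ ω, (k : ℝ) * ∑ i ∈ Finset.range k, ‖e i ω‖ ^ 2 ∂P :=
            integral_mono hsumsq ((integrable_finsetSum _ fun i _ => hsq i).const_mul _) h1
        _ = k * ∑ i ∈ Finset.range k, ∫ ω, ‖e i ω‖ ^ 2 ∂P := by
            rw [integral_const_mul, integral_finsetSum _ fun i _ => hsq i]
        _ ≤ k * ∑ i ∈ Finset.range k, B := by
            gcongr with i
            exact hBk i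
        _ = _ := by simp
    rw [one_div, inv_mul_le_iff₀ (by positivity)]
    calc _ ≤ _ := h2
      _ = _ := by ring
  -- the bound for many steps
  have hfine : (1 / (k : ℝ) ^ 2) * ∫ ω, ‖∑ i ∈ Finset.range k, e i ω‖ ^ 2 ∂P ≤
      C₁ / (α * k) ^ 2 + C₂ * (1 + ∑ i ∈ Finset.range k, τ i ^ 2) / k := by
    have hNL := h.memLp_noise he
    have hNsL : MemLp (fun ω => ∑ i ∈ Finset.range k, noise P obs Γ e i ω) 2 P :=
      memLp_finsetSum _ fun i _ => hNL i
    have hNsq := (memLp_two_iff_integrable_sq_norm hNsL.1).1 hNsL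
    have hnoise := h.integral_sq_noise_le he hBk hT' hT0
    have hNk := h.integral_sq_sum_noise_le he hnoise k
    have hpt := h.norm_sum_sq_le he hα k
    have hi1 : ∀ i, Integrable (fun ω => 2 + 2 * ‖e i ω‖ ^ 2) P := fun i =>
      (integrable_const 2).fun_add ((hsq i).const_mul 2)
    have hi2 : Integrable (fun ω => 2 * ‖e₀‖ ^ 2 + 2 * ‖e k ω‖ ^ 2) P :=
      (integrable_const _).fun_add ((hsq k).const_mul 2)
    have hi3 : Integrable (fun ω => ∑ i ∈ Finset.range k, (2 + 2 * ‖e i ω‖ ^ 2)) P :=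
      integrable_finsetSum _ fun i _ => hi1 i
    have hi4 := ((hi2.const_mul (α⁻¹ ^ 2)).const_mul 3).fun_add
      ((hi3.const_mul (M ^ 2 * (∑ i ∈ Finset.range k, τ i ^ 2))).const_mul 3)
    have hint := integral_mono (hsumsq.const_mul (μ ^ 2)) (hi4.fun_add (hNsq.const_mul 3)) hpt
    rw [integral_const_mul, integral_add hi4 (hNsq.const_mul 3),
      integral_add ((hi2.const_mul (α⁻¹ ^ 2)).const_mul 3)
        ((hi3.const_mul (M ^ 2 * (∑ i ∈ Finset.range k, τ i ^ 2))).const_mul 3),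
      integral_const_mul, integral_const_mul, integral_const_mul, integral_const_mul,
      integral_const_mul, integral_add (integrable_const _) ((hsq k).const_mul 2),
      integral_const_mul, integral_finsetSum _ fun i _ => hi1 i] at hint
    have hs : ∑ i ∈ Finset.range k, ∫ ω, (2 + 2 * ‖e i ω‖ ^ 2) ∂P ≤ k * (2 + 2 * B) := by
      calc _ ≤ ∑ i ∈ Finset.range k, (2 + 2 * B) := by
            refine Finset.sum_le_sum fun i _ => ?_
            rw [integral_add (integrable_const _) ((hsq i).const_mul 2), integral_const_mul]
            simpa using hBk i
        _ = _ := by rw [Finset.sum_const, Finset.card_range, nsmul_eq_mul]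
    have hfin : μ ^ 2 * ∫ ω, ‖∑ i ∈ Finset.range k, e i ω‖ ^ 2 ∂P ≤
        3 * (α⁻¹ ^ 2 * (2 * ‖e₀‖ ^ 2 + 2 * B)) +
        3 * (M ^ 2 * (∑ i ∈ Finset.range k, τ i ^ 2) * (k * (2 + 2 * B))) + 3 * (k * c) := by
      refine hint.trans ?_
      have h1 := hBk k
      rw [integral_const_mul]
      simp only [integral_const, probReal_univ, one_smul]
      gcongr
    have hle : ∫ ω, ‖∑ i ∈ Finset.range k, e i ω‖ ^ 2 ∂P ≤
        (3 * (α⁻¹ ^ 2 * (2 * ‖e₀‖ ^ 2 + 2 * B)) +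
        3 * (M ^ 2 * (∑ i ∈ Finset.range k, τ i ^ 2) * (k * (2 + 2 * B))) + 3 * (k * c)) /
          μ ^ 2 := by
      rw [le_div_iff₀ (by positivity)]
      linarith
    calc _ ≤ (1 / (k : ℝ) ^ 2) * ((3 * (α⁻¹ ^ 2 * (2 * ‖e₀‖ ^ 2 + 2 * B)) +
        3 * (M ^ 2 * (∑ i ∈ Finset.range k, τ i ^ 2) * (k * (2 + 2 * B))) + 3 * (k * c)) /
          μ ^ 2) := by gcongr
      _ = C₁ / (α * k) ^ 2 + (3 * (M ^ 2 * (2 + 2 * B)) / μ ^ 2 *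
            (∑ i ∈ Finset.range k, τ i ^ 2) + 3 * c / μ ^ 2) / k := by
          rw [hC₁]
          field_simp
          ring
      _ ≤ _ := by
          gcongr
          rw [hC₂]
          have h1 : 0 ≤ 3 * (M ^ 2 * (2 + 2 * B)) / μ ^ 2 := by positivity
          have h2 : 0 ≤ 3 * c / μ ^ 2 * ∑ i ∈ Finset.range k, τ i ^ 2 := by positivity
          have h3 : 3 * (M ^ 2 * (2 + 2 * B) + c) / μ ^ 2 =
            3 * (M ^ 2 * (2 + 2 * B)) / μ ^ 2 + 3 * c / μ ^ 2 := by ring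
          rw [h3]
          nlinarith
  have hαk : 0 < α * k := by positivity
  have hlast : 0 ≤ (1 + ∑ i ∈ Finset.range k, τ i ^ 2) / k := by positivity
  -- The fine bound contains (αk)^(-2). For αk ≥ 1 this is at most (αk)^(-1); for αk ≤ 1 the uniform
  -- bound suffices, as B ≤ B/(αk).
  rcases le_total (α * k) 1 with hcase | hcase
  · have h1 : B ≤ B / (α * k) := by
      rw [le_div_iff₀ hαk]
      nlinarith
    have h2 : B / (α * k) ≤ (B + C₁ + C₂ + 1) / (α * k) := by gcongr; linarith
    have h3 : 0 ≤ (B + C₁ + C₂ + 1) * (1 + ∑ i ∈ Finset.range k, τ i ^ 2) / k := by positivity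
    linarith
  · have h1 : C₁ / (α * k) ^ 2 ≤ (B + C₁ + C₂ + 1) / (α * k) := by
      rw [div_le_div_iff₀ (by positivity) hαk]
      have : C₁ * (α * k) ≤ (B + C₁ + C₂ + 1) * (α * k) := by gcongr; linarith
      have h6 : (α * k) ≤ (α * k) ^ 2 := by nlinarith
      calc C₁ * (α * k) ≤ (B + C₁ + C₂ + 1) * (α * k) := this
        _ ≤ _ := by gcongr
    have h2 : C₂ * (1 + ∑ i ∈ Finset.range k, τ i ^ 2) / k ≤
        (B + C₁ + C₂ + 1) * (1 + ∑ i ∈ Finset.range k, τ i ^ 2) / k := by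
      gcongr
      linarith
    linarith

end StochasticApproximation

end

section

/-! ## Calculus on the torus -/

section TorusCalculus

variable {d : ℕ} {F : Type*} [NormedAddCommGroup F] [NormedSpace ℝ F]

lemma proj_add (y z : Euc d) : proj (y + z) = proj y + proj z := rfl

lemma proj_zero : proj (0 : Euc d) = 0 := rfl

lemma continuous_proj : Continuous (proj (d := d)) :=
  continuous_pi fun i => (AddCircle.continuous_mk' 1).comp (by fun_prop)

lemma proj_surjective : Function.Surjective (proj (d := d)) := by
  intro x
  choose y hy using fun i => QuotientAddGroup.mk_surjective (x i)
  exact ⟨WithLp.toLp 2 y, funext hy⟩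

/-- Continuity on the torus can thus be tested on periodic lifts, so that `TorusContDiff` functions
are continuous and, by compactness, bounded. -/
lemma isQuotientMap_proj : IsQuotientMap (proj (d := d)) := by
  have h1 : IsOpenMap (Pi.map fun _ : Fin d => ((↑) : ℝ → UnitAddCircle)) :=
    IsOpenMap.piMap (fun _ => QuotientAddGroup.isOpenMap_coe)
      (Filter.Eventually.of_forall fun _ => QuotientAddGroup.mk_surjective)
  have h2 : IsOpenMap (proj (d := d)) :=
    h1.comp (EuclideanSpace.equiv (Fin d) ℝ).toHomeomorph.isOpenMap
  exact h2.isQuotientMap continuous_proj proj_surjective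

lemma TorusContDiff.of_le {p q : ℕ} {f : Torus d → F} (hf : TorusContDiff p f) (h : q ≤ p) :
    TorusContDiff q f :=
  ContDiff.of_le hf (by exact_mod_cast h)

lemma TorusContDiff.continuous {p : ℕ} {f : Torus d → F} (hf : TorusContDiff p f) :
    Continuous f :=
  isQuotientMap_proj.continuous_iff.2 (ContDiff.continuous hf)

lemma TorusContDiff.measurable {p : ℕ} {f : Torus d → ℝ} (hf : TorusContDiff p f) :
    Measurable f :=
  hf.continuous.measurable

lemma exists_bound_of_continuous {f : Torus d → ℝ} (hf : Continuous f) :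
    ∃ K, 0 ≤ K ∧ ∀ x, |f x| ≤ K := by
  obtain ⟨K, hK⟩ := isCompact_univ.exists_bound_of_continuousOn (f := f) hf.continuousOn
  exact ⟨K, (norm_nonneg _).trans (hK 0 trivial), fun x => hK x trivial⟩

lemma torusContDiff_const {p : ℕ} (c : F) : TorusContDiff p (fun _ : Torus d => c) :=
  contDiff_const

lemma TorusContDiff.add {p : ℕ} {f g : Torus d → F} (hf : TorusContDiff p f)
    (hg : TorusContDiff p g) : TorusContDiff p (fun x => f x + g x) :=
  ContDiff.add hf hg

lemma TorusContDiff.sub {p : ℕ} {f g : Torus d → F} (hf : TorusContDiff p f)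
    (hg : TorusContDiff p g) : TorusContDiff p (fun x => f x - g x) :=
  ContDiff.sub hf hg

lemma TorusContDiff.mul {p : ℕ} {f g : Torus d → ℝ} (hf : TorusContDiff p f)
    (hg : TorusContDiff p g) : TorusContDiff p (fun x => f x * g x) :=
  ContDiff.mul hf hg

lemma TorusContDiff.const_mul {p : ℕ} {f : Torus d → ℝ} (c : ℝ) (hf : TorusContDiff p f) :
    TorusContDiff p (fun x => c * f x) :=
  (torusContDiff_const c).mul hf

lemma TorusContDiff.sum {ι : Type*} {p : ℕ} {f : ι → Torus d → ℝ} {s : Finset ι}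
    (hf : ∀ i ∈ s, TorusContDiff p (f i)) : TorusContDiff p (fun x => ∑ i ∈ s, f i x) :=
  ContDiff.sum hf

lemma TorusContDiff.apply {p n : ℕ} {f : Torus d → Euc n} (hf : TorusContDiff p f) (i : Fin n) :
    TorusContDiff p (fun x => f x i) :=
  (contDiff_euclidean.1 hf) i

/-- The standard basis vectors of `ℝ^d`. -/
abbrev basisVec (i : Fin d) : Euc d := EuclideanSpace.single i (1 : ℝ)

lemma eq_sum_basisVec (z : Euc d) : z = ∑ i, z i • basisVec i := by
  have := (EuclideanSpace.basisFun (Fin d) ℝ).sum_repr z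
  simpa using this.symm

/-- The partial derivatives of a function on the torus. -/
def pd (i : Fin d) (f : Torus d → ℝ) (x : Torus d) : ℝ := fderiv ℝ (localLift f x) 0 (basisVec i)

lemma TorusContDiff.localLift {p : ℕ} {f : Torus d → ℝ} (hf : TorusContDiff p f) (x : Torus d) :
    ContDiff ℝ p (localLift f x) := by
  obtain ⟨y, rfl⟩ := proj_surjective x
  exact ContDiff.comp (g := fun y : Euc d => f (proj y)) hf (contDiff_const.add contDiff_id)

/-- Charts at different base points differ by a translation. Derivatives at nearby points can be
computed in one fixed chart, which makes `pd i f` again a function on the torus that can be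
differentiated. -/
lemma fderiv_localLift (f : Torus d → ℝ) (x : Torus d) (z : Euc d) :
    fderiv ℝ (localLift f x) z = fderiv ℝ (localLift f (x + proj z)) 0 := by
  have h : localLift f (x + proj z) = fun w => localLift f x (z + w) := by
    funext w
    simp only [localLift, proj_add, add_assoc]
  rw [h, fderiv_comp_add_left, add_zero]

lemma pd_add_proj (i : Fin d) (f : Torus d → ℝ) (x : Torus d) (z : Euc d) :
    pd i f (x + proj z) = fderiv ℝ (localLift f x) z (basisVec i) := by
  rw [fderiv_localLift, pd]

lemma localLift_pd (i : Fin d) (f : Torus d → ℝ) (x : Torus d) :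
    localLift (pd i f) x = fun z => fderiv ℝ (localLift f x) z (basisVec i) :=
  funext fun z => pd_add_proj i f x z

lemma TorusContDiff.pd {p : ℕ} {f : Torus d → ℝ} (hf : TorusContDiff (p + 1) f) (i : Fin d) :
    TorusContDiff p (pd i f) := by
  have h1 : (fun y : Euc d => ResidualGradient.pd i f (proj y)) =
      fun y => fderiv ℝ (ResidualGradient.localLift f 0) y (basisVec i) := by
    funext y
    rw [← pd_add_proj, zero_add]
  have h2 : ContDiff ℝ ((p : ℕ) + 1) (ResidualGradient.localLift f 0) := by
    exact_mod_cast hf.localLift 0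
  unfold TorusContDiff
  rw [h1]
  exact (h2.fderiv_right le_rfl).clm_apply contDiff_const

lemma torusGrad_apply {f : Torus d → ℝ} (x : Torus d) (i : Fin d) :
    torusGrad f x i = pd i f x := by
  have h : inner ℝ (gradient (localLift f x) 0) (basisVec i) = pd i f x := by
    rw [gradient, InnerProductSpace.toDual_symm_apply, pd]
  rw [torusGrad, ← h, EuclideanSpace.inner_single_right]
  simp

lemma hessian_apply {g : Euc d → ℝ} (hg : ContDiff ℝ 2 g) (y : Euc d) (i j : Fin d) :
    hessian g y i j = fderiv ℝ (fun z => fderiv ℝ g z (basisVec j)) y (basisVec i) := by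
  have h1 : DifferentiableAt ℝ (fderiv ℝ g) y :=
    (hg.fderiv_right (m := 1) (by norm_num)).differentiable (by norm_num) y
  rw [hessian, Matrix.of_apply, iteratedFDeriv_two_apply]
  rw [fderiv_clm_apply h1 (differentiableAt_const _)]
  simp

lemma torusHess_apply {f : Torus d → ℝ} (hf : TorusContDiff 2 f) (x : Torus d) (i j : Fin d) :
    torusHess f x i j = pd i (pd j f) x := by
  rw [torusHess, hessian_apply (hf.localLift x), pd, localLift_pd]

lemma torusHess_symm {f : Torus d → ℝ} (hf : TorusContDiff 2 f) (x : Torus d) (i j : Fin d) :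
    torusHess f x i j = torusHess f x j i := by
  have h : IsSymmSndFDerivAt ℝ (localLift f x) 0 :=
    (hf.localLift x).contDiffAt.isSymmSndFDerivAt (by simp)
  simp only [torusHess, hessian, Matrix.of_apply, iteratedFDeriv_two_apply]
  exact h _ _

/-! ### Algebra of partial derivatives -/

lemma TorusContDiff.differentiableAt {f : Torus d → ℝ} (hf : TorusContDiff 1 f) (x : Torus d)
    (z : Euc d) : DifferentiableAt ℝ (ResidualGradient.localLift f x) z :=
  (hf.localLift x).differentiable (by norm_num) z

lemma pd_add {f g : Torus d → ℝ} (hf : TorusContDiff 1 f) (hg : TorusContDiff 1 g) (i : Fin d)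
    (x : Torus d) : pd i (fun x => f x + g x) x = pd i f x + pd i g x := by
  have h : localLift (fun x => f x + g x) x = fun z => localLift f x z + localLift g x z := rfl
  rw [pd, h, fderiv_fun_add (hf.differentiableAt x 0) (hg.differentiableAt x 0)]
  rfl

lemma pd_const_mul {f : Torus d → ℝ} (hf : TorusContDiff 1 f) (c : ℝ) (i : Fin d)
    (x : Torus d) : pd i (fun x => c * f x) x = c * pd i f x := by
  have h : localLift (fun x => c * f x) x = fun z => c * localLift f x z := rfl
  rw [pd, h, fderiv_const_mul (hf.differentiableAt x 0)]
  rfl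

lemma pd_mul {f g : Torus d → ℝ} (hf : TorusContDiff 1 f) (hg : TorusContDiff 1 g) (i : Fin d)
    (x : Torus d) : pd i (fun x => f x * g x) x = f x * pd i g x + g x * pd i f x := by
  have h : localLift (fun x => f x * g x) x = fun z => localLift f x z * localLift g x z := rfl
  have h0 : ∀ f : Torus d → ℝ, localLift f x 0 = f x := fun f => by
    simp [localLift, proj_zero]
  rw [pd, h, fderiv_fun_mul (hf.differentiableAt x 0) (hg.differentiableAt x 0), h0, h0]
  rfl

/-! ### Taylor expansions -/

/-- The homogeneous terms `(z · ∇)^j f (x)` of the Taylor expansion of `f` around `x`. -/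
def taylorTerm : ℕ → (Torus d → ℝ) → Torus d → Euc d → ℝ
  | 0, f, x, _ => f x
  | j + 1, f, x, z => ∑ i, z i * taylorTerm j (pd i f) x z

lemma taylorTerm_smul (j : ℕ) (f : Torus d → ℝ) (x : Torus d) (s : ℝ) (z : Euc d) :
    taylorTerm j f x (s • z) = s ^ j * taylorTerm j f x z := by
  induction j generalizing f with
  | zero => simp [taylorTerm]
  | succ j ih =>
    simp only [taylorTerm, ih, PiLp.smul_apply, smul_eq_mul, Finset.mul_sum]
    exact Finset.sum_congr rfl fun i _ => by ring

lemma hasDerivAt_line {f : Torus d → ℝ} (hf : TorusContDiff 1 f) (x : Torus d) (z : Euc d)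
    (s : ℝ) : HasDerivAt (fun s : ℝ => f (x + proj (s • z)))
      (∑ i, z i * pd i f (x + proj (s • z))) s := by
  have h1 := (hf.differentiableAt x (s • z)).hasFDerivAt.comp_hasDerivAt s
    ((hasDerivAt_id s).smul_const z)
  refine h1.congr_deriv ?_
  conv_lhs => rw [one_smul, eq_sum_basisVec z, map_sum]
  refine Finset.sum_congr rfl fun i _ => ?_
  rw [map_smul, smul_eq_mul, pd_add_proj, ← eq_sum_basisVec z]

/-- Taylor's theorem with a uniform remainder. -/
theorem exists_taylor_bound (m : ℕ) {f : Torus d → ℝ} (hf : TorusContDiff m f) :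
    ∃ K, 0 ≤ K ∧ ∀ x z, |f (x + proj z) -
      ∑ j ∈ Finset.range m, (1 / (j.factorial : ℝ)) * taylorTerm j f x z| ≤ K * ‖z‖ ^ m := by
  induction m generalizing f with
  | zero =>
    obtain ⟨K, hK0, hK⟩ := exists_bound_of_continuous hf.continuous
    exact ⟨K, hK0, fun x z => by simpa using hK _⟩
  | succ m ih =>
    choose K hK0 hK using fun i => ih (hf.pd i)
    refine ⟨∑ i, K i, Finset.sum_nonneg fun i _ => hK0 i, fun x z => ?_⟩
    -- The Taylor remainder along the segment from 0 to `z`. Its derivative `g'` combines the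
    -- remainders of order `m` of the partial derivatives, to which the induction hypothesis
    -- applies; the factors `z i` supply the additional power of ‖z‖, and the mean value inequality
    -- on [0, 1] concludes.
    set g : ℝ → ℝ := fun s => f (x + proj (s • z)) -
      ∑ j ∈ Finset.range (m + 1), (1 / (j.factorial : ℝ)) * taylorTerm j f x (s • z) with hg
    set g' : ℝ → ℝ := fun s => ∑ i, z i * (pd i f (x + proj (s • z)) -
      ∑ j ∈ Finset.range m, (1 / (j.factorial : ℝ)) * taylorTerm j (pd i f) x (s • z)) with hg'
    have hder : ∀ s, HasDerivAt g (g' s) s := by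
      intro s
      have h1 := hasDerivAt_line (hf.of_le (Nat.le_add_left 1 m)) x z s
      have h2 : HasDerivAt (fun s : ℝ => ∑ j ∈ Finset.range (m + 1),
          (1 / (j.factorial : ℝ)) * taylorTerm j f x (s • z))
          (∑ j ∈ Finset.range m, (1 / (j.factorial : ℝ)) *
            ∑ i, z i * taylorTerm j (pd i f) x (s • z)) s := by
        have h3 : (fun s : ℝ => ∑ j ∈ Finset.range (m + 1),
            (1 / (j.factorial : ℝ)) * taylorTerm j f x (s • z)) = fun s => f x +
            ∑ j ∈ Finset.range m, (1 / ((j + 1).factorial : ℝ)) * (s ^ (j + 1) *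
              taylorTerm (j + 1) f x z) := by
          funext s
          rw [Finset.sum_range_succ', add_comm]
          simp only [taylorTerm_smul, pow_zero, Nat.factorial_zero, Nat.cast_one, div_one, one_mul]
          rfl
        rw [h3]
        have h4 : HasDerivAt (fun s : ℝ => f x +
            ∑ j ∈ Finset.range m, (1 / ((j + 1).factorial : ℝ)) * (s ^ (j + 1) *
              taylorTerm (j + 1) f x z))
            (∑ j ∈ Finset.range m, (1 / ((j + 1).factorial : ℝ)) *
              ((((j + 1 : ℕ) : ℝ) * s ^ j) * taylorTerm (j + 1) f x z)) s := by
          refine HasDerivAt.const_add _ (HasDerivAt.fun_sum fun j _ => ?_)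
          exact ((hasDerivAt_pow (j + 1) s).mul_const _).const_mul _
        refine h4.congr_deriv (Finset.sum_congr rfl fun j _ => ?_)
        simp only [taylorTerm_smul, taylorTerm, Nat.factorial_succ, Finset.mul_sum]
        refine Finset.sum_congr rfl fun i _ => ?_
        push_cast
        field_simp
      refine (h1.sub h2).congr_deriv ?_
      simp only [hg', mul_sub, Finset.sum_sub_distrib, Finset.mul_sum]
      congr 1
      rw [Finset.sum_comm]
      exact Finset.sum_congr rfl fun j _ => Finset.sum_congr rfl fun i _ => by ring
    have hbound : ∀ s ∈ Set.Icc (0 : ℝ) 1, ‖g' s‖ ≤ (∑ i, K i) * ‖z‖ ^ (m + 1) := by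
      intro s hs
      rw [Finset.sum_mul]
      refine norm_sum_le_of_le _ fun i _ => ?_
      have h1 : ‖s • z‖ ≤ ‖z‖ := by
        rw [norm_smul, Real.norm_of_nonneg hs.1]
        exact mul_le_of_le_one_left (norm_nonneg z) hs.2
      have h2 : |z i| ≤ ‖z‖ := PiLp.norm_apply_le z i
      rw [norm_mul, Real.norm_eq_abs, Real.norm_eq_abs, pow_succ]
      calc _ ≤ ‖z‖ * (K i * ‖s • z‖ ^ m) := by
            gcongr
            exact hK i x (s • z)
        _ ≤ ‖z‖ * (K i * ‖z‖ ^ m) := by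
            have := hK0 i
            gcongr
        _ = _ := by ring
    have hmv := norm_image_sub_le_of_norm_deriv_le_segment_01'
      (fun s _ => (hder s).hasDerivWithinAt) (fun s hs => hbound s ⟨hs.1, hs.2.le⟩)
    have hg0 : g 0 = 0 := by
      simp only [hg, Finset.sum_range_succ', taylorTerm_smul]
      simp [proj_zero, taylorTerm]
    have hg1 : g 1 = f (x + proj z) -
      ∑ j ∈ Finset.range (m + 1), (1 / (j.factorial : ℝ)) * taylorTerm j f x z := by simp [hg]
    rw [hg0, sub_zero, hg1] at hmv
    exact hmv

end TorusCalculus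

end

section

/-! ## The generator and Dynkin's formula -/

variable {d dW : ℕ}

/-- The coefficients of the dynamics are of class `C²`. -/
structure Dynamics.Regular (D : Dynamics d dW) : Prop where
  r : TorusContDiff 2 D.r
  b : TorusContDiff 2 D.b
  sigma : ∀ i j, TorusContDiff 2 fun x => D.sigma x i j

lemma Dynamics.torusContDiff_a {D : Dynamics d dW} {p : ℕ}
    (h : ∀ i j, TorusContDiff p fun x => D.sigma x i j) (i j : Fin d) :
    TorusContDiff p fun x => D.a x i j := by
  simp only [Dynamics.a, Matrix.mul_apply, Matrix.transpose_apply]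
  exact TorusContDiff.sum fun k _ => (h i k).mul (h j k)

lemma Dynamics.a_symm (D : Dynamics d dW) (x : Torus d) (i j : Fin d) : D.a x i j = D.a x j i := by
  simp only [Dynamics.a, Matrix.mul_apply, Matrix.transpose_apply, mul_comm]

lemma Dynamics.symbol_eq (D : Dynamics d dW) (x : Torus d) (M : Matrix (Fin d) (Fin d) ℝ)
    (q : Euc d) :
    D.symbol x M q = (1 / 2) * ∑ i, ∑ j, D.a x i j * M j i + ∑ i, D.b x i * q i := by
  simp only [Dynamics.symbol, Matrix.trace, Matrix.diag, Matrix.mul_apply]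
  congr 1
  simp [PiLp.inner_apply, mul_comm]

/-- The generator of the displacement process started from `x`. -/
@[irreducible]
def Dynamics.gen (D : Dynamics d dW) (g : Euc d → ℝ) (x : Torus d) (y : Euc d) : ℝ :=
  D.symbol (x + proj y) (hessian g y) (gradient g y)

lemma gradient_apply (g : Euc d → ℝ) (y : Euc d) (i : Fin d) :
    gradient g y i = fderiv ℝ g y (basisVec i) := by
  have h : inner ℝ (gradient g y) (basisVec i) = fderiv ℝ g y (basisVec i) := by
    rw [gradient, InnerProductSpace.toDual_symm_apply]
  rw [← h, EuclideanSpace.inner_single_right]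
  simp

lemma abs_gradient_apply_le (g : Euc d → ℝ) (y : Euc d) (i : Fin d) :
    |gradient g y i| ≤ ‖iteratedFDeriv ℝ 1 g y‖ := by
  rw [gradient_apply, norm_iteratedFDeriv_one]
  simpa using (fderiv ℝ g y).le_opNorm (basisVec i)

lemma abs_hessian_apply_le (g : Euc d → ℝ) (y : Euc d) (i j : Fin d) :
    |hessian g y i j| ≤ ‖iteratedFDeriv ℝ 2 g y‖ := by
  rw [hessian, Matrix.of_apply]
  simpa [Fin.prod_univ_two] using (iteratedFDeriv ℝ 2 g y).le_opNorm ![basisVec i, basisVec j]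

namespace Dynamics.Regular

variable {D : Dynamics d dW} (hD : D.Regular)

include hD

lemma exists_coeff_bound :
    ∃ K, 0 ≤ K ∧ (∀ x i j, |D.a x i j| ≤ K) ∧ (∀ x i, |D.b x i| ≤ K) := by
  choose Ka hKa0 hKa using fun i j =>
    exists_bound_of_continuous (Dynamics.torusContDiff_a hD.sigma i j).continuous
  choose Kb hKb0 hKb using fun i => exists_bound_of_continuous (hD.b.apply i).continuous
  refine ⟨∑ i, ∑ j, Ka i j + ∑ i, Kb i, add_nonneg
    (Finset.sum_nonneg fun i _ => Finset.sum_nonneg fun j _ => hKa0 i j)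
    (Finset.sum_nonneg fun i _ => hKb0 i), fun x i j => ?_, fun x i => ?_⟩
  · have h1 : Ka i j ≤ ∑ j, Ka i j :=
      Finset.single_le_sum (fun j _ => hKa0 i j) (Finset.mem_univ j)
    have h2 : ∑ j, Ka i j ≤ ∑ i, ∑ j, Ka i j :=
      Finset.single_le_sum (f := fun i => ∑ j, Ka i j)
        (fun i _ => Finset.sum_nonneg fun j _ => hKa0 i j) (Finset.mem_univ i)
    have h3 : 0 ≤ ∑ i, Kb i := Finset.sum_nonneg fun i _ => hKb0 i
    linarith [hKa i j x]
  · have h1 : Kb i ≤ ∑ i, Kb i := Finset.single_le_sum (fun j _ => hKb0 j) (Finset.mem_univ i)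
    have h2 : 0 ≤ ∑ i, ∑ j, Ka i j :=
      Finset.sum_nonneg fun i _ => Finset.sum_nonneg fun j _ => hKa0 i j
    linarith [hKb i x]

lemma exists_gen_bound :
    ∃ K, 0 ≤ K ∧ ∀ g x y, |D.gen g x y| ≤
      K * (‖iteratedFDeriv ℝ 1 g y‖ + ‖iteratedFDeriv ℝ 2 g y‖) := by
  obtain ⟨K, hK0, hKa, hKb⟩ := hD.exists_coeff_bound
  refine ⟨d * d * K + d * K, by positivity, fun g x y => ?_⟩
  rw [Dynamics.gen, Dynamics.symbol_eq]
  set A := ‖iteratedFDeriv ℝ 1 g y‖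
  set B := ‖iteratedFDeriv ℝ 2 g y‖
  have hA : 0 ≤ A := norm_nonneg _
  have hB : 0 ≤ B := norm_nonneg _
  have h1 : |∑ i, ∑ j, D.a (x + proj y) i j * hessian g y j i| ≤ d * d * (K * B) := by
    calc _ ≤ ∑ i, ∑ j, |D.a (x + proj y) i j * hessian g y j i| :=
          (Finset.abs_sum_le_sum_abs _ _).trans
            (Finset.sum_le_sum fun i _ => Finset.abs_sum_le_sum_abs _ _)
      _ ≤ ∑ i : Fin d, ∑ j : Fin d, K * B := by
          refine Finset.sum_le_sum fun i _ => Finset.sum_le_sum fun j _ => ?_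
          rw [abs_mul]
          exact mul_le_mul (hKa _ _ _) (abs_hessian_apply_le g y j i) (abs_nonneg _) hK0
      _ = _ := by simp; ring
  have h2 : |∑ i, D.b (x + proj y) i * gradient g y i| ≤ d * (K * A) := by
    calc _ ≤ ∑ i, |D.b (x + proj y) i * gradient g y i| := Finset.abs_sum_le_sum_abs _ _
      _ ≤ ∑ i : Fin d, K * A := by
          refine Finset.sum_le_sum fun i _ => ?_
          rw [abs_mul]
          exact mul_le_mul (hKb _ _) (abs_gradient_apply_le g y i) (abs_nonneg _) hK0
      _ = _ := by simp
  have h3 : 0 ≤ d * d * (K * B) := by positivity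
  have h4 : 0 ≤ (d : ℝ) * d * (K * A) := by positivity
  have h5 : 0 ≤ (d : ℝ) * (K * B) := by positivity
  calc _ ≤ |(1 / 2) * ∑ i, ∑ j, D.a (x + proj y) i j * hessian g y j i| +
        |∑ i, D.b (x + proj y) i * gradient g y i| := abs_add_le _ _
    _ ≤ (1 / 2) * (d * d * (K * B)) + d * (K * A) := by
        rw [abs_mul, abs_of_nonneg (by norm_num : (0 : ℝ) ≤ 1 / 2)]
        gcongr
    _ ≤ _ := by nlinarith

lemma continuous_gen {g : Euc d → ℝ} (hg : ContDiff ℝ 2 g) :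
    Continuous fun q : Torus d × Euc d => D.gen g q.1 q.2 := by
  have ha : ∀ i j, Continuous fun x => D.a x i j :=
    fun i j => (Dynamics.torusContDiff_a hD.sigma i j).continuous
  have hb : ∀ i, Continuous fun x => D.b x i := fun i => (hD.b.apply i).continuous
  have hxy : Continuous fun q : Torus d × Euc d => q.1 + proj q.2 :=
    continuous_fst.add (continuous_proj.comp continuous_snd)
  have hh : ∀ i j, Continuous fun y => hessian g y i j := by
    intro i j
    simp only [hessian, Matrix.of_apply]
    exact (ContinuousMultilinearMap.apply ℝ (fun _ : Fin 2 => Euc d) ℝ _).continuous.comp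
      (hg.continuous_iteratedFDeriv le_rfl)
  have hgr : ∀ i, Continuous fun y => gradient g y i := by
    intro i
    simp only [gradient_apply]
    exact (hg.continuous_fderiv (by norm_num)).clm_apply continuous_const
  simp only [Dynamics.gen, Dynamics.symbol_eq]
  refine (continuous_const.mul (continuous_finsetSum _ fun i _ => continuous_finsetSum _
    fun j _ => ((ha i j).comp hxy).mul ((hh j i).comp continuous_snd))).add
    (continuous_finsetSum _ fun i _ => ((hb i).comp hxy).mul ((hgr i).comp continuous_snd))

end Dynamics.Regular

/-- Dynkin's formula for test functions with compact support. -/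
structure DynkinProcess {Ω : Type*} [MeasurableSpace Ω] (D : Dynamics d dW) (P : Measure Ω)
    (X : Ω → Torus d) (W : ℝ → Ω → Euc d) : Prop where
  measurable_X : Measurable X
  measurable_W : ∀ t, Measurable (W t)
  continuous : ∀ ω, Continuous fun t => W t ω
  zero : ∀ ω, W 0 ω = 0
  dynkin : ∀ g : Euc d → ℝ, ContDiff ℝ 2 g → HasCompactSupport g → ∀ s t : ℝ, 0 ≤ s → s ≤ t →
    ∀ F : Torus d × Euc d → ℝ, Measurable F → Integrable (fun ω => F (X ω, W s ω)) P →
    ∫ ω, F (X ω, W s ω) * (g (W t ω) - g (W s ω)) ∂P =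
      ∫ u in s..t, ∫ ω, F (X ω, W s ω) * D.gen g (X ω) (W u ω) ∂P

section

variable {Ω : Type*} [MeasurableSpace Ω] {D : Dynamics d dW} {P : Measure Ω}
  [IsProbabilityMeasure P] {X : Ω → Torus d}

lemma measurable_uncurry_path {W : ℝ → Ω → Euc d} (hm : ∀ t, Measurable (W t))
    (hc : ∀ ω, Continuous fun t => W t ω) : Measurable fun q : ℝ × Ω => W q.1 q.2 :=
  measurable_uncurry_of_continuous_of_measurable hc hm

lemma Dynamics.Regular.measurable_gen (hD : D.Regular) {g : Euc d → ℝ} (hg : ContDiff ℝ 2 g) :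
    Measurable fun q : Torus d × Euc d => D.gen g q.1 q.2 := by
  have h := hD.continuous_gen hg
  exact h.measurable

lemma measurable_position {W : ℝ → Ω → Euc d} (hX : Measurable X) (hm : ∀ t, Measurable (W t))
    (hc : ∀ ω, Continuous fun t => W t ω) : Measurable fun q : ℝ × Ω => (X q.2, W q.1 q.2) :=
  (hX.comp measurable_snd).prodMk (measurable_uncurry_path hm hc)

lemma measurable_gen_path (hD : D.Regular) {g : Euc d → ℝ} (hg : ContDiff ℝ 2 g)
    (hX : Measurable X) {W : ℝ → Ω → Euc d} (hm : ∀ t, Measurable (W t))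
    (hc : ∀ ω, Continuous fun t => W t ω) :
    Measurable fun q : ℝ × Ω => D.gen g (X q.2) (W q.1 q.2) := by
  have h1 := hD.measurable_gen hg
  have h2 := measurable_position hX hm hc
  exact h1.comp h2

lemma exists_bound_of_hasCompactSupport {g : Euc d → ℝ} (hg : ContDiff ℝ 2 g)
    (hgc : HasCompactSupport g) : ∃ K, 0 ≤ K ∧ ∀ y, |g y| ≤ K ∧
      ‖iteratedFDeriv ℝ 1 g y‖ ≤ K ∧ ‖iteratedFDeriv ℝ 2 g y‖ ≤ K := by
  obtain ⟨K0, h0⟩ := hgc.exists_bound_of_continuous hg.continuous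
  obtain ⟨K1, h1⟩ := (hgc.iteratedFDeriv 1).exists_bound_of_continuous
    (hg.continuous_iteratedFDeriv (m := 1) (by norm_num))
  obtain ⟨K2, h2⟩ := (hgc.iteratedFDeriv 2).exists_bound_of_continuous
    (hg.continuous_iteratedFDeriv (m := 2) le_rfl)
  have hp0 := (norm_nonneg _).trans (h0 0)
  have hp1 := (norm_nonneg _).trans (h1 0)
  have hp2 := (norm_nonneg _).trans (h2 0)
  refine ⟨K0 + K1 + K2, by positivity, fun y => ⟨?_, ?_, ?_⟩⟩
  · exact (h0 y).trans (by linarith)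
  · exact (h1 y).trans (by linarith)
  · exact (h2 y).trans (by linarith)

/-- The increment of a martingale after time `s` is orthogonal to the weight `F (X, W s)`, and
Fubini moves the time integral outside the expectation. The weight keeps the information about time
`s` that the two-time moments will require. -/
theorem Dynamics.IsSolution.dynkinProcess (hD : D.Regular) (hX : Measurable X)
    {Y : ℝ≥0 → Ω → Euc d} (h : D.IsSolution P X Y) :
    DynkinProcess D P X (fun t => Y t.toNNReal) := by
  obtain ⟨hc, h0, 𝓕, hX0, hY, hmart⟩ := h
  have hYm : ∀ t, Measurable (Y t) := fun t => (hY t).mono (𝓕.le t) le_rfl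
  have hcW : ∀ ω, Continuous fun t : ℝ => Y t.toNNReal ω := fun ω =>
    (hc ω).comp continuous_real_toNNReal
  refine ⟨hX, fun t => hYm _, hcW, fun ω => by simpa using h0 ω, ?_⟩
  intro g hg hgc s t hs hst F hF hint
  obtain ⟨Kg, hKg0, hKg⟩ := exists_bound_of_hasCompactSupport hg hgc
  obtain ⟨K, hK0, hK⟩ := hD.exists_gen_bound
  have hgen : ∀ x y, |D.gen g x y| ≤ K * (Kg + Kg) := fun x y =>
    (hK g x y).trans (by gcongr; exacts [(hKg y).2.1, (hKg y).2.2])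
  set W : ℝ → Ω → Euc d := fun t => Y t.toNNReal with hW
  have hWm : ∀ t, Measurable (W t) := fun t => hYm _
  have hjoint := measurable_gen_path hD hg hX hWm hcW
  have hgenc : ∀ ω, Continuous fun u => D.gen g (X ω) (W u ω) := fun ω =>
    (hD.continuous_gen hg).comp (continuous_const.prodMk (hcW ω))
  have hM := hmart g hg hgc
  set M : ℝ≥0 → Ω → ℝ := fun t ω => g (Y t ω) - ∫ u in (0 : ℝ)..(t : ℝ),
    D.gen g (X ω) (W u ω) with hMdef
  have hM' : Martingale M 𝓕 P := by
    simp only [hMdef, Dynamics.gen]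
    exact hM
  set V : Ω → ℝ := fun ω => F (X ω, W s ω) with hV
  have hVs : StronglyMeasurable[𝓕 s.toNNReal] V :=
    (hF.comp ((hX0.mono (𝓕.mono zero_le) le_rfl).prodMk (hY s.toNNReal))).stronglyMeasurable
  have hMb : ∀ (t : ℝ≥0) ω, ‖M t ω‖ ≤ Kg + K * (Kg + Kg) * t := by
    intro t ω
    refine (norm_sub_le _ _).trans (add_le_add (hKg _).1 ?_)
    have := intervalIntegral.norm_integral_le_of_norm_le_const (a := 0) (b := (t : ℝ))
      (f := fun u => D.gen g (X ω) (W u ω)) (C := K * (Kg + Kg)) fun u _ => hgen _ _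
    simpa using this
  have hVM : ∀ t : ℝ≥0, Integrable (fun ω => V ω * M t ω) P := fun t =>
    hint.mul_bdd (hM'.integrable t).1 (ae_of_all _ (hMb t))
  -- The weight is known at time `s`, so it comes out of the conditional expectation and the
  -- martingale property applies.
  have hzero : ∫ ω, V ω * M t.toNNReal ω ∂P = ∫ ω, V ω * M s.toNNReal ω ∂P := by
    have h1 : P[fun ω => V ω * M t.toNNReal ω | 𝓕 s.toNNReal] =ᵐ[P]
        fun ω => V ω * M s.toNNReal ω :=
      (condExp_mul_of_stronglyMeasurable_left hVs (hVM _) (hM'.integrable _)).trans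
        (EventuallyEq.rfl.mul (hM'.condExp_ae_eq (Real.toNNReal_le_toNNReal hst)))
    rw [← integral_condExp (𝓕.le s.toNNReal), integral_congr_ae h1]
  have hpt : ∀ ω, V ω * M t.toNNReal ω - V ω * M s.toNNReal ω =
      V ω * (g (W t ω) - g (W s ω)) - ∫ u in s..t, V ω * D.gen g (X ω) (W u ω) := by
    intro ω
    have h1 := intervalIntegral.integral_add_adjacent_intervals
      ((hgenc ω).intervalIntegrable 0 s) ((hgenc ω).intervalIntegrable (μ := volume) s t)
    have h2 : ∀ t, 0 ≤ t → M t.toNNReal ω =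
        g (W t ω) - ∫ u in (0 : ℝ)..t, D.gen g (X ω) (W u ω) := fun t ht => by
      simp only [hMdef, Real.coe_toNNReal t ht, hW]
    rw [intervalIntegral.integral_const_mul, h2 t (hs.trans hst), h2 s hs, ← h1]
    ring
  have hgi : ∀ t, Integrable (fun ω => V ω * g (W t ω)) P := fun t =>
    hint.mul_bdd (hg.continuous.measurable.comp (hWm t)).aestronglyMeasurable
      (ae_of_all _ fun ω => (hKg _).1)
  have hprod : Integrable (Function.uncurry fun (u : ℝ) ω => V ω * D.gen g (X ω) (W u ω))
      ((volume.restrict (Set.uIoc s t)).prod P) := by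
    have : IsFiniteMeasure (volume.restrict (Set.uIoc s t)) := by
      rw [Set.uIoc_of_le hst]
      infer_instance
    have h1 : Integrable (fun q : ℝ × Ω => V q.2) ((volume.restrict (Set.uIoc s t)).prod P) :=
      hint.comp_snd _
    exact h1.mul_bdd hjoint.aestronglyMeasurable (ae_of_all _ fun q => hgen _ _)
  have hi1 : Integrable (fun ω => V ω * (g (W t ω) - g (W s ω))) P := by
    simpa only [mul_sub] using integrable_fun_sub (hgi t) (hgi s)
  have hi2 : Integrable (fun ω => ∫ u in s..t, V ω * D.gen g (X ω) (W u ω)) P := by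
    have := hprod.integral_prod_right
    simp only [intervalIntegral.intervalIntegral_eq_integral_uIoc, if_pos hst, one_smul]
    exact this
  have hfin : ∫ ω, (V ω * M t.toNNReal ω - V ω * M s.toNNReal ω) ∂P = 0 := by
    rw [integral_sub (hVM _) (hVM _), hzero, sub_self]
  simp_rw [hpt] at hfin
  rw [integral_sub hi1 hi2] at hfin
  rw [intervalIntegral_integral_swap hprod]
  linarith

end

end

section

/-! ## Moments of the displacement -/

/-- A smooth saturation at infinity of the monomial `u ^ q`. -/
lemma exists_saturated_pow (q : ℕ) : ∃ (Θ : ℝ → ℝ) (C : ℝ), ContDiff ℝ 2 Θ ∧ 0 ≤ C ∧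
    (∀ u ≤ 1, Θ u = u ^ q) ∧ (∀ u, 2 ≤ u → Θ u = 1) ∧ (∀ u, 0 ≤ u → 0 ≤ Θ u) ∧
    (∀ u, 0 ≤ u → u * |deriv Θ u| ≤ C * Θ u) ∧
    (∀ u, 0 ≤ u → u ^ 2 * |deriv (deriv Θ) u| ≤ C * Θ u) := by
  -- The monomial on u ≤ 1 is glued to the constant 1 on u ≥ 2, so that Θ - 1 will yield compactly
  -- supported test functions. The derivative bounds are scale invariant: they hold for the
  -- monomial, are trivial for the constant, and follow from compactness on [1, 2], where Θ ≥ 1.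
  set χ : ℝ → ℝ := fun u => Real.smoothTransition (2 - u) with hχ
  have hχs : ContDiff ℝ 2 χ := Real.smoothTransition.contDiff.comp (contDiff_const.sub contDiff_id)
  set Θ : ℝ → ℝ := fun u => χ u * u ^ q + (1 - χ u) with hΘ
  have hΘs : ContDiff ℝ 2 Θ := (hχs.mul (contDiff_id.pow q)).add (contDiff_const.sub hχs)
  have h1 : ∀ u ≤ 1, Θ u = u ^ q := fun u hu => by
    have : χ u = 1 := Real.smoothTransition.one_of_one_le (by linarith)
    simp [hΘ, this]
  have h2 : ∀ u, 2 ≤ u → Θ u = 1 := fun u hu => by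
    have : χ u = 0 := Real.smoothTransition.zero_of_nonpos (by linarith)
    simp [hΘ, this]
  have hχ0 : ∀ u, 0 ≤ χ u := fun u => Real.smoothTransition.nonneg _
  have hχ1 : ∀ u, χ u ≤ 1 := fun u => Real.smoothTransition.le_one _
  have hpos : ∀ u, 0 ≤ u → 0 ≤ Θ u := fun u hu => by
    have := mul_nonneg (hχ0 u) (pow_nonneg hu q)
    have := hχ1 u
    simp only [hΘ]
    linarith
  have hge : ∀ u, 1 ≤ u → 1 ≤ Θ u := fun u hu => by
    have h3 : 1 ≤ u ^ q := one_le_pow₀ hu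
    have := mul_le_mul_of_nonneg_left h3 (hχ0 u)
    simp only [hΘ]
    linarith
  have hd1 : Continuous (deriv Θ) := hΘs.continuous_deriv (by norm_num)
  have hd2 : Continuous (deriv (deriv Θ)) := by
    have h3 : ContDiff ℝ 1 (deriv Θ) := by
      rw [show (2 : WithTop ℕ∞) = 1 + 1 by norm_num, contDiff_succ_iff_deriv] at hΘs
      exact hΘs.2.2
    exact h3.continuous_deriv le_rfl
  obtain ⟨B1, hB1⟩ := isCompact_Icc.exists_bound_of_continuousOn (s := Set.Icc (1 : ℝ) 2)
    hd1.continuousOn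
  obtain ⟨B2, hB2⟩ := isCompact_Icc.exists_bound_of_continuousOn (s := Set.Icc (1 : ℝ) 2)
    hd2.continuousOn
  have hB10 : 0 ≤ B1 := (norm_nonneg _).trans (hB1 1 (by norm_num))
  have hB20 : 0 ≤ B2 := (norm_nonneg _).trans (hB2 1 (by norm_num))
  have hlow : ∀ u < 1, deriv Θ u = q * u ^ (q - 1) ∧
      deriv (deriv Θ) u = q * ((q - 1 : ℕ) * u ^ (q - 1 - 1)) := by
    intro u hu
    have e1 : ∀ v < 1, deriv Θ v = q * v ^ (q - 1) := by
      intro v hv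
      have : Θ =ᶠ[𝓝 v] fun u => u ^ q :=
        (eventually_lt_nhds hv).mono fun w hw => h1 w hw.le
      rw [this.deriv_eq]
      simp
    refine ⟨e1 u hu, ?_⟩
    have : deriv Θ =ᶠ[𝓝 u] fun u => q * u ^ (q - 1) :=
      (eventually_lt_nhds hu).mono fun w hw => e1 w hw
    rw [this.deriv_eq]
    simp
  have hhigh : ∀ u, 2 < u → deriv Θ u = 0 ∧ deriv (deriv Θ) u = 0 := by
    intro u hu
    have e1 : ∀ v, 2 < v → deriv Θ v = 0 := by
      intro v hv
      have : Θ =ᶠ[𝓝 v] fun _ => 1 := (eventually_gt_nhds hv).mono fun w hw => h2 w hw.le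
      rw [this.deriv_eq]
      simp
    refine ⟨e1 u hu, ?_⟩
    have : deriv Θ =ᶠ[𝓝 u] fun _ => 0 := (eventually_gt_nhds hu).mono fun w hw => e1 w hw
    rw [this.deriv_eq]
    simp
  -- One constant for all regimes: `q` and `q * q` serve the monomial, `2 * B1` and `4 * B2` the
  -- interval [1, 2], where u ≤ 2 and u² ≤ 4.
  refine ⟨Θ, q + q * q + 2 * B1 + 4 * B2, hΘs, by positivity, h1, h2, hpos, ?_, ?_⟩
  · intro u hu
    rcases lt_or_ge u 1 with hu1 | hu1
    · rw [(hlow u hu1).1, h1 u hu1.le, abs_of_nonneg (by positivity)]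
      have h3 : u * (q * u ^ (q - 1)) = q * u ^ q := by
        rcases q with _ | q
        · simp
        · simp [pow_succ]; ring
      rw [h3]
      gcongr
      have : (0 : ℝ) ≤ q * q := by positivity
      linarith
    rcases le_or_gt u 2 with hu2 | hu2
    · have h3 := hB1 u ⟨hu1, hu2⟩
      have h4 := hge u hu1
      rw [Real.norm_eq_abs] at h3
      have h5 : u * |deriv Θ u| ≤ 2 * B1 := by gcongr
      have h6 : (2 * B1) * 1 ≤ (q + q * q + 2 * B1 + 4 * B2) * Θ u := by
        gcongr
        have : (0 : ℝ) ≤ q + q * q := by positivity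
        linarith
      linarith
    · rw [(hhigh u hu2).1, abs_zero, mul_zero]
      have := hpos u hu
      positivity
  · intro u hu
    rcases lt_or_ge u 1 with hu1 | hu1
    · rw [(hlow u hu1).2, h1 u hu1.le, abs_of_nonneg (by positivity)]
      have h3 : u ^ 2 * (q * ((q - 1 : ℕ) * u ^ (q - 1 - 1))) = q * (q - 1 : ℕ) * u ^ q := by
        rcases q with _ | _ | q
        · simp
        · simp
        · simp [pow_succ]; ring
      rw [h3]
      have h4 : ((q - 1 : ℕ) : ℝ) ≤ q := by exact_mod_cast Nat.sub_le q 1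
      gcongr
      have h5 : (q : ℝ) * (q - 1 : ℕ) ≤ q * q := by gcongr
      have : (0 : ℝ) ≤ q := by positivity
      linarith
    rcases le_or_gt u 2 with hu2 | hu2
    · have h3 := hB2 u ⟨hu1, hu2⟩
      have h4 := hge u hu1
      rw [Real.norm_eq_abs] at h3
      have h5 : u ^ 2 * |deriv (deriv Θ) u| ≤ 2 ^ 2 * B2 := by gcongr
      have h6 : (4 * B2) * 1 ≤ (q + q * q + 2 * B1 + 4 * B2) * Θ u := by
        gcongr
        have : (0 : ℝ) ≤ q + q * q := by positivity
        linarith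
      linarith
    · rw [(hhigh u hu2).2, abs_zero, mul_zero]
      have := hpos u hu
      positivity

variable {d dW : ℕ}

lemma hasFDerivAt_norm_sq_div (t N : ℝ) (z : Euc d) :
    HasFDerivAt (fun z : Euc d => (t + ‖z‖ ^ 2) / N) ((2 / N) • innerSL ℝ z) z := by
  have h1 := ((hasStrictFDerivAt_norm_sq z).hasFDerivAt.const_add t).mul_const (N⁻¹)
  simp only [div_eq_mul_inv]
  refine h1.congr_fderiv ?_
  ext v
  simp
  ring

lemma fderiv_saturated {Θ : ℝ → ℝ} (hΘ : ContDiff ℝ 2 Θ) (t N : ℝ) (z : Euc d) (i : Fin d) :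
    fderiv ℝ (fun z : Euc d => Θ ((t + ‖z‖ ^ 2) / N) - 1) z (basisVec i) =
      deriv Θ ((t + ‖z‖ ^ 2) / N) * ((2 / N) * z i) := by
  have h1 : HasDerivAt Θ (deriv Θ ((t + ‖z‖ ^ 2) / N)) ((t + ‖z‖ ^ 2) / N) :=
    (hΘ.differentiable (by norm_num) _).hasDerivAt
  have h2 := (h1.comp_hasFDerivAt z (hasFDerivAt_norm_sq_div t N z)).sub_const 1
  have h3 := h2.fderiv
  simp only [Function.comp_def] at h3
  rw [h3]
  simp [EuclideanSpace.inner_single_right]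

lemma hessian_saturated {Θ : ℝ → ℝ} (hΘ : ContDiff ℝ 2 Θ) (t N : ℝ) (z : Euc d) (i j : Fin d)
    (hg : ContDiff ℝ 2 fun z : Euc d => Θ ((t + ‖z‖ ^ 2) / N) - 1) :
    hessian (fun z : Euc d => Θ ((t + ‖z‖ ^ 2) / N) - 1) z i j =
      deriv (deriv Θ) ((t + ‖z‖ ^ 2) / N) * ((2 / N) * z i) * ((2 / N) * z j) +
        deriv Θ ((t + ‖z‖ ^ 2) / N) * ((2 / N) * basisVec i j) := by
  rw [hessian_apply hg]
  simp only [fderiv_saturated hΘ]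
  have hd : ContDiff ℝ 1 (deriv Θ) := by
    rw [show (2 : WithTop ℕ∞) = 1 + 1 by norm_num, contDiff_succ_iff_deriv] at hΘ
    exact hΘ.2.2
  have h1 : HasDerivAt (deriv Θ) (deriv (deriv Θ) ((t + ‖z‖ ^ 2) / N)) ((t + ‖z‖ ^ 2) / N) :=
    (hd.differentiable one_ne_zero _).hasDerivAt
  have h2 := h1.comp_hasFDerivAt z (hasFDerivAt_norm_sq_div t N z)
  have h3 : HasFDerivAt (fun z : Euc d => (2 / N) * z j)
      ((2 / N) • (EuclideanSpace.proj j : Euc d →L[ℝ] ℝ)) z :=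
    (EuclideanSpace.proj j : Euc d →L[ℝ] ℝ).hasFDerivAt.const_mul (2 / N)
  have h4 := (h2.mul h3).fderiv
  simp only [Function.comp_def] at h4
  have h5 : (fun z : Euc d => deriv Θ ((t + ‖z‖ ^ 2) / N) * ((2 / N) * z j)) =
    (fun z : Euc d => deriv Θ ((t + ‖z‖ ^ 2) / N)) * fun z : Euc d => (2 / N) * z j := rfl
  rw [h5, h4]
  simp [EuclideanSpace.inner_single_right]
  ring

end

/-! ### Even moments of the displacement, by Grönwall's inequality and Fatou's lemma -/

section

variable {d dW : ℕ}

/-- The generator of the saturated powers of `t + ‖z‖²` is controlled by these powers. -/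
lemma Dynamics.Regular.exists_gen_saturated_bound {D : Dynamics d dW} (hD : D.Regular)
    {Θ : ℝ → ℝ} {C : ℝ} (hΘ : ContDiff ℝ 2 Θ) (hC : 0 ≤ C) (h0 : ∀ u, 0 ≤ u → 0 ≤ Θ u)
    (h1 : ∀ u, 0 ≤ u → u * |deriv Θ u| ≤ C * Θ u)
    (h2 : ∀ u, 0 ≤ u → u ^ 2 * |deriv (deriv Θ) u| ≤ C * Θ u) (T : ℝ) :
    ∃ L, 0 ≤ L ∧ ∀ t N : ℝ, 0 < t → t ≤ T → 0 < N → ∀ x (z : Euc d),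
      |D.gen (fun z : Euc d => Θ ((t + ‖z‖ ^ 2) / N) - 1) x z| ≤
        L / t * Θ ((t + ‖z‖ ^ 2) / N) := by
  obtain ⟨K, hK0, hKa, hKb⟩ := hD.exists_coeff_bound
  -- The Hessian of Θ((t + ‖z‖²)/N) has a part with the second derivative of Θ and a part with the
  -- first, bounded by 4CΘ/t and 2CΘ/t, whence the 6. The other summand comes from the gradient
  -- against the drift.
  refine ⟨d * d * K * (6 * C) + d * K * (2 * (|T| + 1) * C), by positivity, ?_⟩
  intro t N ht htT hN x z
  have hg : ContDiff ℝ 2 fun z : Euc d => Θ ((t + ‖z‖ ^ 2) / N) - 1 :=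
    (hΘ.comp ((contDiff_const.add (contDiff_norm_sq ℝ)).div_const N)).sub contDiff_const
  set u : ℝ := (t + ‖z‖ ^ 2) / N with hu
  have hU : 0 < t + ‖z‖ ^ 2 := by positivity
  have hu0 : 0 < u := by positivity
  have hz0 := norm_nonneg z
  have hT1 : t ≤ |T| := htT.trans (le_abs_self T)
  -- scaling inequalities
  have e1 : 1 / N ≤ u / t := by
    rw [hu, div_div, div_le_div_iff₀ hN (by positivity)]
    nlinarith [sq_nonneg ‖z‖]
  have e2 : ‖z‖ / N ≤ (|T| + 1) * u / t := by
    have h3 : ‖z‖ * t ≤ (|T| + 1) * (t + ‖z‖ ^ 2) := by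
      nlinarith [sq_nonneg (t - ‖z‖), sq_nonneg ‖z‖, abs_nonneg T,
        mul_nonneg (abs_nonneg T) (sq_nonneg ‖z‖), mul_le_mul_of_nonneg_right hT1 ht.le]
    rw [hu, ← mul_div_assoc, div_div, div_le_div_iff₀ hN (by positivity)]
    nlinarith
  have e3 : (‖z‖ / N) ^ 2 ≤ u ^ 2 / t := by
    have h3 : ‖z‖ ^ 2 * t ≤ (t + ‖z‖ ^ 2) ^ 2 := by nlinarith [sq_nonneg ‖z‖, sq_nonneg t]
    rw [hu, div_pow, div_pow, div_div, div_le_div_iff₀ (by positivity) (by positivity)]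
    nlinarith [sq_nonneg N]
  have f1 : |deriv Θ u| * (1 / N) ≤ C * Θ u / t := by
    calc |deriv Θ u| * (1 / N) ≤ |deriv Θ u| * (u / t) := by gcongr
      _ = u * |deriv Θ u| / t := by ring
      _ ≤ _ := div_le_div_of_nonneg_right (h1 u hu0.le) ht.le
  have f2 : |deriv Θ u| * (‖z‖ / N) ≤ (|T| + 1) * (C * Θ u) / t := by
    calc |deriv Θ u| * (‖z‖ / N) ≤ |deriv Θ u| * ((|T| + 1) * u / t) := by gcongr
      _ = (|T| + 1) * (u * |deriv Θ u|) / t := by ring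
      _ ≤ _ := div_le_div_of_nonneg_right
        (mul_le_mul_of_nonneg_left (h1 u hu0.le) (by positivity)) ht.le
  have f3 : |deriv (deriv Θ) u| * (‖z‖ / N) ^ 2 ≤ C * Θ u / t := by
    calc |deriv (deriv Θ) u| * (‖z‖ / N) ^ 2 ≤ |deriv (deriv Θ) u| * (u ^ 2 / t) := by gcongr
      _ = u ^ 2 * |deriv (deriv Θ) u| / t := by ring
      _ ≤ _ := div_le_div_of_nonneg_right (h2 u hu0.le) ht.le
  have hz : ∀ i, |z i| ≤ ‖z‖ := fun i => PiLp.norm_apply_le z i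
  have hbv : ∀ i j : Fin d, |basisVec i j| ≤ 1 := fun i j => by
    rw [PiLp.single_apply]
    split_ifs <;> simp
  have hhess : ∀ i j, |hessian (fun z : Euc d => Θ ((t + ‖z‖ ^ 2) / N) - 1) z i j| ≤
      6 * C * Θ u / t := by
    intro i j
    rw [hessian_saturated hΘ t N z i j hg, ← hu]
    have g1 : |deriv (deriv Θ) u * ((2 / N) * z i) * ((2 / N) * z j)| ≤ 4 * (C * Θ u / t) := by
      have h3 : |z i| * |z j| ≤ ‖z‖ * ‖z‖ := mul_le_mul (hz i) (hz j) (abs_nonneg _) hz0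
      calc _ = 4 * (|deriv (deriv Θ) u| * ((|z i| * |z j|) / N ^ 2)) := by
            rw [abs_mul, abs_mul, abs_mul, abs_mul, abs_of_pos (by positivity : 0 < 2 / N)]
            ring
        _ ≤ 4 * (|deriv (deriv Θ) u| * ((‖z‖ * ‖z‖) / N ^ 2)) := by gcongr
        _ = 4 * (|deriv (deriv Θ) u| * (‖z‖ / N) ^ 2) := by ring
        _ ≤ _ := by gcongr
    have g2 : |deriv Θ u * ((2 / N) * basisVec i j)| ≤ 2 * (C * Θ u / t) := by
      calc _ = 2 * (|deriv Θ u| * (1 / N)) * |basisVec i j| := by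
            rw [abs_mul, abs_mul, abs_of_pos (by positivity : 0 < 2 / N)]
            ring
        _ ≤ 2 * (|deriv Θ u| * (1 / N)) * 1 := by gcongr; exact hbv i j
        _ ≤ _ := by rw [mul_one]; gcongr
    calc _ ≤ _ := abs_add_le _ _
      _ ≤ 4 * (C * Θ u / t) + 2 * (C * Θ u / t) := add_le_add g1 g2
      _ = _ := by ring
  have hgrad : ∀ i, |gradient (fun z : Euc d => Θ ((t + ‖z‖ ^ 2) / N) - 1) z i| ≤
      2 * (|T| + 1) * C * Θ u / t := by
    intro i
    rw [gradient_apply, fderiv_saturated hΘ, ← hu]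
    calc _ = 2 * (|deriv Θ u| * (|z i| / N)) := by
            rw [abs_mul, abs_mul, abs_of_pos (by positivity : 0 < 2 / N)]
            ring
        _ ≤ 2 * (|deriv Θ u| * (‖z‖ / N)) := by gcongr; exact hz i
        _ ≤ 2 * ((|T| + 1) * (C * Θ u) / t) := by gcongr
        _ = _ := by ring
  have hΘu := h0 u hu0.le
  rw [Dynamics.gen, Dynamics.symbol_eq]
  refine (abs_add_le _ _).trans ?_
  have s1 : |∑ i, ∑ j, D.a (x + proj z) i j *
      hessian (fun z : Euc d => Θ ((t + ‖z‖ ^ 2) / N) - 1) z j i| ≤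
      d * d * (K * (6 * C * Θ u / t)) := by
    calc _ ≤ ∑ i, ∑ j, |D.a (x + proj z) i j *
          hessian (fun z : Euc d => Θ ((t + ‖z‖ ^ 2) / N) - 1) z j i| :=
          (Finset.abs_sum_le_sum_abs _ _).trans
            (Finset.sum_le_sum fun i _ => Finset.abs_sum_le_sum_abs _ _)
      _ ≤ ∑ i : Fin d, ∑ j : Fin d, K * (6 * C * Θ u / t) := by
          refine Finset.sum_le_sum fun i _ => Finset.sum_le_sum fun j _ => ?_
          rw [abs_mul]
          exact mul_le_mul (hKa _ _ _) (hhess j i) (abs_nonneg _) hK0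
      _ = _ := by simp; ring
  have s2 : |∑ i, D.b (x + proj z) i *
      gradient (fun z : Euc d => Θ ((t + ‖z‖ ^ 2) / N) - 1) z i| ≤
      d * (K * (2 * (|T| + 1) * C * Θ u / t)) := by
    calc _ ≤ ∑ i, |D.b (x + proj z) i *
          gradient (fun z : Euc d => Θ ((t + ‖z‖ ^ 2) / N) - 1) z i| :=
          Finset.abs_sum_le_sum_abs _ _
      _ ≤ ∑ i : Fin d, K * (2 * (|T| + 1) * C * Θ u / t) := by
          refine Finset.sum_le_sum fun i _ => ?_
          rw [abs_mul]
          exact mul_le_mul (hKb _ _) (hgrad i) (abs_nonneg _) hK0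
      _ = _ := by simp
  have s0 : 0 ≤ (d : ℝ) * d * (K * (6 * C * Θ u / t)) := by positivity
  rw [abs_mul, abs_of_nonneg (by norm_num : (0 : ℝ) ≤ 1 / 2)]
  calc _ ≤ (1 / 2) * (d * d * (K * (6 * C * Θ u / t))) +
        d * (K * (2 * (|T| + 1) * C * Θ u / t)) := by gcongr
    _ ≤ d * d * (K * (6 * C * Θ u / t)) + d * (K * (2 * (|T| + 1) * C * Θ u / t)) := by linarith
    _ = _ := by ring

/-- Integral form of Grönwall's inequality. -/
lemma le_exp_of_integral_bound {m : ℝ → ℝ} {K t : ℝ} (hm : Continuous m) (hm0 : ∀ s, 0 ≤ m s)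
    (hK : 0 ≤ K) (ht : 0 ≤ t)
    (h : ∀ s ∈ Set.Icc 0 t, m s ≤ m 0 + ∫ u in (0 : ℝ)..s, K * m u) :
    m t ≤ m 0 * Real.exp (K * t) := by
  set M : ℝ → ℝ := fun s => m 0 + ∫ u in (0 : ℝ)..s, K * m u with hM
  have hd : ∀ s, HasDerivAt M (K * m s) s := fun s =>
    ((hm.const_mul K).integral_hasStrictDerivAt 0 s).hasDerivAt.const_add _
  have hb := norm_le_gronwallBound_of_norm_deriv_right_le (f := M) (f' := fun s => K * m s)
    (δ := m 0) (K := K) (ε := 0) (a := 0) (b := t)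
    (fun s _ => (hd s).continuousAt.continuousWithinAt)
    (fun s _ => (hd s).hasDerivWithinAt) (by simp [hM, abs_of_nonneg (hm0 0)]) (fun s hs => by
      have h1 := h s ⟨hs.1, hs.2.le⟩
      have h2 : 0 ≤ m s := hm0 s
      rw [Real.norm_of_nonneg (by positivity), Real.norm_of_nonneg (h2.trans h1), add_zero]
      gcongr) t ⟨ht, le_rfl⟩
  rw [gronwallBound_ε0, sub_zero] at hb
  exact ((h t ⟨ht, le_rfl⟩).trans (le_abs_self _)).trans hb

section

variable {Ω : Type*} [MeasurableSpace Ω] {D : Dynamics d dW} {P : Measure Ω}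
  [IsProbabilityMeasure P]

/-- The generator multiplies the test function by at most L/t, so Grönwall's inequality on an
interval of length `t` costs only a factor exp L, uniformly in `t` and `N`. The shift of ‖z‖² by `t`
makes the rate L/t possible: without it the bound would degenerate near z = 0. -/
lemma exists_saturated_moment_bound (hD : D.Regular) {Θ : ℝ → ℝ} {C : ℝ} (hΘ : ContDiff ℝ 2 Θ)
    (hC : 0 ≤ C) (hΘ2 : ∀ u, 2 ≤ u → Θ u = 1) (h0 : ∀ u, 0 ≤ u → 0 ≤ Θ u)
    (h1 : ∀ u, 0 ≤ u → u * |deriv Θ u| ≤ C * Θ u)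
    (h2 : ∀ u, 0 ≤ u → u ^ 2 * |deriv (deriv Θ) u| ≤ C * Θ u) (T : ℝ) :
    ∃ L, 0 ≤ L ∧ ∀ X W, DynkinProcess D P X W → ∀ t N : ℝ, 0 < t → t ≤ T → 0 < N →
      ∫ ω, Θ ((t + ‖W t ω‖ ^ 2) / N) ∂P ≤ Θ (t / N) * Real.exp L := by
  obtain ⟨L, hL0, hL⟩ := hD.exists_gen_saturated_bound hΘ hC h0 h1 h2 T
  refine ⟨L, hL0, fun X W hW t N ht htT hN => ?_⟩
  set G : Euc d → ℝ := fun z => Θ ((t + ‖z‖ ^ 2) / N) with hG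
  have hu : ∀ z : Euc d, 0 ≤ (t + ‖z‖ ^ 2) / N := fun z => by positivity
  have hgs : ContDiff ℝ 2 fun z : Euc d => G z - 1 :=
    (hΘ.comp ((contDiff_const.add (contDiff_norm_sq ℝ)).div_const N)).sub contDiff_const
  have hGc : Continuous G := hΘ.continuous.comp
    ((continuous_const.add (continuous_norm.pow 2)).div_const N)
  have hgc : HasCompactSupport fun z : Euc d => G z - 1 := by
    refine HasCompactSupport.intro (isCompact_closedBall (0 : Euc d) (√(2 * N))) fun z hz => ?_
    rw [Metric.mem_closedBall, dist_zero_right, not_le] at hz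
    have h3 : 2 * N < ‖z‖ ^ 2 := (Real.sqrt_lt' ((Real.sqrt_nonneg _).trans_lt hz)).1 hz
    have h4 : 2 ≤ (t + ‖z‖ ^ 2) / N := by
      rw [le_div_iff₀ hN]
      linarith
    simp [hG, hΘ2 _ h4]
  obtain ⟨B, hB0, hB⟩ := exists_bound_of_hasCompactSupport hgs hgc
  have hGB : ∀ z, ‖G z‖ ≤ B + 1 := fun z => by
    have h3 := (hB z).1
    calc ‖G z‖ = ‖(G z - 1) + 1‖ := by ring_nf
      _ ≤ ‖G z - 1‖ + ‖(1 : ℝ)‖ := norm_add_le _ _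
      _ ≤ _ := by rw [norm_one]; gcongr; exact h3
  set m : ℝ → ℝ := fun s => ∫ ω, G (W s ω) ∂P with hm
  have hmeas : ∀ s, AEStronglyMeasurable (fun ω => G (W s ω)) P := fun s =>
    (hGc.measurable.comp (hW.measurable_W s)).aestronglyMeasurable
  have hint : ∀ s, Integrable (fun ω => G (W s ω)) P := fun s =>
    (integrable_const (B + 1)).mono' (hmeas s) (ae_of_all _ fun ω => hGB _)
  have hmc : Continuous m := by
    refine continuous_of_dominated hmeas (fun s => ae_of_all _ fun ω => hGB _)
      (integrable_const (B + 1)) (ae_of_all _ fun ω => ?_)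
    exact hGc.comp (hW.continuous ω)
  have hm0 : m 0 = Θ (t / N) := by simp [hm, hG, hW.zero]
  have key : m t ≤ m 0 * Real.exp (L / t * t) := by
    refine le_exp_of_integral_bound hmc (fun s => integral_nonneg fun ω => h0 _ (hu _))
      (by positivity) ht.le fun s hs => ?_
    have h3 := hW.dynkin _ hgs hgc 0 s le_rfl hs.1 (fun _ => 1) measurable_const
      (integrable_const _)
    simp only [one_mul, sub_sub_sub_cancel_right, hW.zero] at h3
    rw [integral_sub (hint s) (integrable_const _)] at h3
    have h4 : ‖∫ u in (0 : ℝ)..s, ∫ ω, D.gen (fun z => G z - 1) (X ω) (W u ω) ∂P‖ ≤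
        ∫ u in (0 : ℝ)..s, L / t * m u := by
      refine (intervalIntegral.norm_integral_le_of_norm_le hs.1 (ae_of_all _ fun u _ => ?_)
        ((hmc.const_mul _).intervalIntegrable _ _))
      rw [hm, ← integral_const_mul]
      exact norm_integral_le_of_norm_le ((hint u).const_mul _)
        (ae_of_all _ fun ω => hL t N ht htT hN _ _)
    have h5 : m 0 = ∫ ω, G 0 ∂P := by simp [hm, hW.zero]
    have h6 := (le_abs_self _).trans h4
    rw [← h3, ← h5] at h6
    have h7 : m s = ∫ ω, G (W s ω) ∂P := rfl
    linarith
  rw [div_mul_cancel₀ _ ht.ne', hm0] at key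
  exact key

/-- The moments of the displacement are of the order of those of Brownian motion. -/
theorem exists_moment_bound (hD : D.Regular) (q : ℕ) (T : ℝ) :
    ∃ K, 0 ≤ K ∧ ∀ X W, DynkinProcess D P X W → ∀ t, 0 ≤ t → t ≤ T →
      Integrable (fun ω => ‖W t ω‖ ^ (2 * q)) P ∧ ∫ ω, ‖W t ω‖ ^ (2 * q) ∂P ≤ K * t ^ q := by
  obtain ⟨Θ, C, hΘ, hC, hΘ1, hΘ2, h0, h1, h2⟩ := exists_saturated_pow q
  obtain ⟨L, hL0, hL⟩ := exists_saturated_moment_bound (P := P) hD hΘ hC hΘ2 h0 h1 h2 T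
  refine ⟨Real.exp L, by positivity, fun X W hW t ht htT => ?_⟩
  have hexp : 1 ≤ Real.exp L := Real.one_le_exp hL0
  rcases ht.eq_or_lt with rfl | ht
  · simp only [hW.zero, norm_zero]
    refine ⟨integrable_const _, ?_⟩
    rw [integral_const, probReal_univ, one_smul, pow_mul, zero_pow two_ne_zero]
    rcases q with _ | q
    · simpa using hL0
    · simp
  have hWm := hW.measurable_W t
  -- `f N` equals (t + ‖W‖²)^q as soon as N + 1 exceeds t + ‖W‖². For large N its expectation is at
  -- most exp(L) t^q, since Θ(t/(N+1)) is then a power and the factors N + 1 cancel. Fatou's lemma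
  -- passes to the limit.
  set f : ℕ → Ω → ℝ := fun N ω => ((N : ℝ) + 1) ^ q * Θ ((t + ‖W t ω‖ ^ 2) / (N + 1)) with hf
  have hfm : ∀ N, Measurable (f N) := fun N =>
    (hΘ.continuous.measurable.comp
      ((measurable_const.add (hWm.norm.pow_const 2)).div_const _)).const_mul _
  have hu : ∀ (N : ℕ) (ω : Ω), 0 ≤ (t + ‖W t ω‖ ^ 2) / ((N : ℝ) + 1) := fun N ω => by positivity
  have hf0 : ∀ N ω, 0 ≤ f N ω := fun N ω => mul_nonneg (by positivity) (h0 _ (hu N ω))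
  have hlim : ∀ ω, Tendsto (fun N => ENNReal.ofReal (f N ω)) atTop
      (𝓝 (ENNReal.ofReal ((t + ‖W t ω‖ ^ 2) ^ q))) := by
    intro ω
    refine tendsto_const_nhds.congr' ?_
    obtain ⟨N₀, hN₀⟩ := exists_nat_ge (t + ‖W t ω‖ ^ 2)
    filter_upwards [eventually_ge_atTop N₀] with N hN
    have h3 : (t + ‖W t ω‖ ^ 2) / ((N : ℝ) + 1) ≤ 1 := by
      rw [div_le_one (by positivity)]
      have : (N₀ : ℝ) ≤ N := by exact_mod_cast hN
      linarith
    simp only [hf]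
    rw [hΘ1 _ h3, div_pow, mul_div_cancel₀ _ (by positivity)]
  have hbound : ∀ᶠ N in atTop, ∫⁻ ω, ENNReal.ofReal (f N ω) ∂P ≤
      ENNReal.ofReal (Real.exp L * t ^ q) := by
    obtain ⟨N₀, hN₀⟩ := exists_nat_ge t
    filter_upwards [eventually_ge_atTop N₀] with N hN
    have hN1 : (0 : ℝ) < (N : ℝ) + 1 := by positivity
    have h3 : t / ((N : ℝ) + 1) ≤ 1 := by
      rw [div_le_one hN1]
      have : (N₀ : ℝ) ≤ N := by exact_mod_cast hN
      linarith
    have h4 := hL X W hW t (N + 1) ht htT hN1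
    rw [hΘ1 _ h3] at h4
    have hΘb : ∃ B, ∀ u, 0 ≤ u → ‖Θ u‖ ≤ B := by
      obtain ⟨B, hB⟩ := isCompact_Icc.exists_bound_of_continuousOn (s := Set.Icc (0 : ℝ) 2)
        hΘ.continuous.continuousOn
      refine ⟨max B 1, fun u hu => ?_⟩
      rcases le_total u 2 with h | h
      · exact (hB u ⟨hu, h⟩).trans (le_max_left _ _)
      · rw [hΘ2 u h, norm_one]
        exact le_max_right _ _
    obtain ⟨B, hB⟩ := hΘb
    have h5 : Integrable (f N) P := by
      refine (integrable_const (((N : ℝ) + 1) ^ q * B)).mono' (hfm N).aestronglyMeasurable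
        (ae_of_all _ fun ω => ?_)
      rw [hf, norm_mul, Real.norm_of_nonneg (by positivity)]
      gcongr
      exact hB _ (hu N ω)
    rw [← ofReal_integral_eq_lintegral_ofReal h5 (ae_of_all _ (hf0 N))]
    refine ENNReal.ofReal_le_ofReal ?_
    rw [hf, integral_const_mul]
    calc _ ≤ ((N : ℝ) + 1) ^ q * ((t / ((N : ℝ) + 1)) ^ q * Real.exp L) := by gcongr
      _ = _ := by
        rw [div_pow]
        field_simp
  have hfatou : ∫⁻ ω, ENNReal.ofReal ((t + ‖W t ω‖ ^ 2) ^ q) ∂P ≤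
      ENNReal.ofReal (Real.exp L * t ^ q) := by
    calc _ = ∫⁻ ω, liminf (fun N => ENNReal.ofReal (f N ω)) atTop ∂P :=
          lintegral_congr fun ω => (hlim ω).liminf_eq.symm
      _ ≤ liminf (fun N => ∫⁻ ω, ENNReal.ofReal (f N ω) ∂P) atTop :=
          lintegral_liminf_le fun N => (hfm N).ennreal_ofReal
      _ ≤ _ := liminf_le_of_frequently_le' hbound.frequently
  have hle : ∫⁻ ω, ENNReal.ofReal (‖W t ω‖ ^ (2 * q)) ∂P ≤ ENNReal.ofReal (Real.exp L * t ^ q) := by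
    refine (lintegral_mono fun ω => ENNReal.ofReal_le_ofReal ?_).trans hfatou
    rw [pow_mul]
    gcongr
    linarith
  have hmeas : Measurable fun ω => ‖W t ω‖ ^ (2 * q) := hWm.norm.pow_const _
  have hI : Integrable (fun ω => ‖W t ω‖ ^ (2 * q)) P := by
    refine ⟨hmeas.aestronglyMeasurable, ?_⟩
    rw [hasFiniteIntegral_iff_ofReal (ae_of_all _ fun ω => by positivity)]
    exact hle.trans_lt ENNReal.ofReal_lt_top
  refine ⟨hI, ?_⟩
  rw [← ofReal_integral_eq_lintegral_ofReal hI (ae_of_all _ fun ω => by positivity)] at hle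
  exact (ENNReal.ofReal_le_ofReal_iff (by positivity)).1 hle

end

end

/-! ### Dynkin's formula for test functions of polynomial growth -/

section

variable {d dW : ℕ}

/-- Measurable functions of the position and the displacement that grow at most polynomially in the
displacement. -/
def PolyBdd (F : Torus d × Euc d → ℝ) : Prop :=
  Measurable F ∧ ∃ (C : ℝ) (k : ℕ), 0 ≤ C ∧ ∀ x z, |F (x, z)| ≤ C * (1 + ‖z‖) ^ k

lemma PolyBdd.mul {F H : Torus d × Euc d → ℝ} (hF : PolyBdd F) (hH : PolyBdd H) :
    PolyBdd fun q => F q * H q := by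
  obtain ⟨hFm, C, k, hC, hk⟩ := hF
  obtain ⟨hHm, C', k', hC', hk'⟩ := hH
  refine ⟨hFm.mul hHm, C * C', k + k', by positivity, fun x z => ?_⟩
  rw [abs_mul]
  calc _ ≤ (C * (1 + ‖z‖) ^ k) * (C' * (1 + ‖z‖) ^ k') := by gcongr; exacts [hk x z, hk' x z]
    _ = _ := by ring

lemma PolyBdd.abs {F : Torus d × Euc d → ℝ} (hF : PolyBdd F) : PolyBdd fun q => |F q| := by
  obtain ⟨hFm, C, k, hC, hk⟩ := hF
  exact ⟨hFm.abs, C, k, hC, fun x z => by rw [abs_abs]; exact hk x z⟩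

lemma PolyBdd.add {F H : Torus d × Euc d → ℝ} (hF : PolyBdd F) (hH : PolyBdd H) :
    PolyBdd fun q => F q + H q := by
  obtain ⟨hFm, C, k, hC, hk⟩ := hF
  obtain ⟨hHm, C', k', hC', hk'⟩ := hH
  refine ⟨hFm.add hHm, C + C', k + k', by positivity, fun x z => (abs_add_le _ _).trans ?_⟩
  have h1 : 1 ≤ 1 + ‖z‖ := by linarith [norm_nonneg z]
  calc _ ≤ C * (1 + ‖z‖) ^ k + C' * (1 + ‖z‖) ^ k' := by gcongr; exacts [hk x z, hk' x z]
    _ ≤ C * (1 + ‖z‖) ^ (k + k') + C' * (1 + ‖z‖) ^ (k + k') := by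
        have h2 := pow_le_pow_right₀ h1 (Nat.le_add_right k k')
        have h3 := pow_le_pow_right₀ h1 (Nat.le_add_left k' k)
        exact add_le_add (mul_le_mul_of_nonneg_left h2 hC) (mul_le_mul_of_nonneg_left h3 hC')
    _ = _ := by ring

lemma polyBdd_of_bounded {c : Torus d → ℝ} (hc : Measurable c) {K : ℝ} (hK : ∀ x, |c x| ≤ K) :
    PolyBdd fun q : Torus d × Euc d => c q.1 :=
  ⟨hc.comp measurable_fst, |K|, 0, abs_nonneg _, fun x z => by
    simpa using (hK x).trans (le_abs_self K)⟩

lemma polyBdd_of_hasTemperateGrowth {g : Euc d → ℝ} (hg : g.HasTemperateGrowth) :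
    PolyBdd fun q : Torus d × Euc d => g q.2 := by
  obtain ⟨k, C, hC, hk⟩ := hg.norm_iteratedFDeriv_le_uniform 0
  refine ⟨hg.1.continuous.measurable.comp measurable_snd, C, k, hC, fun x z => ?_⟩
  have := hk 0 le_rfl z
  rwa [norm_iteratedFDeriv_zero] at this

section MomentBounds

variable {Ω : Type*} [MeasurableSpace Ω] {D : Dynamics d dW} {P : Measure Ω}
  [IsProbabilityMeasure P]

lemma exists_growth_bound (hD : D.Regular) (k : ℕ) (T : ℝ) :
    ∃ K, 0 ≤ K ∧ ∀ X W, DynkinProcess D P X W → ∀ t, 0 ≤ t → t ≤ T →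
      Integrable (fun ω => (1 + ‖W t ω‖) ^ (2 * k)) P ∧
        ∫ ω, (1 + ‖W t ω‖) ^ (2 * k) ∂P ≤ K := by
  obtain ⟨K, hK0, hK⟩ := exists_moment_bound (P := P) hD k T
  refine ⟨2 ^ (2 * k) * (1 + K * |T| ^ k), by positivity, fun X W hW t ht htT => ?_⟩
  obtain ⟨hi, hle⟩ := hK X W hW t ht htT
  have hpt : ∀ x : ℝ, 0 ≤ x → (1 + x) ^ (2 * k) ≤ 2 ^ (2 * k) * (1 + x ^ (2 * k)) := by
    intro x hx
    rcases le_total x 1 with h | h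
    · calc (1 + x) ^ (2 * k) ≤ 2 ^ (2 * k) := by gcongr; linarith
        _ ≤ _ := le_mul_of_one_le_right (by positivity) (by linarith [pow_nonneg hx (2 * k)])
    · calc (1 + x) ^ (2 * k) ≤ (2 * x) ^ (2 * k) := by gcongr; linarith
        _ = 2 ^ (2 * k) * x ^ (2 * k) := mul_pow _ _ _
        _ ≤ _ := by gcongr; linarith
  have hi2 : Integrable (fun ω => 2 ^ (2 * k) * (1 + ‖W t ω‖ ^ (2 * k))) P :=
    ((integrable_const 1).fun_add hi).const_mul _
  have hi3 : Integrable (fun ω => (1 + ‖W t ω‖) ^ (2 * k)) P := by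
    refine hi2.mono' (((hW.measurable_W t).norm.const_add 1).pow_const _).aestronglyMeasurable
      (ae_of_all _ fun ω => ?_)
    rw [Real.norm_of_nonneg (by positivity)]
    exact hpt _ (norm_nonneg _)
  refine ⟨hi3, ?_⟩
  calc _ ≤ ∫ ω, 2 ^ (2 * k) * (1 + ‖W t ω‖ ^ (2 * k)) ∂P :=
        integral_mono hi3 hi2 fun ω => hpt _ (norm_nonneg _)
    _ = 2 ^ (2 * k) * (1 + ∫ ω, ‖W t ω‖ ^ (2 * k) ∂P) := by
        rw [integral_const_mul, integral_add (integrable_const 1) hi]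
        simp
    _ ≤ 2 ^ (2 * k) * (1 + K * t ^ k) := by gcongr
    _ ≤ _ := by
        gcongr
        exact htT.trans (le_abs_self T)

/-- Two times are allowed because Dynkin's formula pairs a weight at one time with the generator at
a later one. The product is decoupled into squares, each controlled by the moments at a single time.
-/
lemma exists_integral_mul_bound (hD : D.Regular) {F H : Torus d × Euc d → ℝ} (hF : PolyBdd F)
    (hH : PolyBdd H) (T : ℝ) :
    ∃ K, 0 ≤ K ∧ ∀ X W, DynkinProcess D P X W → ∀ s u, 0 ≤ s → s ≤ T → 0 ≤ u → u ≤ T →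
      Integrable (fun ω => F (X ω, W s ω) * H (X ω, W u ω)) P ∧
        ∫ ω, |F (X ω, W s ω) * H (X ω, W u ω)| ∂P ≤ K := by
  obtain ⟨hFm, C, k, hC, hk⟩ := hF
  obtain ⟨hHm, C', k', hC', hk'⟩ := hH
  obtain ⟨K, hK0, hK⟩ := exists_growth_bound (P := P) hD k T
  obtain ⟨K', hK0', hK'⟩ := exists_growth_bound (P := P) hD k' T
  refine ⟨C * C' * (K + K'), by positivity, fun X W hW s u hs hsT hu huT => ?_⟩
  obtain ⟨hi, hle⟩ := hK X W hW s hs hsT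
  obtain ⟨hi', hle'⟩ := hK' X W hW u hu huT
  have hpt : ∀ ω, |F (X ω, W s ω) * H (X ω, W u ω)| ≤
      C * C' * ((1 + ‖W s ω‖) ^ (2 * k) + (1 + ‖W u ω‖) ^ (2 * k')) := by
    intro ω
    rw [abs_mul]
    calc _ ≤ (C * (1 + ‖W s ω‖) ^ k) * (C' * (1 + ‖W u ω‖) ^ k') := by
          gcongr; exacts [hk _ _, hk' _ _]
      _ = C * C' * ((1 + ‖W s ω‖) ^ k * (1 + ‖W u ω‖) ^ k') := by ring
      _ ≤ _ := by
          gcongr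
          rw [mul_comm 2 k, mul_comm 2 k', pow_mul, pow_mul]
          nlinarith [sq_nonneg ((1 + ‖W s ω‖) ^ k - (1 + ‖W u ω‖) ^ k'),
            sq_nonneg ((1 + ‖W s ω‖) ^ k), sq_nonneg ((1 + ‖W u ω‖) ^ k')]
  have hFX : Measurable fun ω => F (X ω, W s ω) :=
    hFm.comp (hW.measurable_X.prodMk (hW.measurable_W s))
  have hHX : Measurable fun ω => H (X ω, W u ω) :=
    hHm.comp (hW.measurable_X.prodMk (hW.measurable_W u))
  have hI : Integrable (fun ω => F (X ω, W s ω) * H (X ω, W u ω)) P :=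
    ((hi.fun_add hi').const_mul (C * C')).mono' (hFX.mul hHX).aestronglyMeasurable
      (ae_of_all _ hpt)
  refine ⟨hI, ?_⟩
  calc _ ≤ ∫ ω, C * C' * ((1 + ‖W s ω‖) ^ (2 * k) + (1 + ‖W u ω‖) ^ (2 * k')) ∂P :=
        integral_mono hI.abs ((hi.fun_add hi').const_mul (C * C')) hpt
    _ = C * C' * (∫ ω, (1 + ‖W s ω‖) ^ (2 * k) ∂P + ∫ ω, (1 + ‖W u ω‖) ^ (2 * k') ∂P) := by
        rw [integral_const_mul, integral_add hi hi']
    _ ≤ _ := by gcongr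

end MomentBounds

/-- Smooth cutoff functions at scale `N`, with uniformly bounded derivatives. -/
lemma exists_cutoff (d : ℕ) : ∃ (χ : ℕ → Euc d → ℝ) (B : ℝ), 0 ≤ B ∧
    (∀ N, ContDiff ℝ 2 (χ N)) ∧ (∀ N, HasCompactSupport (χ N)) ∧
    (∀ z : Euc d, ∀ᶠ N in atTop, ∀ᶠ w in 𝓝 z, χ N w = 1) ∧
    ∀ N, ∀ j ≤ 2, ∀ z, ‖iteratedFDeriv ℝ j (χ N) z‖ ≤ B := by
  -- A single bump function composed with the contraction by (N+1)⁻¹. The chain rule multiplies its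
  -- derivatives by powers of a number at most 1, so its bounds hold for all scales.
  set f : ContDiffBump (0 : Euc d) := ⟨1, 2, by norm_num, by norm_num⟩ with hf
  have hfs : ContDiff ℝ 2 f := f.contDiff
  obtain ⟨K, hK0, hK⟩ := exists_bound_of_hasCompactSupport hfs f.hasCompactSupport
  set c : ℕ → ℝ := fun N => ((N : ℝ) + 1)⁻¹ with hc
  have hc0 : ∀ N, 0 < c N := fun N => by positivity
  have hc1 : ∀ N, c N ≤ 1 := fun N => inv_le_one_of_one_le₀ (by linarith [N.cast_nonneg (α := ℝ)])
  set L : ℕ → Euc d →L[ℝ] Euc d := fun N => c N • ContinuousLinearMap.id ℝ (Euc d) with hL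
  have hLn : ∀ N, ‖L N‖ ≤ 1 := fun N => by
    rw [hL, norm_smul, Real.norm_of_nonneg (hc0 N).le]
    exact mul_le_one₀ (hc1 N) (norm_nonneg _) ContinuousLinearMap.norm_id_le
  refine ⟨fun N => f ∘ L N, K, hK0, fun N => hfs.comp (L N).contDiff, fun N => ?_, fun z => ?_, ?_⟩
  · exact f.hasCompactSupport.comp_homeomorph (Homeomorph.smulOfNeZero (c N) (hc0 N).ne')
  · obtain ⟨N₀, hN₀⟩ := exists_nat_ge (‖z‖ + 1)
    filter_upwards [eventually_ge_atTop N₀] with N hN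
    filter_upwards [Metric.ball_mem_nhds z one_pos] with w hw
    refine f.one_of_mem_closedBall ?_
    have h1 : ‖w‖ ≤ N₀ := by
      have h2 : ‖w‖ ≤ ‖z‖ + ‖w - z‖ := by
        simpa using norm_add_le z (w - z)
      rw [Metric.mem_ball, dist_eq_norm] at hw
      linarith
    have h3 : (N₀ : ℝ) ≤ N := by exact_mod_cast hN
    rw [Metric.mem_closedBall, dist_zero_right]
    change ‖c N • w‖ ≤ 1
    rw [norm_smul, Real.norm_of_nonneg (hc0 N).le, hc, inv_mul_le_iff₀ (by positivity)]
    linarith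
  · intro N j hj z
    rw [(L N).iteratedFDeriv_comp_right hfs z (by exact_mod_cast hj)]
    refine (ContinuousMultilinearMap.norm_compContinuousLinearMap_le _ _).trans ?_
    have h1 : ∏ _i : Fin j, ‖L N‖ ≤ 1 := Finset.prod_le_one (fun _ _ => norm_nonneg _)
      fun _ _ => hLn N
    have h2 : ‖iteratedFDeriv ℝ j f (L N z)‖ ≤ K := by
      interval_cases j
      · rw [norm_iteratedFDeriv_zero]; exact (hK _).1
      · exact (hK _).2.1
      · exact (hK _).2.2
    calc _ ≤ K * 1 := mul_le_mul h2 h1 (Finset.prod_nonneg fun _ _ => norm_nonneg _) hK0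
      _ = K := mul_one K

/-- The generator is a local operator, so a truncated test function has the same generator wherever
the cutoff is locally 1. -/
lemma Dynamics.gen_congr (D : Dynamics d dW) {g g' : Euc d → ℝ} {z : Euc d}
    (h : ∀ᶠ w in 𝓝 z, g w = g' w) (x : Torus d) : D.gen g x z = D.gen g' x z := by
  have h1 : gradient g z = gradient g' z := by
    rw [gradient, gradient, Filter.EventuallyEq.fderiv_eq h]
  have h2 : hessian g z = hessian g' z := by
    rw [hessian, hessian, (Filter.EventuallyEq.iteratedFDeriv ℝ h 2).eq_of_nhds]
  rw [Dynamics.gen, Dynamics.gen, h1, h2]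

lemma polyBdd_gen {D : Dynamics d dW} (hD : D.Regular) {g : Euc d → ℝ}
    (hg : g.HasTemperateGrowth) : PolyBdd fun q : Torus d × Euc d => D.gen g q.1 q.2 := by
  obtain ⟨k, C, hC, hk⟩ := hg.norm_iteratedFDeriv_le_uniform 2
  obtain ⟨K, hK0, hK⟩ := hD.exists_gen_bound
  refine ⟨hD.measurable_gen (contDiff_infty.1 hg.1 2), K * (2 * C), k, by positivity,
    fun x z => (hK g x z).trans ?_⟩
  calc _ ≤ K * (C * (1 + ‖z‖) ^ k + C * (1 + ‖z‖) ^ k) := by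
        gcongr
        · exact hk 1 (by norm_num) z
        · exact hk 2 le_rfl z
    _ = _ := by ring

/-- Dynkin's formula for smooth test functions of polynomial growth. -/
theorem DynkinProcess.dynkin_poly {Ω : Type*} [MeasurableSpace Ω] {D : Dynamics d dW}
    {P : Measure Ω} [IsProbabilityMeasure P] (hD : D.Regular) {X : Ω → Torus d}
    {W : ℝ → Ω → Euc d} (hW : DynkinProcess D P X W) {g : Euc d → ℝ} (hg : g.HasTemperateGrowth)
    {s t : ℝ} (hs : 0 ≤ s) (hst : s ≤ t) {F : Torus d × Euc d → ℝ} (hF : PolyBdd F) :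
    ∫ ω, F (X ω, W s ω) * (g (W t ω) - g (W s ω)) ∂P =
      ∫ u in s..t, ∫ ω, F (X ω, W s ω) * D.gen g (X ω) (W u ω) ∂P := by
  -- The formula is applied to the truncations χ_N g, and N tends to infinity by dominated
  -- convergence on both sides. The truncations have derivatives of polynomial growth uniformly in
  -- N, and the moments of the process provide the integrable majorants.
  obtain ⟨χ, B, hB0, hχs, hχc, hχ1, hχB⟩ := exists_cutoff d
  obtain ⟨k, C, hC, hk⟩ := hg.norm_iteratedFDeriv_le_uniform 2
  obtain ⟨K, hK0, hK⟩ := hD.exists_gen_bound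
  have hg2 : ContDiff ℝ 2 g := contDiff_infty.1 hg.1 2
  have hgN : ∀ N, ContDiff ℝ 2 fun z => χ N z * g z := fun N => (hχs N).mul hg2
  -- uniform bounds for the derivatives of the truncations
  have hder : ∀ N, ∀ j ≤ 2, ∀ z, ‖iteratedFDeriv ℝ j (fun z => χ N z * g z) z‖ ≤
      4 * B * C * (1 + ‖z‖) ^ k := by
    intro N j hj z
    have hj2 : (j : WithTop ℕ∞) ≤ 2 := by exact_mod_cast hj
    refine (norm_iteratedFDeriv_mul_le (hχs N) hg2 z hj2).trans ?_
    calc _ ≤ ∑ i ∈ Finset.range (j + 1), (j.choose i : ℝ) * B * (C * (1 + ‖z‖) ^ k) := by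
          refine Finset.sum_le_sum fun i hi => ?_
          have hi' : i ≤ j := Nat.lt_succ_iff.1 (Finset.mem_range.1 hi)
          gcongr
          · exact hχB N i (hi'.trans hj) z
          · exact hk (j - i) (by omega) z
      _ = (∑ i ∈ Finset.range (j + 1), (j.choose i : ℝ)) * (B * C * (1 + ‖z‖) ^ k) := by
          rw [Finset.sum_mul]
          exact Finset.sum_congr rfl fun i _ => by ring
      _ = 2 ^ j * (B * C * (1 + ‖z‖) ^ k) := by
          congr 1
          exact_mod_cast Nat.sum_range_choose j
      _ ≤ 2 ^ 2 * (B * C * (1 + ‖z‖) ^ k) := by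
          gcongr
          norm_num
      _ = _ := by ring
  have hgB : ∀ N z, |χ N z * g z| ≤ 4 * B * C * (1 + ‖z‖) ^ k := fun N z => by
    have := hder N 0 (by norm_num) z
    rwa [norm_iteratedFDeriv_zero] at this
  have hgenB : ∀ N x z, |D.gen (fun z => χ N z * g z) x z| ≤
      K * (8 * B * C) * (1 + ‖z‖) ^ k := fun N x z => by
    refine (hK _ x z).trans ?_
    calc _ ≤ K * (4 * B * C * (1 + ‖z‖) ^ k + 4 * B * C * (1 + ‖z‖) ^ k) := by
          gcongr
          · exact hder N 1 (by norm_num) z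
          · exact hder N 2 le_rfl z
      _ = _ := by ring
  have hpow : PolyBdd fun q : Torus d × Euc d => (1 + ‖q.2‖) ^ k :=
    ⟨(measurable_snd.norm.const_add 1).pow_const k, 1, k, zero_le_one, fun x z => by
      rw [abs_of_nonneg (by positivity), one_mul]⟩
  have ht0 : 0 ≤ t := hs.trans hst
  obtain ⟨K', hK0', hK'⟩ := exists_integral_mul_bound (P := P) hD hF.abs hpow t
  have hKu := fun u (hu : 0 ≤ u) (hut : u ≤ t) => hK' X W hW s u hs hst hu hut
  have hFX : Measurable fun ω => F (X ω, W s ω) :=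
    hF.1.comp (hW.measurable_X.prodMk (hW.measurable_W s))
  have hlimg : ∀ z, ∀ᶠ N in atTop, ∀ᶠ w in 𝓝 z, χ N w * g w = g w := fun z =>
    (hχ1 z).mono fun N hN => hN.mono fun w hw => by rw [hw, one_mul]
  -- the left-hand sides
  have hL : Tendsto (fun N => ∫ ω, F (X ω, W s ω) * (χ N (W t ω) * g (W t ω) -
      χ N (W s ω) * g (W s ω)) ∂P) atTop
      (𝓝 (∫ ω, F (X ω, W s ω) * (g (W t ω) - g (W s ω)) ∂P)) := by
    refine tendsto_integral_filter_of_dominated_convergence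
      (fun ω => 4 * B * C * (|F (X ω, W s ω)| * (1 + ‖W t ω‖) ^ k +
        |F (X ω, W s ω)| * (1 + ‖W s ω‖) ^ k)) ?_ ?_ ?_ ?_
    · refine Eventually.of_forall fun N => (hFX.mul ?_).aestronglyMeasurable
      exact ((hgN N).continuous.measurable.comp (hW.measurable_W t)).sub
        ((hgN N).continuous.measurable.comp (hW.measurable_W s))
    · refine Eventually.of_forall fun N => ae_of_all _ fun ω => ?_
      rw [norm_mul, Real.norm_eq_abs, Real.norm_eq_abs]
      calc _ ≤ |F (X ω, W s ω)| * (4 * B * C * (1 + ‖W t ω‖) ^ k +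
            4 * B * C * (1 + ‖W s ω‖) ^ k) := by
            gcongr
            exact (abs_sub _ _).trans (add_le_add (hgB N _) (hgB N _))
        _ = _ := by ring
    · exact ((hKu t ht0 le_rfl).1.fun_add (hKu s hs hst).1).const_mul _
    · refine ae_of_all _ fun ω => ?_
      refine Tendsto.const_mul _ (Tendsto.sub ?_ ?_)
      · exact tendsto_const_nhds.congr' ((hlimg (W t ω)).mono fun N hN => hN.self_of_nhds.symm)
      · exact tendsto_const_nhds.congr' ((hlimg (W s ω)).mono fun N hN => hN.self_of_nhds.symm)
  -- the right-hand sides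
  have hR : Tendsto (fun N => ∫ u in s..t, ∫ ω, F (X ω, W s ω) *
      D.gen (fun z => χ N z * g z) (X ω) (W u ω) ∂P) atTop
      (𝓝 (∫ u in s..t, ∫ ω, F (X ω, W s ω) * D.gen g (X ω) (W u ω) ∂P)) := by
    have hbd : ∀ N u ω, ‖F (X ω, W s ω) * D.gen (fun z => χ N z * g z) (X ω) (W u ω)‖ ≤
        K * (8 * B * C) * (|F (X ω, W s ω)| * (1 + ‖W u ω‖) ^ k) := by
      intro N u ω
      rw [norm_mul, Real.norm_eq_abs, Real.norm_eq_abs]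
      calc _ ≤ |F (X ω, W s ω)| * (K * (8 * B * C) * (1 + ‖W u ω‖) ^ k) := by
            gcongr
            exact hgenB N _ _
        _ = _ := by ring
    refine intervalIntegral.tendsto_integral_filter_of_dominated_convergence
      (fun _ => K * (8 * B * C) * K') ?_ ?_ ?_ ?_
    · refine Eventually.of_forall fun N => StronglyMeasurable.aestronglyMeasurable ?_
      have h1 := measurable_gen_path hD (hgN N) hW.measurable_X hW.measurable_W hW.continuous
      have h2 := (hFX.comp measurable_snd).mul h1
      exact h2.stronglyMeasurable.integral_prod_right' (ν := P)
    · refine Eventually.of_forall fun N => ae_of_all _ fun u hu => ?_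
      rw [Set.uIoc_of_le hst] at hu
      have hu0 : 0 ≤ u := hs.trans hu.1.le
      refine (norm_integral_le_of_norm_le ((hKu u hu0 hu.2).1.const_mul _)
        (ae_of_all _ (hbd N u))).trans ?_
      rw [integral_const_mul]
      gcongr
      refine le_trans (le_of_eq (integral_congr_ae (ae_of_all _ fun ω => ?_))) (hKu u hu0 hu.2).2
      exact (abs_of_nonneg (by positivity)).symm
    · exact intervalIntegrable_const
    · refine ae_of_all _ fun u hu => ?_
      rw [Set.uIoc_of_le hst] at hu
      have hu0 : 0 ≤ u := hs.trans hu.1.le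
      refine tendsto_integral_filter_of_dominated_convergence
        (fun ω => K * (8 * B * C) * (|F (X ω, W s ω)| * (1 + ‖W u ω‖) ^ k)) ?_ ?_ ?_ ?_
      · refine Eventually.of_forall fun N => (hFX.mul ?_).aestronglyMeasurable
        have h1 := hD.measurable_gen (hgN N)
        have h2 := hW.measurable_X.prodMk (hW.measurable_W u)
        have h3 := h1.comp h2
        exact h3
      · exact Eventually.of_forall fun N => ae_of_all _ (hbd N u)
      · exact (hKu u hu0 hu.2).1.const_mul _
      · refine ae_of_all _ fun ω => Tendsto.const_mul _ ?_
        exact tendsto_const_nhds.congr'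
          ((hlimg (W u ω)).mono fun N hN => (D.gen_congr hN (X ω)).symm)
  refine tendsto_nhds_unique hL (hR.congr fun N => ?_)
  have hint : Integrable (fun ω => F (X ω, W s ω)) P := by
    have h1 := (exists_integral_mul_bound (P := P) hD hF
      (polyBdd_of_bounded (d := d) (c := fun _ => 1) measurable_const (K := 1) (by simp)) t)
    obtain ⟨_, _, h2⟩ := h1
    simpa using (h2 X W hW s s hs hst hs hst).1
  exact (hW.dynkin _ (hgN N) ((hχc N).mul_right) s t hs hst F hF.1 hint).symm

end

/-! ### Polynomial test functions, and asymptotics uniform over all processes -/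

section

open Asymptotics

variable {d dW : ℕ}

/-- Polynomial functions on `ℝ^d`. -/
def ev (p : MvPolynomial (Fin d) ℝ) (z : Euc d) : ℝ := MvPolynomial.eval (fun i => z i) p

lemma hasTemperateGrowth_ev (p : MvPolynomial (Fin d) ℝ) : (ev p).HasTemperateGrowth := by
  induction p using MvPolynomial.induction_on with
  | C a =>
    have : ev (MvPolynomial.C a : MvPolynomial (Fin d) ℝ) = fun _ => a := by
      funext z; simp [ev]
    rw [this]
    exact Function.HasTemperateGrowth.const a
  | add p q hp hq =>
    have : ev (p + q) = fun z => ev p z + ev q z := by funext z; simp [ev]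
    rw [this]
    exact hp.add hq
  | mul_X p i hp =>
    have : ev (p * MvPolynomial.X i) = fun z => ev p z * (EuclideanSpace.proj i : Euc d →L[ℝ] ℝ) z := by
      funext z; simp [ev]
    rw [this]
    exact hp.mul (EuclideanSpace.proj i : Euc d →L[ℝ] ℝ).hasTemperateGrowth

lemma fderiv_ev (p : MvPolynomial (Fin d) ℝ) (z : Euc d) (i : Fin d) :
    fderiv ℝ (ev p) z (basisVec i) = ev (MvPolynomial.pderiv i p) z := by
  have hdiff : ∀ p : MvPolynomial (Fin d) ℝ, DifferentiableAt ℝ (ev p) z := fun p =>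
    (hasTemperateGrowth_ev p).1.differentiable (by simp) z
  induction p using MvPolynomial.induction_on with
  | C a =>
    have : ev (MvPolynomial.C a : MvPolynomial (Fin d) ℝ) = fun _ => a := by
      funext z; simp [ev]
    rw [this]
    simp [ev]
  | add p q hp hq =>
    have : ev (p + q) = fun z => ev p z + ev q z := by funext z; simp [ev]
    rw [this, fderiv_fun_add (hdiff p) (hdiff q)]
    simp [hp, hq, ev]
  | mul_X p j hp =>
    have : ev (p * MvPolynomial.X j) = fun z => ev p z * (EuclideanSpace.proj j : Euc d →L[ℝ] ℝ) z := by
      funext z; simp [ev]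
    rw [this, fderiv_fun_mul (hdiff p) (ContinuousLinearMap.differentiableAt _)]
    simp only [ContinuousLinearMap.fderiv, add_apply, FunLike.coe_smul, Pi.smul_apply,
      hp, smul_eq_mul, Derivation.leibniz, MvPolynomial.pderiv_X]
    by_cases h : i = j
    · subst h
      simp [ev, basisVec, mul_comm]
    · simp [ev, basisVec, Ne.symm h, mul_comm]

lemma gen_ev (D : Dynamics d dW) (p : MvPolynomial (Fin d) ℝ) (x : Torus d) (z : Euc d) :
    D.gen (ev p) x z = (1 / 2) * ∑ i, ∑ j, D.a (x + proj z) i j *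
        ev (MvPolynomial.pderiv j (MvPolynomial.pderiv i p)) z +
      ∑ i, D.b (x + proj z) i * ev (MvPolynomial.pderiv i p) z := by
  have h2 : ContDiff ℝ 2 (ev p) := contDiff_infty.1 (hasTemperateGrowth_ev p).1 2
  rw [Dynamics.gen, D.symbol_eq]
  simp only [hessian_apply h2, gradient_apply, fderiv_ev]

lemma abs_coord_le (z : Euc d) (i : Fin d) : |z i| ≤ ‖z‖ := PiLp.norm_apply_le z i

lemma exists_abs_ev_le {p : MvPolynomial (Fin d) ℝ} {q : ℕ} (hp : p.IsHomogeneous q) :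
    ∃ K, 0 ≤ K ∧ ∀ z, |ev p z| ≤ K * ‖z‖ ^ q := by
  refine ⟨∑ s ∈ p.support, |p.coeff s|, Finset.sum_nonneg fun _ _ => abs_nonneg _, fun z => ?_⟩
  rw [ev, MvPolynomial.eval_eq, Finset.sum_mul]
  refine (Finset.abs_sum_le_sum_abs _ _).trans (Finset.sum_le_sum fun s hs => ?_)
  rw [abs_mul, Finset.abs_prod]
  gcongr
  rw [hp.degree_eq_sum_deg_support hs, ← Finset.prod_pow_eq_pow_sum]
  refine Finset.prod_le_prod (fun _ _ => abs_nonneg _) fun i _ => ?_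
  rw [abs_pow]
  exact pow_le_pow_left₀ (abs_nonneg _) (abs_coord_le z i) _

/-- Bounded measurable functions on the torus. -/
def BddMeas (c : Torus d → ℝ) : Prop := Measurable c ∧ ∃ K, 0 ≤ K ∧ ∀ x, |c x| ≤ K

lemma BddMeas.mul {c c' : Torus d → ℝ} (h : BddMeas c) (h' : BddMeas c') :
    BddMeas fun x => c x * c' x := by
  obtain ⟨hm, K, hK0, hK⟩ := h
  obtain ⟨hm', K', hK0', hK'⟩ := h'
  refine ⟨hm.mul hm', K * K', by positivity, fun x => ?_⟩
  rw [abs_mul]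
  exact mul_le_mul (hK x) (hK' x) (abs_nonneg _) hK0

lemma BddMeas.add {c c' : Torus d → ℝ} (h : BddMeas c) (h' : BddMeas c') :
    BddMeas fun x => c x + c' x := by
  obtain ⟨hm, K, hK0, hK⟩ := h
  obtain ⟨hm', K', hK0', hK'⟩ := h'
  exact ⟨hm.add hm', K + K', by positivity, fun x =>
    (abs_add_le _ _).trans (add_le_add (hK x) (hK' x))⟩

lemma bddMeas_const (c : ℝ) : BddMeas fun _ : Torus d => c :=
  ⟨measurable_const, |c|, abs_nonneg _, fun _ => le_rfl⟩

lemma BddMeas.const_mul {c : Torus d → ℝ} (k : ℝ) (h : BddMeas c) : BddMeas fun x => k * c x :=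
  (bddMeas_const k).mul h

lemma BddMeas.sum {ι : Type*} {c : ι → Torus d → ℝ} {s : Finset ι} (h : ∀ i ∈ s, BddMeas (c i)) :
    BddMeas fun x => ∑ i ∈ s, c i x := by
  classical
  induction s using Finset.induction_on with
  | empty => simpa using bddMeas_const 0
  | insert a s ha ih =>
    simp only [Finset.sum_insert ha]
    exact (h a (Finset.mem_insert_self a s)).add
      (ih fun i hi => h i (Finset.mem_insert_of_mem hi))

lemma bddMeas_of_continuous {c : Torus d → ℝ} (h : Continuous c) : BddMeas c :=
  ⟨h.measurable, exists_bound_of_continuous h⟩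

lemma BddMeas.polyBdd {c : Torus d → ℝ} (h : BddMeas c) :
    PolyBdd fun q : Torus d × Euc d => c q.1 := by
  obtain ⟨hm, K, -, hK⟩ := h
  exact polyBdd_of_bounded hm hK

lemma polyBdd_zero : PolyBdd fun _ : Torus d × Euc d => (0 : ℝ) :=
  (bddMeas_const 0).polyBdd

lemma PolyBdd.sum {ι : Type*} {F : ι → Torus d × Euc d → ℝ} {s : Finset ι}
    (h : ∀ i ∈ s, PolyBdd (F i)) : PolyBdd fun q => ∑ i ∈ s, F i q := by
  classical
  induction s using Finset.induction_on with
  | empty => simpa using polyBdd_zero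
  | insert a s ha ih =>
    simp only [Finset.sum_insert ha]
    exact (h a (Finset.mem_insert_self a s)).add
      (ih fun i hi => h i (Finset.mem_insert_of_mem hi))

lemma PolyBdd.const_mul {F : Torus d × Euc d → ℝ} (k : ℝ) (h : PolyBdd F) :
    PolyBdd fun q => k * F q :=
  (bddMeas_const k).polyBdd.mul h

lemma PolyBdd.sub {F H : Torus d × Euc d → ℝ} (hF : PolyBdd F) (hH : PolyBdd H) :
    PolyBdd fun q => F q - H q := by
  simpa [sub_eq_add_neg] using hF.add (hH.const_mul (-1))

lemma polyBdd_ev (p : MvPolynomial (Fin d) ℝ) : PolyBdd fun q : Torus d × Euc d => ev p q.2 :=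
  polyBdd_of_hasTemperateGrowth (hasTemperateGrowth_ev p)

/-! ### Small-time asymptotics of the displacement process -/

/-- The index set of the small-time asymptotics: displacement processes and times in `[0, T]`. -/
def processTimes {Ω : Type*} [MeasurableSpace Ω] (D : Dynamics d dW) (P : Measure Ω) (T : ℝ) :
    Set (((Ω → Torus d) × (ℝ → Ω → Euc d)) × ℝ) :=
  {q | DynkinProcess D P q.1.1 q.1.2 ∧ 0 ≤ q.2 ∧ q.2 ≤ T}

/-- The expectation of a function of the initial state and the displacement. -/
def mean {Ω : Type*} [MeasurableSpace Ω] (P : Measure Ω) (F : Torus d × Euc d → ℝ)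
    (q : ((Ω → Torus d) × (ℝ → Ω → Euc d)) × ℝ) : ℝ :=
  ∫ ω, F (q.1.1 ω, q.1.2 q.2 ω) ∂P

section

variable {Ω : Type*} [MeasurableSpace Ω] {D : Dynamics d dW} {P : Measure Ω}
  [IsProbabilityMeasure P] {T : ℝ}

lemma PolyBdd.integrable (hD : D.Regular) {F : Torus d × Euc d → ℝ} (hF : PolyBdd F)
    {X : Ω → Torus d} {W : ℝ → Ω → Euc d} (hW : DynkinProcess D P X W) {t : ℝ} (ht : 0 ≤ t) :
    Integrable (fun ω => F (X ω, W t ω)) P := by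
  obtain ⟨K, -, hK⟩ := exists_integral_mul_bound (P := P) hD hF (bddMeas_const 1).polyBdd t
  simpa using (hK X W hW t t ht le_rfl ht le_rfl).1

lemma mean_add (hD : D.Regular) {F H : Torus d × Euc d → ℝ} (hF : PolyBdd F) (hH : PolyBdd H)
    {q : ((Ω → Torus d) × (ℝ → Ω → Euc d)) × ℝ} (hq : q ∈ processTimes D P T) :
    mean P (fun y => F y + H y) q = mean P F q + mean P H q :=
  integral_add (hF.integrable hD hq.1 hq.2.1) (hH.integrable hD hq.1 hq.2.1)

lemma mean_sum (hD : D.Regular) {ι : Type*} {F : ι → Torus d × Euc d → ℝ} {s : Finset ι}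
    (hF : ∀ i ∈ s, PolyBdd (F i)) {q : ((Ω → Torus d) × (ℝ → Ω → Euc d)) × ℝ}
    (hq : q ∈ processTimes D P T) :
    mean P (fun y => ∑ i ∈ s, F i y) q = ∑ i ∈ s, mean P (F i) q :=
  integral_finsetSum _ fun i hi => (hF i hi).integrable hD hq.1 hq.2.1

/-- Asymptotics along the principal filter amount to one constant for all processes and all times in
[0, T]. This uniformity is essential, since each real-world observation comes from its own solution.
-/
lemma mean_isBigO_of_le (hD : D.Regular) {F : Torus d × Euc d → ℝ} {K : ℝ}
    (hK0 : 0 ≤ K) (j : ℕ)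
    (hK : ∀ x z, |F (x, z)| ≤ K * ‖z‖ ^ (2 * j)) :
    mean P F =O[𝓟 (processTimes D P T)] fun q => q.2 ^ j := by
  obtain ⟨C, hC0, hC⟩ := exists_moment_bound (P := P) hD j T
  refine isBigO_principal.2 ⟨K * C, fun q hq => ?_⟩
  obtain ⟨h1, h2⟩ := hC _ _ hq.1 _ hq.2.1 hq.2.2
  rw [Real.norm_of_nonneg (pow_nonneg hq.2.1 _)]
  calc ‖mean P F q‖ ≤ ∫ ω, K * ‖q.1.2 q.2 ω‖ ^ (2 * j) ∂P :=
        norm_integral_le_of_norm_le (h1.const_mul K) (ae_of_all _ fun ω => hK _ _)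
    _ = K * ∫ ω, ‖q.1.2 q.2 ω‖ ^ (2 * j) ∂P := integral_const_mul _ _
    _ ≤ K * (C * q.2 ^ j) := by gcongr
    _ = _ := by ring

lemma mean_isBigO_add (hD : D.Regular) {F H : Torus d × Euc d → ℝ} (hF : PolyBdd F)
    (hH : PolyBdd H) {g : ((Ω → Torus d) × (ℝ → Ω → Euc d)) × ℝ → ℝ}
    (h1 : mean P F =O[𝓟 (processTimes D P T)] g)
    (h2 : mean P H =O[𝓟 (processTimes D P T)] g) :
    mean P (fun y => F y + H y) =O[𝓟 (processTimes D P T)] g := by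
  refine (h1.add h2).congr' ?_ EventuallyEq.rfl
  exact eventually_principal.2 fun q hq => (mean_add hD hF hH hq).symm

lemma mean_isBigO_sum (hD : D.Regular) {ι : Type*} {F : ι → Torus d × Euc d → ℝ} {s : Finset ι}
    {g : ((Ω → Torus d) × (ℝ → Ω → Euc d)) × ℝ → ℝ} (hF : ∀ i ∈ s, PolyBdd (F i))
    (h : ∀ i ∈ s, mean P (F i) =O[𝓟 (processTimes D P T)] g) :
    mean P (fun y => ∑ i ∈ s, F i y) =O[𝓟 (processTimes D P T)] g := by
  refine (IsBigO.sum h).congr' ?_ EventuallyEq.rfl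
  refine eventually_principal.2 fun q hq => ?_
  rw [mean_sum hD hF hq, Finset.sum_apply]

/-- Integration in time gains one order. The bound may be used at every earlier time because
`processTimes` is stable under decreasing the time. -/
lemma integral_isBigO {f : ((Ω → Torus d) × (ℝ → Ω → Euc d)) × ℝ → ℝ} {j : ℕ}
    (h : f =O[𝓟 (processTimes D P T)] fun q => q.2 ^ j) :
    (fun q => ∫ u in (0 : ℝ)..q.2, f (q.1, u)) =O[𝓟 (processTimes D P T)]
      fun q => q.2 ^ (j + 1) := by
  obtain ⟨K, hK⟩ := isBigO_principal.1 h
  refine isBigO_principal.2 ⟨|K|, fun q hq => ?_⟩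
  have h1 : ∀ u ∈ Set.uIoc 0 q.2, ‖f (q.1, u)‖ ≤ |K| * q.2 ^ j := by
    intro u hu
    rw [Set.uIoc_of_le hq.2.1] at hu
    refine (hK (q.1, u) ⟨hq.1, hu.1.le, hu.2.trans hq.2.2⟩).trans ?_
    rw [Real.norm_of_nonneg (pow_nonneg hu.1.le _)]
    exact mul_le_mul (le_abs_self K) (pow_le_pow_left₀ hu.1.le hu.2 j) (pow_nonneg hu.1.le _)
      (abs_nonneg _)
  refine (intervalIntegral.norm_integral_le_of_norm_le_const h1).trans (le_of_eq ?_)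
  rw [sub_zero, abs_of_nonneg hq.2.1, Real.norm_of_nonneg (pow_nonneg hq.2.1 _)]
  ring

lemma PolyBdd.intervalIntegrable (hD : D.Regular) {F : Torus d × Euc d → ℝ} (hF : PolyBdd F)
    {X : Ω → Torus d} {W : ℝ → Ω → Euc d} (hW : DynkinProcess D P X W) {t : ℝ} (ht : 0 ≤ t) :
    IntervalIntegrable (fun u => ∫ ω, F (X ω, W u ω) ∂P) volume 0 t := by
  obtain ⟨K, hK0, hK⟩ := exists_integral_mul_bound (P := P) hD hF (bddMeas_const 1).polyBdd t
  have hmeas : StronglyMeasurable fun u => ∫ ω, F (X ω, W u ω) ∂P := by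
    have h1 := hF.1.comp (measurable_position hW.measurable_X hW.measurable_W hW.continuous)
    exact h1.stronglyMeasurable.integral_prod_right' (ν := P)
  refine (intervalIntegrable_const (c := K)).mono_fun' hmeas.aestronglyMeasurable ?_
  refine (ae_restrict_mem measurableSet_uIoc).mono fun u hu => ?_
  rw [Set.uIoc_of_le ht] at hu
  refine (norm_integral_le_integral_norm _).trans ?_
  simpa using (hK X W hW u u hu.1.le hu.2 hu.1.le hu.2).2

lemma integral_mean_add (hD : D.Regular) {F H : Torus d × Euc d → ℝ} (hF : PolyBdd F)
    (hH : PolyBdd H) {q : ((Ω → Torus d) × (ℝ → Ω → Euc d)) × ℝ} (hq : q ∈ processTimes D P T) :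
    ∫ u in (0 : ℝ)..q.2, mean P (fun y => F y + H y) (q.1, u) =
      (∫ u in (0 : ℝ)..q.2, mean P F (q.1, u)) + ∫ u in (0 : ℝ)..q.2, mean P H (q.1, u) := by
  refine Eq.trans ?_ (intervalIntegral.integral_add (hF.intervalIntegrable hD hq.1 hq.2.1)
    (hH.intervalIntegrable hD hq.1 hq.2.1))
  refine intervalIntegral.integral_congr fun u hu => ?_
  rw [Set.uIcc_of_le hq.2.1] at hu
  exact mean_add (T := T) hD hF hH ⟨hq.1, hu.1, hu.2.trans hq.2.2⟩

/-- Dynkin's formula from time zero, where the displacement is zero and the polynomial vanishes. -/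
lemma mean_ev_eq (hD : D.Regular) {c : Torus d → ℝ} (hc : BddMeas c)
    {p : MvPolynomial (Fin d) ℝ} (hp : ev p 0 = 0)
    {q : ((Ω → Torus d) × (ℝ → Ω → Euc d)) × ℝ} (hq : q ∈ processTimes D P T) :
    mean P (fun y => c y.1 * ev p y.2) q =
      ∫ u in (0 : ℝ)..q.2, mean P (fun y => c y.1 * D.gen (ev p) y.1 y.2) (q.1, u) := by
  have h := hq.1.dynkin_poly hD (hasTemperateGrowth_ev p) le_rfl hq.2.1 hc.polyBdd
  simp only [hq.1.zero, hp, sub_zero] at h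
  exact h

end

end

/-! ### Small-time expansion of the moments of the displacement -/

section

open Asymptotics

variable {d dW : ℕ}

lemma exists_lipschitz_bound {f : Torus d → ℝ} (hf : TorusContDiff 1 f) :
    ∃ K, 0 ≤ K ∧ ∀ x z, |f (x + proj z) - f x| ≤ K * ‖z‖ := by
  obtain ⟨K, hK0, hK⟩ := exists_taylor_bound 1 hf
  refine ⟨K, hK0, fun x z => ?_⟩
  simpa [taylorTerm] using hK x z

lemma exists_linear_bound {f : Torus d → ℝ} (hf : TorusContDiff 2 f) :
    ∃ K, 0 ≤ K ∧ ∀ x z, |f (x + proj z) - f x - ∑ k, pd k f x * z k| ≤ K * ‖z‖ ^ 2 := by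
  obtain ⟨K, hK0, hK⟩ := exists_taylor_bound 2 hf
  refine ⟨K, hK0, fun x z => ?_⟩
  have := hK x z
  simp only [Finset.sum_range_succ, Finset.sum_range_zero, taylorTerm, Nat.factorial] at this
  simpa [mul_comm, sub_sub] using this

lemma bddMeas_pd {f : Torus d → ℝ} (hf : TorusContDiff 1 f) (i : Fin d) : BddMeas (pd i f) :=
  bddMeas_of_continuous (TorusContDiff.continuous (p := 0) (TorusContDiff.pd hf i))

lemma Dynamics.Regular.bddMeas_a {D : Dynamics d dW} (hD : D.Regular) (i j : Fin d) :
    BddMeas fun x => D.a x i j :=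
  bddMeas_of_continuous (Dynamics.torusContDiff_a hD.sigma i j).continuous

lemma Dynamics.Regular.bddMeas_b {D : Dynamics d dW} (hD : D.Regular) (i : Fin d) :
    BddMeas fun x => D.b x i :=
  bddMeas_of_continuous (hD.b.apply i).continuous

lemma exists_sum_bound {ι E F : Type*} [NormedAddCommGroup F] (s : Finset ι) {f : ι → E → F → ℝ}
    {q : ℕ} (h : ∀ i ∈ s, ∃ K, 0 ≤ K ∧ ∀ x z, |f i x z| ≤ K * ‖z‖ ^ q) :
    ∃ K, 0 ≤ K ∧ ∀ x z, |∑ i ∈ s, f i x z| ≤ K * ‖z‖ ^ q := by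
  choose! K hK0 hK using h
  refine ⟨∑ i ∈ s, K i, Finset.sum_nonneg hK0, fun x z => ?_⟩
  rw [Finset.sum_mul]
  exact (Finset.abs_sum_le_sum_abs _ _).trans (Finset.sum_le_sum fun i hi => hK i hi x z)

lemma exists_mul_bound {E F : Type*} [NormedAddCommGroup F] {f g : E → F → ℝ} {q r : ℕ}
    (hf : ∃ K, 0 ≤ K ∧ ∀ x z, |f x z| ≤ K * ‖z‖ ^ q)
    (hg : ∃ K, 0 ≤ K ∧ ∀ x z, |g x z| ≤ K * ‖z‖ ^ r) :
    ∃ K, 0 ≤ K ∧ ∀ x z, |f x z * g x z| ≤ K * ‖z‖ ^ (q + r) := by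
  obtain ⟨K, hK0, hK⟩ := hf
  obtain ⟨L, hL0, hL⟩ := hg
  refine ⟨K * L, by positivity, fun x z => ?_⟩
  rw [abs_mul, pow_add]
  calc _ ≤ (K * ‖z‖ ^ q) * (L * ‖z‖ ^ r) := by gcongr; exacts [hK x z, hL x z]
    _ = _ := by ring

lemma exists_add_bound {E F : Type*} [NormedAddCommGroup F] {f g : E → F → ℝ} {q : ℕ}
    (hf : ∃ K, 0 ≤ K ∧ ∀ x z, |f x z| ≤ K * ‖z‖ ^ q)
    (hg : ∃ K, 0 ≤ K ∧ ∀ x z, |g x z| ≤ K * ‖z‖ ^ q) :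
    ∃ K, 0 ≤ K ∧ ∀ x z, |f x z + g x z| ≤ K * ‖z‖ ^ q := by
  obtain ⟨K, hK0, hK⟩ := hf
  obtain ⟨L, hL0, hL⟩ := hg
  refine ⟨K + L, by positivity, fun x z => ?_⟩
  rw [add_mul]
  exact (abs_add_le _ _).trans (add_le_add (hK x z) (hL x z))

lemma BddMeas.exists_bound {c : Torus d → ℝ} (hc : BddMeas c) :
    ∃ K, 0 ≤ K ∧ ∀ (x : Torus d) (z : Euc d), |c x| ≤ K * ‖z‖ ^ 0 := by
  obtain ⟨-, K, hK0, hK⟩ := hc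
  exact ⟨K, hK0, fun x z => by simpa using hK x⟩

lemma exists_ev_bound {p : MvPolynomial (Fin d) ℝ} {q : ℕ} (hp : p.IsHomogeneous q) :
    ∃ K, 0 ≤ K ∧ ∀ (_ : Torus d) z, |ev p z| ≤ K * ‖z‖ ^ q := by
  obtain ⟨K, hK0, hK⟩ := exists_abs_ev_le hp
  exact ⟨K, hK0, fun _ z => hK z⟩

lemma polyBdd_mul_ev {c : Torus d → ℝ} (hc : BddMeas c) (p : MvPolynomial (Fin d) ℝ) :
    PolyBdd fun y : Torus d × Euc d => c y.1 * ev p y.2 :=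
  hc.polyBdd.mul (polyBdd_ev p)

/-- The principal part of the generator, with coefficients frozen at the initial state. -/
def frozenGen (D : Dynamics d dW) (p : MvPolynomial (Fin d) ℝ) (x : Torus d) (z : Euc d) : ℝ :=
  ∑ i, ∑ j, D.a x i j * ev (MvPolynomial.pderiv j (MvPolynomial.pderiv i p)) z

/-- The first-order correction to `frozenGen`. -/
def frozenGenCorr (D : Dynamics d dW) (p : MvPolynomial (Fin d) ℝ) (x : Torus d) (z : Euc d) :
    ℝ :=
  (1 / 2) * (∑ i, ∑ j, ∑ k, pd k (fun x => D.a x i j) x *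
      ev (MvPolynomial.X k * MvPolynomial.pderiv j (MvPolynomial.pderiv i p)) z) +
    ∑ i, D.b x i * ev (MvPolynomial.pderiv i p) z

lemma gen_sub_frozenGen (D : Dynamics d dW) (p : MvPolynomial (Fin d) ℝ) (x : Torus d)
    (z : Euc d) : D.gen (ev p) x z - (1 / 2) * frozenGen D p x z =
      (1 / 2) * (∑ i, ∑ j, (D.a (x + proj z) i j - D.a x i j) *
        ev (MvPolynomial.pderiv j (MvPolynomial.pderiv i p)) z) +
      ∑ i, D.b (x + proj z) i * ev (MvPolynomial.pderiv i p) z := by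
  rw [gen_ev, frozenGen]
  simp only [sub_mul, Finset.sum_sub_distrib]
  ring

/-- The second-order part lowers the degree by two. Freezing its coefficients at the initial state
costs one power of ‖z‖ by Lipschitz continuity, and the drift term only lowers the degree by one. -/
lemma exists_gen_sub_bound {D : Dynamics d dW} (hD : D.Regular) {p : MvPolynomial (Fin d) ℝ}
    {q : ℕ} (hp : p.IsHomogeneous (q + 2)) :
    ∃ K, 0 ≤ K ∧ ∀ x z, |D.gen (ev p) x z - (1 / 2) * frozenGen D p x z| ≤ K * ‖z‖ ^ (q + 1) := by
  have hb : ∀ i, ∃ K, 0 ≤ K ∧ ∀ (x : Torus d) (z : Euc d), |D.b (x + proj z) i| ≤ K * ‖z‖ ^ 0 :=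
    fun i => by
      obtain ⟨-, K, hK0, hK⟩ := hD.bddMeas_b i
      exact ⟨K, hK0, fun x z => by simpa using hK _⟩
  have ha : ∀ i j, ∃ K, 0 ≤ K ∧ ∀ (x : Torus d) (z : Euc d),
      |D.a (x + proj z) i j - D.a x i j| ≤ K * ‖z‖ ^ 1 := fun i j => by
    simpa using exists_lipschitz_bound
      ((Dynamics.torusContDiff_a hD.sigma i j).of_le (by norm_num : 1 ≤ 2))
  have h1 : ∃ K, 0 ≤ K ∧ ∀ (x : Torus d) (z : Euc d),
      |∑ i, ∑ j, (D.a (x + proj z) i j - D.a x i j) *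
        ev (MvPolynomial.pderiv j (MvPolynomial.pderiv i p)) z| ≤ K * ‖z‖ ^ (q + 1) :=
    exists_sum_bound _ fun i _ => exists_sum_bound _ fun j _ => by
      have := exists_mul_bound (ha i j) (exists_ev_bound ((hp.pderiv (i := i)).pderiv (i := j)))
      simpa [add_comm] using this
  have h2 : ∃ K, 0 ≤ K ∧ ∀ (x : Torus d) (z : Euc d),
      |∑ i, D.b (x + proj z) i * ev (MvPolynomial.pderiv i p) z| ≤ K * ‖z‖ ^ (q + 1) :=
    exists_sum_bound _ fun i _ => by
      have := exists_mul_bound (hb i) (exists_ev_bound (hp.pderiv (i := i)))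
      simpa using this
  have h3 := exists_add_bound (exists_mul_bound (bddMeas_const (1 / 2)).exists_bound h1)
    (by simpa using h2)
  simp only [gen_sub_frozenGen]
  simpa using h3

/-- The expansion is pushed one order further: linearising `a` leaves O(‖z‖²), freezing `b` leaves
O(‖z‖). The correction so isolated is homogeneous of degree `q + 1`, of parity opposite to that of
`p`, and this parity is what will be exploited. -/
lemma exists_gen_sub_corr_bound {D : Dynamics d dW} (hD : D.Regular)
    {p : MvPolynomial (Fin d) ℝ} {q : ℕ} (hp : p.IsHomogeneous (q + 2)) :
    ∃ K, 0 ≤ K ∧ ∀ x z, |D.gen (ev p) x z - (1 / 2) * frozenGen D p x z -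
      frozenGenCorr D p x z| ≤ K * ‖z‖ ^ (q + 2) := by
  have hb : ∀ i, ∃ K, 0 ≤ K ∧ ∀ (x : Torus d) (z : Euc d),
      |D.b (x + proj z) i - D.b x i| ≤ K * ‖z‖ ^ 1 := fun i => by
    simpa using exists_lipschitz_bound ((hD.b.apply i).of_le (by norm_num : 1 ≤ 2))
  have ha : ∀ i j, ∃ K, 0 ≤ K ∧ ∀ (x : Torus d) (z : Euc d),
      |D.a (x + proj z) i j - D.a x i j - ∑ k, pd k (fun x => D.a x i j) x * z k| ≤
        K * ‖z‖ ^ 2 := fun i j =>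
    exists_linear_bound (Dynamics.torusContDiff_a hD.sigma i j)
  have h1 : ∃ K, 0 ≤ K ∧ ∀ (x : Torus d) (z : Euc d),
      |∑ i, ∑ j, (D.a (x + proj z) i j - D.a x i j - ∑ k, pd k (fun x => D.a x i j) x * z k) *
        ev (MvPolynomial.pderiv j (MvPolynomial.pderiv i p)) z| ≤ K * ‖z‖ ^ (q + 2) :=
    exists_sum_bound _ fun i _ => exists_sum_bound _ fun j _ => by
      have := exists_mul_bound (ha i j) (exists_ev_bound ((hp.pderiv (i := i)).pderiv (i := j)))
      simpa [add_comm] using this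
  have h2 : ∃ K, 0 ≤ K ∧ ∀ (x : Torus d) (z : Euc d),
      |∑ i, (D.b (x + proj z) i - D.b x i) * ev (MvPolynomial.pderiv i p) z| ≤
        K * ‖z‖ ^ (q + 2) :=
    exists_sum_bound _ fun i _ => by
      have := exists_mul_bound (hb i) (exists_ev_bound (hp.pderiv (i := i)))
      rw [show 1 + (q + 2 - 1) = q + 2 by omega] at this
      exact this
  obtain ⟨K, hK0, hK⟩ := exists_add_bound
    (exists_mul_bound (bddMeas_const (1 / 2)).exists_bound h1) (by simpa using h2)
  refine ⟨K, hK0, fun x z => ?_⟩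
  have h3 : D.gen (ev p) x z - (1 / 2) * frozenGen D p x z - frozenGenCorr D p x z =
      (1 / 2) * (∑ i, ∑ j, (D.a (x + proj z) i j - D.a x i j -
          ∑ k, pd k (fun x => D.a x i j) x * z k) *
        ev (MvPolynomial.pderiv j (MvPolynomial.pderiv i p)) z) +
      ∑ i, (D.b (x + proj z) i - D.b x i) * ev (MvPolynomial.pderiv i p) z := by
    have hX : ∀ k p, ev (MvPolynomial.X k * p) z = z k * ev p z := fun k p => by simp [ev]
    rw [gen_sub_frozenGen, frozenGenCorr]
    simp only [sub_mul, Finset.sum_sub_distrib, hX, Finset.sum_mul, mul_assoc]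
    ring
  rw [h3]
  simpa using hK x z

lemma polyBdd_frozenGen {D : Dynamics d dW} (hD : D.Regular) {c : Torus d → ℝ} (hc : BddMeas c)
    (p : MvPolynomial (Fin d) ℝ) :
    PolyBdd fun y : Torus d × Euc d => c y.1 * ((1 / 2) * frozenGen D p y.1 y.2) :=
  hc.polyBdd.mul (PolyBdd.const_mul _ (PolyBdd.sum fun i _ => PolyBdd.sum fun j _ =>
    polyBdd_mul_ev (hD.bddMeas_a i j) _))

lemma polyBdd_frozenGenCorr {D : Dynamics d dW} (hD : D.Regular) {c : Torus d → ℝ}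
    (hc : BddMeas c) (p : MvPolynomial (Fin d) ℝ) :
    PolyBdd fun y : Torus d × Euc d => c y.1 * frozenGenCorr D p y.1 y.2 :=
  hc.polyBdd.mul ((PolyBdd.const_mul _ (PolyBdd.sum fun i _ => PolyBdd.sum fun j _ =>
    PolyBdd.sum fun k _ => polyBdd_mul_ev (bddMeas_pd
      ((Dynamics.torusContDiff_a hD.sigma i j).of_le (by norm_num : 1 ≤ 2)) k) _)).add
    (PolyBdd.sum fun i _ => polyBdd_mul_ev (hD.bddMeas_b i) _))

lemma ev_zero_of_isHomogeneous {p : MvPolynomial (Fin d) ℝ} {q : ℕ}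
    (hp : p.IsHomogeneous (q + 1)) : ev p 0 = 0 := by
  obtain ⟨K, -, hK⟩ := exists_abs_ev_le hp
  have := hK 0
  rw [norm_zero, zero_pow (Nat.succ_ne_zero q), mul_zero] at this
  exact abs_nonpos_iff.1 this

section

variable {Ω : Type*} [MeasurableSpace Ω] {D : Dynamics d dW} {P : Measure Ω}
  [IsProbabilityMeasure P]

lemma exists_gen_bound_of_linear (hD : D.Regular) {p : MvPolynomial (Fin d) ℝ}
    (hp : p.IsHomogeneous 1) :
    ∃ K, 0 ≤ K ∧ ∀ x z, |D.gen (ev p) x z| ≤ K * ‖z‖ ^ 0 := by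
  have hb : ∀ i, ∃ K, 0 ≤ K ∧ ∀ (x : Torus d) (z : Euc d), |D.b (x + proj z) i| ≤ K * ‖z‖ ^ 0 :=
    fun i => by
      obtain ⟨-, K, hK0, hK⟩ := hD.bddMeas_b i
      exact ⟨K, hK0, fun x z => by simpa using hK _⟩
  have ha : ∀ i j, ∃ K, 0 ≤ K ∧ ∀ (x : Torus d) (z : Euc d),
      |D.a (x + proj z) i j| ≤ K * ‖z‖ ^ 0 := fun i j => by
    obtain ⟨-, K, hK0, hK⟩ := hD.bddMeas_a i j
    exact ⟨K, hK0, fun x z => by simpa using hK _⟩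
  simp only [gen_ev]
  exact exists_add_bound (exists_mul_bound (bddMeas_const (1 / 2)).exists_bound
    (exists_sum_bound _ fun i _ => exists_sum_bound _ fun j _ =>
      exists_mul_bound (ha i j) (exists_ev_bound ((hp.pderiv (i := i)).pderiv (i := j)))))
    (exists_sum_bound _ fun i _ => exists_mul_bound (hb i) (exists_ev_bound (hp.pderiv (i := i))))

lemma polyBdd_gen_ev (hD : D.Regular) {c : Torus d → ℝ} (hc : BddMeas c)
    (p : MvPolynomial (Fin d) ℝ) :
    PolyBdd fun y : Torus d × Euc d => c y.1 * D.gen (ev p) y.1 y.2 :=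
  hc.polyBdd.mul (polyBdd_gen hD (hasTemperateGrowth_ev p))

/-- The frozen coefficients depend on the initial state only and can be absorbed into the bounded
weight; it remains to bound moments of second derivatives of `p`, two degrees lower. -/
lemma mean_frozenGen_isBigO (hD : D.Regular) {T : ℝ} {c : Torus d → ℝ} (hc : BddMeas c)
    {p : MvPolynomial (Fin d) ℝ} {g : ((Ω → Torus d) × (ℝ → Ω → Euc d)) × ℝ → ℝ}
    (h : ∀ (c : Torus d → ℝ) (i j : Fin d), BddMeas c → mean P (fun y => c y.1 *
      ev (MvPolynomial.pderiv j (MvPolynomial.pderiv i p)) y.2) =O[𝓟 (processTimes D P T)] g) :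
    mean P (fun y => c y.1 * ((1 / 2) * frozenGen D p y.1 y.2)) =O[𝓟 (processTimes D P T)] g := by
  have h1 : (fun y : Torus d × Euc d => c y.1 * ((1 / 2) * frozenGen D p y.1 y.2)) =
      fun y => ∑ i, ∑ j, ((1 / 2) * (c y.1 * D.a y.1 i j)) *
        ev (MvPolynomial.pderiv j (MvPolynomial.pderiv i p)) y.2 := by
    funext y
    simp only [frozenGen, Finset.mul_sum]
    exact Finset.sum_congr rfl fun i _ => Finset.sum_congr rfl fun j _ => by ring
  have h2 : ∀ i j, BddMeas fun x => (1 / 2) * (c x * D.a x i j) := fun i j =>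
    (hc.mul (hD.bddMeas_a i j)).const_mul _
  rw [h1]
  exact mean_isBigO_sum hD (fun i _ => PolyBdd.sum fun j _ => polyBdd_mul_ev (h2 i j) _)
    fun i _ => mean_isBigO_sum hD (fun j _ => polyBdd_mul_ev (h2 i j) _)
      fun j _ => h _ i j (h2 i j)

/-- Odd moments of the displacement are of higher order than their size. -/
theorem mean_odd_isBigO (hD : D.Regular) (T : ℝ) (j : ℕ) {c : Torus d → ℝ} (hc : BddMeas c)
    {p : MvPolynomial (Fin d) ℝ} (hp : p.IsHomogeneous (2 * j + 1)) :
    mean P (fun y => c y.1 * ev p y.2) =O[𝓟 (processTimes D P T)] fun q => q.2 ^ (j + 1) := by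
  -- Induction on the degree. The frozen principal part lowers the degree by two and keeps it odd,
  -- so the induction hypothesis applies after an integration in time. For degree at least three,
  -- the rest of the generator is bounded by ‖z‖^(2j), whose moment has the right order without any
  -- cancellation.
  have hdyn : mean P (fun y => c y.1 * D.gen (ev p) y.1 y.2) =O[𝓟 (processTimes D P T)]
      fun q => q.2 ^ j := by
    induction j generalizing c p with
    | zero =>
      obtain ⟨C, hC0, hC⟩ := exists_mul_bound hc.exists_bound (exists_gen_bound_of_linear hD hp)
      exact mean_isBigO_of_le hD hC0 0 hC
    | succ j ih =>
      have hp' : p.IsHomogeneous (2 * j + 1 + 2) := hp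
      obtain ⟨C, hC0, hC⟩ := exists_mul_bound hc.exists_bound (exists_gen_sub_bound hD hp')
      have h1 : mean P (fun y => c y.1 * ((1 / 2) * frozenGen D p y.1 y.2))
          =O[𝓟 (processTimes D P T)] fun q => q.2 ^ (j + 1) := by
        refine mean_frozenGen_isBigO hD hc fun c i k hc => ?_
        have hp2 : (MvPolynomial.pderiv k (MvPolynomial.pderiv i p)).IsHomogeneous (2 * j + 1) :=
          (hp'.pderiv (i := i)).pderiv (i := k)
        refine IsBigO.congr' (integral_isBigO (ih hc hp2)) ?_ EventuallyEq.rfl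
        exact eventually_principal.2 fun q hq =>
          (mean_ev_eq hD hc (ev_zero_of_isHomogeneous hp2) hq).symm
      have h2 : mean P (fun y => c y.1 * (D.gen (ev p) y.1 y.2 -
          (1 / 2) * frozenGen D p y.1 y.2)) =O[𝓟 (processTimes D P T)] fun q => q.2 ^ (j + 1) :=
        mean_isBigO_of_le hD hC0 (j + 1) fun x z => by
          convert hC x z using 3
          ring
      have h3 : PolyBdd fun y : Torus d × Euc d => c y.1 * (D.gen (ev p) y.1 y.2 -
          (1 / 2) * frozenGen D p y.1 y.2) := by
        simpa only [mul_sub] using (polyBdd_gen_ev hD hc p).sub (polyBdd_frozenGen hD hc p)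
      have h4 := mean_isBigO_add hD (polyBdd_frozenGen hD hc p) h3 h1 h2
      refine h4.congr_left fun q => ?_
      congr 1
      funext y
      ring
  refine IsBigO.congr' (integral_isBigO hdyn) ?_ EventuallyEq.rfl
  exact eventually_principal.2 fun q hq =>
    (mean_ev_eq hD hc (ev_zero_of_isHomogeneous hp) hq).symm

/-- The leading term of even moments of the displacement. -/
theorem mean_even_isBigO (hD : D.Regular) (T : ℝ) (j : ℕ) {c : Torus d → ℝ} (hc : BddMeas c)
    {p : MvPolynomial (Fin d) ℝ} (hp : p.IsHomogeneous (2 * j + 2)) :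
    (fun q => mean P (fun y => c y.1 * ev p y.2) q - ∫ u in (0 : ℝ)..q.2,
      mean P (fun y => c y.1 * ((1 / 2) * frozenGen D p y.1 y.2)) (q.1, u))
      =O[𝓟 (processTimes D P T)] fun q => q.2 ^ (j + 2) := by
  obtain ⟨C, hC0, hC⟩ := exists_mul_bound hc.exists_bound (exists_gen_sub_corr_bound hD hp)
  have h1 : mean P (fun y => c y.1 * (D.gen (ev p) y.1 y.2 - (1 / 2) * frozenGen D p y.1 y.2 -
      frozenGenCorr D p y.1 y.2)) =O[𝓟 (processTimes D P T)] fun q => q.2 ^ (j + 1) :=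
    mean_isBigO_of_le hD hC0 (j + 1) fun x z => by
      convert hC x z using 3
      ring
  -- The correction has odd degree 2j + 1, so its moment is O(t^(j+1)) instead of the expected
  -- t^(j+1/2). This is why the error is a full order smaller than the leading term.
  have h2 : mean P (fun y => c y.1 * frozenGenCorr D p y.1 y.2) =O[𝓟 (processTimes D P T)]
      fun q => q.2 ^ (j + 1) := by
    have hf : (fun y : Torus d × Euc d => c y.1 * frozenGenCorr D p y.1 y.2) = fun y =>
        (∑ i, ∑ l, ∑ k, ((1 / 2) * (c y.1 * pd k (fun x => D.a x i l) y.1)) *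
          ev (MvPolynomial.X k * MvPolynomial.pderiv l (MvPolynomial.pderiv i p)) y.2) +
        ∑ i, (c y.1 * D.b y.1 i) * ev (MvPolynomial.pderiv i p) y.2 := by
      funext y
      simp only [frozenGenCorr, mul_add, Finset.mul_sum]
      congr 1
      · exact Finset.sum_congr rfl fun i _ => Finset.sum_congr rfl fun l _ =>
          Finset.sum_congr rfl fun k _ => by ring
      · exact Finset.sum_congr rfl fun i _ => by ring
    have hc1 : ∀ i l k, BddMeas fun x => (1 / 2) * (c x * pd k (fun x => D.a x i l) x) :=
      fun i l k => (hc.mul (bddMeas_pd ((Dynamics.torusContDiff_a hD.sigma i l).of_le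
        (by norm_num : 1 ≤ 2)) k)).const_mul _
    have hc2 : ∀ i, BddMeas fun x => c x * D.b x i := fun i => hc.mul (hD.bddMeas_b i)
    rw [hf]
    refine mean_isBigO_add hD
      (PolyBdd.sum fun i _ => PolyBdd.sum fun l _ => PolyBdd.sum fun k _ =>
        polyBdd_mul_ev (hc1 i l k) _)
      (PolyBdd.sum fun i _ => polyBdd_mul_ev (hc2 i) _) ?_ ?_
    · refine mean_isBigO_sum hD (fun i _ => PolyBdd.sum fun l _ => PolyBdd.sum fun k _ =>
        polyBdd_mul_ev (hc1 i l k) _) fun i _ => mean_isBigO_sum hD (fun l _ => PolyBdd.sum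
        fun k _ => polyBdd_mul_ev (hc1 i l k) _) fun l _ => mean_isBigO_sum hD
        (fun k _ => polyBdd_mul_ev (hc1 i l k) _) fun k _ => ?_
      refine mean_odd_isBigO hD T j (hc1 i l k) ?_
      have := (MvPolynomial.isHomogeneous_X ℝ k).mul ((hp.pderiv (i := i)).pderiv (i := l))
      rwa [show 1 + (2 * j + 2 - 1 - 1) = 2 * j + 1 by omega] at this
    · exact mean_isBigO_sum hD (fun i _ => polyBdd_mul_ev (hc2 i) _) fun i _ =>
        mean_odd_isBigO hD T j (hc2 i) (hp.pderiv (i := i))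
  have h3 : PolyBdd fun y : Torus d × Euc d => c y.1 * (D.gen (ev p) y.1 y.2 -
      (1 / 2) * frozenGen D p y.1 y.2 - frozenGenCorr D p y.1 y.2) := by
    simpa only [mul_sub] using ((polyBdd_gen_ev hD hc p).sub (polyBdd_frozenGen hD hc p)).sub
      (polyBdd_frozenGenCorr hD hc p)
  have h4 := integral_isBigO (mean_isBigO_add hD h3 (polyBdd_frozenGenCorr hD hc p) h1 h2)
  refine IsBigO.congr' h4 ?_ EventuallyEq.rfl
  refine eventually_principal.2 fun q hq => ?_
  have h5 := integral_mean_add hD (polyBdd_frozenGen hD hc p)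
    (h3.add (polyBdd_frozenGenCorr hD hc p)) hq
  dsimp only
  rw [mean_ev_eq hD hc (ev_zero_of_isHomogeneous hp) hq, eq_sub_iff_add_eq', ← h5]
  congr 1
  funext u
  congr 1
  funext y
  ring

lemma ev_X (k : Fin d) (z : Euc d) : ev (MvPolynomial.X k) z = z k := by simp [ev]

lemma ev_X_mul_X (i j : Fin d) (z : Euc d) :
    ev (MvPolynomial.X i * MvPolynomial.X j) z = z i * z j := by simp [ev]

lemma polyBdd_coord (k : Fin d) : PolyBdd fun y : Torus d × Euc d => y.2 k := by
  simpa only [ev_X] using polyBdd_ev (MvPolynomial.X k)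

/-- Monomials in the coordinates. -/
def mon {q : ℕ} (ι : Fin q → Fin d) (z : Euc d) : ℝ := ∏ k, z (ι k)

lemma ev_prod_X {q : ℕ} (ι : Fin q → Fin d) (z : Euc d) :
    ev (∏ k, MvPolynomial.X (ι k)) z = mon ι z := by
  simp [ev, mon]

lemma isHomogeneous_prod_X {q : ℕ} (ι : Fin q → Fin d) :
    (∏ k, MvPolynomial.X (R := ℝ) (ι k)).IsHomogeneous q := by
  simpa using MvPolynomial.IsHomogeneous.prod Finset.univ (fun k => MvPolynomial.X (R := ℝ) (ι k))
    (fun _ => 1) fun k _ => MvPolynomial.isHomogeneous_X ℝ (ι k)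

lemma pderiv_X_eq_C (i j : Fin d) : MvPolynomial.pderiv i (MvPolynomial.X (R := ℝ) j) =
    MvPolynomial.C (if j = i then 1 else 0) := by
  rw [MvPolynomial.pderiv_X, Pi.single_apply]
  split_ifs <;> simp

lemma frozenGen_two (D : Dynamics d dW) (i j : Fin d) (x : Torus d) (z : Euc d) :
    frozenGen D (MvPolynomial.X i * MvPolynomial.X j) x z = 2 * D.a x i j := by
  simp only [frozenGen, ev, Derivation.leibniz, pderiv_X_eq_C, smul_eq_mul, map_add,
    MvPolynomial.pderiv_C, map_mul, MvPolynomial.eval_C, mul_zero, zero_add,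
    mul_add, Finset.sum_add_distrib, mul_ite, mul_one, Finset.sum_ite_eq, Finset.mem_univ, if_true]
  rw [D.a_symm x j i]
  ring

/-- Two second derivatives remove one of the six pairs of variables, each pair in two orders: hence
six terms and the factor 2. -/
lemma frozenGen_four (D : Dynamics d dW) (i j k l : Fin d) (x : Torus d) (z : Euc d) :
    frozenGen D (MvPolynomial.X i * MvPolynomial.X j * (MvPolynomial.X k * MvPolynomial.X l)) x z =
      2 * (D.a x i j * (z k * z l) + D.a x k l * (z i * z j) + D.a x i k * (z j * z l) +
        D.a x i l * (z j * z k) + D.a x j k * (z i * z l) + D.a x j l * (z i * z k)) := by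
  simp only [frozenGen, ev, Derivation.leibniz, pderiv_X_eq_C, smul_eq_mul, map_add,
    MvPolynomial.pderiv_C, map_mul, MvPolynomial.eval_C, MvPolynomial.eval_X, mul_zero, zero_add,
    mul_add, Finset.sum_add_distrib, mul_ite, mul_one, ite_mul, zero_mul,
    Finset.sum_ite_eq, Finset.mem_univ, if_true]
  rw [D.a_symm x j i, D.a_symm x l k, D.a_symm x k i, D.a_symm x l i, D.a_symm x k j,
    D.a_symm x l j]
  ring

/-- Second moments of the displacement. -/
theorem mean_two_isBigO (hD : D.Regular) (T : ℝ) {c : Torus d → ℝ} (hc : BddMeas c)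
    (i j : Fin d) :
    (fun q => mean P (fun y => c y.1 * (y.2 i * y.2 j)) q -
      q.2 * ∫ ω, c (q.1.1 ω) * D.a (q.1.1 ω) i j ∂P) =O[𝓟 (processTimes D P T)]
      fun q => q.2 ^ 2 := by
  have hp : (MvPolynomial.X (R := ℝ) i * MvPolynomial.X j).IsHomogeneous (2 * 0 + 2) :=
    (MvPolynomial.isHomogeneous_X ℝ i).mul (MvPolynomial.isHomogeneous_X ℝ j)
  refine (mean_even_isBigO (P := P) hD T 0 hc hp).congr_left fun q => ?_
  have h1 : ∀ u, mean P (fun y => c y.1 * ((1 / 2) * frozenGen D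
      (MvPolynomial.X i * MvPolynomial.X j) y.1 y.2)) (q.1, u) =
      ∫ ω, c (q.1.1 ω) * D.a (q.1.1 ω) i j ∂P := fun u => by
    refine integral_congr_ae (ae_of_all _ fun ω => ?_)
    simp only [frozenGen_two]
    ring
  simp only [h1, intervalIntegral.integral_const, sub_zero, smul_eq_mul]
  simp [ev]

/-- Fourth moments of the displacement. -/
theorem mean_four_isBigO (hD : D.Regular) (T : ℝ) {c : Torus d → ℝ} (hc : BddMeas c)
    (i j k l : Fin d) :
    (fun q => mean P (fun y => c y.1 * (y.2 i * y.2 j * (y.2 k * y.2 l))) q -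
      q.2 ^ 2 * ∫ ω, c (q.1.1 ω) * (D.a (q.1.1 ω) i j * D.a (q.1.1 ω) k l +
        D.a (q.1.1 ω) i k * D.a (q.1.1 ω) j l + D.a (q.1.1 ω) i l * D.a (q.1.1 ω) j k) ∂P)
      =O[𝓟 (processTimes D P T)] fun q => q.2 ^ 3 := by
  set p : MvPolynomial (Fin d) ℝ := MvPolynomial.X i * MvPolynomial.X j *
    (MvPolynomial.X k * MvPolynomial.X l) with hpdef
  have hp : p.IsHomogeneous (2 * 1 + 2) :=
    ((MvPolynomial.isHomogeneous_X ℝ i).mul (MvPolynomial.isHomogeneous_X ℝ j)).mul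
      ((MvPolynomial.isHomogeneous_X ℝ k).mul (MvPolynomial.isHomogeneous_X ℝ l))
  have hca : ∀ i j, BddMeas fun x => c x * D.a x i j := fun i j => hc.mul (hD.bddMeas_a i j)
  have hB : ∀ i j k l, PolyBdd fun y : Torus d × Euc d => c y.1 * D.a y.1 i j * (y.2 k * y.2 l) :=
    fun i j k l => (hca i j).polyBdd.mul ((polyBdd_coord k).mul (polyBdd_coord l))
  have hA : ∀ i j k l, ∀ q ∈ processTimes D P T, Integrable (fun ω => c (q.1.1 ω) *
      D.a (q.1.1 ω) i j * D.a (q.1.1 ω) k l) P := fun i j k l q hq =>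
    ((hca i j).mul (hD.bddMeas_a k l)).polyBdd.integrable hD hq.1 hq.2.1
  have h2 : ∀ i j k l, (fun q => mean P (fun y => c y.1 * D.a y.1 i j * (y.2 k * y.2 l)) q -
      q.2 * ∫ ω, c (q.1.1 ω) * D.a (q.1.1 ω) i j * D.a (q.1.1 ω) k l ∂P)
      =O[𝓟 (processTimes D P T)] fun q => q.2 ^ 2 := fun i j k l =>
    mean_two_isBigO hD T (hca i j) k l
  -- Each second moment inside the frozen generator is replaced by time multiplied by an entry of
  -- `a`. The six resulting products coincide in pairs, leaving the three pairings of Isserlis'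
  -- formula, and the integral of 2uM over [0, t] is t²M.
  have h3 := integral_isBigO (((((h2 i j k l).add (h2 k l i j)).add (h2 i k j l)).add
    (h2 i l j k)).add ((h2 j k i l).add (h2 j l i k)))
  have h4 := (mean_even_isBigO (P := P) hD T 1 hc hp).add h3
  refine IsBigO.congr' h4 ?_ EventuallyEq.rfl
  refine eventually_principal.2 fun q hq => ?_
  set M := ∫ ω, c (q.1.1 ω) * (D.a (q.1.1 ω) i j * D.a (q.1.1 ω) k l +
        D.a (q.1.1 ω) i k * D.a (q.1.1 ω) j l + D.a (q.1.1 ω) i l * D.a (q.1.1 ω) j k) ∂P with hM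
  have hMeq : (∫ ω, c (q.1.1 ω) * D.a (q.1.1 ω) i j * D.a (q.1.1 ω) k l ∂P) +
      (∫ ω, c (q.1.1 ω) * D.a (q.1.1 ω) i k * D.a (q.1.1 ω) j l ∂P) +
      ∫ ω, c (q.1.1 ω) * D.a (q.1.1 ω) i l * D.a (q.1.1 ω) j k ∂P = M := by
    rw [← integral_add (hA i j k l q hq) (hA i k j l q hq),
      ← integral_add ((hA i j k l q hq).fun_add (hA i k j l q hq)) (hA i l j k q hq)]
    refine integral_congr_ae (ae_of_all _ fun ω => ?_)
    dsimp only
    ring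
  have hswap : ∀ i j k l, ∫ ω, c (q.1.1 ω) * D.a (q.1.1 ω) i j * D.a (q.1.1 ω) k l ∂P =
      ∫ ω, c (q.1.1 ω) * D.a (q.1.1 ω) k l * D.a (q.1.1 ω) i j ∂P := fun i j k l =>
    integral_congr_ae (ae_of_all _ fun ω => by ring)
  have hf : ∀ u ∈ Set.uIcc 0 q.2, mean P (fun y => c y.1 * ((1 / 2) * frozenGen D p y.1 y.2))
      (q.1, u) = mean P (fun y => c y.1 * D.a y.1 i j * (y.2 k * y.2 l)) (q.1, u) +
        mean P (fun y => c y.1 * D.a y.1 k l * (y.2 i * y.2 j)) (q.1, u) +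
        mean P (fun y => c y.1 * D.a y.1 i k * (y.2 j * y.2 l)) (q.1, u) +
        mean P (fun y => c y.1 * D.a y.1 i l * (y.2 j * y.2 k)) (q.1, u) +
        (mean P (fun y => c y.1 * D.a y.1 j k * (y.2 i * y.2 l)) (q.1, u) +
        mean P (fun y => c y.1 * D.a y.1 j l * (y.2 i * y.2 k)) (q.1, u)) := by
    intro u hu
    rw [Set.uIcc_of_le hq.2.1] at hu
    have hq' : (q.1, u) ∈ processTimes D P T := ⟨hq.1, hu.1, hu.2.trans hq.2.2⟩
    rw [← mean_add hD (hB j k i l) (hB j l i k) hq', ← mean_add hD (hB i j k l) (hB k l i j) hq',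
      ← mean_add hD ((hB i j k l).add (hB k l i j)) (hB i k j l) hq',
      ← mean_add hD (((hB i j k l).add (hB k l i j)).add (hB i k j l)) (hB i l j k) hq',
      ← mean_add hD ((((hB i j k l).add (hB k l i j)).add (hB i k j l)).add (hB i l j k))
        ((hB j k i l).add (hB j l i k)) hq']
    congr 1
    funext y
    rw [hpdef, frozenGen_four]
    ring
  have hint : IntervalIntegrable (fun u => mean P (fun y => c y.1 * ((1 / 2) *
      frozenGen D p y.1 y.2)) (q.1, u)) volume 0 q.2 :=
    (polyBdd_frozenGen hD hc p).intervalIntegrable hD hq.1 hq.2.1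
  have h5 : ∫ u in (0 : ℝ)..q.2, u * (2 * M) = q.2 ^ 2 * M := by
    rw [intervalIntegral.integral_mul_const, integral_id]
    ring
  have h6 : mean P (fun y => c y.1 * ev p y.2) q =
      mean P (fun y => c y.1 * (y.2 i * y.2 j * (y.2 k * y.2 l))) q := by
    simp [hpdef, ev]
  have hlin : IntervalIntegrable (fun u => u * (2 * M)) volume 0 q.2 :=
    (by fun_prop : Continuous fun u : ℝ => u * (2 * M)).intervalIntegrable _ _
  have h7 := intervalIntegral.integral_sub hint hlin
  rw [h5] at h7
  dsimp only
  rw [h6, sub_add, sub_right_inj, sub_eq_iff_eq_add', ← sub_eq_iff_eq_add, ← h7]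
  refine intervalIntegral.integral_congr fun u hu => ?_
  rw [hf u hu, ← hMeq, hswap k l i j, hswap j k i l, hswap j l i k]
  ring

/-- Functions of the displacement at two times. -/
lemma exists_two_time_abs_bound (hD : D.Regular) (T : ℝ) {F H : Torus d × Euc d → ℝ} {K : ℝ}
    (hK0 : 0 ≤ K) (p : ℕ)
    (hFK : ∀ x z, |F (x, z)| ≤ K * ‖z‖ ^ p) (hHK : ∀ x z, |H (x, z)| ≤ K * ‖z‖ ^ p) :
    ∃ C, 0 ≤ C ∧ ∀ X W, DynkinProcess D P X W → ∀ s u t, 0 ≤ s → s ≤ t → 0 ≤ u → u ≤ t → t ≤ T →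
      |∫ ω, F (X ω, W s ω) * H (X ω, W u ω) ∂P| ≤ C * t ^ p := by
  obtain ⟨C, hC0, hC⟩ := exists_moment_bound (P := P) hD p T
  refine ⟨K ^ 2 * C, by positivity, fun X W hW s u t hs hst hu hut htT => ?_⟩
  obtain ⟨hi, hle⟩ := hC X W hW s hs (hst.trans htT)
  obtain ⟨hi', hle'⟩ := hC X W hW u hu (hut.trans htT)
  have hpt : ∀ ω, ‖F (X ω, W s ω) * H (X ω, W u ω)‖ ≤
      K ^ 2 / 2 * (‖W s ω‖ ^ (2 * p) + ‖W u ω‖ ^ (2 * p)) := fun ω => by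
    rw [norm_mul, Real.norm_eq_abs, Real.norm_eq_abs]
    calc _ ≤ (K * ‖W s ω‖ ^ p) * (K * ‖W u ω‖ ^ p) := by gcongr; exacts [hFK _ _, hHK _ _]
      _ = K ^ 2 * (‖W s ω‖ ^ p * ‖W u ω‖ ^ p) := by ring
      _ ≤ K ^ 2 * ((‖W s ω‖ ^ (2 * p) + ‖W u ω‖ ^ (2 * p)) / 2) := by
          gcongr
          rw [mul_comm 2 p, pow_mul, pow_mul]
          nlinarith [sq_nonneg (‖W s ω‖ ^ p - ‖W u ω‖ ^ p)]
      _ = _ := by ring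
  refine (norm_integral_le_of_norm_le ((hi.fun_add hi').const_mul _) (ae_of_all _ hpt)).trans ?_
  rw [integral_const_mul, integral_add hi hi']
  calc _ ≤ K ^ 2 / 2 * (C * s ^ p + C * u ^ p) := by gcongr
    _ ≤ K ^ 2 / 2 * (C * t ^ p + C * t ^ p) := by gcongr
    _ = _ := by ring

/-- Unpacks the uniform asymptotics into a constant chosen before the process and the time. -/
lemma exists_mean_bound {F : Torus d × Euc d → ℝ} {T : ℝ} {j : ℕ}
    (h : mean P F =O[𝓟 (processTimes D P T)] fun q => q.2 ^ j) :
    ∃ K, 0 ≤ K ∧ ∀ X W, DynkinProcess D P X W → ∀ t, 0 ≤ t → t ≤ T →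
      |∫ ω, F (X ω, W t ω) ∂P| ≤ K * t ^ j := by
  obtain ⟨K, hK⟩ := isBigO_principal.1 h
  refine ⟨|K|, abs_nonneg _, fun X W hW t ht htT => (hK ((X, W), t) ⟨hW, ht, htT⟩).trans ?_⟩
  rw [Real.norm_of_nonneg (pow_nonneg ht _)]
  exact mul_le_mul_of_nonneg_right (le_abs_self K) (pow_nonneg ht _)

/-- Two-time moments of degree three. -/
lemma exists_two_time_bound_coord (hD : D.Regular) (T : ℝ) {c : Torus d → ℝ} (hc : BddMeas c)
    (i j k : Fin d) :
    ∃ K, 0 ≤ K ∧ ∀ X W, DynkinProcess D P X W → ∀ s t, 0 ≤ s → s ≤ t → t ≤ T →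
      |∫ ω, c (X ω) * W s ω k * (W t ω i * W t ω j) ∂P| ≤ K * t ^ 2 := by
  -- Hölder's inequality alone would give t^(3/2). The quadratic factor at time `t` is written as
  -- its value at time `s` plus a Dynkin increment. The former yields an odd moment of degree three;
  -- in the latter the generator is `a i j` plus O(‖z‖), and the constant part leaves an odd moment
  -- of degree one. Both are O(t²).
  set p : MvPolynomial (Fin d) ℝ := MvPolynomial.X i * MvPolynomial.X j with hpdef
  have hXk := MvPolynomial.isHomogeneous_X ℝ k
  have hp : p.IsHomogeneous (0 + 2) :=
    (MvPolynomial.isHomogeneous_X ℝ i).mul (MvPolynomial.isHomogeneous_X ℝ j)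
  have hF : PolyBdd fun y : Torus d × Euc d => c y.1 * y.2 k := by
    simpa only [ev_X] using polyBdd_mul_ev hc (MvPolynomial.X k)
  have hg : PolyBdd fun y : Torus d × Euc d => D.gen (ev p) y.1 y.2 -
      (1 / 2) * frozenGen D p y.1 y.2 := by
    simpa using (polyBdd_gen_ev hD (bddMeas_const 1) p).sub
      (polyBdd_frozenGen hD (bddMeas_const 1) p)
  obtain ⟨K1, hK10, hK1⟩ := exists_gen_sub_bound hD hp
  obtain ⟨K2, hK20, hK2⟩ := exists_mul_bound hc.exists_bound (exists_ev_bound hXk)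
  obtain ⟨C1, hC10, hC1⟩ := exists_two_time_abs_bound (P := P) hD T (add_nonneg hK10 hK20) 1
    (F := fun y => c y.1 * y.2 k) (H := fun y => D.gen (ev p) y.1 y.2 -
      (1 / 2) * frozenGen D p y.1 y.2)
    (fun x z => by
      have := hK2 x z
      rw [ev_X, zero_add] at this
      exact this.trans (mul_le_mul_of_nonneg_right (by linarith) (by positivity)))
    (fun x z => by
      have := hK1 x z
      rw [zero_add] at this
      exact this.trans (mul_le_mul_of_nonneg_right (by linarith) (by positivity)))
  obtain ⟨C2, hC20, hC2⟩ := exists_mean_bound (mean_odd_isBigO (P := P) hD T 0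
    (hc.mul (hD.bddMeas_a i j)) (hXk))
  obtain ⟨C3, hC30, hC3⟩ := exists_mean_bound (mean_odd_isBigO (P := P) hD T 1 hc
    (p := MvPolynomial.X k * p) (hXk.mul hp))
  refine ⟨C3 + (C1 + C2), by positivity, fun X W hW s t hs hst htT => ?_⟩
  have ht := hs.trans hst
  have hint : ∀ t, 0 ≤ t → t ≤ T → s ≤ T → Integrable (fun ω => c (X ω) * W s ω k *
      ev p (W t ω)) P := fun t ht htT hsT => by
    obtain ⟨_, -, h⟩ := exists_integral_mul_bound (P := P) hD hF (polyBdd_ev p) T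
    exact (h X W hW s t hs hsT ht htT).1
  have hdyn := hW.dynkin_poly hD (hasTemperateGrowth_ev p) hs hst hF
  have hbd : ∀ u ∈ Set.uIoc s t, ‖∫ ω, c (X ω) * W s ω k * D.gen (ev p) (X ω) (W u ω) ∂P‖ ≤
      (C1 + C2) * t := by
    intro u hu
    rw [Set.uIoc_of_le hst] at hu
    have hu0 : 0 ≤ u := hs.trans hu.1.le
    have h1 := hC1 X W hW s u t hs hst hu0 hu.2 htT
    have h2 := hC2 X W hW s hs (hst.trans htT)
    simp only [ev_X, zero_add, pow_one] at h1 h2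
    have hi1 : Integrable (fun ω => c (X ω) * W s ω k * (D.gen (ev p) (X ω) (W u ω) -
        (1 / 2) * frozenGen D p (X ω) (W u ω))) P := by
      obtain ⟨_, -, h⟩ := exists_integral_mul_bound (P := P) hD hF hg T
      exact (h X W hW s u hs (hst.trans htT) hu0 (hu.2.trans htT)).1
    have hi2 : Integrable (fun ω => c (X ω) * D.a (X ω) i j * W s ω k) P := by
      have := (polyBdd_mul_ev (hc.mul (hD.bddMeas_a i j)) (MvPolynomial.X k)).integrable hD hW hs
      simpa only [ev_X] using this
    have h3 : ∫ ω, c (X ω) * W s ω k * D.gen (ev p) (X ω) (W u ω) ∂P =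
        (∫ ω, c (X ω) * W s ω k * (D.gen (ev p) (X ω) (W u ω) -
          (1 / 2) * frozenGen D p (X ω) (W u ω)) ∂P) +
        ∫ ω, c (X ω) * D.a (X ω) i j * W s ω k ∂P := by
      rw [← integral_add hi1 hi2]
      refine integral_congr_ae (ae_of_all _ fun ω => ?_)
      simp only [hpdef, frozenGen_two]
      ring
    rw [h3]
    refine (abs_add_le _ _).trans ?_
    calc _ ≤ C1 * t + C2 * s := add_le_add h1 h2
      _ ≤ C1 * t + C2 * t := by gcongr
      _ = _ := by ring
  have h4 := intervalIntegral.norm_integral_le_of_norm_le_const hbd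
  rw [← hdyn, abs_of_nonneg (sub_nonneg.2 hst)] at h4
  have h5 := hC3 X W hW s hs (hst.trans htT)
  have h6 : ∫ ω, c (X ω) * W s ω k * (W t ω i * W t ω j) ∂P =
      (∫ ω, c (X ω) * ev (MvPolynomial.X k * p) (W s ω) ∂P) +
      ∫ ω, c (X ω) * W s ω k * (ev p (W t ω) - ev p (W s ω)) ∂P := by
    have hi3 : Integrable (fun ω => c (X ω) * W s ω k * (ev p (W t ω) - ev p (W s ω))) P := by
      simpa only [mul_sub] using integrable_fun_sub (hint t ht htT (hst.trans htT))
        (hint s hs (hst.trans htT) (hst.trans htT))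
    have hi4 := (polyBdd_mul_ev hc (MvPolynomial.X k * p)).integrable hD hW hs
    rw [← integral_add hi4 hi3]
    refine integral_congr_ae (ae_of_all _ fun ω => ?_)
    simp only [ev, hpdef, map_mul, MvPolynomial.eval_X]
    ring
  rw [h6]
  refine (abs_add_le _ _).trans ?_
  calc _ ≤ C3 * s ^ 2 + (C1 + C2) * t * (t - s) := add_le_add h5 h4
    _ ≤ C3 * t ^ 2 + (C1 + C2) * t * t := by gcongr; linarith
    _ = _ := by ring

/-- Two-time moments involving a function of the position. -/
theorem exists_two_time_bound (hD : D.Regular) (T : ℝ) {c : Torus d → ℝ} (hc : BddMeas c)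
    {r : Torus d → ℝ} (hr : TorusContDiff 2 r) (i j : Fin d) :
    ∃ K, 0 ≤ K ∧ ∀ X W, DynkinProcess D P X W → ∀ s t, 0 ≤ s → s ≤ t → t ≤ T →
      |∫ ω, c (X ω) * (r (X ω + proj (W s ω)) - r (X ω)) * (W t ω i * W t ω j) ∂P| ≤
        K * t ^ 2 := by
  -- The function `r` is linearised at the initial state. The linear part falls under the coordinate
  -- case; the remainder, bounded by ‖W s‖², meets a quadratic factor at time `t` and needs no
  -- cancellation.
  have hrp : ∀ k, BddMeas (pd k r) := fun k => bddMeas_pd (hr.of_le (by norm_num : 1 ≤ 2)) k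
  choose C hC0 hC using fun k => exists_two_time_bound_coord (P := P) hD T (hc.mul (hrp k)) i j k
  obtain ⟨K1, hK10, hK1⟩ := exists_mul_bound hc.exists_bound (exists_linear_bound hr)
  obtain ⟨K2, hK20, hK2⟩ := exists_ev_bound (d := d) ((MvPolynomial.isHomogeneous_X ℝ i).mul
    (MvPolynomial.isHomogeneous_X ℝ j))
  have hpos : Measurable fun y : Torus d × Euc d => r (y.1 + proj y.2) :=
    (hr.continuous.comp (continuous_fst.add (continuous_proj.comp continuous_snd))).measurable
  have hrb : PolyBdd fun y : Torus d × Euc d => r (y.1 + proj y.2) := by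
    obtain ⟨K, hK0, hK⟩ := exists_bound_of_continuous hr.continuous
    exact ⟨hpos, K, 0, hK0, fun x z => by simpa using hK _⟩
  have hlin : ∀ k, PolyBdd fun y : Torus d × Euc d => pd k r y.1 * y.2 k := fun k => by
    simpa only [ev_X] using polyBdd_mul_ev (hrp k) (MvPolynomial.X k)
  have hF : PolyBdd fun y : Torus d × Euc d => c y.1 * (r (y.1 + proj y.2) - r y.1 -
      ∑ k, pd k r y.1 * y.2 k) :=
    hc.polyBdd.mul ((hrb.sub (bddMeas_of_continuous hr.continuous).polyBdd).sub
      (PolyBdd.sum fun k _ => hlin k))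
  have hH : PolyBdd fun y : Torus d × Euc d => y.2 i * y.2 j :=
    (polyBdd_coord i).mul (polyBdd_coord j)
  obtain ⟨C1, hC10, hC1⟩ := exists_two_time_abs_bound (P := P) hD T
    (add_nonneg hK10 hK20) 2
    (F := fun y => c y.1 * (r (y.1 + proj y.2) - r y.1 - ∑ k, pd k r y.1 * y.2 k))
    (H := fun y => y.2 i * y.2 j)
    (fun x z => (hK1 x z).trans (by rw [zero_add]; gcongr; linarith))
    (fun x z => by
      have := hK2 x z
      rw [ev_X_mul_X] at this
      exact this.trans (by norm_num; gcongr; linarith))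
  refine ⟨C1 + ∑ k, C k, add_nonneg hC10 (Finset.sum_nonneg fun k _ => hC0 k),
    fun X W hW s t hs hst htT => ?_⟩
  have ht := hs.trans hst
  have hi1 : Integrable (fun ω => c (X ω) * (r (X ω + proj (W s ω)) - r (X ω) -
      ∑ k, pd k r (X ω) * W s ω k) * (W t ω i * W t ω j)) P := by
    obtain ⟨_, -, h⟩ := exists_integral_mul_bound (P := P) hD hF hH T
    exact (h X W hW s t hs (hst.trans htT) ht htT).1
  have hi2 : ∀ k, Integrable (fun ω => c (X ω) * pd k r (X ω) * W s ω k *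
      (W t ω i * W t ω j)) P := fun k => by
    obtain ⟨_, -, h⟩ := exists_integral_mul_bound (P := P) hD (hc.polyBdd.mul (hlin k)) hH T
    simpa only [mul_assoc] using (h X W hW s t hs (hst.trans htT) ht htT).1
  have h1 : ∫ ω, c (X ω) * (r (X ω + proj (W s ω)) - r (X ω)) * (W t ω i * W t ω j) ∂P =
      (∫ ω, c (X ω) * (r (X ω + proj (W s ω)) - r (X ω) -
        ∑ k, pd k r (X ω) * W s ω k) * (W t ω i * W t ω j) ∂P) +
      ∑ k, ∫ ω, c (X ω) * pd k r (X ω) * W s ω k * (W t ω i * W t ω j) ∂P := by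
    rw [← integral_finsetSum _ fun k _ => hi2 k,
      ← integral_add hi1 (integrable_finsetSum _ fun k _ => hi2 k)]
    refine integral_congr_ae (ae_of_all _ fun ω => ?_)
    simp only [← Finset.sum_mul, mul_assoc (c (X ω)), ← Finset.mul_sum]
    ring
  rw [h1, add_mul, Finset.sum_mul]
  exact (abs_add_le _ _).trans (add_le_add (hC1 X W hW s t t hs hst ht le_rfl htT)
    ((Finset.abs_sum_le_sum_abs _ _).trans (Finset.sum_le_sum fun k _ => hC k X W hW s t hs hst htT)))

end

end

/-! ### Moment expansions of real-world observations -/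

section

open Asymptotics

variable {d dW : ℕ}

/-- The small-time asymptotics of a sequence of observations with time steps `dt k`. -/
structure MomentExpansion {Ω : Type*} [MeasurableSpace Ω] (D : Dynamics d dW) (P : Measure Ω)
    (dt : ℕ → ℝ) (X : ℕ → Ω → Torus d) (Z : ℕ → Ω → Euc d) (R : ℕ → Ω → ℝ) : Prop where
  measurable_X : ∀ k, Measurable (X k)
  measurable_Z : ∀ k, Measurable (Z k)
  measurable_R : ∀ k, Measurable (R k)
  moment : ∀ q : ℕ, ∃ K, 0 ≤ K ∧ ∀ k, Integrable (fun ω => ‖Z k ω‖ ^ (2 * q)) P ∧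
    ∫ ω, ‖Z k ω‖ ^ (2 * q) ∂P ≤ K * dt k ^ q
  odd : ∀ (j : ℕ) (c : Torus d → ℝ), BddMeas c → ∀ ι : Fin (2 * j + 1) → Fin d,
    (fun k => ∫ ω, c (X k ω) * mon ι (Z k ω) ∂P) =O[⊤] fun k => dt k ^ (j + 1)
  two : ∀ c : Torus d → ℝ, BddMeas c → ∀ i j,
    (fun k => ∫ ω, c (X k ω) * (Z k ω i * Z k ω j) ∂P -
      dt k * ∫ ω, c (X k ω) * D.a (X k ω) i j ∂P) =O[⊤] fun k => dt k ^ 2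
  four : ∀ c : Torus d → ℝ, BddMeas c → ∀ i j l m,
    (fun k => ∫ ω, c (X k ω) * (Z k ω i * Z k ω j * (Z k ω l * Z k ω m)) ∂P -
      dt k ^ 2 * ∫ ω, c (X k ω) * (D.a (X k ω) i j * D.a (X k ω) l m +
        D.a (X k ω) i l * D.a (X k ω) j m + D.a (X k ω) i m * D.a (X k ω) j l) ∂P)
      =O[⊤] fun k => dt k ^ 3
  reward_bdd : ∃ K, 0 ≤ K ∧ ∀ k, ∀ᵐ ω ∂P, |R k ω| ≤ K
  reward_sq : (fun k => ∫ ω, (R k ω - D.r (X k ω)) ^ 2 ∂P) =O[⊤] dt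
  reward : ∀ c : Torus d → ℝ, BddMeas c →
    (fun k => ∫ ω, c (X k ω) * (R k ω - D.r (X k ω)) ∂P) =O[⊤] dt
  reward_two : ∀ c : Torus d → ℝ, BddMeas c → ∀ i j,
    (fun k => ∫ ω, c (X k ω) * (R k ω - D.r (X k ω)) * (Z k ω i * Z k ω j) ∂P)
      =O[⊤] fun k => dt k ^ 2

section

variable {Ω : Type*} [MeasurableSpace Ω] {D : Dynamics d dW} {P : Measure Ω}
  [IsProbabilityMeasure P]

/-- Expectations of time averages along a path. -/
lemma integral_mul_time_average {X : Ω → Torus d} {W : ℝ → Ω → Euc d}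
    (hW : DynkinProcess D P X W) {h : Torus d → ℝ} (hh : Continuous h) {V : Ω → ℝ}
    (hV : Integrable V P) {t : ℝ} (ht : 0 < t) :
    ∫ ω, V ω * ((1 / t) * (∫ s in (0 : ℝ)..t, h (X ω + proj (W s ω))) - h (X ω)) ∂P =
      (1 / t) * ∫ s in (0 : ℝ)..t, ∫ ω, V ω * (h (X ω + proj (W s ω)) - h (X ω)) ∂P := by
  obtain ⟨K, hK0, hK⟩ := exists_bound_of_continuous hh
  have hjoint : Measurable fun q : ℝ × Ω => h (X q.2 + proj (W q.1 q.2)) - h (X q.2) := by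
    have h1 : Measurable fun y : Torus d × Euc d => h (y.1 + proj y.2) - h y.1 :=
      ((hh.comp (continuous_fst.add (continuous_proj.comp continuous_snd))).sub
        (hh.comp continuous_fst)).measurable
    have h2 := h1.comp (measurable_position hW.measurable_X hW.measurable_W hW.continuous)
    exact h2
  have hprod : Integrable (Function.uncurry fun (s : ℝ) ω => V ω *
      (h (X ω + proj (W s ω)) - h (X ω))) ((volume.restrict (Set.uIoc 0 t)).prod P) := by
    have : IsFiniteMeasure (volume.restrict (Set.uIoc 0 t)) := by
      rw [Set.uIoc_of_le ht.le]
      infer_instance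
    have h1 : Integrable (fun q : ℝ × Ω => V q.2) ((volume.restrict (Set.uIoc 0 t)).prod P) :=
      hV.comp_snd _
    exact h1.mul_bdd hjoint.aestronglyMeasurable (ae_of_all _ fun q =>
      (norm_sub_le _ _).trans (add_le_add (hK _) (hK _)))
  rw [intervalIntegral_integral_swap hprod, ← integral_const_mul]
  refine integral_congr_ae (ae_of_all _ fun ω => ?_)
  dsimp only
  have hc : Continuous fun s => h (X ω + proj (W s ω)) :=
    hh.comp (continuous_const.add (continuous_proj.comp (hW.continuous ω)))
  rw [intervalIntegral.integral_const_mul, intervalIntegral.integral_sub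
    (hc.intervalIntegrable _ _) intervalIntegrable_const, intervalIntegral.integral_const,
    sub_zero, smul_eq_mul]
  field_simp

lemma abs_time_average_le {X : Torus d} {W : ℝ → Euc d} {h : Torus d → ℝ} {K : ℝ}
    (hK : ∀ x, |h x| ≤ K) {t : ℝ} (ht : 0 < t) :
    |(1 / t) * ∫ s in (0 : ℝ)..t, h (X + proj (W s))| ≤ K := by
  have h1 := intervalIntegral.norm_integral_le_of_norm_le_const (a := 0) (b := t)
    (f := fun s => h (X + proj (W s))) (C := K) fun s _ => hK _
  rw [sub_zero, abs_of_pos ht, Real.norm_eq_abs] at h1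
  rw [abs_mul, abs_of_pos (one_div_pos.2 ht), one_div_mul_eq_div, div_le_iff₀ ht]
  exact h1

lemma norm_time_average_integral_le {f : ℝ → ℝ} {t C : ℝ} (ht : 0 < t)
    (h : ∀ s, 0 ≤ s → s ≤ t → |f s| ≤ C) : |(1 / t) * ∫ s in (0 : ℝ)..t, f s| ≤ C := by
  have h1 := intervalIntegral.norm_integral_le_of_norm_le_const (a := 0) (b := t)
    (f := f) (C := C) fun s hs => by
      rw [Set.uIoc_of_le ht.le] at hs
      exact h s hs.1.le hs.2
  rw [sub_zero, abs_of_pos ht, Real.norm_eq_abs] at h1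
  rw [abs_mul, abs_of_pos (one_div_pos.2 ht), one_div_mul_eq_div, div_le_iff₀ ht]
  exact h1

/-- The moments of `Z k` are those of the process at time `dt k`. The reward is a time average, so
an expectation against it is an average over s ≤ dt k of moments involving the state at time `s`,
bounded uniformly in `s`. -/
theorem momentExpansion_of_isRealWorldObs (hD : D.Regular) {dt : ℕ → ℝ} (hdt : ∀ k, 0 < dt k)
    {T : ℝ} (hT : ∀ k, dt k ≤ T) {X : ℕ → Ω → Torus d} {Z : ℕ → Ω → Euc d} {R : ℕ → Ω → ℝ}
    (hX : ∀ k, Measurable (X k)) (hZ : ∀ k, Measurable (Z k)) (hR : ∀ k, Measurable (R k))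
    (h : ∀ k, D.IsRealWorldObs P (dt k) (X k) (Z k) (R k)) :
    MomentExpansion D P dt X Z R := by
  have h' : ∀ k, ∃ W, DynkinProcess D P (X k) W ∧ (∀ᵐ ω ∂P, Z k ω = W (dt k) ω) ∧
      ∀ᵐ ω ∂P, R k ω = (1 / dt k) * ∫ t in (0 : ℝ)..dt k, D.r (X k ω + proj (W t ω)) := fun k => by
    obtain ⟨Y, hY, hae⟩ := h k
    exact ⟨_, hY.dynkinProcess hD (hX k), hae.mono fun ω hω => hω.1, hae.mono fun ω hω => hω.2⟩
  choose W hW hZW hRW using h'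
  have hmem : ∀ k, ((X k, W k), dt k) ∈ processTimes D P T := fun k => ⟨hW k, (hdt k).le, hT k⟩
  have htend : Tendsto (fun k => ((X k, W k), dt k)) ⊤ (𝓟 (processTimes D P T)) :=
    tendsto_principal.2 (Eventually.of_forall hmem)
  have hmean : ∀ F : Torus d × Euc d → ℝ, ∀ k, mean P F ((X k, W k), dt k) =
      ∫ ω, F (X k ω, Z k ω) ∂P := fun F k =>
    integral_congr_ae ((hZW k).mono fun ω hω => by simp only [hω])
  have hrc := hD.r.continuous
  obtain ⟨Kr, hKr0, hKr⟩ := exists_bound_of_continuous hrc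
  have hrew : ∀ k, ∀ V : Ω → ℝ, Integrable V P → ∫ ω, V ω * (R k ω - D.r (X k ω)) ∂P =
      (1 / dt k) * ∫ s in (0 : ℝ)..dt k, ∫ ω, V ω *
        (D.r (X k ω + proj (W k s ω)) - D.r (X k ω)) ∂P := fun k V hV => by
    rw [← integral_mul_time_average (hW k) hrc hV (hdt k)]
    exact integral_congr_ae ((hRW k).mono fun ω hω => by simp only [hω])
  have hRb : ∀ k, ∀ᵐ ω ∂P, |R k ω| ≤ Kr := fun k => (hRW k).mono fun ω hω => by
    rw [hω]
    exact abs_time_average_le hKr (hdt k)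
  refine ⟨hX, hZ, hR, fun q => ?_, fun j c hc ι => ?_, fun c hc i j => ?_,
    fun c hc i j l m => ?_, ⟨Kr, hKr0, hRb⟩, ?_, fun c hc => ?_, fun c hc i j => ?_⟩
  · obtain ⟨K, hK0, hK⟩ := exists_moment_bound (P := P) hD q T
    refine ⟨K, hK0, fun k => ?_⟩
    obtain ⟨h1, h2⟩ := hK _ _ (hW k) _ (hdt k).le (hT k)
    have h3 : (fun ω => ‖W k (dt k) ω‖ ^ (2 * q)) =ᵐ[P] fun ω => ‖Z k ω‖ ^ (2 * q) :=
      (hZW k).mono fun ω hω => by simp only [hω]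
    exact ⟨h1.congr h3, by rwa [← integral_congr_ae h3]⟩
  · have h1 := (mean_odd_isBigO (P := P) hD T j hc (isHomogeneous_prod_X ι)).comp_tendsto htend
    refine h1.congr_left fun k => ?_
    simp only [Function.comp_apply, hmean, ev_prod_X]
  · have h1 := (mean_two_isBigO (P := P) hD T hc i j).comp_tendsto htend
    refine h1.congr_left fun k => ?_
    simp only [Function.comp_apply, hmean]
  · have h1 := (mean_four_isBigO (P := P) hD T hc i j l m).comp_tendsto htend
    refine h1.congr_left fun k => ?_
    simp only [Function.comp_apply, hmean]
  · obtain ⟨L, hL0, hL⟩ := exists_lipschitz_bound (hD.r.of_le (by norm_num : 1 ≤ 2))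
    obtain ⟨K, hK0, hK⟩ := exists_moment_bound (P := P) hD 1 T
    refine isBigO_top.2 ⟨L ^ 2 * K, fun k => ?_⟩
    have hbd : ∀ᵐ ω ∂P, ‖R k ω - D.r (X k ω)‖ ≤ Kr + Kr := (hRb k).mono fun ω hω =>
      (norm_sub_le _ _).trans (add_le_add hω (hKr _))
    have hmeas : Measurable fun ω => R k ω - D.r (X k ω) :=
      (hR k).sub (hrc.measurable.comp (hX k))
    have hVi : Integrable (fun ω => R k ω - D.r (X k ω)) P :=
      Integrable.of_bound hmeas.aestronglyMeasurable _ hbd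
    have hV2 : Integrable (fun ω => (R k ω - D.r (X k ω)) ^ 2) P := by
      simpa only [sq] using hVi.mul_bdd hmeas.aestronglyMeasurable hbd
    set S := ∫ ω, (R k ω - D.r (X k ω)) ^ 2 ∂P with hS
    have hS0 : 0 ≤ S := integral_nonneg fun ω => sq_nonneg _
    have h1 := hrew k _ hVi
    -- Only one of the two factors of the square is expanded as a time average. Young's inequality
    -- then gives S ≤ S/2 + O(dt), and S/2 is absorbed into the left-hand side.
    have h2 : |(1 / dt k) * ∫ s in (0 : ℝ)..dt k, ∫ ω, (R k ω - D.r (X k ω)) *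
        (D.r (X k ω + proj (W k s ω)) - D.r (X k ω)) ∂P| ≤ 1 / 2 * S + 1 / 2 * (L ^ 2 * K * dt k) := by
      refine norm_time_average_integral_le (hdt k) fun s hs hst => ?_
      obtain ⟨h3, h4⟩ := hK _ _ (hW k) s hs (hst.trans (hT k))
      have h5 : |∫ ω, (R k ω - D.r (X k ω)) *
        (D.r (X k ω + proj (W k s ω)) - D.r (X k ω)) ∂P| ≤
          ∫ ω, (1 / 2 * (R k ω - D.r (X k ω)) ^ 2 + 1 / 2 * (L ^ 2 * ‖W k s ω‖ ^ (2 * 1))) ∂P := by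
        rw [← Real.norm_eq_abs]
        refine norm_integral_le_of_norm_le ((hV2.const_mul _).fun_add
          ((h3.const_mul _).const_mul _)) (ae_of_all _ fun ω => ?_)
        rw [norm_mul, Real.norm_eq_abs, Real.norm_eq_abs, ← sq_abs (R k ω - _)]
        have h6 := hL (X k ω) (W k s ω)
        have h7 := mul_le_mul_of_nonneg_left h6 (abs_nonneg (R k ω - D.r (X k ω)))
        nlinarith [sq_nonneg (|R k ω - D.r (X k ω)| - L * ‖W k s ω‖)]
      rw [integral_add (hV2.const_mul _) ((h3.const_mul _).const_mul _), integral_const_mul,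
        integral_const_mul, integral_const_mul] at h5
      refine h5.trans ?_
      calc _ ≤ 1 / 2 * S + 1 / 2 * (L ^ 2 * (K * s ^ 1)) := by gcongr
        _ ≤ 1 / 2 * S + 1 / 2 * (L ^ 2 * (K * dt k)) := by rw [pow_one]; gcongr
        _ = _ := by ring
    rw [← h1] at h2
    have h8 : ∫ ω, (R k ω - D.r (X k ω)) * (R k ω - D.r (X k ω)) ∂P = S := by
      rw [hS]; simp only [sq]
    rw [h8, abs_of_nonneg hS0] at h2
    rw [Real.norm_of_nonneg hS0, Real.norm_of_nonneg (hdt k).le]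
    linarith
  · have hcr : ∀ i, BddMeas fun x => c x * pd i D.r x := fun i =>
      hc.mul (bddMeas_pd (hD.r.of_le (by norm_num : 1 ≤ 2)) i)
    have hrb : PolyBdd fun y : Torus d × Euc d => D.r (y.1 + proj y.2) :=
      ⟨(hrc.comp (continuous_fst.add (continuous_proj.comp continuous_snd))).measurable,
        Kr, 0, hKr0, fun x z => by simpa using hKr _⟩
    have hF : PolyBdd fun y : Torus d × Euc d => c y.1 * (D.r (y.1 + proj y.2) - D.r y.1 -
        ∑ i, pd i D.r y.1 * y.2 i) :=
      hc.polyBdd.mul ((hrb.sub (bddMeas_of_continuous hrc).polyBdd).sub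
        (PolyBdd.sum fun i _ => (bddMeas_pd (hD.r.of_le (by norm_num : 1 ≤ 2)) i).polyBdd.mul
          (polyBdd_coord i)))
    have hG : ∀ i, PolyBdd fun y : Torus d × Euc d => c y.1 * pd i D.r y.1 * y.2 i := fun i =>
      (hcr i).polyBdd.mul (polyBdd_coord i)
    obtain ⟨K, hK0, hK⟩ := exists_mul_bound hc.exists_bound (exists_linear_bound hD.r)
    have h1 : mean P (fun y => c y.1 * (D.r (y.1 + proj y.2) - D.r y.1 -
        ∑ i, pd i D.r y.1 * y.2 i)) =O[𝓟 (processTimes D P T)] fun q => q.2 ^ 1 :=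
      mean_isBigO_of_le hD hK0 1 fun x z => by simpa using hK x z
    have h2 : mean P (fun y => ∑ i, c y.1 * pd i D.r y.1 * y.2 i) =O[𝓟 (processTimes D P T)]
        fun q => q.2 ^ 1 := by
      refine mean_isBigO_sum hD (fun i _ => hG i) fun i _ => ?_
      simpa only [ev_X, zero_add] using mean_odd_isBigO (P := P) hD T 0 (hcr i)
        (MvPolynomial.isHomogeneous_X ℝ i)
    have h3 := mean_isBigO_add hD hF (PolyBdd.sum fun i _ => hG i) h1 h2
    obtain ⟨C, hC0, hC⟩ := exists_mean_bound h3
    refine isBigO_top.2 ⟨C, fun k => ?_⟩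
    rw [hrew k _ (hc.polyBdd.integrable hD (hW k) le_rfl), Real.norm_of_nonneg (hdt k).le]
    refine norm_time_average_integral_le (hdt k) fun s hs hst => ?_
    have h4 := hC _ _ (hW k) s hs (hst.trans (hT k))
    have h5 : ∫ ω, c (X k ω) * (D.r (X k ω + proj (W k s ω)) - D.r (X k ω)) ∂P =
        ∫ ω, (c (X k ω) * (D.r (X k ω + proj (W k s ω)) - D.r (X k ω) -
          ∑ i, pd i D.r (X k ω) * W k s ω i) + ∑ i, c (X k ω) * pd i D.r (X k ω) * W k s ω i) ∂P := by
      refine integral_congr_ae (ae_of_all _ fun ω => ?_)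
      simp only [mul_assoc, ← Finset.mul_sum]
      ring
    rw [h5]
    refine h4.trans ?_
    rw [pow_one]
    gcongr
  · obtain ⟨C, hC0, hC⟩ := exists_two_time_bound (P := P) hD T hc hD.r i j
    refine isBigO_top.2 ⟨C, fun k => ?_⟩
    have hVi : Integrable (fun ω => c (X k ω) * (W k (dt k) ω i * W k (dt k) ω j)) P :=
      (hc.polyBdd.mul ((polyBdd_coord i).mul (polyBdd_coord j))).integrable hD (hW k) (hdt k).le
    have h1 : ∫ ω, c (X k ω) * (R k ω - D.r (X k ω)) * (Z k ω i * Z k ω j) ∂P =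
        ∫ ω, c (X k ω) * (W k (dt k) ω i * W k (dt k) ω j) * (R k ω - D.r (X k ω)) ∂P :=
      integral_congr_ae ((hZW k).mono fun ω hω => by simp only [hω]; ring)
    rw [h1, hrew k _ hVi, Real.norm_of_nonneg (pow_nonneg (hdt k).le _)]
    refine norm_time_average_integral_le (hdt k) fun s hs hst => ?_
    refine le_trans (le_of_eq ?_) (hC _ _ (hW k) s (dt k) hs hst (hT k))
    congr 1
    exact integral_congr_ae (ae_of_all _ fun ω => by ring)

end

end

section

/-! ## Gaussian moments and the Euler-Maruyama scheme -/

section Gaussian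

variable {E : Type*} [NormedAddCommGroup E] [InnerProductSpace ℝ E] [FiniteDimensional ℝ E]
  [MeasurableSpace E] [BorelSpace E]

lemma integrable_norm_pow_stdGaussian (p : ℕ) :
    Integrable (fun x : E => ‖x‖ ^ p) (stdGaussian E) := by
  have h := (IsGaussian.memLp_id (stdGaussian E) p (ENNReal.natCast_ne_top p)).integrable_norm_pow'
  simpa using h

lemma integrable_stdGaussian_of_le {G : E → ℝ} (hG : Measurable G) {K : ℝ} {p : ℕ}
    (h : ∀ x, |G x| ≤ K * ‖x‖ ^ p) : Integrable G (stdGaussian E) :=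
  ((integrable_norm_pow_stdGaussian p).const_mul K).mono' hG.aestronglyMeasurable (ae_of_all _ h)

lemma integral_comp_neg_stdGaussian (G : E → ℝ) :
    ∫ x, G (-x) ∂(stdGaussian E) = ∫ x, G x ∂(stdGaussian E) := by
  have h := stdGaussian_map (E := E) (LinearIsometryEquiv.neg ℝ : E ≃ₗᵢ[ℝ] E)
  conv_rhs => rw [← h]
  exact (MeasurableEquiv.neg E).measurableEmbedding.integral_map G |>.symm

lemma integral_stdGaussian_of_odd {G : E → ℝ} (h : ∀ x, G (-x) = -G x) :
    ∫ x, G x ∂(stdGaussian E) = 0 := by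
  have h1 := integral_comp_neg_stdGaussian G
  simp only [h, integral_neg] at h1
  linarith

/-- The fourth moment is the fourth derivative at zero of the moment generating function exp(vt²/2);
every derivative is a polynomial times this exponential. -/
lemma integral_pow_four_gaussianReal (v : ℝ≥0) :
    ∫ x, x ^ 4 ∂(gaussianReal 0 v) = 3 * (v : ℝ) ^ 2 := by
  have h0 : (0 : ℝ) ∈ interior (integrableExpSet id (gaussianReal 0 v)) := by
    simp [integrableExpSet_id_gaussianReal]
  have h1 := iteratedDeriv_mgf_zero h0 4
  have h2 : mgf id (gaussianReal 0 v) = fun t => Real.exp (v * t ^ 2 / 2) := by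
    funext t
    rw [mgf_gaussianReal (p := gaussianReal 0 v) (X := id) (Measure.map_id)]
    simp
  have hE : ∀ t : ℝ, HasDerivAt (fun t : ℝ => Real.exp (v * t ^ 2 / 2))
      (v * t * Real.exp (v * t ^ 2 / 2)) t := fun t => by
    have := (((hasDerivAt_pow 2 t).const_mul (v : ℝ)).div_const 2).exp
    convert this using 1
    push_cast
    ring
  have hpoly : ∀ p p' : ℝ → ℝ, (∀ t, HasDerivAt p (p' t) t) →
      deriv (fun t => p t * Real.exp (v * t ^ 2 / 2)) =
        fun t => (p' t + v * t * p t) * Real.exp (v * t ^ 2 / 2) := fun p p' hp => by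
    funext t
    rw [((hp t).fun_mul (hE t)).deriv]
    ring
  have hd1 : deriv (fun t : ℝ => Real.exp (v * t ^ 2 / 2)) =
      fun t => (v * t) * Real.exp (v * t ^ 2 / 2) := funext fun t => (hE t).deriv
  have hp1 : ∀ t : ℝ, HasDerivAt (fun t : ℝ => (v : ℝ) * t) (v : ℝ) t := fun t => by
    simpa using (hasDerivAt_id t).const_mul (v : ℝ)
  have hp2 : ∀ t : ℝ, HasDerivAt (fun t : ℝ => (v : ℝ) + v * t * (v * t)) (2 * v ^ 2 * t) t :=
    fun t => (((hp1 t).fun_mul (hp1 t)).const_add (v : ℝ)).congr_deriv (by ring)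
  have hp3 : ∀ t : ℝ, HasDerivAt (fun t : ℝ => 2 * v ^ 2 * t + v * t * (v + v * t * (v * t)))
      (2 * v ^ 2 + (v * (v + v * t * (v * t)) + v * t * (2 * v ^ 2 * t))) t := fun t => by
    have h := ((hasDerivAt_id t).const_mul (2 * (v : ℝ) ^ 2)).fun_add ((hp1 t).fun_mul (hp2 t))
    simpa using h
  rw [h2, iteratedDeriv_succ, iteratedDeriv_succ, iteratedDeriv_succ, iteratedDeriv_one, hd1,
    hpoly _ _ hp1, hpoly _ _ hp2, hpoly _ _ hp3] at h1
  simp only [Pi.pow_apply, id] at h1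
  rw [← h1]
  simp
  ring

lemma map_inner_stdGaussian (u : E) :
    (stdGaussian E).map (fun x => inner ℝ u x) = gaussianReal 0 (‖u‖ ^ 2).toNNReal := by
  have h := IsGaussian.map_eq_gaussianReal (μ := stdGaussian E) (innerSL ℝ u)
  rw [integral_strongDual_stdGaussian, variance_dual_stdGaussian, innerSL_apply_norm] at h
  exact h

lemma integral_inner_sq_stdGaussian (u : E) :
    ∫ x, (inner ℝ u x) ^ 2 ∂(stdGaussian E) = ‖u‖ ^ 2 := by
  have h := variance_dual_stdGaussian (innerSL ℝ u)
  rw [variance_eq_integral (by fun_prop), integral_strongDual_stdGaussian, innerSL_apply_norm] at h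
  simpa using h

lemma integral_inner_pow_four_stdGaussian (u : E) :
    ∫ x, (inner ℝ u x) ^ 4 ∂(stdGaussian E) = 3 * ‖u‖ ^ 4 := by
  have h := integral_pow_four_gaussianReal (‖u‖ ^ 2).toNNReal
  rw [← map_inner_stdGaussian, integral_map (by fun_prop) (by fun_prop),
    Real.coe_toNNReal _ (sq_nonneg _)] at h
  rw [h]
  ring

lemma integrable_inner_pow_stdGaussian (u : E) (p : ℕ) :
    Integrable (fun x => (inner ℝ u x) ^ p) (stdGaussian E) :=
  integrable_stdGaussian_of_le (K := ‖u‖ ^ p) (p := p) (by fun_prop) fun x => by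
    rw [abs_pow, ← mul_pow]
    exact pow_le_pow_left₀ (abs_nonneg _) (abs_real_inner_le_norm u x) p

lemma integral_inner_mul_inner_stdGaussian (u v : E) :
    ∫ x, inner ℝ u x * inner ℝ v x ∂(stdGaussian E) = inner ℝ u v := by
  have h : ∀ x : E, inner ℝ u x * inner ℝ v x =
      (1 / 4 : ℝ) * ((inner ℝ (u + v) x) ^ 2 - (inner ℝ (u - v) x) ^ 2) := fun x => by
    rw [inner_add_left, inner_sub_left]
    ring
  simp_rw [h]
  rw [integral_const_mul, integral_sub (integrable_inner_pow_stdGaussian _ 2)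
    (integrable_inner_pow_stdGaussian _ 2), integral_inner_sq_stdGaussian,
    integral_inner_sq_stdGaussian, norm_add_sq_real, norm_sub_sq_real]
  ring

/-- Isserlis' formula for four factors. -/
lemma integral_inner_four_stdGaussian (u v w y : E) :
    ∫ x, inner ℝ u x * inner ℝ v x * (inner ℝ w x * inner ℝ y x) ∂(stdGaussian E) =
      inner ℝ u v * inner ℝ w y + inner ℝ u w * inner ℝ v y + inner ℝ u y * inner ℝ v w := by
  -- Polarisation of the fourth power: a signed sum over the eight sign patterns up to a global
  -- sign, normalised by 8 · 4! = 192. The formula is thereby reduced to fourth moments of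
  -- one-dimensional Gaussians.
  have h : ∀ x : E, inner ℝ u x * inner ℝ v x * (inner ℝ w x * inner ℝ y x) =
      (1 / 192 : ℝ) * (((inner ℝ (u + v + w + y) x) ^ 4 + (inner ℝ (u + v - w - y) x) ^ 4) +
        ((inner ℝ (u - v + w - y) x) ^ 4 + (inner ℝ (u - v - w + y) x) ^ 4) -
        (((inner ℝ (u + v + w - y) x) ^ 4 + (inner ℝ (u + v - w + y) x) ^ 4) +
        ((inner ℝ (u - v + w + y) x) ^ 4 + (inner ℝ (u - v - w - y) x) ^ 4))) := fun x => by
    simp only [inner_add_left, inner_sub_left]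
    ring
  have hi := fun u : E => integrable_inner_pow_stdGaussian u 4
  simp_rw [h]
  rw [integral_const_mul, integral_sub
    (((hi _).fun_add (hi _)).fun_add ((hi _).fun_add (hi _)))
    (((hi _).fun_add (hi _)).fun_add ((hi _).fun_add (hi _))),
    integral_add ((hi _).fun_add (hi _)) ((hi _).fun_add (hi _)),
    integral_add ((hi _).fun_add (hi _)) ((hi _).fun_add (hi _)),
    integral_add (hi _) (hi _), integral_add (hi _) (hi _), integral_add (hi _) (hi _),
    integral_add (hi _) (hi _)]
  have h4 : ∀ u : E, ∫ x, (inner ℝ u x) ^ 4 ∂(stdGaussian E) = 3 * (inner ℝ u u) ^ 2 := fun u => by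
    rw [integral_inner_pow_four_stdGaussian, real_inner_self_eq_norm_sq]
    ring
  simp only [h4]
  simp only [inner_add_left, inner_sub_left, inner_add_right, inner_sub_right,
    real_inner_comm u v, real_inner_comm u w, real_inner_comm u y, real_inner_comm v w,
    real_inner_comm v y, real_inner_comm w y]
  ring

end Gaussian

end

/-! ### Moment expansions of the Euler-Maruyama scheme -/

section

open Asymptotics

variable {d dW : ℕ}

/-- The `i`-th coordinate of the diffusion applied to the noise. -/
def Dynamics.noise (D : Dynamics d dW) (x : Torus d) (e : Euc dW) (i : Fin d) : ℝ :=
  inner ℝ (WithLp.toLp 2 (D.sigma x i) : Euc dW) e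

lemma Dynamics.noise_eq (D : Dynamics d dW) (x : Torus d) (e : Euc dW) (i : Fin d) :
    D.noise x e i = ((D.sigma x).mulVec (WithLp.ofLp e)) i := by
  simp [Dynamics.noise, PiLp.inner_apply, Matrix.mulVec, dotProduct, mul_comm]

lemma Dynamics.a_eq_inner (D : Dynamics d dW) (x : Torus d) (i j : Fin d) :
    inner ℝ (WithLp.toLp 2 (D.sigma x i) : Euc dW) (WithLp.toLp 2 (D.sigma x j)) = D.a x i j := by
  simp [Dynamics.a, PiLp.inner_apply, Matrix.mul_apply, mul_comm]

lemma Dynamics.noise_neg (D : Dynamics d dW) (x : Torus d) (e : Euc dW) (i : Fin d) :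
    D.noise x (-e) i = -D.noise x e i := inner_neg_right _ _

lemma Dynamics.Regular.measurable_noise {D : Dynamics d dW} (hD : D.Regular) (i : Fin d) :
    Measurable fun q : Torus d × Euc dW => D.noise q.1 q.2 i := by
  have h : (fun q : Torus d × Euc dW => D.noise q.1 q.2 i) =
      fun q => ∑ j, D.sigma q.1 i j * q.2 j := by
    funext q
    rw [Dynamics.noise_eq]
    rfl
  rw [h]
  refine Finset.measurable_sum _ fun j _ => ?_
  have h1 : Measurable fun q : Torus d × Euc dW => D.sigma q.1 i j :=
    (hD.sigma i j).measurable.comp measurable_fst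
  exact h1.mul (by fun_prop)

lemma Dynamics.Regular.exists_noise_bound {D : Dynamics d dW} (hD : D.Regular) :
    ∃ K, 0 ≤ K ∧ ∀ x e i, |D.noise x e i| ≤ K * ‖e‖ := by
  choose K hK0 hK using fun i j => exists_bound_of_continuous (hD.sigma i j).continuous
  refine ⟨∑ i, ∑ j, K i j, Finset.sum_nonneg fun i _ => Finset.sum_nonneg fun j _ => hK0 i j,
    fun x e i => ?_⟩
  have h1 : D.noise x e i = ∑ j, D.sigma x i j * e j := by rw [Dynamics.noise_eq]; rfl
  rw [h1]
  calc _ ≤ ∑ j, K i j * ‖e‖ := (Finset.abs_sum_le_sum_abs _ _).trans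
        (Finset.sum_le_sum fun j _ => by
          rw [abs_mul]
          exact mul_le_mul (hK i j x) (abs_coord_le e j) (abs_nonneg _) (hK0 i j))
    _ = (∑ j, K i j) * ‖e‖ := (Finset.sum_mul _ _ _).symm
    _ ≤ _ := mul_le_mul_of_nonneg_right (Finset.single_le_sum (f := fun i => ∑ j, K i j)
        (fun i _ => Finset.sum_nonneg fun j _ => hK0 i j) (Finset.mem_univ i)) (norm_nonneg _)

section

variable {Ω : Type*} [MeasurableSpace Ω] {D : Dynamics d dW} {P : Measure Ω}
  [IsProbabilityMeasure P]

/-- A bounded coefficient times a product of noise coordinates. -/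
def noiseMon (D : Dynamics d dW) {q : ℕ} (c : Torus d → ℝ) (s : Finset (Fin q)) (ι : Fin q → Fin d)
    (y : Torus d × Euc dW) : ℝ :=
  c y.1 * ∏ k ∈ s, D.noise y.1 y.2 (ι k)

lemma measurable_noiseMon (hD : D.Regular) {q : ℕ} {c : Torus d → ℝ} (hc : BddMeas c)
    (s : Finset (Fin q)) (ι : Fin q → Fin d) : Measurable (noiseMon D c s ι) :=
  (hc.1.comp measurable_fst).mul (Finset.measurable_fun_prod _ fun k _ => hD.measurable_noise (ι k))

lemma exists_noiseMon_bound (hD : D.Regular) {q : ℕ} {c : Torus d → ℝ} (hc : BddMeas c)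
    (s : Finset (Fin q)) (ι : Fin q → Fin d) :
    ∃ K, 0 ≤ K ∧ ∀ x e, |noiseMon D c s ι (x, e)| ≤ K * ‖e‖ ^ s.card := by
  obtain ⟨-, C, hC0, hC⟩ := hc
  obtain ⟨K, hK0, hK⟩ := hD.exists_noise_bound
  refine ⟨C * K ^ s.card, by positivity, fun x e => ?_⟩
  rw [noiseMon, abs_mul, Finset.abs_prod, mul_assoc, ← mul_pow, ← Finset.prod_const]
  exact mul_le_mul (hC x) (Finset.prod_le_prod (fun _ _ => abs_nonneg _) fun k _ => hK x e (ι k))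
    (Finset.prod_nonneg fun _ _ => abs_nonneg _) hC0

variable {X : Ω → Torus d} {ξ : Ω → Euc dW} (hX : Measurable X) (hξ : Measurable ξ)
  (hlaw : P.map ξ = stdGaussian (Euc dW)) (hind : IndepFun X ξ P)

include hX hξ hlaw hind

lemma integrable_noiseMon (hD : D.Regular) {q : ℕ} {c : Torus d → ℝ} (hc : BddMeas c)
    (s : Finset (Fin q)) (ι : Fin q → Fin d) :
    Integrable (fun ω => noiseMon D c s ι (X ω, ξ ω)) P := by
  obtain ⟨K, hK0, hK⟩ := exists_noiseMon_bound hD hc s ι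
  have h1 : Integrable (fun ω => ‖ξ ω‖ ^ s.card) P := by
    have h2 := integrable_norm_pow_stdGaussian (E := Euc dW) s.card
    rw [← hlaw, integrable_map_measure (by fun_prop) hξ.aemeasurable] at h2
    exact h2
  exact (h1.const_mul K).mono'
    ((measurable_noiseMon hD hc s ι).comp (hX.prodMk hξ)).aestronglyMeasurable
    (ae_of_all _ fun ω => hK _ _)

lemma integral_noiseMon (hD : D.Regular) {q : ℕ} {c : Torus d → ℝ} (hc : BddMeas c)
    (s : Finset (Fin q)) (ι : Fin q → Fin d) :
    ∫ ω, noiseMon D c s ι (X ω, ξ ω) ∂P =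
      ∫ ω, ∫ e, noiseMon D c s ι (X ω, e) ∂(stdGaussian (Euc dW)) ∂P := by
  have hm := measurable_noiseMon hD hc s ι
  rw [integral_freeze hX hξ hind hm.stronglyMeasurable
    (integrable_noiseMon hX hξ hlaw hind hD hc s ι)]
  refine integral_congr_ae (ae_of_all _ fun ω => ?_)
  have hm' : Measurable fun e => noiseMon D c s ι (X ω, e) := hm.comp measurable_prodMk_left
  dsimp only
  rw [← hlaw, integral_map hξ.aemeasurable hm'.aestronglyMeasurable]

/-- With `X` frozen, the integrand is odd in the Gaussian noise, whose law is symmetric. -/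
lemma integral_noiseMon_odd (hD : D.Regular) {q : ℕ} {c : Torus d → ℝ} (hc : BddMeas c)
    {s : Finset (Fin q)} (hs : Odd s.card) (ι : Fin q → Fin d) :
    ∫ ω, noiseMon D c s ι (X ω, ξ ω) ∂P = 0 := by
  rw [integral_noiseMon hX hξ hlaw hind hD hc s ι]
  have h : ∀ x, ∫ e, noiseMon D c s ι (x, e) ∂(stdGaussian (Euc dW)) = 0 := fun x =>
    integral_stdGaussian_of_odd fun e => by
      simp only [noiseMon, Dynamics.noise_neg, Finset.prod_neg, hs.neg_one_pow]
      ring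
  simp [h]

omit hX hξ hlaw hind in
lemma exists_integral_noiseMon_bound (hD : D.Regular) {q : ℕ} {c : Torus d → ℝ} (hc : BddMeas c)
    (s : Finset (Fin q)) (ι : Fin q → Fin d) :
    ∃ K, 0 ≤ K ∧ ∀ (X : Ω → Torus d) (ξ : Ω → Euc dW), Measurable X → Measurable ξ →
      P.map ξ = stdGaussian (Euc dW) → IndepFun X ξ P →
      |∫ ω, noiseMon D c s ι (X ω, ξ ω) ∂P| ≤ K := by
  obtain ⟨K, hK0, hK⟩ := exists_noiseMon_bound hD hc s ι
  have h2 := integrable_norm_pow_stdGaussian (E := Euc dW) s.card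
  refine ⟨K * ∫ e, ‖e‖ ^ s.card ∂(stdGaussian (Euc dW)), mul_nonneg hK0
    (integral_nonneg fun _ => by positivity), fun X ξ hX hξ hlaw hind => ?_⟩
  have h3 : ∫ ω, ‖ξ ω‖ ^ s.card ∂P = ∫ e, ‖e‖ ^ s.card ∂(stdGaussian (Euc dW)) := by
    rw [← hlaw, integral_map hξ.aemeasurable (by fun_prop)]
  have h1 : Integrable (fun ω => ‖ξ ω‖ ^ s.card) P := by
    rw [← hlaw, integrable_map_measure (by fun_prop) hξ.aemeasurable] at h2
    exact h2
  rw [← h3, ← integral_const_mul, ← Real.norm_eq_abs]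
  exact norm_integral_le_of_norm_le (h1.const_mul K) (ae_of_all _ fun ω => hK _ _)

end

/-- The expansion of monomials of an Euler-Maruyama increment. -/
lemma mon_euler (D : Dynamics d dW) {q : ℕ} (ι : Fin q → Fin d) (c : Torus d → ℝ) {t : ℝ}
    (ht : 0 ≤ t) (x : Torus d) (e : Euc dW) :
    c x * mon ι (t • D.b x + Real.sqrt t •
        WithLp.toLp 2 ((D.sigma x).mulVec (WithLp.ofLp e))) =
      ∑ s : Finset (Fin q), Real.sqrt t ^ (q + s.card) *
        noiseMon D (fun x => c x * ∏ k ∈ s, D.b x (ι k)) sᶜ ι (x, e) := by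
  -- A factor √t is taken out of each coordinate, so that a drift term carries one more √t than a
  -- noise term. With `s` the set of factors in which the drift is chosen, the exponent of √t is q +
  -- |s|.
  have h1 : ∀ k, (t • D.b x + Real.sqrt t •
        WithLp.toLp 2 ((D.sigma x).mulVec (WithLp.ofLp e)) : Euc d) (ι k) =
      Real.sqrt t * (Real.sqrt t * D.b x (ι k) + D.noise x e (ι k)) := fun k => by
    rw [Dynamics.noise_eq]
    simp only [PiLp.add_apply, PiLp.smul_apply, smul_eq_mul]
    nth_rewrite 1 [← Real.mul_self_sqrt ht]
    ring
  simp only [mon, h1, Finset.prod_mul_distrib, Finset.prod_const, Finset.card_univ,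
    Fintype.card_fin, Fintype.prod_add, Finset.mul_sum, noiseMon]
  refine Finset.sum_congr rfl fun s _ => ?_
  rw [pow_add]
  ring

section

variable {Ω : Type*} [MeasurableSpace Ω] {D : Dynamics d dW} {P : Measure Ω}
  [IsProbabilityMeasure P]

lemma BddMeas.mul_prod_b (hD : D.Regular) {q : ℕ} {c : Torus d → ℝ} (hc : BddMeas c)
    (s : Finset (Fin q)) (ι : Fin q → Fin d) : BddMeas fun x => c x * ∏ k ∈ s, D.b x (ι k) := by
  refine hc.mul (bddMeas_of_continuous ?_)
  exact continuous_finsetProd _ fun k _ => (hD.b.apply (ι k)).continuous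

/-- The moments of the Euler-Maruyama increments. -/
theorem euler_mon_isBigO (hD : D.Regular) {dt : ℕ → ℝ} (hdt : ∀ k, 0 < dt k)
    {T : ℝ} (hT : ∀ k, dt k ≤ T) {X : ℕ → Ω → Torus d} {Z : ℕ → Ω → Euc d} {ξ : ℕ → Ω → Euc dW}
    (hX : ∀ k, Measurable (X k)) (hξ : ∀ k, Measurable (ξ k))
    (hlaw : ∀ k, P.map (ξ k) = stdGaussian (Euc dW)) (hind : ∀ k, IndepFun (X k) (ξ k) P)
    (hZ : ∀ k, ∀ᵐ ω ∂P, Z k ω = dt k • D.b (X k ω) + Real.sqrt (dt k) •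
      WithLp.toLp 2 ((D.sigma (X k ω)).mulVec (WithLp.ofLp (ξ k ω))))
    {q : ℕ} (ι : Fin q → Fin d) {c : Torus d → ℝ} (hc : BddMeas c) (j : ℕ) (hj : 2 * j ≤ q + 2)
    (hj' : q + 1 ≤ 2 * j) :
    (fun k => ∫ ω, c (X k ω) * mon ι (Z k ω) ∂P - Real.sqrt (dt k) ^ q *
      ∫ ω, noiseMon D c Finset.univ ι (X k ω, ξ k ω) ∂P) =O[⊤] fun k => dt k ^ j := by
  have hcs := fun s : Finset (Fin q) => hc.mul_prod_b hD s ι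
  have h1 : ∀ k, ∫ ω, c (X k ω) * mon ι (Z k ω) ∂P = ∑ s : Finset (Fin q),
      Real.sqrt (dt k) ^ (q + s.card) * ∫ ω, noiseMon D (fun x => c x * ∏ k ∈ s, D.b x (ι k))
        sᶜ ι (X k ω, ξ k ω) ∂P := fun k => by
    have h2 : ∀ᵐ ω ∂P, c (X k ω) * mon ι (Z k ω) = ∑ s : Finset (Fin q),
        Real.sqrt (dt k) ^ (q + s.card) * noiseMon D (fun x => c x * ∏ k ∈ s, D.b x (ι k))
          sᶜ ι (X k ω, ξ k ω) := (hZ k).mono fun ω hω => by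
      rw [hω, mon_euler D ι c (hdt k).le]
    rw [integral_congr_ae h2, integral_finsetSum _ fun s _ =>
      (integrable_noiseMon (hX k) (hξ k) (hlaw k) (hind k) hD (hcs s) sᶜ ι).const_mul _]
    exact Finset.sum_congr rfl fun s _ => integral_const_mul _ _
  have h3 : ∀ k, ∫ ω, c (X k ω) * mon ι (Z k ω) ∂P - Real.sqrt (dt k) ^ q *
      ∫ ω, noiseMon D c Finset.univ ι (X k ω, ξ k ω) ∂P =
      ∑ s ∈ Finset.univ.erase (∅ : Finset (Fin q)),
      Real.sqrt (dt k) ^ (q + s.card) * ∫ ω, noiseMon D (fun x => c x * ∏ k ∈ s, D.b x (ι k))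
        sᶜ ι (X k ω, ξ k ω) ∂P := fun k => by
    rw [h1, ← Finset.add_sum_erase _ _ (Finset.mem_univ (∅ : Finset (Fin q)))]
    simp
  simp only [h3]
  -- The term without drift has been subtracted, so `s` is nonempty. Terms with an odd number of
  -- noise factors vanish by symmetry. In the others q + |s| is even and exceeds q, hence is at
  -- least `2 * j`, the least even number above q.
  refine IsBigO.fun_sum fun s hs => ?_
  have hs0 : 1 ≤ s.card := Finset.card_pos.2 (Finset.nonempty_iff_ne_empty.2 (Finset.ne_of_mem_erase hs))
  rcases Nat.even_or_odd sᶜ.card with he | ho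
  · obtain ⟨K, hK0, hK⟩ := exists_integral_noiseMon_bound (P := P) hD (hcs s) sᶜ ι
    have hcard : s.card + sᶜ.card = q := by simp [Finset.card_add_card_compl]
    obtain ⟨r, hr⟩ := he
    have hex : ∃ m, q + s.card = 2 * (j + m) := by
      refine ⟨(q + s.card) / 2 - j, ?_⟩
      omega
    obtain ⟨m, hm⟩ := hex
    refine isBigO_top.2 ⟨|T| ^ m * K, fun k => ?_⟩
    have h4 : Real.sqrt (dt k) ^ (q + s.card) = dt k ^ j * dt k ^ m := by
      rw [hm, pow_mul, Real.sq_sqrt (hdt k).le, pow_add]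
    have h5 : dt k ^ m ≤ |T| ^ m := pow_le_pow_left₀ (hdt k).le ((hT k).trans (le_abs_self T)) m
    have hp := hdt k
    rw [h4, norm_mul, Real.norm_of_nonneg (r := dt k ^ j * dt k ^ m) (by positivity),
      Real.norm_of_nonneg (r := dt k ^ j) (by positivity), Real.norm_eq_abs]
    calc _ ≤ dt k ^ j * |T| ^ m * K := by
          gcongr
          exact hK _ _ (hX k) (hξ k) (hlaw k) (hind k)
      _ = _ := by ring
  · simp only [integral_noiseMon_odd (hX _) (hξ _) (hlaw _) (hind _) hD (hcs s) ho ι, mul_zero]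
    exact isBigO_zero _ _

lemma integral_noise_two (D : Dynamics d dW) (x : Torus d) (i j : Fin d) :
    ∫ e, D.noise x e i * D.noise x e j ∂(stdGaussian (Euc dW)) = D.a x i j := by
  simp only [Dynamics.noise]
  rw [integral_inner_mul_inner_stdGaussian, D.a_eq_inner]

lemma integral_noise_four (D : Dynamics d dW) (x : Torus d) (i j l m : Fin d) :
    ∫ e, D.noise x e i * D.noise x e j * (D.noise x e l * D.noise x e m)
        ∂(stdGaussian (Euc dW)) =
      D.a x i j * D.a x l m + D.a x i l * D.a x j m + D.a x i m * D.a x j l := by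
  simp only [Dynamics.noise]
  rw [integral_inner_four_stdGaussian]
  simp only [D.a_eq_inner]

lemma mon_four (i j l m : Fin d) (z : Euc d) :
    mon ![i, j, l, m] z = z i * z j * (z l * z m) := by
  simp [mon, Fin.prod_univ_four, mul_assoc]

lemma noiseMon_four (D : Dynamics d dW) (c : Torus d → ℝ) (i j l m : Fin d)
    (y : Torus d × Euc dW) : noiseMon D c Finset.univ ![i, j, l, m] y =
      c y.1 * (D.noise y.1 y.2 i * D.noise y.1 y.2 j *
        (D.noise y.1 y.2 l * D.noise y.1 y.2 m)) := by
  simp [noiseMon, Fin.prod_univ_four, mul_assoc]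

lemma norm_le_sum_abs (z : Euc d) : ‖z‖ ≤ ∑ i, |z i| := by
  conv_lhs => rw [eq_sum_basisVec z]
  refine (norm_sum_le _ _).trans (Finset.sum_le_sum fun i _ => ?_)
  simp [norm_smul, basisVec]

/-- The increment is at most a constant times √t (1 + ‖ξ‖), the drift contributing t ≤ √t √T, and
Gaussian moments are finite. -/
theorem exists_euler_moment_bound (hD : D.Regular) (T : ℝ) (q : ℕ) :
    ∃ K, 0 ≤ K ∧ ∀ (t : ℝ) (X : Ω → Torus d) (Z : Ω → Euc d) (ξ : Ω → Euc dW), 0 < t → t ≤ T →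
      Measurable Z → Measurable ξ → P.map ξ = stdGaussian (Euc dW) →
      (∀ᵐ ω ∂P, Z ω = t • D.b (X ω) + Real.sqrt t •
        WithLp.toLp 2 ((D.sigma (X ω)).mulVec (WithLp.ofLp (ξ ω)))) →
      Integrable (fun ω => ‖Z ω‖ ^ (2 * q)) P ∧ ∫ ω, ‖Z ω‖ ^ (2 * q) ∂P ≤ K * t ^ q := by
  obtain ⟨K, hK0, hK⟩ := hD.exists_noise_bound
  obtain ⟨B, hB0, -, hB⟩ := hD.exists_coeff_bound
  set M : ℝ := d * (Real.sqrt T * B + K) with hM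
  have hM0 : 0 ≤ M := by positivity
  set I : ℝ := ∫ e, (1 + ‖e‖) ^ (2 * q) ∂(stdGaussian (Euc dW)) with hI
  have hI0 : 0 ≤ I := integral_nonneg fun e => by positivity
  have hint : Integrable (fun e : Euc dW => (1 + ‖e‖) ^ (2 * q)) (stdGaussian (Euc dW)) := by
    refine (((integrable_const (1 : ℝ)).fun_add (integrable_norm_pow_stdGaussian
      (2 * q))).const_mul (2 ^ (2 * q - 1))).mono' (by fun_prop) (ae_of_all _ fun e => ?_)
    rw [Real.norm_of_nonneg (by positivity)]
    simpa using add_pow_le zero_le_one (norm_nonneg e) (2 * q)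
  refine ⟨M ^ (2 * q) * I, by positivity, fun t X Z ξ ht htT hZ hξ hlaw hae => ?_⟩
  have hpt : ∀ᵐ ω ∂P, ‖‖Z ω‖ ^ (2 * q)‖ ≤ t ^ q * M ^ (2 * q) * (1 + ‖ξ ω‖) ^ (2 * q) := by
    refine hae.mono fun ω hω => ?_
    have h1 : ∀ i, |Z ω i| ≤ Real.sqrt t * (Real.sqrt T * B + K) * (1 + ‖ξ ω‖) := fun i => by
      have h2 : Z ω i = t * D.b (X ω) i + Real.sqrt t * D.noise (X ω) (ξ ω) i := by
        rw [hω, Dynamics.noise_eq]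
        rfl
      have h3 : t ≤ Real.sqrt t * Real.sqrt T := by
        nth_rewrite 1 [← Real.mul_self_sqrt ht.le]
        gcongr
      rw [h2]
      calc _ ≤ t * |D.b (X ω) i| + Real.sqrt t * |D.noise (X ω) (ξ ω) i| := by
            refine (abs_add_le _ _).trans (le_of_eq ?_)
            rw [abs_mul, abs_mul, abs_of_pos ht, abs_of_nonneg (Real.sqrt_nonneg t)]
        _ ≤ Real.sqrt t * Real.sqrt T * B + Real.sqrt t * (K * ‖ξ ω‖) := by
            gcongr
            exacts [hB _ _, hK _ _ _]
        _ ≤ Real.sqrt t * Real.sqrt T * B + Real.sqrt t * (K * ‖ξ ω‖) +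
            (Real.sqrt t * Real.sqrt T * B * ‖ξ ω‖ + Real.sqrt t * K) :=
              le_add_of_nonneg_right (by positivity)
        _ = _ := by ring
    have h4 : ‖Z ω‖ ≤ Real.sqrt t * M * (1 + ‖ξ ω‖) := by
      refine (norm_le_sum_abs _).trans ((Finset.sum_le_sum fun i _ => h1 i).trans (le_of_eq ?_))
      rw [Finset.sum_const, Finset.card_univ, Fintype.card_fin, nsmul_eq_mul, hM]
      ring
    rw [Real.norm_of_nonneg (by positivity)]
    calc _ ≤ (Real.sqrt t * M * (1 + ‖ξ ω‖)) ^ (2 * q) := by gcongr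
      _ = _ := by rw [mul_pow, mul_pow, pow_mul, Real.sq_sqrt ht.le]
  have hint' : Integrable (fun ω => (1 + ‖ξ ω‖) ^ (2 * q)) P := by
    rw [← hlaw, integrable_map_measure (by fun_prop) hξ.aemeasurable] at hint
    exact hint
  have hI' : ∫ ω, (1 + ‖ξ ω‖) ^ (2 * q) ∂P = I := by
    rw [hI, ← hlaw, integral_map hξ.aemeasurable (by fun_prop)]
  have hZi := (hint'.const_mul (t ^ q * M ^ (2 * q))).mono'
    (hZ.norm.pow_const _).aestronglyMeasurable hpt
  refine ⟨hZi, ?_⟩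
  calc _ ≤ ∫ ω, t ^ q * M ^ (2 * q) * (1 + ‖ξ ω‖) ^ (2 * q) ∂P :=
        integral_mono_ae hZi (hint'.const_mul _) (hpt.mono fun ω hω => (le_abs_self _).trans hω)
    _ = _ := by
        rw [integral_const_mul, hI']
        ring

/-- The reward is exact here, so the conditions on its deviation are void. The moments follow from
`euler_mon_isBigO` once the pure noise term is computed with the covariance and Isserlis' formula.
-/
theorem momentExpansion_of_isSimulatorObs (hD : D.Regular) {dt : ℕ → ℝ} (hdt : ∀ k, 0 < dt k)
    {T : ℝ} (hT : ∀ k, dt k ≤ T) {X : ℕ → Ω → Torus d} {Z : ℕ → Ω → Euc d} {R : ℕ → Ω → ℝ}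
    (hX : ∀ k, Measurable (X k)) (hZ : ∀ k, Measurable (Z k)) (hR : ∀ k, Measurable (R k))
    (h : ∀ k, D.IsSimulatorObs P (dt k) (X k) (Z k) (R k)) :
    MomentExpansion D P dt X Z R := by
  choose ξ hξ hlaw hind hobs using h
  have hZe := fun k => (hobs k).mono fun ω hω => hω.1
  have hRe := fun k => (hobs k).mono fun ω hω => hω.2
  obtain ⟨Kr, hKr0, hKr⟩ := exists_bound_of_continuous hD.r.continuous
  refine ⟨hX, hZ, hR, fun q => ?_, fun j c hc ι => ?_, fun c hc i j => ?_,
    fun c hc i j l m => ?_, ⟨Kr, hKr0, fun k => (hRe k).mono fun ω hω => by rw [hω]; exact hKr _⟩,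
    ?_, fun c hc => ?_, fun c hc i j => ?_⟩
  · obtain ⟨K, hK0, hK⟩ := exists_euler_moment_bound (P := P) hD T q
    exact ⟨K, hK0, fun k => hK (dt k) (X k) (Z k) (ξ k) (hdt k) (hT k) (hZ k) (hξ k) (hlaw k)
      (hZe k)⟩
  · have h1 := euler_mon_isBigO hD hdt hT hX hξ hlaw hind hZe ι hc (j + 1) (by omega) (by omega)
    refine h1.congr_left fun k => ?_
    rw [integral_noiseMon_odd (hX k) (hξ k) (hlaw k) (hind k) hD hc (by simp) ι]
    simp
  · have h1 := euler_mon_isBigO hD hdt hT hX hξ hlaw hind hZe ![i, j] hc 2 (by omega) (by omega)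
    refine h1.congr_left fun k => ?_
    rw [integral_noiseMon (hX k) (hξ k) (hlaw k) (hind k) hD hc]
    simp only [mon, noiseMon, Fin.prod_univ_two, Matrix.cons_val_zero, Matrix.cons_val_one,
      integral_const_mul, integral_noise_two, Real.sq_sqrt (hdt k).le]
  · have h1 := euler_mon_isBigO hD hdt hT hX hξ hlaw hind hZe ![i, j, l, m] hc 3 (by omega)
      (by omega)
    refine h1.congr_left fun k => ?_
    have h4 : Real.sqrt (dt k) ^ 4 = dt k ^ 2 := by
      rw [show 4 = 2 * 2 from rfl, pow_mul, Real.sq_sqrt (hdt k).le]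
    rw [integral_noiseMon (hX k) (hξ k) (hlaw k) (hind k) hD hc]
    simp only [mon_four, noiseMon_four, integral_const_mul, integral_noise_four]
    exact congrArg (fun u => _ - u * _) h4
  · refine (isBigO_zero dt ⊤).congr_left fun k => ?_
    rw [integral_congr_ae (g := fun _ => 0) ((hRe k).mono fun ω hω => by simp [hω])]
    simp
  · refine (isBigO_zero dt ⊤).congr_left fun k => ?_
    rw [integral_congr_ae (g := fun _ => 0) ((hRe k).mono fun ω hω => by simp [hω])]
    simp
  · refine (isBigO_zero (fun k => dt k ^ 2) ⊤).congr_left fun k => ?_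
    rw [integral_congr_ae (g := fun _ => 0) ((hRe k).mono fun ω hω => by simp [hω])]
    simp

end

end

section

open Asymptotics

variable {d dW : ℕ}

/-! ## Expectations of polynomials in the displacement -/

/-- Homogeneous polynomials of degree `q` in the displacement whose coefficients are bounded
functions of the position. -/
inductive IsForm : ℕ → (Torus d → Euc d → ℝ) → Prop
  | zero (q : ℕ) : IsForm q fun _ _ => 0
  | mon {q : ℕ} {c : Torus d → ℝ} (hc : BddMeas c) (ι : Fin q → Fin d) :
      IsForm q fun x z => c x * mon ι z
  | add {q : ℕ} {F G : Torus d → Euc d → ℝ} : IsForm q F → IsForm q G →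
      IsForm q fun x z => F x z + G x z

lemma measurable_mon {q : ℕ} (ι : Fin q → Fin d) : Measurable (mon ι) :=
  Finset.measurable_fun_prod _ fun k _ => by fun_prop

lemma abs_mon_le {q : ℕ} (ι : Fin q → Fin d) (z : Euc d) : |mon ι z| ≤ ‖z‖ ^ q := by
  rw [mon, Finset.abs_prod]
  simpa using Finset.prod_le_prod (s := Finset.univ) (fun _ _ => abs_nonneg _)
    fun k _ => abs_coord_le z (ι k)

namespace IsForm

lemma const {c : Torus d → ℝ} (hc : BddMeas c) : IsForm 0 fun x (_ : Euc d) => c x := by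
  convert IsForm.mon hc (Fin.elim0 : Fin 0 → Fin d) using 3
  simp [ResidualGradient.mon]

lemma coord (i : Fin d) : IsForm 1 fun (_ : Torus d) z => z i := by
  convert IsForm.mon (bddMeas_const 1) (fun _ : Fin 1 => i) using 3
  simp [ResidualGradient.mon]

lemma mul {q r : ℕ} {F G : Torus d → Euc d → ℝ} (hF : IsForm q F) (hG : IsForm r G) :
    IsForm (q + r) fun x z => F x z * G x z := by
  induction hF with
  | zero => simpa only [zero_mul] using IsForm.zero _
  | mon hc ι =>
    induction hG with
    | zero => simpa only [mul_zero] using IsForm.zero _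
    | mon hc' κ =>
      convert IsForm.mon (hc.mul hc') (Fin.append ι κ) using 3
      simp only [ResidualGradient.mon, Fin.prod_univ_add, Fin.append_left, Fin.append_right]
      ring
    | add _ _ h1 h2 => simpa only [mul_add] using h1.add h2
  | add _ _ h1 h2 => simpa only [add_mul] using h1.add h2

lemma coeff_mul {q : ℕ} {c : Torus d → ℝ} {F : Torus d → Euc d → ℝ} (hc : BddMeas c)
    (hF : IsForm q F) : IsForm q fun x z => c x * F x z := by
  simpa using (const hc).mul hF

lemma const_mul {q : ℕ} {F : Torus d → Euc d → ℝ} (k : ℝ) (hF : IsForm q F) :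
    IsForm q fun x z => k * F x z := coeff_mul (bddMeas_const k) hF

lemma sum {ι : Type*} {q : ℕ} {F : ι → Torus d → Euc d → ℝ} {s : Finset ι}
    (h : ∀ i ∈ s, IsForm q (F i)) : IsForm q fun x z => ∑ i ∈ s, F i x z := by
  classical
  induction s using Finset.induction_on with
  | empty => simpa using IsForm.zero q
  | insert a s ha ih =>
    simp only [Finset.sum_insert ha]
    exact (h a (Finset.mem_insert_self a s)).add
      (ih fun i hi => h i (Finset.mem_insert_of_mem hi))

lemma polyBdd {q : ℕ} {F : Torus d → Euc d → ℝ} (hF : IsForm q F) :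
    PolyBdd fun y : Torus d × Euc d => F y.1 y.2 := by
  induction hF with
  | zero => exact polyBdd_zero
  | mon hc ι =>
    refine hc.polyBdd.mul ⟨(measurable_mon ι).comp measurable_snd, 1, q, zero_le_one,
      fun x z => (abs_mon_le ι z).trans ?_⟩
    rw [one_mul]
    exact pow_le_pow_left₀ (norm_nonneg _) (le_add_of_nonneg_left zero_le_one) _
  | add _ _ h1 h2 => exact h1.add h2

lemma exists_bound {q : ℕ} {F : Torus d → Euc d → ℝ} (hF : IsForm q F) :
    ∃ K, 0 ≤ K ∧ ∀ x z, |F x z| ≤ K * ‖z‖ ^ q := by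
  induction hF with
  | zero => exact ⟨0, le_rfl, fun x z => by simp⟩
  | mon hc ι =>
    obtain ⟨-, K, hK0, hK⟩ := hc
    refine ⟨K, hK0, fun x z => ?_⟩
    rw [abs_mul]
    exact mul_le_mul (hK x) (abs_mon_le ι z) (abs_nonneg _) hK0
  | add _ _ h1 h2 => exact exists_add_bound h1 h2

end IsForm

lemma TorusContDiff.bddMeas {p : ℕ} {f : Torus d → ℝ} (hf : TorusContDiff p f) : BddMeas f :=
  bddMeas_of_continuous hf.continuous

lemma isForm_taylorTerm (j : ℕ) {f : Torus d → ℝ} (hf : TorusContDiff j f) :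
    IsForm j (taylorTerm j f) := by
  induction j generalizing f with
  | zero => exact IsForm.const hf.bddMeas
  | succ j ih =>
    simp only [taylorTerm]
    exact IsForm.sum fun i _ => by
      simpa only [mul_comm, add_comm] using (ih (hf.pd i)).mul (IsForm.coord i)

/-- Quadratic forms in the displacement. -/
def quad (H : Fin d → Fin d → Torus d → ℝ) (x : Torus d) (z : Euc d) : ℝ :=
  ∑ i, ∑ j, H i j x * (z i * z j)

lemma isForm_quad {H : Fin d → Fin d → Torus d → ℝ} (hH : ∀ i j, BddMeas (H i j)) :
    IsForm 2 (quad H) :=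
  IsForm.sum fun i _ => IsForm.sum fun j _ =>
    IsForm.coeff_mul (hH i j) ((IsForm.coord i).mul (IsForm.coord j))

namespace MomentExpansion

variable {Ω : Type*} [MeasurableSpace Ω] {D : Dynamics d dW} {P : Measure Ω}
  [IsProbabilityMeasure P] {dt : ℕ → ℝ} {X : ℕ → Ω → Torus d} {Z : ℕ → Ω → Euc d}
  {R : ℕ → Ω → ℝ} (h : MomentExpansion D P dt X Z R)

include h

lemma measurable_comp {F : Torus d × Euc d → ℝ} (hF : Measurable F) (k : ℕ) :
    Measurable fun ω => F (X k ω, Z k ω) :=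
  hF.comp ((h.measurable_X k).prodMk (h.measurable_Z k))

lemma integrable {F : Torus d × Euc d → ℝ} (hF : PolyBdd F) (k : ℕ) :
    Integrable (fun ω => F (X k ω, Z k ω)) P := by
  obtain ⟨hm, C, q, hC0, hC⟩ := hF
  obtain ⟨_, -, hK⟩ := h.moment q
  have h1 : ∀ ω, ‖F (X k ω, Z k ω)‖ ≤ C * (2 ^ (2 * q - 1) * (1 + ‖Z k ω‖ ^ (2 * q))) := fun ω => by
    refine (hC _ _).trans (mul_le_mul_of_nonneg_left ?_ hC0)
    have h2 : (1 + ‖Z k ω‖) ^ q ≤ (1 + ‖Z k ω‖) ^ (2 * q) :=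
      pow_le_pow_right₀ (by linarith [norm_nonneg (Z k ω)]) (by omega)
    exact h2.trans (by simpa using add_pow_le zero_le_one (norm_nonneg (Z k ω)) (2 * q))
  exact ((((integrable_const 1).fun_add (hK k).1).const_mul _).const_mul C).mono'
    (h.measurable_comp hm k).aestronglyMeasurable (ae_of_all _ h1)

lemma integrable_reward_mul {V : Ω → ℝ} (hV : Integrable V P) (k : ℕ) :
    Integrable (fun ω => R k ω * V ω) P := by
  obtain ⟨K, hK0, hK⟩ := h.reward_bdd
  have := hV.mul_bdd (h.measurable_R k).aestronglyMeasurable (hK k)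
  simpa only [mul_comm] using this

lemma odd_form {j : ℕ} {F : Torus d → Euc d → ℝ} (hF : IsForm (2 * j + 1) F) :
    (fun k => ∫ ω, F (X k ω) (Z k ω) ∂P) =O[⊤] fun k => dt k ^ (j + 1) := by
  generalize hq : 2 * j + 1 = q at hF
  induction hF with
  | zero =>
    refine (isBigO_zero (fun k => dt k ^ (j + 1)) ⊤).congr_left fun k => ?_
    simp
  | mon hc ι => subst hq; exact h.odd j _ hc ι
  | add hF hG h1 h2 =>
    refine (h1.add h2).congr_left fun k => ?_
    exact (integral_add (h.integrable hF.polyBdd k) (h.integrable hG.polyBdd k)).symm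

lemma two_quad {H : Fin d → Fin d → Torus d → ℝ} (hH : ∀ i j, BddMeas (H i j))
    (ha : ∀ i j, BddMeas fun x => D.a x i j) :
    (fun k => ∫ ω, quad H (X k ω) (Z k ω) ∂P -
      dt k * ∫ ω, (∑ i, ∑ j, H i j (X k ω) * D.a (X k ω) i j) ∂P) =O[⊤] fun k => dt k ^ 2 := by
  have h1 := IsBigO.fun_sum (s := Finset.univ) fun i (_ : i ∈ Finset.univ) =>
    IsBigO.fun_sum (s := Finset.univ) fun j (_ : j ∈ Finset.univ) => h.two (H i j) (hH i j) i j
  refine h1.congr_left fun k => ?_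
  have hB : ∀ i j, PolyBdd fun y : Torus d × Euc d => H i j y.1 * (y.2 i * y.2 j) := fun i j =>
    (hH i j).polyBdd.mul ((polyBdd_coord i).mul (polyBdd_coord j))
  have hA : ∀ i j, PolyBdd fun y : Torus d × Euc d => H i j y.1 * D.a y.1 i j := fun i j =>
    ((hH i j).mul (ha i j)).polyBdd
  simp only [quad]
  rw [integral_finsetSum _ fun i _ => h.integrable (PolyBdd.sum fun j _ => hB i j) k,
    integral_finsetSum _ fun i _ => h.integrable (PolyBdd.sum fun j _ => hA i j) k]
  simp only [integral_finsetSum _ fun j _ => h.integrable (hB _ j) k,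
    integral_finsetSum _ fun j _ => h.integrable (hA _ j) k, Finset.sum_sub_distrib,
    Finset.mul_sum]

lemma four_quad {H : Fin d → Fin d → Torus d → ℝ} (hH : ∀ i j, BddMeas (H i j))
    (ha : ∀ i j, BddMeas fun x => D.a x i j) :
    (fun k => ∫ ω, quad H (X k ω) (Z k ω) ^ 2 ∂P - dt k ^ 2 *
      ∫ ω, (∑ i, ∑ j, ∑ l, ∑ m, H i j (X k ω) * H l m (X k ω) *
        (D.a (X k ω) i j * D.a (X k ω) l m + D.a (X k ω) i l * D.a (X k ω) j m +
          D.a (X k ω) i m * D.a (X k ω) j l)) ∂P) =O[⊤] fun k => dt k ^ 3 := by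
  have h1 := IsBigO.fun_sum (s := Finset.univ) fun i (_ : i ∈ Finset.univ) =>
    IsBigO.fun_sum (s := Finset.univ) fun j (_ : j ∈ Finset.univ) =>
    IsBigO.fun_sum (s := Finset.univ) fun l (_ : l ∈ Finset.univ) =>
    IsBigO.fun_sum (s := Finset.univ) fun m (_ : m ∈ Finset.univ) =>
      h.four (fun x => H i j x * H l m x) ((hH i j).mul (hH l m)) i j l m
  refine h1.congr_left fun k => ?_
  have hB : ∀ i j l m, PolyBdd fun y : Torus d × Euc d =>
      H i j y.1 * H l m y.1 * (y.2 i * y.2 j * (y.2 l * y.2 m)) := fun i j l m =>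
    ((hH i j).mul (hH l m)).polyBdd.mul (((polyBdd_coord i).mul (polyBdd_coord j)).mul
      ((polyBdd_coord l).mul (polyBdd_coord m)))
  have hA : ∀ i j l m, PolyBdd fun y : Torus d × Euc d => H i j y.1 * H l m y.1 *
      (D.a y.1 i j * D.a y.1 l m + D.a y.1 i l * D.a y.1 j m + D.a y.1 i m * D.a y.1 j l) :=
    fun i j l m => (((hH i j).mul (hH l m)).mul ((((ha i j).mul (ha l m)).add
      ((ha i l).mul (ha j m))).add ((ha i m).mul (ha j l)))).polyBdd
  have hsq : ∀ x z, quad H x z ^ 2 = ∑ i, ∑ j, ∑ l, ∑ m,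
      H i j x * H l m x * (z i * z j * (z l * z m)) := fun x z => by
    simp only [quad, sq, Finset.sum_mul, Finset.mul_sum]
    refine Finset.sum_congr rfl fun i _ => Finset.sum_congr rfl fun j _ =>
      Finset.sum_congr rfl fun l _ => Finset.sum_congr rfl fun m _ => ?_
    ring
  simp only [hsq]
  rw [integral_finsetSum _ fun i _ => h.integrable (PolyBdd.sum fun j _ => PolyBdd.sum fun l _ =>
      PolyBdd.sum fun m _ => hB i j l m) k,
    integral_finsetSum _ fun i _ => h.integrable (PolyBdd.sum fun j _ => PolyBdd.sum fun l _ =>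
      PolyBdd.sum fun m _ => hA i j l m) k]
  simp only [integral_finsetSum _ fun j _ => h.integrable (PolyBdd.sum fun l _ =>
      PolyBdd.sum fun m _ => hB _ j l m) k,
    integral_finsetSum _ fun j _ => h.integrable (PolyBdd.sum fun l _ =>
      PolyBdd.sum fun m _ => hA _ j l m) k]
  simp only [integral_finsetSum _ fun l _ => h.integrable (PolyBdd.sum fun m _ => hB _ _ l m) k,
    integral_finsetSum _ fun l _ => h.integrable (PolyBdd.sum fun m _ => hA _ _ l m) k]
  simp only [integral_finsetSum _ fun m _ => h.integrable (hB _ _ _ m) k,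
    integral_finsetSum _ fun m _ => h.integrable (hA _ _ _ m) k, Finset.sum_sub_distrib,
    Finset.mul_sum]

/-- Moments of the rescaled displacement. -/
lemma exists_scaled_moment_bound (hdt : ∀ k, 0 < dt k) (q : ℕ) :
    ∃ K, 0 ≤ K ∧ ∀ k, Integrable (fun ω => (1 + ‖Z k ω‖ ^ 2 / dt k) ^ q) P ∧
      ∫ ω, (1 + ‖Z k ω‖ ^ 2 / dt k) ^ q ∂P ≤ K := by
  obtain ⟨K, hK0, hK⟩ := h.moment q
  refine ⟨2 ^ (q - 1) * (1 + K), by positivity, fun k => ?_⟩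
  have hd := hdt k
  obtain ⟨h1, h2⟩ := hK k
  have hpt : ∀ ω, (1 + ‖Z k ω‖ ^ 2 / dt k) ^ q ≤
      2 ^ (q - 1) * (1 + 1 / dt k ^ q * ‖Z k ω‖ ^ (2 * q)) := fun ω => by
    have := add_pow_le zero_le_one (div_nonneg (sq_nonneg ‖Z k ω‖) hd.le) q
    rw [one_pow, div_pow, ← pow_mul] at this
    refine this.trans (le_of_eq ?_)
    ring
  have hi : Integrable (fun ω => 2 ^ (q - 1) * (1 + 1 / dt k ^ q * ‖Z k ω‖ ^ (2 * q))) P :=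
    ((integrable_const 1).fun_add (h1.const_mul _)).const_mul _
  have hi' : Integrable (fun ω => (1 + ‖Z k ω‖ ^ 2 / dt k) ^ q) P := by
    refine hi.mono' ?_ (ae_of_all _ fun ω => ?_)
    · have := h.measurable_Z k
      exact Measurable.aestronglyMeasurable (by fun_prop)
    · rw [Real.norm_of_nonneg (by positivity)]
      exact hpt ω
  refine ⟨hi', (integral_mono hi' hi hpt).trans ?_⟩
  rw [integral_const_mul, integral_add (integrable_const 1) (h1.const_mul _), integral_const_mul]
  simp only [integral_const, probReal_univ, smul_eq_mul, mul_one]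
  gcongr
  rw [one_div_mul_eq_div, div_le_iff₀ (by positivity)]
  exact h2

/-- Functions dominated by the rescaled displacement are of the order of their prefactor. -/
lemma isBigO_of_scaled_bound (hdt : ∀ k, 0 < dt k) {V : ℕ → Ω → ℝ} {K : ℝ} (hK : 0 ≤ K)
    (j q : ℕ) (hV : ∀ k, ∀ᵐ ω ∂P, |V k ω| ≤ K * dt k ^ j * (1 + ‖Z k ω‖ ^ 2 / dt k) ^ q) :
    (fun k => ∫ ω, V k ω ∂P) =O[⊤] fun k => dt k ^ j := by
  obtain ⟨C, hC0, hC⟩ := h.exists_scaled_moment_bound hdt q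
  refine isBigO_top.2 ⟨K * C, fun k => ?_⟩
  have hd := hdt k
  obtain ⟨h1, h2⟩ := hC k
  refine (norm_integral_le_of_norm_le (h1.const_mul _) (hV k)).trans ?_
  rw [integral_const_mul, Real.norm_of_nonneg (by positivity)]
  calc _ ≤ K * dt k ^ j * C := by gcongr
    _ = _ := by ring

end MomentExpansion

end

section

open Asymptotics

variable {d dW : ℕ}

/-! ## Small-time expansions along the observations -/

/-- The leading part of the rescaled increments of a function along the observations. -/
def leadingTerm (Q : Torus d → ℝ) (H : Fin d → Fin d → Torus d → ℝ) (t : ℝ) (x : Torus d)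
    (z : Euc d) : ℝ :=
  Q x - 1 / 2 * (1 / t) * quad H x z

/-- The part of odd degree of the rescaled increments. -/
def oddTerm (F₁ F₃ : Torus d → Euc d → ℝ) (t : ℝ) (x : Torus d) (z : Euc d) : ℝ :=
  F₁ x z + 1 / t * F₃ x z

/-- Contraction of a matrix-valued function with the diffusion matrix. -/
def contract (D : Dynamics d dW) (H : Fin d → Fin d → Torus d → ℝ) (x : Torus d) : ℝ :=
  ∑ i, ∑ j, H i j x * D.a x i j

/-- The limit of the second moment of `quad H`, on the scale of the time step. -/
def quartic (D : Dynamics d dW) (H : Fin d → Fin d → Torus d → ℝ) (x : Torus d) : ℝ :=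
  ∑ i, ∑ j, ∑ l, ∑ m, H i j x * H l m x *
    (D.a x i j * D.a x l m + D.a x i l * D.a x j m + D.a x i m * D.a x j l)

/-- A family of functions with a small-time expansion, uniformly on the observation space. -/
structure HasExpansion (ψ : ℝ → Torus d → Euc d → ℝ) (Q : Torus d → ℝ)
    (H : Fin d → Fin d → Torus d → ℝ) (F₁ F₃ : Torus d → Euc d → ℝ) : Prop where
  measurable : ∀ t, Measurable fun y : Torus d × Euc d => ψ t y.1 y.2
  bdd_Q : BddMeas Q
  bdd_H : ∀ i j, BddMeas (H i j)
  form₁ : IsForm 1 F₁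
  form₃ : IsForm 3 F₃
  bound : ∃ K, 0 ≤ K ∧ ∀ t x z, 0 < t →
    |ψ t x z - leadingTerm Q H t x z - oddTerm F₁ F₃ t x z| ≤ K * t * (1 + ‖z‖ ^ 2 / t) ^ 2

lemma isBigO_one_div_mul {dt : ℕ → ℝ} (hdt : ∀ k, 0 < dt k) (m j : ℕ) {f : ℕ → ℝ}
    (hf : f =O[⊤] fun k => dt k ^ (m + j)) :
    (fun k => (1 / dt k ^ m) * f k) =O[⊤] fun k => dt k ^ j := by
  refine ((isBigO_refl (fun k => 1 / dt k ^ m) ⊤).mul hf).congr_right fun k => ?_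
  have := (hdt k).ne'
  rw [pow_add]
  field_simp

namespace HasExpansion

variable {ψ : ℝ → Torus d → Euc d → ℝ} {Q : Torus d → ℝ} {H : Fin d → Fin d → Torus d → ℝ}
  {F₁ F₃ : Torus d → Euc d → ℝ} (e : HasExpansion ψ Q H F₁ F₃)

include e

lemma exists_leadingTerm_bound : ∃ K, 0 ≤ K ∧ ∀ t x z, 0 < t →
    |leadingTerm Q H t x z| ≤ K * (1 + ‖z‖ ^ 2 / t) := by
  obtain ⟨-, K, hK0, hK⟩ := e.bdd_Q
  obtain ⟨L, hL0, hL⟩ := (isForm_quad e.bdd_H).exists_bound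
  refine ⟨K + L, by positivity, fun t x z ht => ?_⟩
  rw [leadingTerm]
  calc _ ≤ K + 1 / 2 * (1 / t) * (L * ‖z‖ ^ 2) := by
        refine (abs_sub _ _).trans (add_le_add (hK x) ?_)
        rw [abs_mul, abs_of_nonneg (by positivity : 0 ≤ 1 / 2 * (1 / t))]
        gcongr
        exact hL x z
    _ = K + 1 / 2 * (L * (‖z‖ ^ 2 / t)) := by ring
    _ ≤ _ := by
        have h1 : 0 ≤ ‖z‖ ^ 2 / t := by positivity
        nlinarith [mul_nonneg hL0 h1, mul_nonneg hK0 h1]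

/-- On the scale ‖z‖² ~ t both summands are of size √t. Everything is measured by the rescaled
variable ‖z‖²/t, whose moments are bounded uniformly along the observations. -/
lemma exists_oddTerm_sq_bound : ∃ K, 0 ≤ K ∧ ∀ t x z, 0 < t →
    oddTerm F₁ F₃ t x z ^ 2 ≤ K * t * (1 + ‖z‖ ^ 2 / t) ^ 3 := by
  obtain ⟨K, hK0, hK⟩ := e.form₁.exists_bound
  obtain ⟨L, hL0, hL⟩ := e.form₃.exists_bound
  refine ⟨(K + L) ^ 2, by positivity, fun t x z ht => ?_⟩
  have h1 : |oddTerm F₁ F₃ t x z| ≤ (K + L) * ‖z‖ * (1 + ‖z‖ ^ 2 / t) := by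
    rw [oddTerm]
    calc _ ≤ K * ‖z‖ ^ 1 + 1 / t * (L * ‖z‖ ^ 3) := by
          refine (abs_add_le _ _).trans (add_le_add (hK x z) ?_)
          rw [abs_mul, abs_of_nonneg (by positivity : 0 ≤ 1 / t)]
          gcongr
          exact hL x z
      _ = K * ‖z‖ + L * ‖z‖ * (‖z‖ ^ 2 / t) := by ring
      _ ≤ K * ‖z‖ + L * ‖z‖ * (‖z‖ ^ 2 / t) + (K * ‖z‖ * (‖z‖ ^ 2 / t) + L * ‖z‖) :=
          le_add_of_nonneg_right (by positivity)
      _ = _ := by ring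
  rw [← sq_abs]
  calc _ ≤ ((K + L) * ‖z‖ * (1 + ‖z‖ ^ 2 / t)) ^ 2 := by gcongr
    _ = (K + L) ^ 2 * (t * (‖z‖ ^ 2 / t)) * (1 + ‖z‖ ^ 2 / t) ^ 2 := by
        field_simp
    _ ≤ (K + L) ^ 2 * (t * (1 + ‖z‖ ^ 2 / t)) * (1 + ‖z‖ ^ 2 / t) ^ 2 := by gcongr; linarith
    _ = _ := by ring

lemma exists_bound {T : ℝ} (hT : 0 ≤ T) : ∃ K, 0 ≤ K ∧ ∀ t x z, 0 < t → t ≤ T →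
    |ψ t x z| ≤ K * (1 + ‖z‖ ^ 2 / t) ^ 3 := by
  obtain ⟨K0, hK00, hK0⟩ := e.exists_leadingTerm_bound
  obtain ⟨K1, hK10, hK1⟩ := e.exists_oddTerm_sq_bound
  obtain ⟨K2, hK20, hK2⟩ := e.bound
  refine ⟨K0 + (1 + K1 * T) + K2 * T, by positivity, fun t x z ht htT => ?_⟩
  set s := 1 + ‖z‖ ^ 2 / t with hs
  have hs1 : 1 ≤ s := by rw [hs]; linarith [div_nonneg (sq_nonneg ‖z‖) ht.le]
  have h1 : s ≤ s ^ 3 := by simpa using pow_le_pow_right₀ hs1 (by norm_num : 1 ≤ 3)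
  have h2 : s ^ 2 ≤ s ^ 3 := pow_le_pow_right₀ hs1 (by norm_num)
  have h3 : 1 ≤ s ^ 3 := one_le_pow₀ hs1
  have h4 : |oddTerm F₁ F₃ t x z| ≤ (1 + K1 * T) * s ^ 3 := by
    have h5 := hK1 t x z ht
    have h6 : K1 * t * s ^ 3 ≤ K1 * T * s ^ 3 := by gcongr
    have h7 : |oddTerm F₁ F₃ t x z| ≤ 1 + oddTerm F₁ F₃ t x z ^ 2 := by
      rw [← sq_abs]
      nlinarith [sq_nonneg (|oddTerm F₁ F₃ t x z| - 1), abs_nonneg (oddTerm F₁ F₃ t x z)]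
    rw [← hs] at h5
    linarith
  have h8 : ψ t x z = leadingTerm Q H t x z + oddTerm F₁ F₃ t x z +
      (ψ t x z - leadingTerm Q H t x z - oddTerm F₁ F₃ t x z) := by ring
  rw [h8]
  calc _ ≤ K0 * s + (1 + K1 * T) * s ^ 3 + K2 * t * s ^ 2 :=
        (abs_add_three _ _ _).trans (add_le_add (add_le_add (hK0 t x z ht) h4) (hK2 t x z ht))
    _ ≤ K0 * s ^ 3 + (1 + K1 * T) * s ^ 3 + K2 * T * s ^ 3 := by gcongr
    _ = _ := by ring

lemma polyBdd {t : ℝ} (ht : 0 < t) : PolyBdd fun y : Torus d × Euc d => ψ t y.1 y.2 := by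
  obtain ⟨K, hK0, hK⟩ := e.exists_bound ht.le
  refine ⟨e.measurable t, K * (1 + 1 / t) ^ 3, 6, by positivity, fun x z => ?_⟩
  refine (hK t x z ht le_rfl).trans ?_
  rw [mul_assoc]
  refine mul_le_mul_of_nonneg_left ?_ hK0
  rw [show (6 : ℕ) = 2 * 3 from rfl, pow_mul, ← mul_pow]
  refine pow_le_pow_left₀ (by positivity) ?_ 3
  have h1 : 0 ≤ 1 / t := by positivity
  have h2 : ‖z‖ ^ 2 / t = 1 / t * ‖z‖ ^ 2 := by ring
  rw [h2]
  nlinarith [norm_nonneg z, mul_nonneg h1 (norm_nonneg z)]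

lemma polyBdd_leadingTerm (t : ℝ) :
    PolyBdd fun y : Torus d × Euc d => leadingTerm Q H t y.1 y.2 :=
  e.bdd_Q.polyBdd.sub ((isForm_quad e.bdd_H).polyBdd.const_mul _)

lemma polyBdd_oddTerm (t : ℝ) : PolyBdd fun y : Torus d × Euc d => oddTerm F₁ F₃ t y.1 y.2 :=
  e.form₁.polyBdd.add (e.form₃.polyBdd.const_mul _)

variable {Ω : Type*} [MeasurableSpace Ω] {D : Dynamics d dW} {P : Measure Ω}
  [IsProbabilityMeasure P] {dt : ℕ → ℝ} {X : ℕ → Ω → Torus d} {Z : ℕ → Ω → Euc d}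
  {R : ℕ → Ω → ℝ} (h : MomentExpansion D P dt X Z R) (hdt : ∀ k, 0 < dt k)

include h hdt

/-- The size √t improves to order `dt` in mean, because odd moments are half an order smaller than
their size. -/
lemma integral_mul_oddTerm_isBigO {c : Torus d → ℝ} (hc : BddMeas c) :
    (fun k => ∫ ω, c (X k ω) * oddTerm F₁ F₃ (dt k) (X k ω) (Z k ω) ∂P) =O[⊤] dt := by
  have h1 := h.odd_form (j := 0) (IsForm.coeff_mul hc e.form₁)
  have h2 := isBigO_one_div_mul hdt 1 1 (h.odd_form (j := 1) (IsForm.coeff_mul hc e.form₃))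
  have h3 := (h1.congr_right (g₂ := dt) fun k => by ring).add
    (h2.congr_right (g₂ := dt) fun k => by ring)
  refine h3.congr_left fun k => ?_
  rw [← integral_const_mul, ← integral_add (h.integrable (IsForm.coeff_mul hc e.form₁).polyBdd k)
    ((h.integrable (IsForm.coeff_mul hc e.form₃).polyBdd k).const_mul _)]
  refine integral_congr_ae (ae_of_all _ fun ω => ?_)
  simp only [oddTerm]
  ring

/-- Even times odd is odd: only moments of degree 1, 3 and 5 occur, weighted by 1, 1/t and 1/t², and
each of these is of order `dt`. -/
lemma integral_leadingTerm_mul_oddTerm_isBigO :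
    (fun k => ∫ ω, leadingTerm Q H (dt k) (X k ω) (Z k ω) *
      oddTerm F₁ F₃ (dt k) (X k ω) (Z k ω) ∂P) =O[⊤] dt := by
  have hq := isForm_quad e.bdd_H
  have h1 := e.integral_mul_oddTerm_isBigO h hdt e.bdd_Q
  have h2 := isBigO_one_div_mul hdt 1 1 (h.odd_form (j := 1) (hq.mul e.form₁))
  have h3 := isBigO_one_div_mul hdt 2 1 (h.odd_form (j := 2) (hq.mul e.form₃))
  have h4 := (h1.sub ((h2.congr_right (g₂ := dt) fun k => by ring).const_mul_left (1 / 2))).sub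
    ((h3.congr_right (g₂ := dt) fun k => by ring).const_mul_left (1 / 2))
  refine h4.congr_left fun k => ?_
  have hi1 : Integrable (fun ω => Q (X k ω) * oddTerm F₁ F₃ (dt k) (X k ω) (Z k ω)) P :=
    h.integrable (e.bdd_Q.polyBdd.mul (e.polyBdd_oddTerm (dt k))) k
  have hi2 := h.integrable (hq.mul e.form₁).polyBdd k
  have hi3 := h.integrable (hq.mul e.form₃).polyBdd k
  rw [← integral_const_mul, ← integral_const_mul, ← integral_const_mul, ← integral_const_mul,
    ← integral_sub hi1 ((hi2.const_mul _).const_mul _),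
    ← integral_sub (integrable_fun_sub hi1 ((hi2.const_mul _).const_mul _))
      ((hi3.const_mul _).const_mul _)]
  refine integral_congr_ae (ae_of_all _ fun ω => ?_)
  simp only [leadingTerm, oddTerm]
  ring

lemma integral_mul_leadingTerm_isBigO (ha : ∀ i j, BddMeas fun x => D.a x i j)
    {c : Torus d → ℝ} (hc : BddMeas c) :
    (fun k => ∫ ω, c (X k ω) * leadingTerm Q H (dt k) (X k ω) (Z k ω) ∂P -
      ∫ ω, c (X k ω) * (Q (X k ω) - 1 / 2 * contract D H (X k ω)) ∂P) =O[⊤] dt := by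
  have hcH : ∀ i j, BddMeas fun x => c x * H i j x := fun i j => hc.mul (e.bdd_H i j)
  have h1 := (isBigO_one_div_mul hdt 1 1 (h.two_quad (H := fun i j x => c x * H i j x)
    hcH ha)).const_mul_left (-1 / 2)
  refine (h1.congr_right (g₂ := dt) fun k => by ring).congr_left fun k => ?_
  have hctr : ∀ x, ∑ i, ∑ j, c x * H i j x * D.a x i j = c x * contract D H x := fun x => by
    simp only [contract, Finset.mul_sum, mul_assoc]
  have hquad : ∀ x z, quad (fun i j x => c x * H i j x) x z = c x * quad H x z := fun x z => by
    simp only [quad, Finset.mul_sum, mul_assoc]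
  have hcb : BddMeas fun x => c x * contract D H x :=
    hc.mul (BddMeas.sum fun i _ => BddMeas.sum fun j _ => (e.bdd_H i j).mul (ha i j))
  have hi0 : Integrable (fun ω => c (X k ω) * Q (X k ω)) P :=
    h.integrable (hc.mul e.bdd_Q).polyBdd k
  have hi1 : Integrable (fun ω => c (X k ω) * quad H (X k ω) (Z k ω)) P :=
    h.integrable (hc.polyBdd.mul (isForm_quad e.bdd_H).polyBdd) k
  have hi2 : Integrable (fun ω => c (X k ω) * contract D H (X k ω)) P :=
    h.integrable hcb.polyBdd k
  have h3 : ∫ ω, c (X k ω) * leadingTerm Q H (dt k) (X k ω) (Z k ω) ∂P =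
      (∫ ω, c (X k ω) * Q (X k ω) ∂P) -
        1 / 2 * (1 / dt k) * ∫ ω, c (X k ω) * quad H (X k ω) (Z k ω) ∂P := by
    rw [← integral_const_mul, ← integral_sub hi0 (hi1.const_mul _)]
    refine integral_congr_ae (ae_of_all _ fun ω => ?_)
    simp only [leadingTerm]
    ring
  have h4 : ∫ ω, c (X k ω) * (Q (X k ω) - 1 / 2 * contract D H (X k ω)) ∂P =
      (∫ ω, c (X k ω) * Q (X k ω) ∂P) - 1 / 2 * ∫ ω, c (X k ω) * contract D H (X k ω) ∂P := by
    rw [← integral_const_mul, ← integral_sub hi0 (hi2.const_mul _)]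
    refine integral_congr_ae (ae_of_all _ fun ω => ?_)
    ring
  have hd := (hdt k).ne'
  rw [h3, h4]
  simp only [hctr, hquad]
  field_simp
  ring

lemma integral_leadingTerm_sq_isBigO (ha : ∀ i j, BddMeas fun x => D.a x i j) :
    (fun k => ∫ ω, leadingTerm Q H (dt k) (X k ω) (Z k ω) ^ 2 ∂P -
      ∫ ω, (Q (X k ω) ^ 2 - Q (X k ω) * contract D H (X k ω) +
        1 / 4 * quartic D H (X k ω)) ∂P) =O[⊤] dt := by
  -- The square of the leading term is 2Q times the leading term, minus Q², plus `quad ^ 2` over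
  -- 4t². Only the last piece requires fourth moments.
  have h1 := (e.integral_mul_leadingTerm_isBigO h hdt ha e.bdd_Q).const_mul_left 2
  have h2 := (isBigO_one_div_mul hdt 2 1 (h.four_quad e.bdd_H ha)).const_mul_left (1 / 4)
  refine (h1.add (h2.congr_right (g₂ := dt) fun k => by ring)).congr_left fun k => ?_
  have hcon : BddMeas (contract D H) :=
    BddMeas.sum fun i _ => BddMeas.sum fun j _ => (e.bdd_H i j).mul (ha i j)
  have hqua : BddMeas (quartic D H) :=
    BddMeas.sum fun i _ => BddMeas.sum fun j _ => BddMeas.sum fun l _ => BddMeas.sum fun m _ =>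
      ((e.bdd_H i j).mul (e.bdd_H l m)).mul ((((ha i j).mul (ha l m)).add
      ((ha i l).mul (ha j m))).add ((ha i m).mul (ha j l)))
  have hi0 : Integrable (fun ω => Q (X k ω) ^ 2) P := by
    simpa only [sq] using h.integrable (e.bdd_Q.mul e.bdd_Q).polyBdd k
  have hi1 : Integrable (fun ω => Q (X k ω) * leadingTerm Q H (dt k) (X k ω) (Z k ω)) P :=
    h.integrable (e.bdd_Q.polyBdd.mul (e.polyBdd_leadingTerm _)) k
  have hi2 : Integrable (fun ω => quad H (X k ω) (Z k ω) ^ 2) P := by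
    simpa only [sq] using h.integrable ((isForm_quad e.bdd_H).mul (isForm_quad e.bdd_H)).polyBdd k
  have hi3 : Integrable (fun ω => Q (X k ω) * (Q (X k ω) - 1 / 2 * contract D H (X k ω))) P :=
    h.integrable (e.bdd_Q.polyBdd.mul (e.bdd_Q.polyBdd.sub (hcon.polyBdd.const_mul _))) k
  have hi4 : Integrable (fun ω => quartic D H (X k ω)) P := h.integrable hqua.polyBdd k
  have h3 : ∫ ω, leadingTerm Q H (dt k) (X k ω) (Z k ω) ^ 2 ∂P =
      2 * (∫ ω, Q (X k ω) * leadingTerm Q H (dt k) (X k ω) (Z k ω) ∂P) -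
        (∫ ω, Q (X k ω) ^ 2 ∂P) + 1 / 4 * (1 / dt k ^ 2) *
        ∫ ω, quad H (X k ω) (Z k ω) ^ 2 ∂P := by
    rw [← integral_const_mul, ← integral_const_mul, ← integral_sub (hi1.const_mul _) hi0,
      ← integral_add (integrable_fun_sub (hi1.const_mul _) hi0) (hi2.const_mul _)]
    refine integral_congr_ae (ae_of_all _ fun ω => ?_)
    simp only [leadingTerm]
    ring
  have h4 : ∫ ω, (Q (X k ω) ^ 2 - Q (X k ω) * contract D H (X k ω) +
        1 / 4 * quartic D H (X k ω)) ∂P =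
      2 * (∫ ω, Q (X k ω) * (Q (X k ω) - 1 / 2 * contract D H (X k ω)) ∂P) -
        (∫ ω, Q (X k ω) ^ 2 ∂P) + 1 / 4 * ∫ ω, quartic D H (X k ω) ∂P := by
    rw [← integral_const_mul, ← integral_const_mul, ← integral_sub (hi3.const_mul _) hi0,
      ← integral_add (integrable_fun_sub (hi3.const_mul _) hi0) (hi4.const_mul _)]
    refine integral_congr_ae (ae_of_all _ fun ω => ?_)
    ring
  have h5 : ∀ x, ∑ i, ∑ j, ∑ l, ∑ m, H i j x * H l m x *
    (D.a x i j * D.a x l m + D.a x i l * D.a x j m + D.a x i m * D.a x j l) = quartic D H x :=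
    fun x => rfl
  have hd := (hdt k).ne'
  rw [h3, h4]
  simp only [h5]
  field_simp
  ring

/-- Second moments. -/
theorem integral_sq_isBigO (ha : ∀ i j, BddMeas fun x => D.a x i j) {T : ℝ}
    (hT : ∀ k, dt k ≤ T) :
    (fun k => ∫ ω, ψ (dt k) (X k ω) (Z k ω) ^ 2 ∂P -
      ∫ ω, (Q (X k ω) ^ 2 - Q (X k ω) * contract D H (X k ω) +
        1 / 4 * quartic D H (X k ω)) ∂P) =O[⊤] dt := by
  have hT0 : 0 ≤ T := (hdt 0).le.trans (hT 0)
  obtain ⟨K0, hK00, hK0⟩ := e.exists_leadingTerm_bound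
  obtain ⟨K1, hK10, hK1⟩ := e.exists_oddTerm_sq_bound
  obtain ⟨K2, hK20, hK2⟩ := e.bound
  -- With ψ = p + o + r, the leading, odd and remaining parts, ψ² - p² - 2po = (o + r)² + 2pr. Its
  -- terms are small by size alone: o² and pr are O(t) and r² is O(t²), up to powers of the rescaled
  -- displacement. The product po is kept apart because its smallness comes from parity.
  have hrem : (fun k => ∫ ω, (ψ (dt k) (X k ω) (Z k ω) ^ 2 -
      leadingTerm Q H (dt k) (X k ω) (Z k ω) ^ 2 -
      2 * (leadingTerm Q H (dt k) (X k ω) (Z k ω) * oddTerm F₁ F₃ (dt k) (X k ω) (Z k ω))) ∂P)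
      =O[⊤] dt := by
    refine (h.isBigO_of_scaled_bound hdt (K := 2 * K1 + 2 * K2 ^ 2 * T + 2 * K0 * K2)
      (by positivity) 1 4 fun k => ae_of_all _ fun ω => ?_).congr_right fun k => by ring
    set x := X k ω
    set z := Z k ω
    set t := dt k
    have ht : 0 < t := hdt k
    set s := 1 + ‖z‖ ^ 2 / t with hs
    have hs1 : 1 ≤ s := by rw [hs]; linarith [div_nonneg (sq_nonneg ‖z‖) ht.le]
    have h0 := hK0 t x z ht
    have h1 := hK1 t x z ht
    have h2 := hK2 t x z ht
    rw [← hs] at h0 h1 h2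
    set p := leadingTerm Q H t x z
    set o := oddTerm F₁ F₃ t x z
    set r := ψ t x z - p - o with hr
    have heq : ψ t x z ^ 2 - p ^ 2 - 2 * (p * o) = (o + r) ^ 2 + 2 * (p * r) := by
      rw [hr]; ring
    have hr2 : r ^ 2 ≤ (K2 * t * s ^ 2) ^ 2 := by
      rw [← sq_abs]
      exact pow_le_pow_left₀ (abs_nonneg _) h2 2
    have hpr : |p * r| ≤ K0 * s * (K2 * t * s ^ 2) := by
      rw [abs_mul]
      exact mul_le_mul h0 h2 (abs_nonneg _) (by positivity)
    have h3 : s ^ 3 ≤ s ^ 4 := pow_le_pow_right₀ hs1 (by norm_num)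
    rw [heq]
    calc _ ≤ (2 * o ^ 2 + 2 * r ^ 2) + 2 * |p * r| := by
          refine (abs_add_le _ _).trans (add_le_add ?_ ?_)
          · rw [abs_of_nonneg (sq_nonneg _)]
            nlinarith [sq_nonneg (o - r)]
          · rw [abs_mul, abs_two]
      _ ≤ (2 * (K1 * t * s ^ 3) + 2 * (K2 * t * s ^ 2) ^ 2) + 2 * (K0 * s * (K2 * t * s ^ 2)) := by
          gcongr
      _ = 2 * K1 * t * s ^ 3 + 2 * K2 ^ 2 * t * t * s ^ 4 + 2 * K0 * K2 * t * s ^ 3 := by ring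
      _ ≤ 2 * K1 * t * s ^ 4 + 2 * K2 ^ 2 * T * t * s ^ 4 + 2 * K0 * K2 * t * s ^ 4 := by
          gcongr
          exact hT k
      _ = _ := by ring
  have h1 := ((e.integral_leadingTerm_sq_isBigO h hdt ha).add
    ((e.integral_leadingTerm_mul_oddTerm_isBigO h hdt).const_mul_left 2)).add hrem
  refine h1.congr_left fun k => ?_
  have hi0 : Integrable (fun ω => ψ (dt k) (X k ω) (Z k ω) ^ 2) P := by
    simpa only [sq] using h.integrable ((e.polyBdd (hdt k)).mul (e.polyBdd (hdt k))) k
  have hi1 : Integrable (fun ω => leadingTerm Q H (dt k) (X k ω) (Z k ω) ^ 2) P := by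
    simpa only [sq] using
      h.integrable ((e.polyBdd_leadingTerm (dt k)).mul (e.polyBdd_leadingTerm (dt k))) k
  have hi2 : Integrable (fun ω => leadingTerm Q H (dt k) (X k ω) (Z k ω) *
      oddTerm F₁ F₃ (dt k) (X k ω) (Z k ω)) P :=
    h.integrable ((e.polyBdd_leadingTerm (dt k)).mul (e.polyBdd_oddTerm (dt k))) k
  rw [integral_sub (integrable_fun_sub hi0 hi1) (hi2.const_mul _), integral_sub hi0 hi1,
    integral_const_mul]
  ring

end HasExpansion

end

/-! ### Correlations of the temporal differences with the reward -/

section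

open Asymptotics

variable {d dW : ℕ}

section

variable {Ω : Type*} [MeasurableSpace Ω] {D : Dynamics d dW} {P : Measure Ω}
  [IsProbabilityMeasure P] {dt : ℕ → ℝ} {X : ℕ → Ω → Torus d} {Z : ℕ → Ω → Euc d}
  {R : ℕ → Ω → ℝ} (h : MomentExpansion D P dt X Z R)

include h

namespace MomentExpansion

lemma integrable_reward_sub_mul (hr : BddMeas D.r) {F : Torus d × Euc d → ℝ} (hF : PolyBdd F)
    (k : ℕ) : Integrable (fun ω => (R k ω - D.r (X k ω)) * F (X k ω, Z k ω)) P := by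
  have h1 := h.integrable_reward_mul (h.integrable hF k) k
  have h2 : Integrable (fun ω => D.r (X k ω) * F (X k ω, Z k ω)) P :=
    h.integrable (hr.polyBdd.mul hF) k
  simpa only [sub_mul] using integrable_fun_sub h1 h2

lemma integrable_reward_sub_sq (hr : BddMeas D.r) (k : ℕ) :
    Integrable (fun ω => (R k ω - D.r (X k ω)) ^ 2) P := by
  obtain ⟨K, hK0, hK⟩ := h.reward_bdd
  have h0 : Integrable (fun ω => R k ω - D.r (X k ω)) P := by
    simpa only [mul_one] using h.integrable_reward_sub_mul hr (bddMeas_const 1).polyBdd k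
  have h1 := h.integrable_reward_mul h0 k
  obtain ⟨hm, L, hL0, hL⟩ := hr
  have h2 := h0.bdd_mul (hm.comp (h.measurable_X k)).aestronglyMeasurable
    (ae_of_all _ fun ω => hL (X k ω))
  refine (integrable_fun_sub h1 h2).congr (ae_of_all _ fun ω => ?_)
  simp only [Function.comp_apply]
  ring

/-- The order dt² is needed because the leading term divides the quadratic form by dt. It is
supplied by the two-time moments for real-world observations. -/
lemma reward_quad (hr : BddMeas D.r) {H : Fin d → Fin d → Torus d → ℝ}
    (hH : ∀ i j, BddMeas (H i j)) :
    (fun k => ∫ ω, (R k ω - D.r (X k ω)) * quad H (X k ω) (Z k ω) ∂P) =O[⊤]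
      fun k => dt k ^ 2 := by
  have h1 := IsBigO.fun_sum (s := Finset.univ) fun i (_ : i ∈ Finset.univ) =>
    IsBigO.fun_sum (s := Finset.univ) fun j (_ : j ∈ Finset.univ) =>
      h.reward_two (H i j) (hH i j) i j
  refine h1.congr_left fun k => ?_
  have hB : ∀ i j, Integrable (fun ω => H i j (X k ω) * (R k ω - D.r (X k ω)) *
      (Z k ω i * Z k ω j)) P := fun i j => by
    have h2 := h.integrable_reward_sub_mul hr
      ((hH i j).polyBdd.mul ((polyBdd_coord i).mul (polyBdd_coord j))) k
    refine h2.congr (ae_of_all _ fun ω => ?_)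
    ring
  simp only [← integral_finsetSum _ fun j _ => hB _ j]
  rw [← integral_finsetSum _ fun i _ => integrable_finsetSum _ fun j _ => hB i j]
  refine integral_congr_ae (ae_of_all _ fun ω => ?_)
  simp only [quad, Finset.mul_sum]
  refine Finset.sum_congr rfl fun i _ => Finset.sum_congr rfl fun j _ => ?_
  ring

end MomentExpansion

namespace HasExpansion

variable {ψ : ℝ → Torus d → Euc d → ℝ} {Q : Torus d → ℝ} {H : Fin d → Fin d → Torus d → ℝ}
  {F₁ F₃ : Torus d → Euc d → ℝ} (e : HasExpansion ψ Q H F₁ F₃) (hdt : ∀ k, 0 < dt k)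

include e hdt

/-- Both the reward error and the odd term have mean squares of order `dt`, so the inequality
between geometric and arithmetic means suffices and no correlation has to be computed. -/
lemma integral_reward_sub_mul_oddTerm_isBigO (hr : BddMeas D.r) :
    (fun k => ∫ ω, (R k ω - D.r (X k ω)) * oddTerm F₁ F₃ (dt k) (X k ω) (Z k ω) ∂P)
      =O[⊤] dt := by
  obtain ⟨K, hK0, hK⟩ := e.exists_oddTerm_sq_bound
  have h1 : (fun k => ∫ ω, oddTerm F₁ F₃ (dt k) (X k ω) (Z k ω) ^ 2 ∂P) =O[⊤] dt := by
    refine (h.isBigO_of_scaled_bound hdt hK0 1 3 fun k => ae_of_all _ fun ω => ?_).congr_right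
      fun k => pow_one _
    rw [abs_of_nonneg (sq_nonneg _), pow_one]
    exact hK _ _ _ (hdt k)
  refine IsBigO.trans (isBigO_of_le _ fun k => ?_) (h.reward_sq.add h1)
  have hi1 := h.integrable_reward_sub_sq hr k
  have hi2 : Integrable (fun ω => oddTerm F₁ F₃ (dt k) (X k ω) (Z k ω) ^ 2) P := by
    simpa only [sq] using
      h.integrable ((e.polyBdd_oddTerm (dt k)).mul (e.polyBdd_oddTerm (dt k))) k
  rw [← integral_add hi1 hi2]
  refine (norm_integral_le_of_norm_le (hi1.add hi2) (ae_of_all _ fun ω => ?_)).trans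
    (le_abs_self _)
  rw [Real.norm_eq_abs, abs_mul, Pi.add_apply, ← sq_abs (R k ω - _), ← sq_abs (oddTerm _ _ _ _ _)]
  nlinarith [sq_nonneg (|R k ω - D.r (X k ω)| - |oddTerm F₁ F₃ (dt k) (X k ω) (Z k ω)|),
    sq_nonneg (|R k ω - D.r (X k ω)| + |oddTerm F₁ F₃ (dt k) (X k ω) (Z k ω)|)]

lemma integral_reward_sub_mul_leadingTerm_isBigO (hr : BddMeas D.r) :
    (fun k => ∫ ω, (R k ω - D.r (X k ω)) * leadingTerm Q H (dt k) (X k ω) (Z k ω) ∂P)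
      =O[⊤] dt := by
  have h1 := h.reward Q e.bdd_Q
  have h2 := (isBigO_one_div_mul hdt 1 1 (h.reward_quad hr e.bdd_H)).const_mul_left (1 / 2)
  refine (h1.sub (h2.congr_right (g₂ := dt) fun k => by ring)).congr_left fun k => ?_
  have hi1 : Integrable (fun ω => Q (X k ω) * (R k ω - D.r (X k ω))) P := by
    simpa only [mul_comm] using h.integrable_reward_sub_mul hr e.bdd_Q.polyBdd k
  have hi2 := h.integrable_reward_sub_mul hr (isForm_quad e.bdd_H).polyBdd k
  rw [← integral_const_mul, ← integral_const_mul,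
    ← integral_sub hi1 ((hi2.const_mul _).const_mul _)]
  refine integral_congr_ae (ae_of_all _ fun ω => ?_)
  simp only [leadingTerm]
  ring

/-- First moments against the reward. -/
theorem integral_reward_mul_isBigO (ha : ∀ i j, BddMeas fun x => D.a x i j)
    (hr : BddMeas D.r) :
    (fun k => ∫ ω, R k ω * ψ (dt k) (X k ω) (Z k ω) ∂P -
      ∫ ω, D.r (X k ω) * (Q (X k ω) - 1 / 2 * contract D H (X k ω)) ∂P) =O[⊤] dt := by
  obtain ⟨K, hK0, hK⟩ := h.reward_bdd
  obtain ⟨K2, hK20, hK2⟩ := e.bound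
  have hrem : (fun k => ∫ ω, R k ω * (ψ (dt k) (X k ω) (Z k ω) -
      leadingTerm Q H (dt k) (X k ω) (Z k ω) - oddTerm F₁ F₃ (dt k) (X k ω) (Z k ω)) ∂P)
      =O[⊤] dt := by
    refine (h.isBigO_of_scaled_bound hdt (K := K * K2) (by positivity) 1 2 fun k => ?_).congr_right
      fun k => pow_one _
    filter_upwards [hK k] with ω hω
    rw [abs_mul, pow_one]
    calc _ ≤ K * (K2 * dt k * (1 + ‖Z k ω‖ ^ 2 / dt k) ^ 2) :=
          mul_le_mul hω (hK2 _ _ _ (hdt k)) (abs_nonneg _) hK0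
      _ = _ := by ring
  -- The reward is split as `r` plus its error, and ψ as leading term plus odd term plus remainder;
  -- only `r` times the leading term has a limit, and all other products are of order `dt`.
  have h1 := ((((e.integral_mul_leadingTerm_isBigO h hdt ha hr).add
    (e.integral_mul_oddTerm_isBigO h hdt hr)).add
    (integral_reward_sub_mul_leadingTerm_isBigO h e hdt hr)).add
    (integral_reward_sub_mul_oddTerm_isBigO h e hdt hr)).add hrem
  refine h1.congr_left fun k => ?_
  have hl := e.polyBdd_leadingTerm (dt k)
  have ho := e.polyBdd_oddTerm (dt k)
  have hψ := e.polyBdd (hdt k)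
  have i1 : Integrable (fun ω => D.r (X k ω) * leadingTerm Q H (dt k) (X k ω) (Z k ω)) P :=
    h.integrable (hr.polyBdd.mul hl) k
  have i2 : Integrable (fun ω => D.r (X k ω) * oddTerm F₁ F₃ (dt k) (X k ω) (Z k ω)) P :=
    h.integrable (hr.polyBdd.mul ho) k
  have i3 := h.integrable_reward_sub_mul hr hl k
  have i4 := h.integrable_reward_sub_mul hr ho k
  have i5 : Integrable (fun ω => R k ω * (ψ (dt k) (X k ω) (Z k ω) -
      leadingTerm Q H (dt k) (X k ω) (Z k ω) - oddTerm F₁ F₃ (dt k) (X k ω) (Z k ω))) P :=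
    h.integrable_reward_mul (h.integrable ((hψ.sub hl).sub ho) k) k
  have heq : ∫ ω, R k ω * ψ (dt k) (X k ω) (Z k ω) ∂P =
      (∫ ω, D.r (X k ω) * leadingTerm Q H (dt k) (X k ω) (Z k ω) ∂P) +
      (∫ ω, D.r (X k ω) * oddTerm F₁ F₃ (dt k) (X k ω) (Z k ω) ∂P) +
      (∫ ω, (R k ω - D.r (X k ω)) * leadingTerm Q H (dt k) (X k ω) (Z k ω) ∂P) +
      (∫ ω, (R k ω - D.r (X k ω)) * oddTerm F₁ F₃ (dt k) (X k ω) (Z k ω) ∂P) +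
      ∫ ω, R k ω * (ψ (dt k) (X k ω) (Z k ω) -
      leadingTerm Q H (dt k) (X k ω) (Z k ω) - oddTerm F₁ F₃ (dt k) (X k ω) (Z k ω)) ∂P := by
    rw [← integral_add i1 i2, ← integral_add (i1.fun_add i2) i3,
      ← integral_add ((i1.fun_add i2).fun_add i3) i4,
      ← integral_add (((i1.fun_add i2).fun_add i3).fun_add i4) i5]
    refine integral_congr_ae (ae_of_all _ fun ω => ?_)
    ring
  rw [heq]
  ring

/-- Fourth moments. -/
lemma exists_integral_pow_four_bound {T : ℝ} (hT : ∀ k, dt k ≤ T) :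
    ∃ K, 0 ≤ K ∧ ∀ k, ∫ ω, ψ (dt k) (X k ω) (Z k ω) ^ 4 ∂P ≤ K := by
  have hT0 : 0 ≤ T := (hdt 0).le.trans (hT 0)
  obtain ⟨K, hK0, hK⟩ := e.exists_bound hT0
  obtain ⟨C, hC0, hC⟩ := h.exists_scaled_moment_bound hdt 12
  refine ⟨K ^ 4 * C, by positivity, fun k => ?_⟩
  obtain ⟨h1, h2⟩ := hC k
  have h3 : ∀ ω, ‖ψ (dt k) (X k ω) (Z k ω) ^ 4‖ ≤
      K ^ 4 * (1 + ‖Z k ω‖ ^ 2 / dt k) ^ 12 := fun ω => by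
    rw [norm_pow, Real.norm_eq_abs]
    calc _ ≤ (K * (1 + ‖Z k ω‖ ^ 2 / dt k) ^ 3) ^ 4 :=
          pow_le_pow_left₀ (abs_nonneg _) (hK _ _ _ (hdt k) (hT k)) 4
      _ = _ := by ring
  refine (le_abs_self _).trans ?_
  rw [← Real.norm_eq_abs]
  refine (norm_integral_le_of_norm_le (h1.const_mul _) (ae_of_all _ h3)).trans ?_
  rw [integral_const_mul]
  gcongr

end HasExpansion

end

end

/-! ### Taylor expansion of the temporal difference and the energy density -/

section

open Asymptotics

variable {d dW : ℕ}

lemma inner_torusGrad {f : Torus d → ℝ} (x : Torus d) (z : Euc d) :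
    inner ℝ z (torusGrad f x) = ∑ i, z i * pd i f x := by
  simp only [PiLp.inner_apply, torusGrad_apply]
  exact Finset.sum_congr rfl fun i _ => mul_comm _ _

/-- The part of the stochastic temporal difference that does not involve the reward. -/
def Dynamics.td (D : Dynamics d dW) (f : Torus d → ℝ) (t : ℝ) (x : Torus d) (z : Euc d) : ℝ :=
  (1 / t) * (f x - Real.exp (-D.rho * t) * f (x + proj z)) +
    (1 / t) * inner ℝ (z - t • D.b x) (torusGrad f x)

/-- The first-order part of the operator `𝓛`. -/
def Dynamics.firstOrder (D : Dynamics d dW) (f : Torus d → ℝ) (x : Torus d) : ℝ :=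
  D.rho * f x - inner ℝ (D.b x) (torusGrad f x)

/-- Second partial derivatives. -/
def secondDeriv (f : Torus d → ℝ) (i j : Fin d) (x : Torus d) : ℝ := pd j (pd i f) x

lemma torusHess_eq_secondDeriv {f : Torus d → ℝ} (hf : TorusContDiff 2 f) (x : Torus d)
    (i j : Fin d) : torusHess f x i j = secondDeriv f j i x := torusHess_apply hf x i j

lemma secondDeriv_symm {f : Torus d → ℝ} (hf : TorusContDiff 2 f) (x : Torus d)
    (i j : Fin d) : secondDeriv f i j x = secondDeriv f j i x := by
  rw [← torusHess_eq_secondDeriv hf, torusHess_symm hf, torusHess_eq_secondDeriv hf]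

lemma Dynamics.L_eq (D : Dynamics d dW) {f : Torus d → ℝ} (hf : TorusContDiff 2 f)
    (x : Torus d) : D.L f x = D.firstOrder f x - 1 / 2 * contract D (secondDeriv f) x := by
  simp only [Dynamics.L, Dynamics.symbol, Dynamics.firstOrder, contract, Matrix.trace,
    Matrix.diag_apply, Matrix.mul_apply, torusHess_eq_secondDeriv hf]
  have : ∀ i j, D.a x i j * secondDeriv f i j x = secondDeriv f i j x * D.a x i j :=
    fun i j => mul_comm _ _
  simp only [this]
  ring

/-- The bilinear form whose integral is the quadratic part of the residual gradient cost. -/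
def Dynamics.energy (D : Dynamics d dW) (f g : Torus d → ℝ) (x : Torus d) : ℝ :=
  D.L f x * D.L g x + 1 / 2 * ((D.a x * torusHess f x) * (D.a x * torusHess g x)).trace

lemma Dynamics.energy_symm (D : Dynamics d dW) (f g : Torus d → ℝ) (x : Torus d) :
    D.energy f g x = D.energy g f x := by
  rw [Dynamics.energy, Dynamics.energy, Matrix.trace_mul_comm, mul_comm (D.L f x)]

lemma Dynamics.trace_sq_eq (D : Dynamics d dW) {f : Torus d → ℝ} (hf : TorusContDiff 2 f)
    (x : Torus d) : ((D.a x * torusHess f x) * (D.a x * torusHess f x)).trace =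
      ∑ i, ∑ j, ∑ l, ∑ m, secondDeriv f i j x * secondDeriv f l m x *
        (D.a x i l * D.a x j m) := by
  simp only [Matrix.trace, Matrix.diag_apply, Matrix.mul_apply, torusHess_eq_secondDeriv hf,
    Finset.sum_mul, Finset.mul_sum]
  have h1 : ∀ i j l m : Fin d, D.a x i m * secondDeriv f j m x * (D.a x j l * secondDeriv f i l x)
      = secondDeriv f m j x * secondDeriv f i l x * (D.a x m i * D.a x j l) := fun i j l m => by
    rw [secondDeriv_symm hf x j m, D.a_symm x i m]
    ring
  simp only [h1]
  rw [Finset.sum_congr rfl fun i _ => Finset.sum_congr rfl fun j _ => Finset.sum_comm,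
    Finset.sum_congr rfl fun i _ => Finset.sum_comm, Finset.sum_comm]
  exact Finset.sum_congr rfl fun i _ => Finset.sum_comm

/-- Of the three Isserlis pairings, one gives the square of the contraction; the other two coincide
by symmetry of the Hessian and give twice the trace. Since 𝓛f is the first-order part minus half the
contraction, the square is completed and half the trace is left. The second term of the cost is thus
the limiting variance of the quadratic fluctuations. -/
lemma Dynamics.energy_self (D : Dynamics d dW) {f : Torus d → ℝ} (hf : TorusContDiff 2 f)
    (x : Torus d) : D.energy f f x = D.firstOrder f x ^ 2 -
      D.firstOrder f x * contract D (secondDeriv f) x +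
      1 / 4 * quartic D (secondDeriv f) x := by
  have h1 : quartic D (secondDeriv f) x = contract D (secondDeriv f) x ^ 2 +
      2 * ((D.a x * torusHess f x) * (D.a x * torusHess f x)).trace := by
    have h2 : ∑ i, ∑ j, ∑ l, ∑ m, secondDeriv f i j x * secondDeriv f l m x *
        (D.a x i m * D.a x j l) = ∑ i, ∑ j, ∑ l, ∑ m, secondDeriv f i j x * secondDeriv f l m x *
        (D.a x i l * D.a x j m) := by
      refine Finset.sum_congr rfl fun i _ => Finset.sum_congr rfl fun j _ => ?_
      rw [Finset.sum_comm]
      simp only [secondDeriv_symm hf x _ _]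
    have h3 : contract D (secondDeriv f) x ^ 2 = ∑ i, ∑ j, ∑ l, ∑ m,
        secondDeriv f i j x * secondDeriv f l m x * (D.a x i j * D.a x l m) := by
      simp only [contract, sq]
      rw [Finset.sum_mul]
      refine Finset.sum_congr rfl fun i _ => ?_
      rw [Finset.sum_mul]
      refine Finset.sum_congr rfl fun j _ => ?_
      simp only [Finset.mul_sum]
      refine Finset.sum_congr rfl fun l _ => Finset.sum_congr rfl fun m _ => ?_
      ring
    rw [D.trace_sq_eq hf, two_mul, h3, ← add_assoc]
    nth_rewrite 2 [← h2]
    simp only [quartic, mul_add, Finset.sum_add_distrib]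
  rw [Dynamics.energy, D.L_eq hf, h1]
  ring

lemma abs_one_sub_exp_neg_sub_le {y : ℝ} (hy : 0 ≤ y) : |1 - Real.exp (-y) - y| ≤ y ^ 2 := by
  have h1 := Real.add_one_le_exp (-y)
  have h2 : Real.exp (-y) * (1 + y) ≤ 1 := by
    have h3 : Real.exp (-y) * (y + 1) ≤ Real.exp (-y) * Real.exp y :=
      mul_le_mul_of_nonneg_left (Real.add_one_le_exp y) (Real.exp_pos _).le
    rw [← Real.exp_add, neg_add_cancel, Real.exp_zero] at h3
    linarith
  have h3 : Real.exp (-y) ≤ 1 - y + y ^ 2 := by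
    nlinarith [pow_nonneg hy 3]
  rw [abs_le]
  constructor <;> nlinarith

lemma Dynamics.measurable_td (D : Dynamics d dW) (hD : D.Regular) {f : Torus d → ℝ}
    (hf : TorusContDiff 1 f) (t : ℝ) :
    Measurable fun y : Torus d × Euc d => D.td f t y.1 y.2 := by
  have h1 : Measurable fun y : Torus d × Euc d => f (y.1 + proj y.2) :=
    (hf.continuous.comp (continuous_fst.add (continuous_proj.comp continuous_snd))).measurable
  have h2 : Measurable fun y : Torus d × Euc d => f y.1 :=
    (hf.continuous.comp continuous_fst).measurable
  have h3 : ∀ i, Measurable fun y : Torus d × Euc d => pd i f y.1 := fun i =>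
    (bddMeas_pd hf i).1.comp measurable_fst
  have h4 : ∀ i, Measurable fun y : Torus d × Euc d => D.b y.1 i := fun i =>
    (hD.bddMeas_b i).1.comp measurable_fst
  simp only [Dynamics.td, inner_torusGrad, PiLp.sub_apply, PiLp.smul_apply, smul_eq_mul]
  refine ((h2.sub (h1.const_mul _)).const_mul _).add ((Finset.measurable_fun_sum _ fun i _ => ?_).const_mul _)
  have h5 : Measurable fun y : Torus d × Euc d => y.2 i := by fun_prop
  exact (h5.sub ((h4 i).const_mul t)).mul (h3 i)

/-- The gradient term of the temporal difference cancels the contribution ∇f·z/t of size t^(-1/2),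
up to the drift. The discount contributes ρf and, multiplied by the increment of `f`, the odd term
ρ∇f·z. The remainder collects the fourth-order Taylor error divided by t, the quadratic error of the
exponential divided by t, and ρ times the second-order Taylor error. -/
theorem Dynamics.hasExpansion_td (D : Dynamics d dW) (hρ : 0 < D.rho) (hD : D.Regular)
    {f : Torus d → ℝ} (hf : TorusContDiff 4 f) :
    HasExpansion (D.td f) (D.firstOrder f) (secondDeriv f)
      (fun x z => D.rho * taylorTerm 1 f x z) (fun x z => -(1 / 6) * taylorTerm 3 f x z) where
  measurable := D.measurable_td hD (hf.of_le (by norm_num))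
  bdd_Q := by
    have hf1 : TorusContDiff 1 f := hf.of_le (by norm_num)
    have h1 : BddMeas fun x => ∑ i, D.b x i * pd i f x :=
      BddMeas.sum fun i _ => (hD.bddMeas_b i).mul (bddMeas_pd hf1 i)
    have h2 : BddMeas fun x => D.rho * f x + (-1) * ∑ i, D.b x i * pd i f x :=
      (hf.bddMeas.const_mul _).add (h1.const_mul _)
    convert h2 using 2 with x
    rw [Dynamics.firstOrder, inner_torusGrad]
    ring
  bdd_H i j := bddMeas_pd ((hf.of_le (by norm_num : 2 ≤ 4)).pd i) j
  form₁ := (isForm_taylorTerm 1 (hf.of_le (by norm_num))).const_mul _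
  form₃ := (isForm_taylorTerm 3 (hf.of_le (by norm_num))).const_mul _
  bound := by
    obtain ⟨K4, hK40, hK4⟩ := exists_taylor_bound 4 hf
    obtain ⟨K2, hK20, hK2⟩ := exists_taylor_bound 2 (hf.of_le (by norm_num))
    obtain ⟨K0, hK00, hK0⟩ := exists_bound_of_continuous hf.continuous
    refine ⟨K4 + D.rho ^ 2 * K0 + D.rho * K2, by positivity, fun t x z ht => ?_⟩
    have h4 := hK4 x z
    have h2 := hK2 x z
    have h0 := hK0 (x + proj z)
    have he := abs_one_sub_exp_neg_sub_le (mul_nonneg hρ.le ht.le)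
    simp only [Finset.sum_range_succ, Finset.sum_range_zero, Nat.factorial, zero_add, Nat.cast_one,
      div_one, one_mul, mul_one, Nat.succ_eq_add_one, Nat.reduceMul, Nat.reduceAdd,
      Nat.cast_ofNat] at h4 h2
    have hT1 : taylorTerm 1 f x z = ∑ i, z i * pd i f x := rfl
    have hT0 : taylorTerm 0 f x z = f x := rfl
    have hT2 : taylorTerm 2 f x z = quad (secondDeriv f) x z := by
      simp only [taylorTerm, quad, secondDeriv, Finset.mul_sum]
      refine Finset.sum_congr rfl fun i _ => Finset.sum_congr rfl fun j _ => ?_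
      ring
    rw [hT0] at h4 h2
    rw [hT2] at h4
    set s := ‖z‖ ^ 2 / t with hs
    have hs0 : 0 ≤ s := by positivity
    have hz : ‖z‖ ^ 2 = t * s := by rw [hs]; field_simp
    have hz4 : ‖z‖ ^ 4 = (t * s) ^ 2 := by rw [← hz]; ring
    rw [hz4] at h4
    rw [hz] at h2
    set r4 := f (x + proj z) - (f x + taylorTerm 1 f x z + 1 / 2 * quad (secondDeriv f) x z +
      1 / 6 * taylorTerm 3 f x z) with hr4
    set r2 := f (x + proj z) - (f x + taylorTerm 1 f x z) with hr2
    have hinner : inner ℝ (z - t • D.b x) (torusGrad f x) =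
        taylorTerm 1 f x z - t * inner ℝ (D.b x) (torusGrad f x) := by
      rw [inner_sub_left, real_inner_smul_left, inner_torusGrad x z, hT1]
    have key : D.td f t x z - leadingTerm (D.firstOrder f) (secondDeriv f) t x z -
        oddTerm (fun x z => D.rho * taylorTerm 1 f x z)
          (fun x z => -(1 / 6) * taylorTerm 3 f x z) t x z =
        -(1 / t * r4) + 1 / t * (1 - Real.exp (-(D.rho * t)) - D.rho * t) * f (x + proj z) +
          D.rho * r2 := by
      rw [Dynamics.td, leadingTerm, oddTerm, Dynamics.firstOrder, hinner, hr4, hr2, neg_mul]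
      field_simp
      ring
    rw [key]
    have b1 : |-(1 / t * r4)| ≤ K4 * t * s ^ 2 := by
      rw [abs_neg, abs_mul, abs_of_nonneg (by positivity : 0 ≤ 1 / t)]
      calc _ ≤ 1 / t * (K4 * (t * s) ^ 2) := by gcongr
        _ = _ := by field_simp
    have b2 : |1 / t * (1 - Real.exp (-(D.rho * t)) - D.rho * t) * f (x + proj z)| ≤
        D.rho ^ 2 * K0 * t := by
      rw [abs_mul, abs_mul, abs_of_nonneg (by positivity : 0 ≤ 1 / t)]
      calc _ ≤ 1 / t * (D.rho * t) ^ 2 * K0 := by gcongr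
        _ = _ := by field_simp
    have b3 : |D.rho * r2| ≤ D.rho * K2 * t * s := by
      rw [abs_mul, abs_of_pos hρ]
      calc _ ≤ D.rho * (K2 * (t * s)) := by gcongr
        _ = _ := by ring
    have c1 : s ^ 2 ≤ (1 + s) ^ 2 := by gcongr; linarith
    have c2 : 1 ≤ (1 + s) ^ 2 := one_le_pow₀ (by linarith)
    have c3 : s ≤ (1 + s) ^ 2 := by nlinarith
    calc _ ≤ K4 * t * s ^ 2 + D.rho ^ 2 * K0 * t * 1 + D.rho * K2 * t * s := by
          rw [mul_one]
          exact (abs_add_three _ _ _).trans (add_le_add (add_le_add b1 b2) b3)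
      _ ≤ K4 * t * (1 + s) ^ 2 + D.rho ^ 2 * K0 * t * (1 + s) ^ 2 +
          D.rho * K2 * t * (1 + s) ^ 2 := by gcongr
      _ = _ := by ring

end

section

open Asymptotics

variable {d dW : ℕ}

/-! ### Linearity -/

section

variable {f g : Torus d → ℝ}

lemma torusGrad_add (hf : TorusContDiff 1 f) (hg : TorusContDiff 1 g) (x : Torus d) :
    torusGrad (fun x => f x + g x) x = torusGrad f x + torusGrad g x := by
  ext i
  simp only [PiLp.add_apply, torusGrad_apply, pd_add hf hg]

lemma torusGrad_const_mul (hf : TorusContDiff 1 f) (c : ℝ) (x : Torus d) :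
    torusGrad (fun x => c * f x) x = c • torusGrad f x := by
  ext i
  simp only [PiLp.smul_apply, torusGrad_apply, pd_const_mul hf, smul_eq_mul]

lemma torusHess_add (hf : TorusContDiff 2 f) (hg : TorusContDiff 2 g) (x : Torus d) :
    torusHess (fun x => f x + g x) x = torusHess f x + torusHess g x := by
  ext i j
  have h1 : pd j (fun x => f x + g x) = fun x => pd j f x + pd j g x :=
    funext fun x => pd_add (hf.of_le one_le_two) (hg.of_le one_le_two) j x
  rw [Matrix.add_apply, torusHess_apply (hf.add hg), torusHess_apply hf, torusHess_apply hg, h1,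
    pd_add (hf.pd j) (hg.pd j)]

lemma torusHess_const_mul (hf : TorusContDiff 2 f) (c : ℝ) (x : Torus d) :
    torusHess (fun x => c * f x) x = c • torusHess f x := by
  ext i j
  have h1 : pd j (fun x => c * f x) = fun x => c * pd j f x :=
    funext fun x => pd_const_mul (hf.of_le one_le_two) c j x
  rw [Matrix.smul_apply, torusHess_apply (hf.const_mul c), torusHess_apply hf, h1,
    pd_const_mul (hf.pd j), smul_eq_mul]

variable (D : Dynamics d dW)

lemma Dynamics.symbol_add (x : Torus d) (M N : Matrix (Fin d) (Fin d) ℝ) (q r : Euc d) :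
    D.symbol x (M + N) (q + r) = D.symbol x M q + D.symbol x N r := by
  simp only [Dynamics.symbol, mul_add, Matrix.trace_add, inner_add_right]
  ring

lemma Dynamics.symbol_smul (x : Torus d) (c : ℝ) (M : Matrix (Fin d) (Fin d) ℝ) (q : Euc d) :
    D.symbol x (c • M) (c • q) = c * D.symbol x M q := by
  simp only [Dynamics.symbol, Matrix.mul_smul, Matrix.trace_smul, real_inner_smul_right,
    smul_eq_mul]
  ring

lemma Dynamics.L_add (hf : TorusContDiff 2 f) (hg : TorusContDiff 2 g) (x : Torus d) :
    D.L (fun x => f x + g x) x = D.L f x + D.L g x := by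
  rw [Dynamics.L, torusHess_add hf hg, torusGrad_add (hf.of_le one_le_two) (hg.of_le one_le_two),
    D.symbol_add, Dynamics.L, Dynamics.L]
  ring

lemma Dynamics.L_const_mul (hf : TorusContDiff 2 f) (c : ℝ) (x : Torus d) :
    D.L (fun x => c * f x) x = c * D.L f x := by
  rw [Dynamics.L, torusHess_const_mul hf, torusGrad_const_mul (hf.of_le one_le_two),
    D.symbol_smul, Dynamics.L]
  ring

lemma Dynamics.td_add (hf : TorusContDiff 1 f) (hg : TorusContDiff 1 g) (t : ℝ) (x : Torus d)
    (z : Euc d) : D.td (fun x => f x + g x) t x z = D.td f t x z + D.td g t x z := by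
  simp only [Dynamics.td, torusGrad_add hf hg, inner_add_right]
  ring

lemma Dynamics.td_const_mul (hf : TorusContDiff 1 f) (c t : ℝ) (x : Torus d) (z : Euc d) :
    D.td (fun x => c * f x) t x z = c * D.td f t x z := by
  simp only [Dynamics.td, torusGrad_const_mul hf, real_inner_smul_right]
  ring

/-- Additive and homogeneous maps on `C²` functions commute with linear combinations. -/
lemma map_lincomb {n : ℕ} {V : Type*} [AddCommGroup V] [Module ℝ V] (T : (Torus d → ℝ) → V)
    (hadd : ∀ f g, TorusContDiff 2 f → TorusContDiff 2 g → T (fun x => f x + g x) = T f + T g)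
    (hmul : ∀ (c : ℝ) f, TorusContDiff 2 f → T (fun x => c * f x) = c • T f)
    {φ : Fin n → Torus d → ℝ} (hφ : ∀ i, TorusContDiff 2 (φ i)) (θ : Fin n → ℝ) :
    T (fun x => ∑ i, θ i * φ i x) = ∑ i, θ i • T (φ i) := by
  classical
  have key : ∀ s : Finset (Fin n), T (fun x => ∑ i ∈ s, θ i * φ i x) = ∑ i ∈ s, θ i • T (φ i) := by
    intro s
    induction s using Finset.induction_on with
    | empty =>
      have := hmul 0 (fun _ => 0) (torusContDiff_const 0)
      simpa using this
    | insert a s ha ih =>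
      simp only [Finset.sum_insert ha]
      rw [hadd _ _ ((hφ a).const_mul _) (TorusContDiff.sum fun i _ => (hφ i).const_mul _), ih,
        hmul _ _ (hφ a)]
  exact key Finset.univ

lemma Dynamics.energy_add_self (hf : TorusContDiff 2 f) (hg : TorusContDiff 2 g) (x : Torus d) :
    D.energy (fun x => f x + g x) (fun x => f x + g x) x =
      D.energy f f x + 2 * D.energy f g x + D.energy g g x := by
  simp only [Dynamics.energy, D.L_add hf hg, torusHess_add hf hg, mul_add, add_mul,
    Matrix.trace_add]
  rw [Matrix.trace_mul_comm (D.a x * torusHess g x) (D.a x * torusHess f x)]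
  ring

/-! ### Regularity -/

variable {D} {p : ℕ} (hb : TorusContDiff p D.b)
  (hσ : ∀ i j, TorusContDiff p fun x => D.sigma x i j)

include hb hσ

lemma Dynamics.torusContDiff_L (hf : TorusContDiff (p + 2) f) : TorusContDiff p (D.L f) := by
  have hf2 : TorusContDiff 2 f := hf.of_le (by omega)
  have ha := Dynamics.torusContDiff_a hσ
  have h1 : TorusContDiff p fun x => D.rho * f x - (1 / 2 * (∑ i, ∑ j, D.a x i j * pd j (pd i f) x)
      + ∑ i, D.b x i * pd i f x) :=
    ((hf.of_le (by omega)).const_mul _).sub (((TorusContDiff.sum fun i _ =>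
      TorusContDiff.sum fun j _ => (ha i j).mul
        (TorusContDiff.pd (TorusContDiff.pd hf i) j)).const_mul _).add
      (TorusContDiff.sum fun i _ => (hb.apply i).mul
        ((TorusContDiff.pd (p := p + 1) hf i).of_le (by omega))))
  convert h1 using 2 with x
  simp only [Dynamics.L, D.symbol_eq, torusHess_apply hf2, torusGrad_apply]

/-- The limiting integrand must be `C^p`, the class on which the laws of the `X k` are compared with
`m`. This is why the features have two more derivatives than the coefficients. -/
lemma Dynamics.torusContDiff_energy (hf : TorusContDiff (p + 2) f)
    (hg : TorusContDiff (p + 2) g) : TorusContDiff p (D.energy f g) := by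
  have ha := Dynamics.torusContDiff_a hσ
  have h2 : ∀ f : Torus d → ℝ, TorusContDiff (p + 2) f → ∀ i j,
      TorusContDiff p fun x => (D.a x * torusHess f x) i j := fun f hf i j => by
    have hf2 : TorusContDiff 2 f := hf.of_le (by omega)
    simp only [Matrix.mul_apply, torusHess_apply hf2]
    exact TorusContDiff.sum fun k _ => (ha i k).mul
        (TorusContDiff.pd (TorusContDiff.pd hf j) k)
  refine ((Dynamics.torusContDiff_L hb hσ hf).mul (Dynamics.torusContDiff_L hb hσ hg)).add
    (TorusContDiff.const_mul _ ?_)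
  simp only [Matrix.trace, Matrix.diag_apply, Matrix.mul_apply (M := D.a _ * _)]
  exact TorusContDiff.sum fun i _ => TorusContDiff.sum fun j _ => (h2 f hf i j).mul (h2 g hg j i)

end

/-! ### Limits of the second moments of the stochastic temporal differences -/

section

variable {Ω : Type*} [MeasurableSpace Ω] {D : Dynamics d dW} {P : Measure Ω}
  [IsProbabilityMeasure P] {dt : ℕ → ℝ} {X : ℕ → Ω → Torus d} {Z : ℕ → Ω → Euc d}
  {R : ℕ → Ω → ℝ} (h : MomentExpansion D P dt X Z R) (hdt : ∀ k, 0 < dt k) {T : ℝ}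
  (hT : ∀ k, dt k ≤ T) (hρ : 0 < D.rho) {p : ℕ} (hp : 2 ≤ p)
  (hr : TorusContDiff p D.r) (hb : TorusContDiff p D.b)
  (hσ : ∀ i j, TorusContDiff p fun x => D.sigma x i j) {f g : Torus d → ℝ}
  (hf : TorusContDiff (p + 2) f) (hg : TorusContDiff (p + 2) g)

include hp hr hb hσ

lemma regular_of_le : D.Regular where
  r := hr.of_le hp
  b := hb.of_le hp
  sigma i j := (hσ i j).of_le hp

include h hdt hρ

include hf in
lemma integral_reward_mul_td_isBigO :
    (fun k => ∫ ω, R k ω * D.td f (dt k) (X k ω) (Z k ω) ∂P -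
      ∫ ω, D.r (X k ω) * D.L f (X k ω) ∂P) =O[⊤] dt := by
  have hD := regular_of_le hp hr hb hσ
  have e := D.hasExpansion_td hρ hD (hf.of_le (by omega : 4 ≤ p + 2))
  have h1 := HasExpansion.integral_reward_mul_isBigO h e hdt hD.bddMeas_a hr.bddMeas
  simpa only [← D.L_eq (hf.of_le (by omega : 2 ≤ p + 2))] using h1

include hT

include hf in
lemma integral_td_sq_isBigO :
    (fun k => ∫ ω, D.td f (dt k) (X k ω) (Z k ω) ^ 2 ∂P -
      ∫ ω, D.energy f f (X k ω) ∂P) =O[⊤] dt := by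
  have hD := regular_of_le hp hr hb hσ
  have e := D.hasExpansion_td hρ hD (hf.of_le (by omega : 4 ≤ p + 2))
  have h1 := e.integral_sq_isBigO h hdt hD.bddMeas_a hT
  simpa only [← D.energy_self (hf.of_le (by omega : 2 ≤ p + 2))] using h1

include hf hg in
theorem integral_td_mul_td_isBigO :
    (fun k => ∫ ω, D.td f (dt k) (X k ω) (Z k ω) * D.td g (dt k) (X k ω) (Z k ω) ∂P -
      ∫ ω, D.energy f g (X k ω) ∂P) =O[⊤] dt := by
  have hD := regular_of_le hp hr hb hσ
  have hI : ∀ f g : Torus d → ℝ, TorusContDiff (p + 2) f → TorusContDiff (p + 2) g → ∀ k,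
      Integrable (fun ω => D.td f (dt k) (X k ω) (Z k ω) * D.td g (dt k) (X k ω) (Z k ω)) P :=
    fun f g hf hg k => h.integrable
      (((D.hasExpansion_td hρ hD (hf.of_le (by omega : 4 ≤ p + 2))).polyBdd (hdt k)).mul
      ((D.hasExpansion_td hρ hD (hg.of_le (by omega : 4 ≤ p + 2))).polyBdd (hdt k))) k
  have hE : ∀ f g : Torus d → ℝ, TorusContDiff (p + 2) f → TorusContDiff (p + 2) g → ∀ k,
      Integrable (fun ω => D.energy f g (X k ω)) P := fun f g hf hg k =>
    h.integrable (Dynamics.torusContDiff_energy hb hσ hf hg).bddMeas.polyBdd k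
  have hf1 : TorusContDiff 1 f := hf.of_le (by omega)
  have hg1 : TorusContDiff 1 g := hg.of_le (by omega)
  have hf2 : TorusContDiff 2 f := hf.of_le (by omega)
  have hg2 : TorusContDiff 2 g := hg.of_le (by omega)
  have h1 := integral_td_sq_isBigO h hdt hT hρ hp hr hb hσ hf
  have h2 := integral_td_sq_isBigO h hdt hT hρ hp hr hb hσ hg
  have h3 := integral_td_sq_isBigO h hdt hT hρ hp hr hb hσ (hf.add hg)
  -- Polarisation: the diagonal case for f + g, minus those for f and g, halved.
  refine (((h3.sub h1).sub h2).const_mul_left (1 / 2)).congr_left fun k => ?_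
  have e1 : ∫ ω, D.td (fun x => f x + g x) (dt k) (X k ω) (Z k ω) ^ 2 ∂P =
      (∫ ω, D.td f (dt k) (X k ω) (Z k ω) * D.td f (dt k) (X k ω) (Z k ω) ∂P) +
      2 * (∫ ω, D.td f (dt k) (X k ω) (Z k ω) * D.td g (dt k) (X k ω) (Z k ω) ∂P) +
      ∫ ω, D.td g (dt k) (X k ω) (Z k ω) * D.td g (dt k) (X k ω) (Z k ω) ∂P := by
    rw [← integral_const_mul, ← integral_add (hI f f hf hf k) ((hI f g hf hg k).const_mul _),
      ← integral_add ((hI f f hf hf k).fun_add ((hI f g hf hg k).const_mul _)) (hI g g hg hg k)]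
    refine integral_congr_ae (ae_of_all _ fun ω => ?_)
    simp only [D.td_add hf1 hg1]
    ring
  have e2 : ∫ ω, D.energy (fun x => f x + g x) (fun x => f x + g x) (X k ω) ∂P =
      (∫ ω, D.energy f f (X k ω) ∂P) + 2 * (∫ ω, D.energy f g (X k ω) ∂P) +
      ∫ ω, D.energy g g (X k ω) ∂P := by
    rw [← integral_const_mul, ← integral_add (hE f f hf hf k) ((hE f g hf hg k).const_mul _),
      ← integral_add ((hE f f hf hf k).fun_add ((hE f g hf hg k).const_mul _)) (hE g g hg hg k)]
    refine integral_congr_ae (ae_of_all _ fun ω => ?_)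
    simp only [D.energy_add_self hf2 hg2]
  rw [e1, e2]
  simp only [sq]
  ring

end

end

/-! ### Linearity in the parameter, and dissipativity under the stationary measure -/

section

variable {d dW n : ℕ}

/-- The components of the features. -/
def feature (φ : Torus d → Euc n) (i : Fin n) : Torus d → ℝ := fun x => φ x i

lemma value_eq (φ : Torus d → Euc n) (θ : Euc n) :
    value φ θ = fun x => ∑ i, θ i * feature φ i x := by
  funext x
  simp only [value, feature, PiLp.inner_apply]
  exact Finset.sum_congr rfl fun i _ => mul_comm _ _

lemma torusContDiff_feature {q : ℕ} {φ : Torus d → Euc n} (hφ : TorusContDiff q φ) (i : Fin n) :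
    TorusContDiff q (feature φ i) := hφ.apply i

lemma torusContDiff_value {q : ℕ} {φ : Torus d → Euc n} (hφ : TorusContDiff q φ) (θ : Euc n) :
    TorusContDiff q (value φ θ) := by
  rw [value_eq]
  exact TorusContDiff.sum fun i _ => (torusContDiff_feature hφ i).const_mul _

section

variable (D : Dynamics d dW) {φ : Torus d → Euc n} (hφ : TorusContDiff 2 φ)

include hφ

lemma Dynamics.L_value (θ : Euc n) (x : Torus d) :
    D.L (value φ θ) x = ∑ i, θ i * D.L (feature φ i) x := by
  rw [value_eq]
  exact map_lincomb (fun f => D.L f x) (fun f g hf hg => D.L_add hf hg x)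
    (fun c f hf => D.L_const_mul hf c x) (torusContDiff_feature hφ) θ

lemma torusHess_value (θ : Euc n) (x : Torus d) :
    torusHess (value φ θ) x = ∑ i, θ i • torusHess (feature φ i) x := by
  rw [value_eq]
  exact map_lincomb (fun f => torusHess f x) (fun f g hf hg => torusHess_add hf hg x)
    (fun c f hf => torusHess_const_mul hf c x) (torusContDiff_feature hφ) θ

lemma Dynamics.td_value (θ : Euc n) (t : ℝ) (x : Torus d) (z : Euc d) :
    D.td (value φ θ) t x z = ∑ i, θ i * D.td (feature φ i) t x z := by
  rw [value_eq]
  exact map_lincomb (fun f => D.td f t x z)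
    (fun f g hf hg => D.td_add (hf.of_le one_le_two) (hg.of_le one_le_two) t x z)
    (fun c f hf => D.td_const_mul (hf.of_le one_le_two) c t x z) (torusContDiff_feature hφ) θ

lemma Dynamics.energy_value (θ η : Euc n) (x : Torus d) :
    D.energy (value φ θ) (value φ η) x =
      ∑ i, ∑ j, θ i * η j * D.energy (feature φ i) (feature φ j) x := by
  have h1 : ((D.a x * ∑ i, θ i • torusHess (feature φ i) x) *
      (D.a x * ∑ j, η j • torusHess (feature φ j) x)).trace = ∑ i, ∑ j, θ i * η j *
      ((D.a x * torusHess (feature φ i) x) * (D.a x * torusHess (feature φ j) x)).trace := by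
    rw [Finset.mul_sum, Finset.sum_mul, Matrix.trace_sum]
    refine Finset.sum_congr rfl fun i _ => ?_
    rw [Finset.mul_sum, Finset.mul_sum, Matrix.trace_sum]
    refine Finset.sum_congr rfl fun j _ => ?_
    simp only [Matrix.mul_smul, Matrix.smul_mul, Matrix.trace_smul, smul_eq_mul]
    ring
  rw [Dynamics.energy, D.L_value hφ, D.L_value hφ, torusHess_value hφ, torusHess_value hφ, h1,
    Finset.sum_mul_sum, Finset.mul_sum, ← Finset.sum_add_distrib]
  refine Finset.sum_congr rfl fun i _ => ?_
  rw [Finset.mul_sum, ← Finset.sum_add_distrib]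
  refine Finset.sum_congr rfl fun j _ => ?_
  rw [Dynamics.energy]
  ring

end

/-! ### Consequences of stationarity -/

lemma Dynamics.contract_grad_nonneg (D : Dynamics d dW) (x : Torus d) (q : Fin d → ℝ) :
    0 ≤ ∑ i, ∑ j, D.a x i j * (q i * q j) := by
  have h : ∑ i, ∑ j, D.a x i j * (q i * q j) = ∑ k, (∑ i, D.sigma x i k * q i) ^ 2 := by
    simp only [Dynamics.a, Matrix.mul_apply, Matrix.transpose_apply, sq, Finset.sum_mul,
      Finset.mul_sum]
    rw [Finset.sum_congr rfl fun i _ => Finset.sum_comm, Finset.sum_comm]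
    refine Finset.sum_congr rfl fun k _ => ?_
    rw [Finset.sum_comm]
    refine Finset.sum_congr rfl fun i _ => Finset.sum_congr rfl fun j _ => ?_
    ring
  rw [h]
  positivity

/-- By cyclicity the trace equals that of `N * N` with `N = σᵀ D²f σ` symmetric, which is the
squared Frobenius norm of `N`. -/
lemma Dynamics.trace_nonneg (D : Dynamics d dW) {f : Torus d → ℝ} (hf : TorusContDiff 2 f)
    (x : Torus d) : 0 ≤ ((D.a x * torusHess f x) * (D.a x * torusHess f x)).trace := by
  set S := D.sigma x
  set M := torusHess f x
  set N := S.transpose * M * S with hN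
  have hM : M.transpose = M := by
    ext i j
    exact torusHess_symm hf x j i
  have hNs : N.transpose = N := by
    simp only [hN, Matrix.transpose_mul, Matrix.transpose_transpose, hM, Matrix.mul_assoc]
  have h : ((D.a x * M) * (D.a x * M)).trace = (N * N).trace := by
    have h1 : (D.a x * M) * (D.a x * M) = S * (S.transpose * M * S * S.transpose * M) := by
      simp only [Dynamics.a, Matrix.mul_assoc, S]
    rw [h1, Matrix.trace_mul_comm]
    simp only [hN, Matrix.mul_assoc]
  rw [h]
  nth_rewrite 2 [← hNs]
  simp only [Matrix.trace, Matrix.diag_apply, Matrix.mul_apply, Matrix.transpose_apply]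
  exact Finset.sum_nonneg fun i _ => Finset.sum_nonneg fun j _ => mul_self_nonneg _

/-- The carré du champ identity: the failure of the generator to be a derivation on squares is the
nonnegative form `a` evaluated at the gradient. -/
lemma Dynamics.symbol_sq (D : Dynamics d dW) {f : Torus d → ℝ} (hf : TorusContDiff 2 f)
    (x : Torus d) : D.symbol x (torusHess (fun x => f x * f x) x)
        (torusGrad (fun x => f x * f x) x) =
      2 * (f x * D.symbol x (torusHess f x) (torusGrad f x)) +
        ∑ i, ∑ j, D.a x i j * (pd i f x * pd j f x) := by
  have hf1 : TorusContDiff 1 f := hf.of_le one_le_two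
  have h1 : ∀ i x, pd i (fun x => f x * f x) x = 2 * (f x * pd i f x) := fun i x => by
    rw [pd_mul hf1 hf1]
    ring
  have h2 : ∀ i j, pd j (pd i fun x => f x * f x) x =
      2 * (f x * pd j (pd i f) x) + 2 * (pd i f x * pd j f x) := fun i j => by
    rw [show (pd i fun x => f x * f x) = fun x => 2 * (f x * pd i f x) from funext (h1 i),
      pd_const_mul (hf1.mul (hf.pd i)), pd_mul hf1 (hf.pd i)]
    ring
  simp only [D.symbol_eq, torusHess_apply (hf.mul hf), torusHess_apply hf, torusGrad_apply, h1, h2,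
    mul_add, Finset.sum_add_distrib, Finset.mul_sum]
  have h3 : ∀ i j, 1 / 2 * (D.a x i j * (2 * (f x * pd j (pd i f) x))) =
      2 * (f x * (1 / 2 * (D.a x i j * pd j (pd i f) x))) := fun i j => by ring
  have h4 : ∀ i j, 1 / 2 * (D.a x i j * (2 * (pd i f x * pd j f x))) =
      D.a x i j * (pd i f x * pd j f x) := fun i j => by ring
  have h5 : ∀ i, D.b x i * (2 * (f x * pd i f x)) = 2 * (f x * (D.b x i * pd i f x)) :=
    fun i => by ring
  simp only [h3, h4, h5]
  ring

section

variable {D : Dynamics d dW} {p : ℕ} (hb : TorusContDiff p D.b)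
  (hσ : ∀ i j, TorusContDiff p fun x => D.sigma x i j) {m : Measure (Torus d)}
  [IsProbabilityMeasure m]

lemma BddMeas.integrable {c : Torus d → ℝ} (hc : BddMeas c) : Integrable c m := by
  obtain ⟨hm, K, -, hK⟩ := hc
  exact Integrable.of_bound hm.aestronglyMeasurable K (ae_of_all _ hK)

lemma TorusContDiff.integrable {q : ℕ} {f : Torus d → ℝ} (hf : TorusContDiff q f) :
    Integrable f m := hf.bddMeas.integrable

include hb hσ

/-- Dissipativity of the generator in `L²` of a stationary measure. -/
theorem Dynamics.IsStationary.mul_integral_sq_le (hm : D.IsStationary m) {f : Torus d → ℝ}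
    (hf : TorusContDiff (p + 2) f) :
    D.rho * ∫ x, f x ^ 2 ∂m ≤ ∫ x, f x * D.L f x ∂m := by
  have hf2 : TorusContDiff 2 f := hf.of_le (by omega)
  have hfp : TorusContDiff p f := hf.of_le (by omega)
  have i1 : Integrable (fun x => f x * D.L f x) m :=
    (hfp.mul (Dynamics.torusContDiff_L hb hσ hf)).integrable
  have i2 : Integrable (fun x => f x ^ 2) m := by
    simpa only [sq] using (hfp.mul hfp).integrable
  have h1 := hm _ (hf2.mul hf2)
  -- Stationarity removes the generator G of f². As f 𝓛f - ρf² = -f Gf, the added multiple cancels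
  -- the term 2f Gf of the carré du champ identity, and what is left of the integrand is pointwise
  -- nonnegative.
  have h2 : ∫ x, (D.symbol x (torusHess (fun x => f x * f x) x)
      (torusGrad (fun x => f x * f x) x) + 2 * (f x * D.L f x - D.rho * f x ^ 2)) ∂m =
      2 * ((∫ x, f x * D.L f x ∂m) - D.rho * ∫ x, f x ^ 2 ∂m) := by
    have i3 : Integrable (fun x => D.symbol x (torusHess (fun x => f x * f x) x)
      (torusGrad (fun x => f x * f x) x)) m := by
      have h3 : TorusContDiff 0 fun x => D.symbol x (torusHess (fun x => f x * f x) x)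
          (torusGrad (fun x => f x * f x) x) := by
        simp only [D.symbol_eq, torusHess_apply (hf2.mul hf2), torusGrad_apply]
        have ha := Dynamics.torusContDiff_a hσ
        exact ((TorusContDiff.sum fun i _ => TorusContDiff.sum fun j _ =>
          ((ha i j).of_le (Nat.zero_le p)).mul
            (TorusContDiff.pd (TorusContDiff.pd (hf2.mul hf2) i) j)).const_mul _).add
          (TorusContDiff.sum fun i _ => ((hb.apply i).of_le (Nat.zero_le p)).mul
            ((TorusContDiff.pd (hf2.mul hf2) i).of_le zero_le_one))
      exact h3.integrable
    rw [integral_add i3 ((integrable_fun_sub i1 (i2.const_mul _)).const_mul _), h1,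
      integral_const_mul, integral_sub i1 (i2.const_mul _), integral_const_mul, zero_add]
  have h3 : 0 ≤ ∫ x, (D.symbol x (torusHess (fun x => f x * f x) x)
      (torusGrad (fun x => f x * f x) x) + 2 * (f x * D.L f x - D.rho * f x ^ 2)) ∂m := by
    refine integral_nonneg fun x => ?_
    have h4 := D.contract_grad_nonneg x fun i => pd i f x
    simp only [Pi.zero_apply]
    rw [D.symbol_sq hf2, Dynamics.L]
    nlinarith
  linarith

lemma Dynamics.integral_L_sq_le_energy {f : Torus d → ℝ} (hf : TorusContDiff (p + 2) f) :
    ∫ x, D.L f x ^ 2 ∂m ≤ ∫ x, D.energy f f x ∂m := by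
  have hL := Dynamics.torusContDiff_L hb hσ hf
  refine integral_mono ?_ (Dynamics.torusContDiff_energy hb hσ hf hf).integrable fun x => ?_
  · simpa only [sq] using (hL.mul hL).integrable
  · have := D.trace_nonneg (hf.of_le (by omega)) x
    simp only [Dynamics.energy]
    nlinarith

/-- The energy dominates the square of 𝓛f, so 𝓛f vanishes almost everywhere; dissipativity then
reads ρ∫f² ≤ 0, and ρ is positive. -/
lemma Dynamics.IsStationary.ae_eq_zero_of_energy (hρ : 0 < D.rho) (hm : D.IsStationary m)
    {f : Torus d → ℝ} (hf : TorusContDiff (p + 2) f) (h0 : ∫ x, D.energy f f x ∂m ≤ 0) :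
    ∀ᵐ x ∂m, f x = 0 := by
  have hL := Dynamics.torusContDiff_L hb hσ hf
  have hfp : TorusContDiff p f := hf.of_le (by omega)
  have i1 : Integrable (fun x => D.L f x ^ 2) m := by
    simpa only [sq] using (hL.mul hL).integrable
  have i2 : Integrable (fun x => f x ^ 2) m := by
    simpa only [sq] using (hfp.mul hfp).integrable
  have h1 : ∫ x, D.L f x ^ 2 ∂m = 0 :=
    le_antisymm ((Dynamics.integral_L_sq_le_energy hb hσ hf).trans h0)
      (integral_nonneg fun x => sq_nonneg _)
  have h2 := (integral_eq_zero_iff_of_nonneg (fun x => sq_nonneg _) i1).1 h1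
  have h3 : ∫ x, f x * D.L f x ∂m = 0 := by
    refine integral_eq_zero_of_ae ?_
    filter_upwards [h2] with x hx
    have : D.L f x = 0 := by simpa using hx
    simp [this]
  have h4 := hm.mul_integral_sq_le hb hσ hf
  rw [h3] at h4
  have h5 : ∫ x, f x ^ 2 ∂m = 0 :=
    le_antisymm (by by_contra h; push Not at h; nlinarith) (integral_nonneg fun x => sq_nonneg _)
  filter_upwards [(integral_eq_zero_iff_of_nonneg (fun x => sq_nonneg _) i2).1 h5] with x hx
  simpa using hx

end

end

section

variable {d dW n : ℕ}

/-! ## The normal equations and the coercivity of the cost -/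

/-- The matrix of the quadratic part of the residual gradient cost. -/
def Dynamics.gram (D : Dynamics d dW) (φ : Torus d → Euc n) (m : Measure (Torus d)) :
    Matrix (Fin n) (Fin n) ℝ :=
  Matrix.of fun i j => ∫ x, D.energy (feature φ i) (feature φ j) x ∂m

/-- The linear part of the residual gradient cost. -/
def Dynamics.rewardVec (D : Dynamics d dW) (φ : Torus d → Euc n) (m : Measure (Torus d)) : Euc n :=
  WithLp.toLp 2 fun i => ∫ x, D.r x * D.L (feature φ i) x ∂m

/-- The half Hessian of the residual gradient cost. -/
def Dynamics.gramOp (D : Dynamics d dW) (φ : Torus d → Euc n) (m : Measure (Torus d)) :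
    Euc n →L[ℝ] Euc n :=
  Matrix.toEuclideanCLM (𝕜 := ℝ) (D.gram φ m)

lemma Dynamics.gramOp_apply (D : Dynamics d dW) (φ : Torus d → Euc n) (m : Measure (Torus d))
    (e : Euc n) (i : Fin n) : D.gramOp φ m e i = ∑ j, D.gram φ m i j * e j := by
  rw [Dynamics.gramOp, Matrix.ofLp_toEuclideanCLM]
  rfl

/-- Positive quadratic forms in finite dimension are coercive. -/
lemma exists_coercive {E : Type*} [NormedAddCommGroup E] [InnerProductSpace ℝ E]
    [FiniteDimensional ℝ E] (A : E →L[ℝ] E) (hA : ∀ e, e ≠ 0 → 0 < inner ℝ (A e) e) :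
    ∃ μ : ℝ, 0 < μ ∧ ∀ e, μ * ‖e‖ ^ 2 ≤ inner ℝ (A e) e := by
  have hcont : Continuous fun e => inner ℝ (A e) e := A.continuous.inner continuous_id
  -- The constant is the minimum on the unit sphere, extended by homogeneity. The sphere is empty
  -- when the space is trivial, and then any constant works.
  by_cases hne : (Metric.sphere (0 : E) 1).Nonempty
  · obtain ⟨u, hu, hmin⟩ := (isCompact_sphere (0 : E) 1).exists_isMinOn hne hcont.continuousOn
    have hu0 : u ≠ 0 := by
      rintro rfl
      simp at hu
    refine ⟨_, hA u hu0, fun e => ?_⟩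
    rcases eq_or_ne e 0 with rfl | he
    · simp
    · have h1 : ‖e‖⁻¹ • e ∈ Metric.sphere (0 : E) 1 := by
        simp [norm_smul, he]
      have h2 : inner ℝ (A u) u ≤ inner ℝ (A (‖e‖⁻¹ • e)) (‖e‖⁻¹ • e) := hmin h1
      have hn : 0 < ‖e‖ := norm_pos_iff.2 he
      rw [map_smul, real_inner_smul_left, real_inner_smul_right] at h2
      calc _ ≤ ‖e‖⁻¹ * (‖e‖⁻¹ * inner ℝ (A e) e) * ‖e‖ ^ 2 := by gcongr
        _ = _ := by field_simp
  · refine ⟨1, one_pos, fun e => ?_⟩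
    have he : e = 0 := by
      by_contra he
      exact hne ⟨‖e‖⁻¹ • e, by simp [norm_smul, he]⟩
    simp [he]

section

variable {D : Dynamics d dW} {p : ℕ} (hb : TorusContDiff p D.b)
  (hσ : ∀ i j, TorusContDiff p fun x => D.sigma x i j) {m : Measure (Torus d)}
  [IsProbabilityMeasure m] {φ : Torus d → Euc n} (hφ : TorusContDiff (p + 2) φ)

include hb hσ hφ

lemma Dynamics.inner_gramOp (θ η : Euc n) :
    inner ℝ (D.gramOp φ m θ) η = ∫ x, D.energy (value φ θ) (value φ η) x ∂m := by
  have hφ2 : TorusContDiff 2 φ := hφ.of_le (by omega)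
  have hi : ∀ i j, Integrable (fun x => D.energy (feature φ i) (feature φ j) x) m := fun i j =>
    (Dynamics.torusContDiff_energy hb hσ (torusContDiff_feature hφ i)
      (torusContDiff_feature hφ j)).integrable
  simp only [D.energy_value hφ2]
  rw [integral_finsetSum _ fun i _ => integrable_finsetSum _ fun j _ => (hi i j).const_mul _]
  simp only [integral_finsetSum _ fun j _ => (hi _ j).const_mul _, integral_const_mul]
  rw [PiLp.inner_apply, Finset.sum_comm]
  refine Finset.sum_congr rfl fun i _ => ?_
  simp only [D.gramOp_apply, Dynamics.gram, Matrix.of_apply]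
  rw [RCLike.inner_apply, conj_trivial, Finset.mul_sum]
  refine Finset.sum_congr rfl fun j _ => ?_
  simp only [D.energy_symm (feature φ i)]
  ring

theorem Dynamics.IsStationary.exists_coercive (hρ : 0 < D.rho) (hm : D.IsStationary m)
    (hindep : ∀ θ : Euc n, (∀ᵐ x ∂m, value φ θ x = 0) → θ = 0) :
    ∃ μ : ℝ, 0 < μ ∧ ∀ e, μ * ‖e‖ ^ 2 ≤ inner ℝ (D.gramOp φ m e) e := by
  refine ResidualGradient.exists_coercive _ fun e he => ?_
  by_contra h
  push Not at h
  rw [Dynamics.inner_gramOp hb hσ hφ] at h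
  exact he (hindep e (hm.ae_eq_zero_of_energy hb hσ hρ (torusContDiff_value hφ e) h))

variable (hr : TorusContDiff p D.r)

include hr

lemma Dynamics.inner_rewardVec (θ : Euc n) :
    inner ℝ (D.rewardVec φ m) θ = ∫ x, D.r x * D.L (value φ θ) x ∂m := by
  have hφ2 : TorusContDiff 2 φ := hφ.of_le (by omega)
  have hi : ∀ i, Integrable (fun x => D.r x * D.L (feature φ i) x) m := fun i =>
    (hr.mul (Dynamics.torusContDiff_L hb hσ (torusContDiff_feature hφ i))).integrable
  have h1 : ∀ x, D.r x * D.L (value φ θ) x =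
      ∑ i, θ i * (D.r x * D.L (feature φ i) x) := fun x => by
    rw [D.L_value hφ2, Finset.mul_sum]
    exact Finset.sum_congr rfl fun i _ => by ring
  simp only [h1]
  rw [integral_finsetSum _ fun i _ => (hi i).const_mul _]
  simp only [integral_const_mul, PiLp.inner_apply]
  rfl

/-- The energy density gathers the quadratic contributions of both terms of the cost, the squared
residual and the trace. The cost is thus an explicit quadratic polynomial in the parameter. -/
lemma Dynamics.cost_eq (θ : Euc n) : D.cost φ m θ =
    inner ℝ (D.gramOp φ m θ) θ - 2 * inner ℝ (D.rewardVec φ m) θ + ∫ x, D.r x ^ 2 ∂m := by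
  have hv := torusContDiff_value hφ θ
  have hL := Dynamics.torusContDiff_L hb hσ hv
  have hE := Dynamics.torusContDiff_energy hb hσ hv hv
  have i1 : Integrable (fun x => (D.L (value φ θ) x - D.r x) ^ 2) m := by
    simpa only [sq] using ((hL.sub hr).mul (hL.sub hr)).integrable
  have i2 : Integrable (fun x => D.r x ^ 2) m := by
    simpa only [sq] using (hr.mul hr).integrable
  have i3 : Integrable (fun x => D.r x * D.L (value φ θ) x) m := (hr.mul hL).integrable
  have i4 : Integrable (fun x => 1 / 2 * ((D.a x * torusHess (value φ θ) x) ^ 2).trace) m := by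
    refine (hE.sub (hL.mul hL)).integrable.congr (ae_of_all _ fun x => ?_)
    simp only [Dynamics.energy, sq]
    ring
  rw [Dynamics.inner_gramOp hb hσ hφ, Dynamics.inner_rewardVec hb hσ hφ hr, Dynamics.cost,
    ← integral_const_mul, ← integral_const_mul, ← integral_add i1 i4,
    ← integral_sub hE.integrable (i3.const_mul _),
    ← integral_add (integrable_fun_sub hE.integrable (i3.const_mul _)) i2]
  refine integral_congr_ae (ae_of_all _ fun x => ?_)
  simp only [Dynamics.energy, sq]
  ring

/-- The normal equations. -/
theorem Dynamics.gramOp_eq_of_isMin {θs : Euc n} (hθs : ∀ θ, D.cost φ m θs ≤ D.cost φ m θ) :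
    D.gramOp φ m θs = D.rewardVec φ m := by
  set A := D.gramOp φ m
  set c := D.rewardVec φ m
  set w := A θs - c with hw
  have hsymm : inner ℝ (A w) θs = inner ℝ (A θs) w := by
    rw [Dynamics.inner_gramOp hb hσ hφ, Dynamics.inner_gramOp hb hσ hφ]
    simp only [D.energy_symm (value φ w)]
  have h1 : ∀ s : ℝ, 0 ≤ 2 * s * ‖w‖ ^ 2 + s ^ 2 * inner ℝ (A w) w := fun s => by
    have h2 := hθs (θs + s • w)
    rw [Dynamics.cost_eq hb hσ hφ hr, Dynamics.cost_eq hb hσ hφ hr] at h2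
    have h3 : ‖w‖ ^ 2 = inner ℝ (A θs) w - inner ℝ c w := by
      rw [← inner_sub_left, ← hw, real_inner_self_eq_norm_sq]
    simp only [map_add, map_smul, inner_add_left, inner_add_right, real_inner_smul_left,
      real_inner_smul_right] at h2
    have h4 : inner ℝ (A w) θs = inner ℝ (A θs) w := hsymm
    rw [h3]
    simp only [A, c] at h4 ⊢
    rw [h4] at h2
    linarith
  have hq : 0 ≤ inner ℝ (A w) w := by
    have h2 := h1 1
    have h3 := h1 (-1)
    linarith
  -- A descent step along the residual `w`, nearly the optimal one, would lower the cost unless `w =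
  -- 0`. The `+ 1` keeps the denominator positive when the quadratic form vanishes at `w`.
  have h4 := h1 (-(‖w‖ ^ 2 / (inner ℝ (A w) w + 1)))
  have h5 : ‖w‖ = 0 := by
    by_contra hne
    have hpos : 0 < ‖w‖ ^ 2 := by positivity
    set q := inner ℝ (A w) w
    have h6 : 2 * -(‖w‖ ^ 2 / (q + 1)) * ‖w‖ ^ 2 + (-(‖w‖ ^ 2 / (q + 1))) ^ 2 * q =
        -((‖w‖ ^ 2) ^ 2 * (q + 2) / (q + 1) ^ 2) := by
      field_simp
      ring
    rw [h6] at h4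
    have : 0 < (‖w‖ ^ 2) ^ 2 * (q + 2) / (q + 1) ^ 2 := by positivity
    linarith
  exact sub_eq_zero.1 (norm_eq_zero.1 h5)

end

end

section

open Asymptotics

variable {d dW n : ℕ}

/-! ## The stochastic residual gradient method -/

/-- The gradient of the stochastic temporal difference with respect to the parameter. -/
def Dynamics.tdVec (D : Dynamics d dW) (φ : Torus d → Euc n) (t : ℝ) (x : Torus d) (z : Euc d) :
    Euc n :=
  WithLp.toLp 2 fun i => D.td (feature φ i) t x z

/-- The stochastic residual gradient at the parameter `θs + e`. -/
def Dynamics.field (D : Dynamics d dW) (φ : Torus d → Euc n) (dt : ℕ → ℝ) (θs : Euc n) (k : ℕ)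
    (s : Torus d × Euc d × ℝ) (e : Euc n) : Euc n :=
  (inner ℝ (θs + e) (D.tdVec φ (dt k) s.1 s.2.1) - s.2.2) • D.tdVec φ (dt k) s.1 s.2.1

section

variable {Ω : Type*} [MeasurableSpace Ω] {D : Dynamics d dW} {P : Measure Ω}
  [IsProbabilityMeasure P] {dt : ℕ → ℝ} {X : ℕ → Ω → Torus d} {Z : ℕ → Ω → Euc d}
  {R : ℕ → Ω → ℝ} (h : MomentExpansion D P dt X Z R) (hdt : ∀ k, 0 < dt k) {T : ℝ}
  (hT : ∀ k, dt k ≤ T) (hρ : 0 < D.rho) {p : ℕ} (hp : 2 ≤ p)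
  (hr : TorusContDiff p D.r) (hb : TorusContDiff p D.b)
  (hσ : ∀ i j, TorusContDiff p fun x => D.sigma x i j) {φ : Torus d → Euc n}
  (hφ : TorusContDiff (p + 2) φ)

include hρ hp hr hb hσ hφ

lemma hasExpansion_feature (i : Fin n) :
    HasExpansion (D.td (feature φ i)) (D.firstOrder (feature φ i)) (secondDeriv (feature φ i))
      (fun x z => D.rho * taylorTerm 1 (feature φ i) x z)
      (fun x z => -(1 / 6) * taylorTerm 3 (feature φ i) x z) :=
  D.hasExpansion_td hρ (regular_of_le hp hr hb hσ)
    ((torusContDiff_feature hφ i).of_le (by omega : 4 ≤ p + 2))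

lemma measurable_tdVec (t : ℝ) :
    Measurable fun y : Torus d × Euc d => D.tdVec φ t y.1 y.2 := by
  have h1 : Measurable fun (y : Torus d × Euc d) (i : Fin n) => D.td (feature φ i) t y.1 y.2 :=
    measurable_pi_lambda _ fun i => (hasExpansion_feature hρ hp hr hb hσ hφ i).measurable t
  have h2 := (PiLp.continuous_toLp 2 (fun _ : Fin n => ℝ)).measurable.comp h1
  exact h2

lemma measurable_field (θs : Euc n) (k : ℕ) :
    Measurable fun q : Euc n × (Torus d × Euc d × ℝ) => D.field φ dt θs k q.2 q.1 := by
  have h1 : Measurable fun q : Euc n × (Torus d × Euc d × ℝ) =>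
      D.tdVec φ (dt k) q.2.1 q.2.2.1 := by
    have h0 : Measurable fun q : Euc n × (Torus d × Euc d × ℝ) => (q.2.1, q.2.2.1) :=
      measurable_snd.fst.prodMk measurable_snd.snd.fst
    have h2 := (measurable_tdVec hρ hp hr hb hσ hφ (dt k)).comp h0
    exact h2
  exact (((measurable_fst.const_add θs).inner h1).sub measurable_snd.snd.snd).smul h1

include h hdt

lemma integrable_td_mul_td (i j : Fin n) (k : ℕ) :
    Integrable (fun ω => D.td (feature φ i) (dt k) (X k ω) (Z k ω) *
      D.td (feature φ j) (dt k) (X k ω) (Z k ω)) P :=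
  h.integrable (((hasExpansion_feature hρ hp hr hb hσ hφ i).polyBdd (hdt k)).mul
    ((hasExpansion_feature hρ hp hr hb hσ hφ j).polyBdd (hdt k))) k

lemma integrable_reward_mul_td (i : Fin n) (k : ℕ) :
    Integrable (fun ω => R k ω * D.td (feature φ i) (dt k) (X k ω) (Z k ω)) P :=
  h.integrable_reward_mul
    (h.integrable ((hasExpansion_feature hρ hp hr hb hσ hφ i).polyBdd (hdt k)) k) k

include hT

/-- The stochastic gradient is quadratic in `tdVec`, so its second moment calls for fourth moments.
They stay bounded as the time step vanishes thanks to the cancellation in the temporal difference.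
-/
lemma exists_norm_tdVec_pow_four_bound : ∃ K, 0 ≤ K ∧ ∀ k,
    Integrable (fun ω => ‖D.tdVec φ (dt k) (X k ω) (Z k ω)‖ ^ 4) P ∧
      ∫ ω, ‖D.tdVec φ (dt k) (X k ω) (Z k ω)‖ ^ 4 ∂P ≤ K := by
  choose K hK0 hK using fun i =>
    HasExpansion.exists_integral_pow_four_bound h (hasExpansion_feature hρ hp hr hb hσ hφ i) hdt hT
  refine ⟨n * ∑ i, K i, mul_nonneg (Nat.cast_nonneg n) (Finset.sum_nonneg fun i _ => hK0 i),
    fun k => ?_⟩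
  have hi : ∀ i, Integrable (fun ω => D.td (feature φ i) (dt k) (X k ω) (Z k ω) ^ 4) P := fun i => by
    have h1 := (hasExpansion_feature hρ hp hr hb hσ hφ i).polyBdd (hdt k)
    have h2 := h.integrable ((h1.mul h1).mul (h1.mul h1)) k
    refine h2.congr (ae_of_all _ fun ω => ?_)
    ring
  have hsum : Integrable (fun ω => n * ∑ i, D.td (feature φ i) (dt k) (X k ω) (Z k ω) ^ 4) P :=
    (integrable_finsetSum _ fun i _ => hi i).const_mul _
  have hle : ∀ ω, ‖D.tdVec φ (dt k) (X k ω) (Z k ω)‖ ^ 4 ≤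
      n * ∑ i, D.td (feature φ i) (dt k) (X k ω) (Z k ω) ^ 4 := fun ω => by
    have h1 : ‖D.tdVec φ (dt k) (X k ω) (Z k ω)‖ ^ 2 =
        ∑ i, D.td (feature φ i) (dt k) (X k ω) (Z k ω) ^ 2 := by
      rw [EuclideanSpace.real_norm_sq_eq]
      rfl
    have h2 := sq_sum_le_card_mul_sum_sq (s := Finset.univ)
      (f := fun i => D.td (feature φ i) (dt k) (X k ω) (Z k ω) ^ 2)
    rw [← h1, ← pow_mul, Finset.card_univ, Fintype.card_fin] at h2
    simpa only [← pow_mul] using h2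
  have hm : Measurable fun ω => ‖D.tdVec φ (dt k) (X k ω) (Z k ω)‖ ^ 4 := by
    have h1 := (measurable_tdVec hρ hp hr hb hσ hφ (dt k)).comp
      ((h.measurable_X k).prodMk (h.measurable_Z k))
    have h2 : Measurable fun ω => D.tdVec φ (dt k) (X k ω) (Z k ω) := h1
    exact h2.norm.pow_const 4
  have hint : Integrable (fun ω => ‖D.tdVec φ (dt k) (X k ω) (Z k ω)‖ ^ 4) P := by
    refine hsum.mono' hm.aestronglyMeasurable (ae_of_all _ fun ω => ?_)
    rw [Real.norm_of_nonneg (by positivity)]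
    exact hle ω
  refine ⟨hint, (integral_mono hint hsum hle).trans ?_⟩
  rw [integral_const_mul, integral_finsetSum _ fun i _ => hi i]
  exact mul_le_mul_of_nonneg_left (Finset.sum_le_sum fun i _ => hK i k) (Nat.cast_nonneg n)

lemma exists_field_sq_bound (θs : Euc n) : ∃ M, 0 ≤ M ∧ ∀ k e,
    Integrable (fun ω => ‖D.field φ dt θs k (X k ω, Z k ω, R k ω) e‖ ^ 2) P ∧
      ∫ ω, ‖D.field φ dt θs k (X k ω, Z k ω, R k ω) e‖ ^ 2 ∂P ≤ M * (1 + ‖e‖ ^ 2) := by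
  obtain ⟨C, hC0, hC⟩ := exists_norm_tdVec_pow_four_bound h hdt hT hρ hp hr hb hσ hφ
  obtain ⟨K, hK0, hK⟩ := h.reward_bdd
  refine ⟨4 * (1 + ‖θs‖ ^ 2 + K ^ 2) * (1 + C), by positivity, fun k e => ?_⟩
  obtain ⟨h1, h2⟩ := hC k
  have hle : ∀ᵐ ω ∂P, ‖D.field φ dt θs k (X k ω, Z k ω, R k ω) e‖ ^ 2 ≤
      4 * (1 + ‖θs‖ ^ 2 + K ^ 2) * (1 + ‖e‖ ^ 2) *
        (1 + ‖D.tdVec φ (dt k) (X k ω) (Z k ω)‖ ^ 4) := by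
    filter_upwards [hK k] with ω hω
    rw [Dynamics.field, norm_smul, mul_pow, Real.norm_eq_abs]
    simp only
    set V := D.tdVec φ (dt k) (X k ω) (Z k ω)
    have h3 : |inner ℝ (θs + e) V - R k ω| ≤ (‖θs‖ + ‖e‖) * ‖V‖ + K := by
      refine (abs_sub _ _).trans (add_le_add ((abs_real_inner_le_norm _ _).trans ?_) hω)
      gcongr
      exact norm_add_le _ _
    have h4 : |inner ℝ (θs + e) V - R k ω| ^ 2 ≤
        4 * (‖θs‖ ^ 2 + ‖e‖ ^ 2) * ‖V‖ ^ 2 + 2 * K ^ 2 :=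
      calc _ ≤ ((‖θs‖ + ‖e‖) * ‖V‖ + K) ^ 2 := by gcongr
        _ ≤ 2 * ((‖θs‖ + ‖e‖) ^ 2 * ‖V‖ ^ 2) + 2 * K ^ 2 := by
          nlinarith [sq_nonneg ((‖θs‖ + ‖e‖) * ‖V‖ - K)]
        _ ≤ 2 * (2 * (‖θs‖ ^ 2 + ‖e‖ ^ 2) * ‖V‖ ^ 2) + 2 * K ^ 2 := by
          gcongr
          nlinarith [sq_nonneg (‖θs‖ - ‖e‖)]
        _ = _ := by ring
    have h5 : ‖V‖ ^ 2 ≤ 1 + ‖V‖ ^ 4 := by nlinarith [sq_nonneg (‖V‖ ^ 2 - 1), sq_nonneg (‖V‖ ^ 2)]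
    calc _ ≤ (4 * (‖θs‖ ^ 2 + ‖e‖ ^ 2) * ‖V‖ ^ 2 + 2 * K ^ 2) * ‖V‖ ^ 2 := by gcongr
      _ = 4 * (‖θs‖ ^ 2 + ‖e‖ ^ 2) * ‖V‖ ^ 4 + 2 * K ^ 2 * ‖V‖ ^ 2 := by ring
      _ ≤ 4 * (‖θs‖ ^ 2 + ‖e‖ ^ 2) * (1 + ‖V‖ ^ 4) + 2 * K ^ 2 * (1 + ‖V‖ ^ 4) := by
        gcongr
        linarith
      _ = (4 * (‖θs‖ ^ 2 + ‖e‖ ^ 2) + 2 * K ^ 2) * (1 + ‖V‖ ^ 4) := by ring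
      _ ≤ _ := by
        gcongr
        nlinarith [mul_nonneg (sq_nonneg ‖θs‖) (sq_nonneg ‖e‖), mul_nonneg (sq_nonneg K)
          (sq_nonneg ‖e‖), sq_nonneg K, sq_nonneg ‖θs‖, sq_nonneg ‖e‖]
  have hbd := ((integrable_const (1 : ℝ)).fun_add h1).const_mul
    (4 * (1 + ‖θs‖ ^ 2 + K ^ 2) * (1 + ‖e‖ ^ 2))
  have hm : Measurable fun ω => ‖D.field φ dt θs k (X k ω, Z k ω, R k ω) e‖ ^ 2 := by
    have h3 := (measurable_field (dt := dt) hρ hp hr hb hσ hφ θs k).comp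
      (measurable_const (a := e) |>.prodMk
        ((h.measurable_X k).prodMk ((h.measurable_Z k).prodMk (h.measurable_R k))))
    exact h3.norm.pow_const 2
  have hint : Integrable (fun ω => ‖D.field φ dt θs k (X k ω, Z k ω, R k ω) e‖ ^ 2) P := by
    refine hbd.mono' hm.aestronglyMeasurable ?_
    filter_upwards [hle] with ω hω
    rwa [Real.norm_of_nonneg (by positivity)]
  refine ⟨hint, (integral_mono_ae hint hbd hle).trans ?_⟩
  rw [integral_const_mul, integral_add (integrable_const 1) h1]
  simp only [integral_const, probReal_univ, smul_eq_mul, mul_one]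
  calc _ ≤ 4 * (1 + ‖θs‖ ^ 2 + K ^ 2) * (1 + ‖e‖ ^ 2) * (1 + C) := by gcongr
    _ = _ := by ring

variable {m : Measure (Torus d)} [IsProbabilityMeasure m]
  (hlaw : ∀ f : Torus d → ℝ, TorusContDiff p f →
      ∃ C : ℝ, 0 < C ∧ ∀ k, |∫ ω, f (X k ω) ∂P - ∫ x, f x ∂m| ≤ C * dt k)

include hlaw

/-- Two errors of order `dt`: the conditional second moment is replaced by the energy density at `X
k`, and the law of `X k` by `m`. -/
lemma exists_gram_bias_bound (i j : Fin n) : ∃ K, 0 ≤ K ∧ ∀ k,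
    |∫ ω, D.td (feature φ i) (dt k) (X k ω) (Z k ω) *
      D.td (feature φ j) (dt k) (X k ω) (Z k ω) ∂P - D.gram φ m i j| ≤ K * dt k := by
  have hi := torusContDiff_feature hφ i
  have hj := torusContDiff_feature hφ j
  obtain ⟨C, hC⟩ := isBigO_top.1 (integral_td_mul_td_isBigO h hdt hT hρ hp hr hb hσ hi hj)
  obtain ⟨C', hC'0, hC'⟩ := hlaw _ (Dynamics.torusContDiff_energy hb hσ hi hj)
  refine ⟨|C| + C', by positivity, fun k => ?_⟩
  have h1 := hC k
  rw [Real.norm_eq_abs, Real.norm_of_nonneg (hdt k).le] at h1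
  have h2 : C * dt k ≤ |C| * dt k := mul_le_mul_of_nonneg_right (le_abs_self C) (hdt k).le
  have h3 := abs_sub_le (∫ ω, D.td (feature φ i) (dt k) (X k ω) (Z k ω) *
      D.td (feature φ j) (dt k) (X k ω) (Z k ω) ∂P)
    (∫ ω, D.energy (feature φ i) (feature φ j) (X k ω) ∂P) (D.gram φ m i j)
  have h4 : |∫ ω, D.energy (feature φ i) (feature φ j) (X k ω) ∂P - D.gram φ m i j| ≤ C' * dt k :=
    hC' k
  linarith

lemma exists_reward_bias_bound (i : Fin n) : ∃ K, 0 ≤ K ∧ ∀ k,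
    |∫ ω, R k ω * D.td (feature φ i) (dt k) (X k ω) (Z k ω) ∂P - D.rewardVec φ m i| ≤
      K * dt k := by
  have hi := torusContDiff_feature hφ i
  obtain ⟨C, hC⟩ := isBigO_top.1 (integral_reward_mul_td_isBigO h hdt hρ hp hr hb hσ hi)
  obtain ⟨C', hC'0, hC'⟩ := hlaw _ (hr.mul (Dynamics.torusContDiff_L hb hσ hi))
  refine ⟨|C| + C', by positivity, fun k => ?_⟩
  have h1 := hC k
  rw [Real.norm_eq_abs, Real.norm_of_nonneg (hdt k).le] at h1
  have h2 : C * dt k ≤ |C| * dt k := mul_le_mul_of_nonneg_right (le_abs_self C) (hdt k).le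
  have h3 := abs_sub_le (∫ ω, R k ω * D.td (feature φ i) (dt k) (X k ω) (Z k ω) ∂P)
    (∫ ω, D.r (X k ω) * D.L (feature φ i) (X k ω) ∂P) (D.rewardVec φ m i)
  have h4 : |∫ ω, D.r (X k ω) * D.L (feature φ i) (X k ω) ∂P - D.rewardVec φ m i| ≤ C' * dt k :=
    hC' k
  linarith

/-- The bias of the stochastic residual gradient. -/
lemma exists_field_bias_bound {θs : Euc n} (hθs : ∀ θ, D.cost φ m θs ≤ D.cost φ m θ) :
    ∃ M, 0 ≤ M ∧ ∀ k e, ‖∫ ω, D.field φ dt θs k (X k ω, Z k ω, R k ω) e ∂P - D.gramOp φ m e‖ ≤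
      M * dt k * (1 + ‖e‖) := by
  choose K hK0 hK using exists_gram_bias_bound h hdt hT hρ hp hr hb hσ hφ hlaw
  choose L hL0 hL using exists_reward_bias_bound h hdt hT hρ hp hr hb hσ hφ hlaw
  obtain ⟨M, hM0, hM⟩ := exists_field_sq_bound h hdt hT hρ hp hr hb hσ hφ θs
  have hS0 : 0 ≤ ∑ i, (∑ j, K i j + L i) :=
    Finset.sum_nonneg fun i _ => add_nonneg (Finset.sum_nonneg fun j _ => hK0 i j) (hL0 i)
  refine ⟨(∑ i, (∑ j, K i j + L i)) * (1 + ‖θs‖), by positivity, fun k e => ?_⟩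
  have hd := hdt k
  have hmeas : Measurable fun ω => D.field φ dt θs k (X k ω, Z k ω, R k ω) e := by
    have h3 := (measurable_field (dt := dt) hρ hp hr hb hσ hφ θs k).comp
      (measurable_const (a := e) |>.prodMk
        ((h.measurable_X k).prodMk ((h.measurable_Z k).prodMk (h.measurable_R k))))
    exact h3
  have hint : Integrable (fun ω => D.field φ dt θs k (X k ω, Z k ω, R k ω) e) P :=
    ((memLp_two_iff_integrable_sq_norm hmeas.aestronglyMeasurable).2 (hM k e).1).integrable
      one_le_two
  have hcomp : ∀ i, (∫ ω, D.field φ dt θs k (X k ω, Z k ω, R k ω) e ∂P - D.gramOp φ m e) i =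
      ∑ j, (θs + e) j * (∫ ω, D.td (feature φ i) (dt k) (X k ω) (Z k ω) *
        D.td (feature φ j) (dt k) (X k ω) (Z k ω) ∂P - D.gram φ m i j) -
      (∫ ω, R k ω * D.td (feature φ i) (dt k) (X k ω) (Z k ω) ∂P - D.rewardVec φ m i) := by
    intro i
    have e1 : (∫ ω, D.field φ dt θs k (X k ω, Z k ω, R k ω) e ∂P) i =
        ∫ ω, D.field φ dt θs k (X k ω, Z k ω, R k ω) e i ∂P :=
      ((EuclideanSpace.proj (𝕜 := ℝ) i).integral_comp_comm hint).symm
    have e2 : ∀ ω, D.field φ dt θs k (X k ω, Z k ω, R k ω) e i =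
        ∑ j, (θs + e) j * (D.td (feature φ i) (dt k) (X k ω) (Z k ω) *
          D.td (feature φ j) (dt k) (X k ω) (Z k ω)) -
        R k ω * D.td (feature φ i) (dt k) (X k ω) (Z k ω) := fun ω => by
      have e3 : inner ℝ (θs + e) (D.tdVec φ (dt k) (X k ω) (Z k ω)) =
          ∑ j, (θs + e) j * D.td (feature φ j) (dt k) (X k ω) (Z k ω) := by
        rw [PiLp.inner_apply]
        exact Finset.sum_congr rfl fun j _ => mul_comm _ _
      rw [Dynamics.field, PiLp.smul_apply, smul_eq_mul]
      simp only [e3]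
      rw [Dynamics.tdVec, sub_mul, Finset.sum_mul]
      congr 1
      refine Finset.sum_congr rfl fun j _ => ?_
      simp only
      ring
    have i1 := fun j => integrable_td_mul_td h hdt hρ hp hr hb hσ hφ i j k
    have i2 := integrable_reward_mul_td h hdt hρ hp hr hb hσ hφ i k
    -- The normal equations turn the limit of the reward term into `A θs`, so that the constant
    -- parts cancel and the limiting mean field is linear in `e`.
    have e4 := congrArg (fun v : Euc n => v i) (Dynamics.gramOp_eq_of_isMin hb hσ hφ hr hθs)
    simp only [D.gramOp_apply] at e4
    rw [PiLp.sub_apply, e1]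
    simp only [e2]
    rw [integral_sub (integrable_finsetSum _ fun j _ => (i1 j).const_mul _) i2,
      integral_finsetSum _ fun j _ => (i1 j).const_mul _, D.gramOp_apply, ← e4]
    simp only [integral_const_mul]
    have e5 : ∀ c : Fin n → ℝ, ∑ j, (θs + e) j * (c j - D.gram φ m i j) =
        ∑ j, (θs + e) j * c j - ∑ j, D.gram φ m i j * θs j - ∑ j, D.gram φ m i j * e j :=
      fun c => by
        rw [← Finset.sum_sub_distrib, ← Finset.sum_sub_distrib]
        refine Finset.sum_congr rfl fun j _ => ?_
        rw [PiLp.add_apply]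
        ring
    rw [e5]
    ring
  have hw : ∀ j, |(θs + e) j| ≤ ‖θs‖ + ‖e‖ := fun j =>
    (abs_coord_le (θs + e) j).trans (norm_add_le _ _)
  refine (norm_le_sum_abs _).trans ?_
  calc _ ≤ ∑ i, (∑ j, K i j + L i) * ((1 + ‖θs‖ + ‖e‖) * dt k) := by
        refine Finset.sum_le_sum fun i _ => ?_
        rw [hcomp]
        refine (abs_sub _ _).trans ?_
        rw [add_mul, Finset.sum_mul]
        refine add_le_add ((Finset.abs_sum_le_sum_abs _ _).trans
          (Finset.sum_le_sum fun j _ => ?_)) ((hL i k).trans ?_)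
        · rw [abs_mul]
          calc _ ≤ (‖θs‖ + ‖e‖) * (K i j * dt k) :=
                mul_le_mul (hw j) (hK i j k) (abs_nonneg _) (by positivity)
            _ ≤ (1 + ‖θs‖ + ‖e‖) * (K i j * dt k) :=
                mul_le_mul_of_nonneg_right (by linarith) (mul_nonneg (hK0 i j) hd.le)
            _ = _ := by ring
        · have h1 : 0 ≤ L i * dt k * (‖θs‖ + ‖e‖) :=
            mul_nonneg (mul_nonneg (hL0 i) hd.le) (by positivity)
          linarith
    _ = (∑ i, (∑ j, K i j + L i)) * ((1 + ‖θs‖ + ‖e‖) * dt k) := by rw [Finset.sum_mul]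
    _ ≤ (∑ i, (∑ j, K i j + L i)) * (((1 + ‖θs‖) * (1 + ‖e‖)) * dt k) := by
        gcongr
        nlinarith [mul_nonneg (norm_nonneg θs) (norm_nonneg e)]
    _ = _ := by ring

/-- The stochastic residual gradient method, centred at the minimiser, is a stochastic
approximation of the gradient flow of the cost. -/
theorem exists_stochasticApproximation (hdt0 : Tendsto dt atTop (𝓝 0)) (hm : D.IsStationary m)
    (hindep : ∀ θ : Euc n, (∀ᵐ x ∂m, value φ θ x = 0) → θ = 0)
    (hInd : iIndepFun (fun k ω => (X k ω, Z k ω, R k ω)) P) {θs : Euc n}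
    (hθs : ∀ θ, D.cost φ m θs ≤ D.cost φ m θ) :
    ∃ M μ, StochasticApproximation P (fun k ω => (X k ω, Z k ω, R k ω)) (D.field φ dt θs)
      (D.gramOp φ m) dt M μ := by
  obtain ⟨M₁, hM₁0, hM₁⟩ := exists_field_sq_bound h hdt hT hρ hp hr hb hσ hφ θs
  obtain ⟨M₂, hM₂0, hM₂⟩ := exists_field_bias_bound h hdt hT hρ hp hr hb hσ hφ hlaw hθs
  obtain ⟨μ, hμ0, hμ⟩ := hm.exists_coercive hb hσ hφ hρ hindep
  refine ⟨M₁ + M₂, μ, ?_⟩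
  exact
  { measurable_obs := fun k =>
      (h.measurable_X k).prodMk ((h.measurable_Z k).prodMk (h.measurable_R k))
    indep := hInd
    measurable_field := measurable_field hρ hp hr hb hσ hφ θs
    integrable_sq := fun k e => (hM₁ k e).1
    sq_le := fun k e => (hM₁ k e).2.trans (by gcongr; linarith)
    bias_le := fun k e => (hM₂ k e).trans (by
      have := (hdt k).le
      gcongr
      linarith)
    coercive := hμ
    M_nonneg := by positivity
    mu_pos := hμ0
    tau_nonneg := fun k => (hdt k).le
    tau_tendsto := hdt0 }

end

end

/-! ### From errors of the parameter to errors of the residual -/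

section

variable {d dW n : ℕ}

section

variable (D : Dynamics d dW) {φ : Torus d → Euc n} (hφ : TorusContDiff 2 φ)

include hφ

/-- The temporal difference is affine in the parameter, its gradient being the vector of temporal
differences of the features. The algorithm is therefore a linear recursion with random coefficients.
-/
lemma Dynamics.stochTD_eq {t : ℝ} (ht : 0 < t) (x : Torus d) (z : Euc d) (R : ℝ) (θ : Euc n) :
    D.stochTD φ t x z R θ = inner ℝ (D.tdVec φ t x z) θ - R := by
  have h1 : inner ℝ (D.tdVec φ t x z) θ = D.td (value φ θ) t x z := by
    rw [D.td_value hφ, PiLp.inner_apply]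
    rfl
  rw [h1, Dynamics.stochTD, Dynamics.td]
  field_simp
  ring

lemma Dynamics.gradient_stochTD {t : ℝ} (ht : 0 < t) (x : Torus d) (z : Euc d) (R : ℝ)
    (θ : Euc n) : gradient (D.stochTD φ t x z R) θ = D.tdVec φ t x z := by
  have h1 : D.stochTD φ t x z R = fun θ => inner ℝ (D.tdVec φ t x z) θ - R :=
    funext fun θ => D.stochTD_eq hφ ht x z R θ
  refine HasGradientAt.gradient ?_
  rw [h1, hasGradientAt_iff_hasFDerivAt]
  exact ((InnerProductSpace.toDual ℝ (Euc n) (D.tdVec φ t x z)).hasFDerivAt (x := θ)).sub_const R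

variable {Ω : Type*} [MeasurableSpace Ω] {P : Measure Ω} {dt : ℕ → ℝ} (hdt : ∀ k, 0 < dt k)
  (X : ℕ → Ω → Torus d) (Z : ℕ → Ω → Euc d) (R : ℕ → Ω → ℝ) (α : ℝ) (θ₀ θs : Euc n)

include hdt

lemma Dynamics.isTrajectory_iterate :
    StochasticApproximation.IsTrajectory P (fun k ω => (X k ω, Z k ω, R k ω)) (D.field φ dt θs) α
      (θ₀ - θs) fun k ω => D.iterate φ dt X Z R α θ₀ k ω - θs where
  zero _ := rfl
  succ k ω := by
    rw [Dynamics.iterate, Dynamics.field, add_sub_cancel]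
    simp only [D.gradient_stochTD hφ (hdt k), D.stochTD_eq hφ (hdt k)]
    rw [real_inner_comm]
    abel

omit hφ hdt in
lemma Dynamics.average_sub {k : ℕ} (hk : 1 ≤ k) (ω : Ω) :
    D.average φ dt X Z R α θ₀ k ω - θs =
      (1 / (k : ℝ)) • ∑ i ∈ Finset.range k, (D.iterate φ dt X Z R α θ₀ i ω - θs) := by
  have hk0 : (k : ℝ) ≠ 0 := by positivity
  rw [Dynamics.average, Finset.sum_sub_distrib, smul_sub, Finset.sum_const, Finset.card_range,
    ← Nat.cast_smul_eq_nsmul ℝ, smul_smul, one_div, inv_mul_cancel₀ hk0, one_smul]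

end

section

variable {D : Dynamics d dW} {p : ℕ} (hb : TorusContDiff p D.b)
  (hσ : ∀ i j, TorusContDiff p fun x => D.sigma x i j) {φ : Torus d → Euc n}
  (hφ : TorusContDiff (p + 2) φ) {m : Measure (Torus d)} [IsProbabilityMeasure m]

include hb hσ hφ

/-- Cauchy-Schwarz over the features, whose images under 𝓛 are bounded on the torus. The factor `n`
is kept explicit because it must multiply the second term of the final bound, including for `n = 0`.
-/
lemma Dynamics.exists_abs_L_sub_sq_le : ∃ K, 0 ≤ K ∧ ∀ θ η : Euc n, ∀ x,
    |D.L (value φ θ) x - D.L (value φ η) x| ^ 2 ≤ K * n * ‖θ - η‖ ^ 2 := by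
  choose _ K hK0 hK using fun i => (Dynamics.torusContDiff_L hb hσ
    (torusContDiff_feature hφ i)).bddMeas
  refine ⟨∑ i, K i ^ 2, Finset.sum_nonneg fun i _ => sq_nonneg _, fun θ η x => ?_⟩
  have h1 : D.L (value φ θ) x - D.L (value φ η) x =
      ∑ i, (θ - η) i * D.L (feature φ i) x := by
    rw [D.L_value (hφ.of_le (by omega)), D.L_value (hφ.of_le (by omega)),
      ← Finset.sum_sub_distrib]
    refine Finset.sum_congr rfl fun i _ => ?_
    rw [PiLp.sub_apply]
    ring
  have h2 : ∑ i, D.L (feature φ i) x ^ 2 ≤ (∑ i, K i ^ 2) * n := by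
    calc _ ≤ ∑ i, K i ^ 2 := Finset.sum_le_sum fun i _ => by
          rw [← sq_abs]
          exact pow_le_pow_left₀ (abs_nonneg _) (hK i x) 2
      _ ≤ ∑ _i : Fin n, ∑ j, K j ^ 2 := Finset.sum_le_sum fun i _ =>
          Finset.single_le_sum (f := fun j => K j ^ 2) (fun j _ => sq_nonneg _) (Finset.mem_univ i)
      _ = _ := by simp [mul_comm]
  rw [sq_abs, h1]
  refine (Finset.sum_mul_sq_le_sq_mul_sq _ _ _).trans ?_
  rw [← EuclideanSpace.real_norm_sq_eq, mul_comm]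
  gcongr

/-- Mean square errors of the parameters control those of the residuals. -/
lemma Dynamics.exists_meanSquareErrorLE : ∃ K, 0 ≤ K ∧
    ∀ {Ω : Type*} [MeasurableSpace Ω] (P : Measure Ω) [IsProbabilityMeasure P] (θbar : Ω → Euc n)
      (θs : Euc n), Measurable θbar → ∀ B : ℝ, Integrable (fun ω => ‖θbar ω - θs‖ ^ 2) P →
      ∫ ω, ‖θbar ω - θs‖ ^ 2 ∂P ≤ B → ∀ B', K * n * B ≤ B' →
      D.MeanSquareErrorLE φ m P θbar θs B' := by
  obtain ⟨K, hK0, hK⟩ := Dynamics.exists_abs_L_sub_sq_le hb hσ hφ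
  refine ⟨K, hK0, fun P _ θbar θs hθ B hi hB B' hB' => ?_⟩
  have hL : ∀ i, Measurable (D.L (feature φ i)) := fun i =>
    (Dynamics.torusContDiff_L hb hσ (torusContDiff_feature hφ i)).measurable
  have hmeas : Measurable fun q : _ × Torus d =>
      |D.L (value φ (θbar q.1)) q.2 - D.L (value φ θs) q.2| ^ 2 := by
    simp only [D.L_value (hφ.of_le (by omega : 2 ≤ p + 2)), sq_abs]
    have h1 : ∀ i, Measurable fun q : _ × Torus d => θbar q.1 i := fun i => by
      have h2 : Measurable fun ω => θbar ω i := by fun_prop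
      exact h2.comp measurable_fst
    exact ((Finset.measurable_fun_sum _ fun i _ => (h1 i).mul ((hL i).comp measurable_snd)).sub
      (Finset.measurable_fun_sum _ fun i _ =>
        ((hL i).comp measurable_snd).const_mul _)).pow_const 2
  have hdom : Integrable (fun q : _ × Torus d => K * n * ‖θbar q.1 - θs‖ ^ 2) (P.prod m) :=
    (hi.const_mul (K * n)).comp_fst m
  have hint := hdom.mono' hmeas.aestronglyMeasurable (ae_of_all _ fun q => by
    rw [Real.norm_of_nonneg (by positivity)]
    exact hK _ _ _)
  refine ⟨hint, (integral_mono hint hdom fun q => hK _ _ _).trans ?_⟩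
  rw [integral_fun_fst (fun ω => K * n * ‖θbar ω - θs‖ ^ 2), integral_const_mul]
  simp only [probReal_univ, one_smul]
  refine le_trans ?_ hB'
  gcongr

end

/-- The inequality log y ≤ y^ε/ε at y = 1 + k ≤ 2k; the constant 1 is absorbed since k^ε ≥ 1. -/
lemma one_add_mul_log_le {a ε : ℝ} (ha : 0 < a) (hε : 0 < ε) {k : ℕ} (hk : 1 ≤ k) :
    1 + a * Real.log (1 + k) ≤ (1 + a * 2 ^ ε / ε) * (k : ℝ) ^ ε := by
  have hk1 : (1 : ℝ) ≤ k := by exact_mod_cast hk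
  have h1 : Real.log (1 + k) ≤ 2 ^ ε * (k : ℝ) ^ ε / ε := by
    refine (Real.log_le_rpow_div (by positivity) hε).trans ?_
    rw [← Real.mul_rpow (by norm_num) (by positivity)]
    gcongr
    linarith
  have h2 : 1 ≤ (k : ℝ) ^ ε := Real.one_le_rpow hk1 hε.le
  calc _ ≤ (k : ℝ) ^ ε + a * (2 ^ ε * (k : ℝ) ^ ε / ε) := by gcongr
    _ = _ := by ring

end

end ResidualGradient

end

theorem mainTheorem8 {d dW n p : ℕ}
    -- the dynamics, the features and their regularity
    (D : ResidualGradient.Dynamics d dW) (hρ : 0 < D.rho)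
    (hp : 2 ≤ p)
    (hr : ResidualGradient.TorusContDiff p D.r)
    (hb : ResidualGradient.TorusContDiff p D.b)
    (hσ : ∀ i j, ResidualGradient.TorusContDiff p (fun x => D.sigma x i j))
    (φ : ResidualGradient.Torus d → ResidualGradient.Euc n)
    (hφ : ResidualGradient.TorusContDiff (p + 2) φ)
    -- the stationary measure; linear independence of the features (modulo `m`-null sets)
    (m : Measure (ResidualGradient.Torus d)) [IsProbabilityMeasure m]
    (hm : D.IsStationary m)
    (hindep : ∀ θ : ResidualGradient.Euc n,
      (∀ᵐ x ∂m, ResidualGradient.value φ θ x = 0) → θ = 0)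
    -- the observations
    {Ω : Type*} [MeasurableSpace Ω] (P : Measure Ω) [IsProbabilityMeasure P]
    (dt : ℕ → ℝ) (hdt : ∀ k, 0 < dt k) (hdt0 : Tendsto dt atTop (𝓝 0))
    (X : ℕ → Ω → ResidualGradient.Torus d) (Z : ℕ → Ω → ResidualGradient.Euc d) (R : ℕ → Ω → ℝ)
    (hX : ∀ k, Measurable (X k)) (hZ : ∀ k, Measurable (Z k)) (hR : ∀ k, Measurable (R k))
    (hInd : iIndepFun (fun k ω => (X k ω, Z k ω, R k ω)) P)
    (hObs : (∀ k, D.IsRealWorldObs P (dt k) (X k) (Z k) (R k)) ∨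
      (∀ k, D.IsSimulatorObs P (dt k) (X k) (Z k) (R k)))
    (hlaw : ∀ f : ResidualGradient.Torus d → ℝ, ResidualGradient.TorusContDiff p f →
      ∃ C : ℝ, 0 < C ∧ ∀ k, |∫ ω, f (X k ω) ∂P - ∫ x, f x ∂m| ≤ C * dt k)
    -- the initial parameter and the minimiser of the residual gradient cost
    (θ₀ θs : ResidualGradient.Euc n)
    (hθs : ∀ θ, D.cost φ m θs ≤ D.cost φ m θ) :
    ((Summable fun k => dt k ^ 2) →
      ∃ C R₀ : ℝ, 0 < C ∧ 0 < R₀ ∧ ∀ α : ℝ, 0 < α → α < (R₀ ^ 2)⁻¹ → ∀ k : ℕ, 1 ≤ k →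
        D.MeanSquareErrorLE φ m P (D.average φ dt X Z R α θ₀ k) θs
          (C / (α * k) + C * n / k)) ∧
    (∀ a : ℝ, 0 < a →
      (∀ k : ℕ, ∑ i ∈ Finset.range k, dt i ^ 2 ≤ a * Real.log (1 + k)) →
      ∀ ε : ℝ, 0 < ε →
        ∃ C R₀ : ℝ, 0 < C ∧ 0 < R₀ ∧ ∀ α : ℝ, 0 < α → α < (R₀ ^ 2)⁻¹ → ∀ k : ℕ, 1 ≤ k →
          D.MeanSquareErrorLE φ m P (D.average φ dt X Z R α θ₀ k) θs
            (C / (α * k) + C * n / (k : ℝ) ^ (1 - ε))) := by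
  have hφ2 : ResidualGradient.TorusContDiff 2 φ := hφ.of_le (by omega)
  have hD : D.Regular := ResidualGradient.regular_of_le hp hr hb hσ
  obtain ⟨T, hT⟩ := hdt0.bddAbove_range
  have hT' : ∀ k, dt k ≤ T := fun k => hT ⟨k, rfl⟩
  have h : ResidualGradient.MomentExpansion D P dt X Z R := hObs.elim
    (ResidualGradient.momentExpansion_of_isRealWorldObs hD hdt hT' hX hZ hR)
    (ResidualGradient.momentExpansion_of_isSimulatorObs hD hdt hT' hX hZ hR)
  obtain ⟨M, μ, hSA⟩ := ResidualGradient.exists_stochasticApproximation h hdt hT' hρ hp hr hb hσ hφ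
    hlaw hdt0 hm hindep hInd hθs
  obtain ⟨C, R₀, hC, hR₀, hbound⟩ := hSA.average_bound (θ₀ - θs)
  obtain ⟨K, hK, hMSE⟩ := ResidualGradient.Dynamics.exists_meanSquareErrorLE hb hσ hφ (m := m)
  -- The estimate common to both claims, before anything is assumed on the sum of the squared steps.
  -- The centred iterates form a trajectory of the abstract recursion, and their average is the
  -- error of the averaged iterate.
  have key : ∀ α : ℝ, 0 < α → α < (R₀ ^ 2)⁻¹ → ∀ k : ℕ, 1 ≤ k → ∀ B : ℝ,
      K * n * (C / (α * k) + C * (1 + ∑ i ∈ Finset.range k, dt i ^ 2) / k) ≤ B →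
      D.MeanSquareErrorLE φ m P (D.average φ dt X Z R α θ₀ k) θs B := by
    intro α hα hα' k hk B hB
    have htraj := D.isTrajectory_iterate hφ2 (P := P) hdt X Z R α θ₀ θs
    obtain ⟨hi, hle⟩ := hbound α hα hα' _ htraj k hk
    simp only [← D.average_sub X Z R α θ₀ θs hk] at hi hle
    have hmeas : Measurable (D.average φ dt X Z R α θ₀ k) := by
      have hsum : Measurable fun ω => ∑ i ∈ Finset.range k, D.iterate φ dt X Z R α θ₀ i ω :=
        Finset.measurable_fun_sum _ fun i _ => by
          simpa only [sub_add_cancel] using (hSA.measurable_trajectory htraj i).add_const θs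
      exact hsum.const_smul (1 / (k : ℝ))
    exact hMSE P _ θs hmeas _ hi hle B hB
  refine ⟨fun hsum => ?_, fun a ha hlog ε hε => ?_⟩
  · set S := ∑' k, dt k ^ 2 with hS
    have hS0 : 0 ≤ S := tsum_nonneg fun k => sq_nonneg _
    -- The first summand serves the term in 1/(αk), the second the term in n/k; the `+ 1` secures
    -- positivity when `K` or `n` vanishes.
    refine ⟨K * n * C + K * C * (1 + S) + 1, R₀, by positivity, hR₀,
      fun α hα hα' k hk => key α hα hα' k hk _ ?_⟩
    have hk0 : (0 : ℝ) < k := by positivity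
    have hle : ∑ i ∈ Finset.range k, dt i ^ 2 ≤ S :=
      hsum.sum_le_tsum _ fun i _ => sq_nonneg _
    calc _ ≤ K * n * (C / (α * k) + C * (1 + S) / k) := by gcongr
      _ = K * n * C / (α * k) + K * C * (1 + S) * n / k := by ring
      _ ≤ _ := by
        gcongr
        · have : 0 ≤ K * C * (1 + S) := by positivity
          linarith
        · have : 0 ≤ K * n * C := by positivity
          linarith
  · set S := 1 + a * 2 ^ ε / ε with hS
    have hS0 : 0 < S := by positivity
    refine ⟨K * n * C + K * C * S + 1, R₀, by positivity, hR₀,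
      fun α hα hα' k hk => key α hα hα' k hk _ ?_⟩
    have hk0 : (0 : ℝ) < k := by positivity
    -- The logarithmic growth is traded for a power k^ε, which lowers the exponent of k in the
    -- second term to 1 - ε.
    have hle : 1 + ∑ i ∈ Finset.range k, dt i ^ 2 ≤ S * (k : ℝ) ^ ε :=
      (add_le_add le_rfl (hlog k)).trans (ResidualGradient.one_add_mul_log_le ha hε hk)
    have hpow : (k : ℝ) ^ (1 - ε) = k / (k : ℝ) ^ ε := by
      rw [Real.rpow_sub hk0, Real.rpow_one]
    have hkε : 0 < (k : ℝ) ^ ε := Real.rpow_pos_of_pos hk0 ε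
    calc _ ≤ K * n * (C / (α * k) + C * (S * (k : ℝ) ^ ε) / k) := by gcongr
      _ = K * n * C / (α * k) + K * C * S * n / (k : ℝ) ^ (1 - ε) := by
        rw [hpow]
        field_simp
      _ ≤ _ := by
        gcongr
        · have : 0 ≤ K * C * S := by positivity
          linarith
        · have : 0 ≤ K * n * C := by positivity
          linarith
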